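/- **Setting.** Let $\tau>0$, $N\ge 1$, let $\sigma_1,\dots,\sigma_N\in[\tau,\tau^{-1}]$ satisfy $\frac1N\sum_i\sigma_i=1$ (the eigenvalues, with multiplicity, of $\Sigma=TT^\dagger$, where $T$ is $N\times M$ and $N\le M$), and let $z\in\mathbb C$ satisfy $\tau\le\big||z|^2-1\big|\le\tau^{-1}$. Write $w=E+i\eta$ and put $$\Upsilon(w,u)=u+\frac1N\sum_{i=1}^N\sigma_i(1+u)\Big[w\Big(1+\sigma_i\frac{1+u}{-w(1+u)^2+|z|^2}\Big)(1+u)-|z|^2\Big]^{-1}.$$ Let $m_{1c}$ be the analytic function on $\mathbb C_+$ with $m_{1c}(w),\,w\,m_{1c}(w)\in\mathbb C_+$ and $$m_{1c}=\frac1N\sum_i\sigma_i\Big[-w\Big(1+\frac{\sigma_i}{-w(1+m_{1c})+\frac{|z|^2}{1+m_{1c}}}\Big)+\frac{|z|^2}{1+m_{1c}}\Big]^{-1},$$ that is, $\Upsilon(w,m_{1c}(w))=0$. Let $m_{2c}=\big[-w(1+m_{1c})+|z|^2/(1+m_{1c})\big]^{-1}$, and for real $x$ let $m_{1c}(x)=\lim_{\eta\downarrow0}m_{1c}(x+i\eta)$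 and $\rho_{1c}(x)=\frac1\pi\lim_{\eta\downarrow0}\operatorname{Im}m_{1c}(x+i\eta)$. The closed support of $\rho_{1c}$ is a finite union of disjoint compact intervals in $[0,\infty)$, the *bulk components*; their end points are the *edges*. Let $\kappa=\kappa(E)$ be the distance from $E$ to the set of nonzero edges. **Regularity.** Let $$f(r,m)=-r+m+\frac1N\sum_i\sigma_i\frac{m(m^2-|z|^2)}{rm^3-(\sigma_i+|z|^2)m^2-r|z|^2m+|z|^4},\qquad m_c(x)=\sqrt x\,(1+m_{1c}(x))\quad(x>0).$$ For $\epsilon>0$, an edge $e\ne0$ is *$\epsilon$-regular* if $m_c(e)$ has distance at least $\epsilon$ from every root $m$ of the $N$ cubic denominators of $f(\sqrt e,\cdot)$, and $|\partial_m^2f(\sqrt e,m_c(e))|\ge\epsilon$. For a function $c:(0,\infty)\to(0,\infty)$, a bulk component $[a,b]$ is *$c$-regular* if $\rho_{1c}\ge c(r)$ on $[a+r,b-r]$ for every $r>0$. **Domains.** For $0<\zeta<1$ and $\tau'>0$ let $$\mathbf D=\{w\in\mathbb C_+:0\le E\le\zeta^{-1},\ N^{-1+\zeta}|m_{2c}(w)|^{-1}\le\eta\le\zeta^{-1}\},\qquad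 \mathbf D_L=\{w\in\mathbb C_+:0\le E\le\zeta^{-1},\ \eta\ge\zeta^{-1}\},$$ $$\mathbf D^b_{[a,b]}=\{w\in\mathbf D:E\in[a+\tau',b-\tau']\},\quad \mathbf D^o=\{w\in\mathbf D:\operatorname{dist}(E,\operatorname{supp}\rho_{1c})\ge\tau'\},\quad \mathbf D^e_e=\{w\in\mathbf D:|E-e|\le\tau'\}.$$ For $w\in\mathbf D$ let $L(w)=\{w\}\cup\{w'\in\mathbf D:\operatorname{Re}w'=E,\ \operatorname{Im}w'\in[\eta,1]\cap N^{-10}\mathbb N\}$. **Stability.** The equation $\Upsilon=0$ is *stable on $\mathbf S\subset\mathbf D$ with constant $C$* if the following holds. Let $\delta:\mathbf S\to\mathbb R$ satisfy $N^{-2}|m_{1c}|\le\delta\le(\log N)^{-1}|m_{1c}|$ on $\mathbf S$ (with the convention $(\log 1)^{-1}=0$), be Lipschitz continuous with constant at most $N^4$, and be non-increasing in $\eta$ for each fixed $E$. Let $u_1$ be the Stieltjes transform $u_1(w)=\int\frac{g(x)}{x-w}\,dx$ of a nonnegative integrable function $g$ supported in $[0,\infty)$. If $w\in\mathbf S$ and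 $|\Upsilon(w',u_1(w'))|\le\delta(w')$ for all $w'\in L(w)$, then $$|u_1(w)-m_{1c}(w)|\le\frac{C\,\delta(w)}{\sqrt{\kappa+\eta+\delta(w)}}.\tag{1}$$ It is *stable on $\mathbf D_L$ with constant $C$* if for every such $u_1$, every $w\in\mathbf D_L$ and every $0\le\delta\le(\log N)^{-1}|m_{1c}(w)|$, the bound $|\Upsilon(w,u_1(w))|\le\delta$ implies $|u_1(w)-m_{1c}(w)|\le C\delta$. **Lemma 3.6.** Let $\tau>0$. In each case below the constant $C>0$ does not depend on $w$, $N$, $\sigma_1,\dots,\sigma_N$ and $z$, which are arbitrary subject to the above. Cases 1, 2 and 4 hold for all $\tau'\in(0,\tau_0]$ with some $\tau_0=\tau_0(\tau)>0$, and Case 3 for all $\tau'\in(0,\tau_0]$ with some $\tau_0=\tau_0(\tau,\epsilon)>0$; $\zeta\in(0,1)$ is arbitrary. 1. For every $c:(0,\infty)\to(0,\infty)$ there is $C=C(\tau,\tau',\zeta,c)$ such that $\Upsilon=0$ is stable with constant $C$ on $\mathbf D^b_{[a,b]}$, for every $c$-regular bulk component $[a,b]$. 2. There is $C=C(\tau,\tau',\zeta)$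 such that $\Upsilon=0$ is stable with constant $C$ on $\mathbf D^o$. 3. For every $\epsilon>0$ there is $C=C(\tau,\tau',\zeta,\epsilon)$ such that $\Upsilon=0$ is stable with constant $C$ on $\mathbf D^e_e$, for every $\epsilon$-regular edge $e\neq0$. 4. For every $\epsilon>0$ there is $C=C(\tau,\tau',\zeta,\epsilon)$ such that, if $|z|^2\le1-\tau$, then $\Upsilon=0$ is stable with constant $C$ on $\{w\in\mathbf D^e_0:|w|^{1/2}+|z|^2\ge\epsilon\}$, where in (1) the term $\delta(w)$ under the square root is replaced by $\min\{\delta(w),1\}$. 5. There is $C=C(\tau,\zeta)$ such that $\Upsilon=0$ is stable with constant $C$ on $\mathbf D_L$. -/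

import Mathlib

open MeasureTheory Filter Topology

noncomputable section

namespace SelfCon

variable {N : ℕ}

/-- The standing assumptions on `(Σ, z)` in the case `N ≤ M`. The numbers `σ 0, …, σ (N-1)` are the
eigenvalues of `Σ = T T†`, listed with multiplicity; they lie in `[τ, τ⁻¹]` and have mean one, and
`z` is away from the unit circle. A sum `∑ i, l_i F(s_i)` over distinct eigenvalues `s_i` with
multiplicities `l_i` is the sum `∑ i, F (σ i)`. -/
def Admissible (τ : ℝ) (σ : Fin N → ℝ) (z : ℂ) : Prop :=
  (∀ i, τ ≤ σ i ∧ σ i ≤ τ⁻¹) ∧ (1 / (N : ℝ)) * ∑ i, σ i = 1 ∧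
    τ ≤ |‖z‖ ^ 2 - 1| ∧ |‖z‖ ^ 2 - 1| ≤ τ⁻¹

/-- `m` is analytic on the upper half plane, `m w` and `w * m w` have positive imaginary part there,
and `m` solves the self-consistent equation. -/
def IsM1c (σ : Fin N → ℝ) (z : ℂ) (m : ℂ → ℂ) : Prop :=
  DifferentiableOn ℂ m {w : ℂ | 0 < w.im} ∧
    ∀ w : ℂ, 0 < w.im → 0 < (m w).im ∧ 0 < (w * m w).im ∧
      m w = (1 / (N : ℂ)) * ∑ i, (σ i : ℂ) *
        (-w * (1 + (σ i : ℂ) / (-w * (1 + m w) + (‖z‖ : ℂ) ^ 2 / (1 + m w)))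
          + (‖z‖ : ℂ) ^ 2 / (1 + m w))⁻¹

/-- The function `m_{1c}`: the solution of the self-consistent equation, unique on the
upper half plane. Its values outside the upper half plane are never used. -/
def m1c (σ : Fin N → ℝ) (z : ℂ) : ℂ → ℂ :=
  Classical.epsilon (IsM1c σ z)

/-- The function `m_{2c}`, obtained from `m_{1c}` through `1/m₂ = -w (1+m₁) + |z|²/(1+m₁)`. -/
def m2c (σ : Fin N → ℝ) (z : ℂ) (w : ℂ) : ℂ :=
  (-w * (1 + m1c σ z w) + (‖z‖ : ℂ) ^ 2 / (1 + m1c σ z w))⁻¹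

/-- The boundary value `m_{1c}(x) = lim_{η ↓ 0} m_{1c}(x + iη)`. -/
def m1cReal (σ : Fin N → ℝ) (z : ℂ) (x : ℝ) : ℂ :=
  limUnder (𝓝[>] (0 : ℝ)) fun η : ℝ => m1c σ z ((x : ℂ) + (η : ℂ) * Complex.I)

/-- The density `ρ_{1c}(x) = π⁻¹ lim_{η ↓ 0} Im m_{1c}(x + iη)`. -/
def rho1c (σ : Fin N → ℝ) (z : ℂ) (x : ℝ) : ℝ :=
  (1 / Real.pi) *
    limUnder (𝓝[>] (0 : ℝ)) fun η : ℝ => (m1c σ z ((x : ℂ) + (η : ℂ) * Complex.I)).im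

/-- The closed support of `ρ_{1c}`. -/
def supp (σ : Fin N → ℝ) (z : ℂ) : Set ℝ := tsupport (rho1c σ z)

/-- The edges: the end points of the components of the support, that is, its boundary points. -/
def edges (σ : Fin N → ℝ) (z : ℂ) : Set ℝ := frontier (supp σ z)

/-- `[a, b]` is a bulk component `[e_{2k}, e_{2k-1}]`. -/
def IsBulkComponent (σ : Fin N → ℝ) (z : ℂ) (a b : ℝ) : Prop :=
  a < b ∧ connectedComponentIn (supp σ z) a = Set.Icc a b

/-- The distance `κ(E)` from `E` to the set of nonzero edges. -/
def kappa (σ : Fin N → ℝ) (z : ℂ) (E : ℝ) : ℝ :=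
  Metric.infDist E {e | e ∈ edges σ z ∧ 0 < e}

/-- The cubic denominator `r m³ - (s + |z|²) m² - r |z|² m + |z|⁴`, with `r = √w`. -/
def cubic (s : ℝ) (z : ℂ) (r m : ℂ) : ℂ :=
  r * m ^ 3 - ((s : ℂ) + (‖z‖ : ℂ) ^ 2) * m ^ 2 - r * (‖z‖ : ℂ) ^ 2 * m + (‖z‖ : ℂ) ^ 4

/-- The function `f(r, m)`, with `r = √w`. -/
def f (σ : Fin N → ℝ) (z : ℂ) (r m : ℂ) : ℂ :=
  -r + m + (1 / (N : ℂ)) * ∑ i, (σ i : ℂ) * (m * (m ^ 2 - (‖z‖ : ℂ) ^ 2) / cubic (σ i) z r m)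

/-- The boundary value `m_c(x) = √x (1 + m_{1c}(x))` for `x > 0`. -/
def mcReal (σ : Fin N → ℝ) (z : ℂ) (x : ℝ) : ℂ :=
  (Real.sqrt x : ℂ) * (1 + m1cReal σ z x)

/-- Regularity of a nonzero edge `e` with constant `ε`: `m_c(e)` has distance at least `ε` from all
roots of the cubics (which are real, namely `a_i(e)`, `b_i(e)` and `-c_i(e)`), and
`|∂_m² f(√e, m_c(e))| ≥ ε`. -/
def RegularEdge (σ : Fin N → ℝ) (z : ℂ) (ε e : ℝ) : Prop :=
  (∀ i, ∀ r : ℝ, cubic (σ i) z (Real.sqrt e : ℂ) (r : ℂ) = 0 → ε ≤ ‖mcReal σ z e - (r : ℂ)‖) ∧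
    ε ≤ ‖iteratedDeriv 2 (fun m : ℂ => f σ z (Real.sqrt e : ℂ) m) (mcReal σ z e)‖

/-- Regularity of a bulk component `[a, b]`, with the lower bound `c r` for the density on
`[a + r, b - r]`, for every `r > 0`. -/
def RegularBulk (σ : Fin N → ℝ) (z : ℂ) (c : ℝ → ℝ) (a b : ℝ) : Prop :=
  ∀ r : ℝ, 0 < r → ∀ x ∈ Set.Icc (a + r) (b - r), c r ≤ rho1c σ z x

/-- The fundamental domain `𝐃(ζ, N)`. -/
def dom (σ : Fin N → ℝ) (z : ℂ) (ζ : ℝ) : Set ℂ :=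
  {w | 0 < w.im ∧ 0 ≤ w.re ∧ w.re ≤ ζ⁻¹ ∧
    (N : ℝ) ^ (-1 + ζ) * ‖m2c σ z w‖⁻¹ ≤ w.im ∧ w.im ≤ ζ⁻¹}

/-- The domain near an edge `e`. -/
def domEdge (σ : Fin N → ℝ) (z : ℂ) (ζ τ' e : ℝ) : Set ℂ :=
  {w | w ∈ dom σ z ζ ∧ |w.re - e| ≤ τ'}

/-- The domain of a bulk component `[a, b]`. -/
def domBulk (σ : Fin N → ℝ) (z : ℂ) (ζ τ' a b : ℝ) : Set ℂ :=
  {w | w ∈ dom σ z ζ ∧ w.re ∈ Set.Icc (a + τ') (b - τ')}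

/-- The domain outside the spectrum. -/
def domOut (σ : Fin N → ℝ) (z : ℂ) (ζ τ' : ℝ) : Set ℂ :=
  {w | w ∈ dom σ z ζ ∧ τ' ≤ Metric.infDist w.re (supp σ z)}

/-- The domain `𝐃_L(ζ)` of large `η`. -/
def domLarge (ζ : ℝ) : Set ℂ :=
  {w | 0 < w.im ∧ 0 ≤ w.re ∧ w.re ≤ ζ⁻¹ ∧ ζ⁻¹ ≤ w.im}

/-- The left-hand side `Υ(w, u)` of the self-consistent equation. -/
def Upsilon (σ : Fin N → ℝ) (z : ℂ) (w u : ℂ) : ℂ :=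
  u + (1 / (N : ℂ)) * ∑ i, (σ i : ℂ) * (1 + u) *
    (w * (1 + (σ i : ℂ) * ((1 + u) / (-w * (1 + u) ^ 2 + (‖z‖ : ℂ) ^ 2))) * (1 + u)
      - (‖z‖ : ℂ) ^ 2)⁻¹

/-- The discrete set `L(w)`. -/
def lattice (σ : Fin N → ℝ) (z : ℂ) (ζ : ℝ) (w : ℂ) : Set ℂ :=
  {w} ∪ {w' | w' ∈ dom σ z ζ ∧ w'.re = w.re ∧ w.im ≤ w'.im ∧ w'.im ≤ 1 ∧
    ∃ k : ℕ, w'.im = (k : ℝ) / (N : ℝ) ^ 10}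

/-- The Stieltjes transform of `g`. -/
def stieltjes (g : ℝ → ℝ) (w : ℂ) : ℂ := ∫ x : ℝ, (g x : ℂ) / ((x : ℂ) - w)

/-- `g` is a nonnegative integrable function on the half line `[0, ∞)`, extended by zero. -/
def IsDensity (g : ℝ → ℝ) : Prop :=
  Integrable g ∧ (∀ x, 0 ≤ g x) ∧ ∀ x < 0, g x = 0

/-- Stability of `Υ(w, m₁) = 0` on a subset `S` of the fundamental domain, with constant `C`.
The error bound is `C δ / √(κ + η + cap δ)`; the usual form is `cap δ = δ`. -/
def StableOn (σ : Fin N → ℝ) (z : ℂ) (ζ : ℝ) (S : Set ℂ) (cap : ℝ → ℝ) (C : ℝ) : Prop :=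
  ∀ δ : ℂ → ℝ,
    (∀ w ∈ S, ((N : ℝ) ^ 2)⁻¹ * ‖m1c σ z w‖ ≤ δ w ∧ δ w ≤ (Real.log N)⁻¹ * ‖m1c σ z w‖) →
    LipschitzOnWith ((N : NNReal) ^ 4) δ S →
    (∀ w ∈ S, ∀ w' ∈ S, w'.re = w.re → w.im ≤ w'.im → δ w' ≤ δ w) →
    ∀ g : ℝ → ℝ, IsDensity g →
    ∀ w ∈ S, (∀ w' ∈ lattice σ z ζ w, ‖Upsilon σ z w' (stieltjes g w')‖ ≤ δ w') →
      ‖stieltjes g w - m1c σ z w‖ ≤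
        C * δ w / Real.sqrt (kappa σ z w.re + w.im + cap (δ w))

/-- Stability of `Υ(w, m₁) = 0` on `𝐃_L(ζ)`, with constant `C`. -/
def StableLarge (σ : Fin N → ℝ) (z : ℂ) (ζ C : ℝ) : Prop :=
  ∀ g : ℝ → ℝ, IsDensity g → ∀ w ∈ domLarge ζ, ∀ δ : ℝ, 0 ≤ δ →
    δ ≤ (Real.log N)⁻¹ * ‖m1c σ z w‖ →
    ‖Upsilon σ z w (stieltjes g w)‖ ≤ δ → ‖stieltjes g w - m1c σ z w‖ ≤ C * δ

end SelfCon

end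

/-!
Put `r = √w`, `m = r (1 + u)` and `q = |z|²`. Then `Υ(w, u) = FF(r, m) / r`, where
`FF(r, m) = m - r + avg (σ / b)` is built from `a = m - q/m` and `b = r - q/m - σ/a`. All of these
have positive imaginary part when `r` and `m` have. The difference of two values of `FF` is given by
an exact identity (`FF_sub`): in `m` it is the difference of the arguments times `1 - KK`, with a
kernel `KK` that is an average of products of terms at the two points. Hence Cauchy–Schwarz
(`norm_KK_sq_le`) bounds `|KK|²` by the product of the diagonal majorants `K1` at the two points.
The imaginary part of the equation (`Sol.im_eq`) reads `(1 - K1) Im m = (1 + A1) Im r`, so `K1 < 1`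
at every solution. This gives uniqueness, the existence of `m₁` as the limit of an iteration
(`exists_isM1c`), and stability for all `u` with a constant depending on `Im r` only
(`Sol.strong_stability`). The latter settles large `η`, and bounded `N`.

Close to the real axis stability is local: if `m`, `a` and all `b` are bounded below (`Nice`) and
`|1 - KK|` is bounded below at the solution, then the equation is stable for `u` close to `m₁`
(`exists_local_stability`), with constants independent of `N`. That `u₁` is close to `m₁` is known
at `η = 1`. It propagates down along the lattice, whose mesh is so fine that neither function
changes much from one point to the next, while stability improves the bound at each point (`chain`).
It remains to find the lower bounds in each region.

In the bulk, the lower bound on the density bounds `Im m` from below along the whole vertical line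
(`exists_im_ge_of_rho`). Each summand of `KK` on the diagonal is a combination of squares whose
phases cannot all be zero then, so `Re KK` stays below `K1 < 1` by a fixed amount
(`exists_nice_of_im`). Near zero, for `|z| < 1`, the bound on `Im m` holds by a direct argument
(`exists_im_ge_near_zero`). Outside the support, `-1/b` is a bounded analytic function with
nonnegative imaginary part whose boundary values are real in a gap. The Poisson kernel then gives
linear decay of `Im (-1/b)` (`im_le_of_gap`, `exists_decay`), which makes `1 - K1` and `|b|` bounded
below; next to zero, for `|z| > 1`, the bound on `K1` is direct (`exists_K1_le_near_zero`).

At a nonzero edge the boundary value of `m` exists, because its cluster points would otherwise fill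
an interval of roots of a polynomial (`exists_edge_limit`). It is real, and degenerate, `KK = 1`,
because otherwise the solution would be real around the edge (`KK_eq_one_of_edge`). Regularity says
that it is nonsingular and that the second derivative of `FF` in `m` is bounded below there, so
Taylor expansion (`exists_expansion`) gives `|m - M|² ≍ |w - e|` (`exists_sqrt_behaviour`) and
the corresponding stability with a square root loss (`exists_sqrt_stability`). The bound propagates
along the lattice with a threshold of order `|w - e|^(1/2)` while `δ` is small compared to `|w - e|`,
and of order one afterwards (`exists_bound_of_edgeStable`).
-/

open MeasureTheory Filter Topology

noncomputable section

namespace SelfCon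

/-! ### Averages over the eigenvalues -/

/-- The average `N⁻¹ ∑ i, x i`, for real or complex `x`. -/
def avg {N : ℕ} {K : Type*} [DivisionRing K] (x : Fin N → K) : K := (1 / (N : K)) * ∑ i, x i

section avg
variable {N : ℕ}

lemma avg_add {K : Type*} [DivisionRing K] (x y : Fin N → K) :
    avg (fun i => x i + y i) = avg x + avg y := by
  simp [avg, Finset.sum_add_distrib, mul_add]

lemma avg_sub {K : Type*} [DivisionRing K] (x y : Fin N → K) :
    avg (fun i => x i - y i) = avg x - avg y := by
  simp [avg, Finset.sum_sub_distrib, mul_sub]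

lemma avg_mul_left {K : Type*} [Field K] (c : K) (x : Fin N → K) :
    avg (fun i => c * x i) = c * avg x := by
  simp only [avg, ← Finset.mul_sum]; ring

lemma avg_const {K : Type*} [Field K] [CharZero K] (hN : N ≠ 0) (c : K) :
    avg (fun _ : Fin N => c) = c := by
  have : (N : K) ≠ 0 := by exact_mod_cast hN
  simp [avg, this]

lemma avg_re (x : Fin N → ℂ) : (avg x).re = avg fun i => (x i).re := by
  have : (1 / (N : ℂ)) = ((1 / (N : ℝ) : ℝ) : ℂ) := by push_cast; rfl
  rw [avg, this, Complex.re_ofReal_mul, Complex.re_sum, avg]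

lemma avg_im (x : Fin N → ℂ) : (avg x).im = avg fun i => (x i).im := by
  have : (1 / (N : ℂ)) = ((1 / (N : ℝ) : ℝ) : ℂ) := by push_cast; rfl
  rw [avg, this, Complex.im_ofReal_mul, Complex.im_sum, avg]

lemma avg_ofReal (x : Fin N → ℝ) : avg (fun i => (x i : ℂ)) = ((avg x : ℝ) : ℂ) := by
  simp [avg]

lemma avg_mono {x y : Fin N → ℝ} (h : ∀ i, x i ≤ y i) : avg x ≤ avg y := by
  unfold avg
  exact mul_le_mul_of_nonneg_left (Finset.sum_le_sum fun i _ => h i) (by positivity)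

lemma avg_nonneg {x : Fin N → ℝ} (h : ∀ i, 0 ≤ x i) : 0 ≤ avg x := by
  unfold avg
  exact mul_nonneg (by positivity) (Finset.sum_nonneg fun i _ => h i)

lemma avg_pos (hN : N ≠ 0) {x : Fin N → ℝ} (h : ∀ i, 0 < x i) : 0 < avg x := by
  unfold avg
  have : 0 < N := Nat.pos_of_ne_zero hN
  have : Nonempty (Fin N) := ⟨⟨0, this⟩⟩
  exact mul_pos (by positivity) (Finset.sum_pos (fun i _ => h i) Finset.univ_nonempty)

lemma norm_avg_le (x : Fin N → ℂ) : ‖avg x‖ ≤ avg fun i => ‖x i‖ := by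
  unfold avg
  rw [norm_mul]
  have : ‖(1 / (N : ℂ))‖ = 1 / (N : ℝ) := by simp
  rw [this]
  exact mul_le_mul_of_nonneg_left (norm_sum_le _ _) (by positivity)

lemma le_avg_mul {x : Fin N → ℝ} (h : ∀ i, 0 ≤ x i) (i : Fin N) : x i ≤ N * avg x := by
  have hN : (N : ℝ) ≠ 0 := by
    have := i.pos; positivity
  have : (N : ℝ) * avg x = ∑ i, x i := by unfold avg; field_simp
  rw [this]
  exact Finset.single_le_sum (fun i _ => h i) (Finset.mem_univ i)

/-- The Cauchy–Schwarz inequality for averages. -/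
lemma avg_mul_sq_le (x y : Fin N → ℝ) :
    (avg fun i => x i * y i) ^ 2 ≤ (avg fun i => x i ^ 2) * avg fun i => y i ^ 2 := by
  unfold avg
  have := Finset.sum_mul_sq_le_sq_mul_sq Finset.univ x y
  calc _ = (1 / (N : ℝ)) ^ 2 * (∑ i, x i * y i) ^ 2 := by ring
    _ ≤ (1 / (N : ℝ)) ^ 2 * ((∑ i, x i ^ 2) * ∑ i, y i ^ 2) := by gcongr
    _ = _ := by ring

lemma norm_avg_mul_sq_le (x y : Fin N → ℂ) :
    ‖avg fun i => x i * y i‖ ^ 2 ≤ (avg fun i => ‖x i‖ ^ 2) * avg fun i => ‖y i‖ ^ 2 := by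
  refine le_trans ?_ (avg_mul_sq_le _ _)
  refine pow_le_pow_left₀ (norm_nonneg _) ?_ 2
  exact (norm_avg_le _).trans (le_of_eq (by simp))

end avg

/-! ### The equation in the variable `m = r (1 + u)`, `r = √w` -/

/-- `a = m - q / m`. -/
def aa (q : ℝ) (m : ℂ) : ℂ := m - q / m

/-- `r - q / m`. -/
def ss (q : ℝ) (r m : ℂ) : ℂ := r - q / m

/-- `b = r - q / m - s / a`, whose average inverse drives the equation. -/
def bb (q s : ℝ) (r m : ℂ) : ℂ := r - q / m - s / aa q m

/-- The equation in the variables `r = √w` and `m = r (1 + u)`, with `q = |z|²`; all of its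
building blocks have positive imaginary part when `r` and `m` have. -/
def FF {N : ℕ} (σ : Fin N → ℝ) (q : ℝ) (r m : ℂ) : ℂ :=
  m - r + avg fun i => (σ i : ℂ) / bb q (σ i) r m

/-- The summand of the divided difference of `FF`. -/
def kterm (q s : ℝ) (r m r' m' : ℂ) : ℂ :=
  s * ((bb q s r m)⁻¹ * (bb q s r' m')⁻¹) *
    (q * (m⁻¹ * m'⁻¹) + s * ((aa q m)⁻¹ * (aa q m')⁻¹) * (1 + q * (m⁻¹ * m'⁻¹)))

/-- The kernel of the divided difference: `1 - KK` is the divided difference of `FF` in `m`. -/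
def KK {N : ℕ} (σ : Fin N → ℝ) (q : ℝ) (r m r' m' : ℂ) : ℂ :=
  avg fun i => kterm q (σ i) r m r' m'

/-- The positive majorant of `kterm`. -/
def kpos (q s : ℝ) (r m : ℂ) : ℝ :=
  s / ‖bb q s r m‖ ^ 2 * (q / ‖m‖ ^ 2 + s / ‖aa q m‖ ^ 2 * (1 + q / ‖m‖ ^ 2))

/-- The average of the majorants `kpos`. The imaginary part of the equation reads `(1 - K1) Im m =
(1 + A1) Im r`, so `K1 < 1` at every solution. -/
def K1 {N : ℕ} (σ : Fin N → ℝ) (q : ℝ) (r m : ℂ) : ℝ := avg fun i => kpos q (σ i) r m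

/-- The average of `σ / |b|²`. -/
def A1 {N : ℕ} (σ : Fin N → ℝ) (q : ℝ) (r m : ℂ) : ℝ :=
  avg fun i => σ i / ‖bb q (σ i) r m‖ ^ 2

/-- The average of `σ² / |a b|²`. -/
def B1 {N : ℕ} (σ : Fin N → ℝ) (q : ℝ) (r m : ℂ) : ℝ :=
  avg fun i => σ i ^ 2 / (‖bb q (σ i) r m‖ ^ 2 * ‖aa q m‖ ^ 2)

/-- The standing assumptions on `σ` and `q = |z|²`, together with `0 < τ`. -/
structure Par {N : ℕ} (τ : ℝ) (σ : Fin N → ℝ) (q : ℝ) : Prop where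
  tau : 0 < τ
  lo : ∀ i, τ ≤ σ i
  hi : ∀ i, σ i ≤ τ⁻¹
  mean : avg σ = 1
  q0 : 0 ≤ q
  qgap : τ ≤ |q - 1|
  qhi : q ≤ 1 + τ⁻¹

lemma Admissible.par {N : ℕ} {τ : ℝ} {σ : Fin N → ℝ} {z : ℂ} (hτ : 0 < τ)
    (h : Admissible τ σ z) : Par τ σ (‖z‖ ^ 2) := by
  obtain ⟨h1, h2, h3, h4⟩ := h
  refine ⟨hτ, fun i => (h1 i).1, fun i => (h1 i).2, h2, by positivity, h3, ?_⟩
  have := le_abs_self (‖z‖ ^ 2 - 1)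
  linarith

namespace Par
variable {N : ℕ} {τ : ℝ} {σ : Fin N → ℝ} {q : ℝ}

lemma N_ne (h : Par τ σ q) : N ≠ 0 := by
  rintro rfl
  have := h.mean
  simp [avg] at this

lemma spos (h : Par τ σ q) (i : Fin N) : 0 < σ i := h.tau.trans_le (h.lo i)

lemma tau_le_one (h : Par τ σ q) : τ ≤ 1 := by
  rw [← h.mean, ← avg_const (K := ℝ) h.N_ne τ]
  exact avg_mono h.lo

end Par

section im
variable {q s : ℝ} {r m : ℂ}

lemma inv_im_eq (x : ℂ) : (x⁻¹).im = -x.im / ‖x‖ ^ 2 := by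
  rw [Complex.inv_im, Complex.normSq_eq_norm_sq]

lemma inv_re_eq (x : ℂ) : (x⁻¹).re = x.re / ‖x‖ ^ 2 := by
  rw [Complex.inv_re, Complex.normSq_eq_norm_sq]

lemma div_im_eq (t : ℝ) (x : ℂ) : ((t : ℂ) / x).im = -(t * x.im / ‖x‖ ^ 2) := by
  rw [div_eq_mul_inv, Complex.im_ofReal_mul, inv_im_eq]; ring

lemma div_re_eq (t : ℝ) (x : ℂ) : ((t : ℂ) / x).re = t * x.re / ‖x‖ ^ 2 := by
  rw [div_eq_mul_inv, Complex.re_ofReal_mul, inv_re_eq]; ring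

lemma aa_im : (aa q m).im = m.im * (1 + q / ‖m‖ ^ 2) := by
  rw [aa, Complex.sub_im, div_im_eq]; ring

lemma aa_re : (aa q m).re = m.re * (1 - q / ‖m‖ ^ 2) := by
  rw [aa, Complex.sub_re, div_re_eq]; ring

lemma ss_im : (ss q r m).im = r.im + q * m.im / ‖m‖ ^ 2 := by
  rw [ss, Complex.sub_im, div_im_eq]; ring

lemma bb_eq : bb q s r m = ss q r m - s / aa q m := rfl

lemma bb_im : (bb q s r m).im =
    r.im + m.im * (q / ‖m‖ ^ 2 + s / ‖aa q m‖ ^ 2 * (1 + q / ‖m‖ ^ 2)) := by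
  rw [bb_eq, Complex.sub_im, ss_im, div_im_eq, aa_im]; ring

lemma bb_re : (bb q s r m).re =
    r.re - m.re * (q / ‖m‖ ^ 2 + s / ‖aa q m‖ ^ 2 * (1 - q / ‖m‖ ^ 2)) := by
  rw [bb, Complex.sub_re, Complex.sub_re, div_re_eq, div_re_eq, aa_re]; ring

lemma le_aa_im (hq : 0 ≤ q) (hm : 0 < m.im) : m.im ≤ (aa q m).im := by
  rw [aa_im]
  have : 0 ≤ q / ‖m‖ ^ 2 := by positivity
  nlinarith

lemma le_bb_im (hq : 0 ≤ q) (hs : 0 ≤ s) (hm : 0 < m.im) : r.im ≤ (bb q s r m).im := by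
  rw [bb_im]
  have : 0 ≤ m.im * (q / ‖m‖ ^ 2 + s / ‖aa q m‖ ^ 2 * (1 + q / ‖m‖ ^ 2)) := by positivity
  linarith

lemma ne_zero_of_im_pos {x : ℂ} (h : 0 < x.im) : x ≠ 0 := by
  rintro rfl; simp at h

lemma aa_im_pos (hq : 0 ≤ q) (hm : 0 < m.im) : 0 < (aa q m).im := hm.trans_le (le_aa_im hq hm)

lemma aa_ne (hq : 0 ≤ q) (hm : 0 < m.im) : aa q m ≠ 0 := ne_zero_of_im_pos (aa_im_pos hq hm)

lemma bb_im_pos (hq : 0 ≤ q) (hs : 0 ≤ s) (hr : 0 < r.im) (hm : 0 < m.im) :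
    0 < (bb q s r m).im := hr.trans_le (le_bb_im hq hs hm)

lemma bb_ne (hq : 0 ≤ q) (hs : 0 ≤ s) (hr : 0 < r.im) (hm : 0 < m.im) : bb q s r m ≠ 0 :=
  ne_zero_of_im_pos (bb_im_pos hq hs hr hm)

lemma ss_im_pos (hq : 0 ≤ q) (hr : 0 < r.im) (hm : 0 < m.im) : 0 < (ss q r m).im := by
  rw [ss_im]
  have : 0 ≤ q * m.im / ‖m‖ ^ 2 := by positivity
  linarith

lemma ss_ne (hq : 0 ≤ q) (hr : 0 < r.im) (hm : 0 < m.im) : ss q r m ≠ 0 :=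
  ne_zero_of_im_pos (ss_im_pos hq hr hm)

lemma norm_inv_bb_le (hq : 0 ≤ q) (hs : 0 ≤ s) (hr : 0 < r.im) (hm : 0 < m.im) :
    ‖bb q s r m‖⁻¹ ≤ r.im⁻¹ := by
  have h1 := le_bb_im (r := r) hq hs hm
  have h2 := (le_abs_self _).trans (Complex.abs_im_le_norm (bb q s r m))
  exact inv_anti₀ hr (h1.trans h2)

end im

section identities
variable {N : ℕ} {τ : ℝ} {σ : Fin N → ℝ} {q : ℝ} {r m r' m' : ℂ}

/-- `K1` in terms of `A1` and `B1`. -/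
lemma K1_eq : K1 σ q r m =
    A1 σ q r m * (q / ‖m‖ ^ 2) + B1 σ q r m * (1 + q / ‖m‖ ^ 2) := by
  rw [K1, A1, B1, mul_comm _ (q / ‖m‖ ^ 2), mul_comm _ (1 + q / ‖m‖ ^ 2), ← avg_mul_left,
    ← avg_mul_left, ← avg_add]
  congr 1; ext i
  rw [kpos, div_mul_eq_div_div]; ring

/-- The imaginary part of the equation. -/
lemma FF_im : (FF σ q r m).im = m.im - r.im * (1 + A1 σ q r m) - m.im * K1 σ q r m := by
  have : (avg fun i => (σ i : ℂ) / bb q (σ i) r m).im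
      = - (r.im * A1 σ q r m) - m.im * K1 σ q r m := by
    rw [avg_im, A1, K1, ← avg_mul_left, ← avg_mul_left, neg_eq_neg_one_mul, ← avg_mul_left,
      ← avg_sub]
    congr 1; ext i
    rw [div_im_eq, bb_im, kpos]; ring
  rw [FF, Complex.add_im, this, Complex.sub_im]; ring

/-- The real part of the equation. -/
lemma FF_re : (FF σ q r m).re =
    m.re * (1 - K1 σ q r m + 2 * B1 σ q r m * (q / ‖m‖ ^ 2)) - r.re * (1 - A1 σ q r m) := by
  have : (avg fun i => (σ i : ℂ) / bb q (σ i) r m).re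
      = r.re * A1 σ q r m - m.re * (A1 σ q r m * (q / ‖m‖ ^ 2)
          + B1 σ q r m * (1 - q / ‖m‖ ^ 2)) := by
    rw [avg_re, mul_comm (A1 σ q r m) (q / ‖m‖ ^ 2), mul_comm (B1 σ q r m), A1, B1,
      ← avg_mul_left, ← avg_mul_left, ← avg_mul_left, ← avg_add, ← avg_mul_left, ← avg_sub]
    congr 1; ext i
    rw [div_re_eq, bb_re, div_mul_eq_div_div]; ring
  rw [FF, Complex.add_re, this, Complex.sub_re, K1_eq]; ring

lemma A1_nonneg (h : Par τ σ q) : 0 ≤ A1 σ q r m :=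
  avg_nonneg fun i => by have := h.spos i; positivity

lemma B1_nonneg : 0 ≤ B1 σ q r m :=
  avg_nonneg fun i => by positivity

lemma K1_nonneg (h : Par τ σ q) : 0 ≤ K1 σ q r m :=
  avg_nonneg fun i => by have := h.spos i; have := h.q0; unfold kpos; positivity

lemma aa_sub (hm : m ≠ 0) (hm' : m' ≠ 0) :
    aa q m - aa q m' = (m - m') * (1 + q * (m⁻¹ * m'⁻¹)) := by
  unfold aa; field_simp; ring

lemma bb_sub {s : ℝ} (hm : m ≠ 0) (hm' : m' ≠ 0) (ha : aa q m ≠ 0) (ha' : aa q m' ≠ 0) :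
    bb q s r m - bb q s r' m' = (r - r') + (m - m') *
      (q * (m⁻¹ * m'⁻¹) + s * ((aa q m)⁻¹ * (aa q m')⁻¹) * (1 + q * (m⁻¹ * m'⁻¹))) := by
  have h1 : (q : ℂ) / m - q / m' = -((m - m') * (q * (m⁻¹ * m'⁻¹))) := by field_simp; ring
  have h2 : (s : ℂ) / aa q m - s / aa q m' =
      -(aa q m - aa q m') * (s * ((aa q m)⁻¹ * (aa q m')⁻¹)) := by field_simp; ring
  rw [aa_sub hm hm'] at h2
  unfold bb
  linear_combination -h1 - h2

/-- The exact two-point identity for the equation. Everything below is deduced from it: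
uniqueness, stability, and Lipschitz continuity in `r`. -/
lemma FF_sub (hm : m ≠ 0) (hm' : m' ≠ 0) (ha : aa q m ≠ 0) (ha' : aa q m' ≠ 0)
    (hb : ∀ i, bb q (σ i) r m ≠ 0) (hb' : ∀ i, bb q (σ i) r' m' ≠ 0) :
    FF σ q r m - FF σ q r' m' = (m - m') * (1 - KK σ q r m r' m') -
      (r - r') * (1 + avg fun i => (σ i : ℂ) * ((bb q (σ i) r m)⁻¹ * (bb q (σ i) r' m')⁻¹)) := by
  have : (avg fun i => (σ i : ℂ) / bb q (σ i) r m) - (avg fun i => (σ i : ℂ) / bb q (σ i) r' m')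
      = - ((m - m') * KK σ q r m r' m') -
      (r - r') * (avg fun i => (σ i : ℂ) * ((bb q (σ i) r m)⁻¹ * (bb q (σ i) r' m')⁻¹)) := by
    rw [KK, neg_mul_eq_neg_mul, ← avg_mul_left, ← avg_mul_left, ← avg_sub, ← avg_sub]
    congr 1; ext i
    have e : (σ i : ℂ) / bb q (σ i) r m - (σ i : ℂ) / bb q (σ i) r' m' =
      - (bb q (σ i) r m - bb q (σ i) r' m') * (σ i : ℂ) *
        ((bb q (σ i) r m)⁻¹ * (bb q (σ i) r' m')⁻¹) := by
      have := hb i; have := hb' i; field_simp; ring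
    rw [e, bb_sub hm hm' ha ha', kterm]; ring
  unfold FF
  linear_combination this

/-- Cauchy–Schwarz for a single summand of the kernel. -/
lemma norm_kterm_le {s : ℝ} (hs : 0 ≤ s) (hq : 0 ≤ q) :
    ‖kterm q s r m r' m'‖ ≤ √(kpos q s r m) * √(kpos q s r' m') := by
  set β := ‖bb q s r m‖⁻¹ with hβ
  set β' := ‖bb q s r' m'‖⁻¹ with hβ'
  set α := ‖aa q m‖⁻¹ with hα
  set α' := ‖aa q m'‖⁻¹ with hα'
  set μ := ‖m‖⁻¹ with hμ
  set μ' := ‖m'‖⁻¹ with hμ'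
  have b0 : 0 ≤ β := by positivity
  have b0' : 0 ≤ β' := by positivity
  have a0 : 0 ≤ α := by positivity
  have a0' : 0 ≤ α' := by positivity
  have m0 : 0 ≤ μ := by positivity
  have m0' : 0 ≤ μ' := by positivity
  have e1 : kpos q s r m = s * β ^ 2 * (q * μ ^ 2 + s * α ^ 2 * (1 + q * μ ^ 2)) := by
    rw [kpos, hβ, hα, hμ]; simp only [inv_pow, div_eq_mul_inv]
  have e2 : kpos q s r' m' = s * β' ^ 2 * (q * μ' ^ 2 + s * α' ^ 2 * (1 + q * μ' ^ 2)) := by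
    rw [kpos, hβ', hα', hμ']; simp only [inv_pow, div_eq_mul_inv]
  have e3 : ‖kterm q s r m r' m'‖ ≤ s * (β * β') *
      (q * (μ * μ') + s * (α * α') * (1 + q * (μ * μ'))) := by
    unfold kterm
    rw [norm_mul, norm_mul, norm_mul, norm_inv, norm_inv, Complex.norm_real, Real.norm_of_nonneg hs]
    gcongr
    refine (norm_add_le _ _).trans ?_
    simp only [norm_mul, norm_inv, Complex.norm_real, Real.norm_of_nonneg hs, Real.norm_of_nonneg hq]
    gcongr
    refine (norm_add_le _ _).trans ?_
    simp only [norm_mul, norm_inv, Complex.norm_real, Real.norm_of_nonneg hq, norm_one]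
    exact le_rfl
  refine e3.trans ?_
  rw [← Real.sqrt_mul (by rw [e1]; positivity)]
  apply Real.le_sqrt_of_sq_le
  rw [e1, e2]
  have key : (q * (μ * μ') + s * (α * α') * (1 + q * (μ * μ'))) ^ 2 ≤
      (q * μ ^ 2 + s * α ^ 2 * (1 + q * μ ^ 2)) * (q * μ' ^ 2 + s * α' ^ 2 * (1 + q * μ' ^ 2)) := by
    have t1 : 0 ≤ q * s * (μ * α' - μ' * α) ^ 2 := by positivity
    have t2 : 0 ≤ q * q * s * (μ * α' * μ' - μ' * α * μ) ^ 2 := by positivity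
    have t3 : 0 ≤ s * s * q * (α * α' * μ' - α * α' * μ) ^ 2 := by positivity
    nlinarith [t1, t2, t3]
  calc _ = (s * (β * β')) ^ 2 * (q * (μ * μ') + s * (α * α') * (1 + q * (μ * μ'))) ^ 2 := by ring
    _ ≤ (s * (β * β')) ^ 2 * ((q * μ ^ 2 + s * α ^ 2 * (1 + q * μ ^ 2)) *
      (q * μ' ^ 2 + s * α' ^ 2 * (1 + q * μ' ^ 2))) := by gcongr
    _ = _ := by ring

/-- Cauchy–Schwarz for the kernel. -/
lemma norm_KK_sq_le (h : Par τ σ q) :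
    ‖KK σ q r m r' m'‖ ^ 2 ≤ K1 σ q r m * K1 σ q r' m' := by
  have h0 : ∀ r m i, 0 ≤ kpos q (σ i) r m := fun r m i => by
    have := h.spos i; have := h.q0; unfold kpos; positivity
  have h1 : ‖KK σ q r m r' m'‖ ≤ avg fun i => √(kpos q (σ i) r m) * √(kpos q (σ i) r' m') :=
    (norm_avg_le _).trans (avg_mono fun i => norm_kterm_le (h.spos i).le h.q0)
  refine (pow_le_pow_left₀ (norm_nonneg _) h1 2).trans ((avg_mul_sq_le _ _).trans ?_)
  simp only [Real.sq_sqrt (h0 _ _ _)]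
  exact le_rfl

/-- The factorization of the equation; the factor `r - q/m` is the spurious root. -/
lemma FF_factor (h : Par τ σ q) (ha : aa q m ≠ 0) (hb : ∀ i, bb q (σ i) r m ≠ 0) :
    FF σ q r m = ss q r m * (aa q m * (avg fun i => (bb q (σ i) r m)⁻¹) - 1) := by
  have : (avg fun i => (σ i : ℂ) / bb q (σ i) r m) =
      aa q m * ss q r m * (avg fun i => (bb q (σ i) r m)⁻¹) - aa q m := by
    conv_rhs => rw [← avg_const (K := ℂ) h.N_ne (aa q m), ← avg_mul_left, ← avg_sub]
    rw [avg_const h.N_ne]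
    congr 1; ext i
    have h1 := hb i
    have h2 : (σ i : ℂ) = aa q m * (ss q r m - bb q (σ i) r m) := by
      rw [bb_eq]; field_simp; ring
    field_simp
    linear_combination h2
  rw [FF, this]
  have : m - r = aa q m - ss q r m := by unfold aa ss; ring
  rw [this]; ring

end identities

/-! ### A priori bounds for solutions -/

/-- `m` solves the equation at `r`, both lying in the upper half plane. -/
structure Sol {N : ℕ} (σ : Fin N → ℝ) (q : ℝ) (r m : ℂ) : Prop where
  r_im : 0 < r.im
  m_im : 0 < m.im
  eq : FF σ q r m = 0

section
variable {N : ℕ} {τ : ℝ} {σ : Fin N → ℝ} {q : ℝ} {r m u : ℂ}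

lemma avg_sigma_div_norm_le (h : Par τ σ q) (hr : 0 < r.im) (hu : 0 < u.im) :
    ‖avg fun i => (σ i : ℂ) / bb q (σ i) r u‖ ≤ r.im⁻¹ := by
  refine (norm_avg_le _).trans ?_
  have : r.im⁻¹ = avg fun i => r.im⁻¹ * σ i := by rw [avg_mul_left, h.mean, mul_one]
  rw [this]
  refine avg_mono fun i => ?_
  have := norm_inv_bb_le (s := σ i) h.q0 (h.spos i).le hr hu
  rw [norm_div, Complex.norm_real, Real.norm_of_nonneg (h.spos i).le, div_eq_mul_inv, mul_comm]
  have := h.spos i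
  gcongr

namespace Sol

lemma m_ne (S : Sol σ q r m) : m ≠ 0 := ne_zero_of_im_pos S.m_im

lemma norm_m_pos (S : Sol σ q r m) : 0 < ‖m‖ := norm_pos_iff.2 S.m_ne

lemma aa_ne (S : Sol σ q r m) (h : Par τ σ q) : aa q m ≠ 0 := SelfCon.aa_ne h.q0 S.m_im

lemma bb_ne (S : Sol σ q r m) (h : Par τ σ q) (i : Fin N) : bb q (σ i) r m ≠ 0 :=
  SelfCon.bb_ne h.q0 (h.spos i).le S.r_im S.m_im

/-- The imaginary part of the equation at a solution: `1 - K1` is the ratio of `Im r` and `Im m`,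
up to a factor between one and two. -/
lemma im_eq (S : Sol σ q r m) : m.im * (1 - K1 σ q r m) = r.im * (1 + A1 σ q r m) := by
  have := congrArg Complex.im S.eq
  rw [FF_im, Complex.zero_im] at this
  linarith

/-- The real part of the equation at a solution. -/
lemma re_eq (S : Sol σ q r m) :
    m.re * (1 - K1 σ q r m + 2 * B1 σ q r m * (q / ‖m‖ ^ 2)) = r.re * (1 - A1 σ q r m) := by
  have := congrArg Complex.re S.eq
  rw [FF_re, Complex.zero_re] at this
  linarith

lemma K1_lt_one (S : Sol σ q r m) (h : Par τ σ q) : K1 σ q r m < 1 := by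
  have h1 := S.im_eq
  have h2 : 0 < r.im * (1 + A1 σ q r m) := by
    have := S.r_im; have := A1_nonneg (r := r) (m := m) h; positivity
  rw [← h1] at h2
  have := (pos_iff_pos_of_mul_pos h2).1 S.m_im
  linarith

/-- The reduced equation, obtained by dividing out the spurious factor `r - q/m`. -/
lemma avg_inv_bb (S : Sol σ q r m) (h : Par τ σ q) :
    (avg fun i => (bb q (σ i) r m)⁻¹) = (aa q m)⁻¹ := by
  have h1 := FF_factor h (S.aa_ne h) (S.bb_ne h)
  rw [S.eq] at h1
  have h2 := (mul_eq_zero.1 h1.symm).resolve_left (ss_ne h.q0 S.r_im S.m_im)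
  exact eq_inv_of_mul_eq_one_right (sub_eq_zero.1 h2)

/-- The basic a priori bound; it comes from the imaginary part of the reduced equation. -/
lemma A1_lt_one (S : Sol σ q r m) (h : Par τ σ q) : A1 σ q r m < 1 := by
  have h1 := congrArg Complex.im (S.avg_inv_bb h)
  have ha := aa_im_pos h.q0 S.m_im
  have hs := ss_im_pos h.q0 S.r_im S.m_im
  have hA : 0 < avg fun i => 1 / ‖bb q (σ i) r m‖ ^ 2 :=
    avg_pos h.N_ne fun i => by
      have := norm_pos_iff.2 (S.bb_ne h i); positivity
  have h2 : (avg fun i => (bb q (σ i) r m)⁻¹).im =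
      -(((ss q r m).im * avg fun i => 1 / ‖bb q (σ i) r m‖ ^ 2) +
        (aa q m).im / ‖aa q m‖ ^ 2 * A1 σ q r m) := by
    rw [avg_im, A1, ← avg_mul_left, ← avg_mul_left, ← avg_add, neg_eq_neg_one_mul, ← avg_mul_left]
    congr 1; ext i
    rw [inv_im_eq, bb_eq, Complex.sub_im, div_im_eq]
    ring
  rw [h2, inv_im_eq] at h1
  have h3 : (aa q m).im / ‖aa q m‖ ^ 2 * (1 - A1 σ q r m) =
      (ss q r m).im * avg fun i => 1 / ‖bb q (σ i) r m‖ ^ 2 := by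
    linear_combination h1
  have h4 : 0 < (aa q m).im / ‖aa q m‖ ^ 2 * (1 - A1 σ q r m) := by rw [h3]; positivity
  have h5 : 0 < (aa q m).im / ‖aa q m‖ ^ 2 := by
    have := norm_pos_iff.2 (S.aa_ne h); positivity
  have := (pos_iff_pos_of_mul_pos h4).1 h5
  linarith

/-- The Cauchy–Schwarz inequality applied to `m - r = -avg (σ / b)`; the weights `σ` have mean
one. -/
lemma norm_sub_sq_le (S : Sol σ q r m) (h : Par τ σ q) : ‖m - r‖ ^ 2 ≤ A1 σ q r m := by
  have h1 : m - r = - avg fun i => (√(σ i) : ℂ) * ((√(σ i) : ℂ) / bb q (σ i) r m) := by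
    have h2 := S.eq
    rw [FF] at h2
    have : (fun i => (√(σ i) : ℂ) * ((√(σ i) : ℂ) / bb q (σ i) r m)) =
        fun i => (σ i : ℂ) / bb q (σ i) r m := by
      ext i
      rw [← mul_div_assoc, ← Complex.ofReal_mul, Real.mul_self_sqrt (h.spos i).le]
    rw [this]
    linear_combination h2
  rw [h1, norm_neg]
  refine (norm_avg_mul_sq_le _ _).trans ?_
  have e1 : (avg fun i => ‖(√(σ i) : ℂ)‖ ^ 2) = 1 := by
    rw [← h.mean]; congr 1; ext i
    rw [Complex.norm_real, Real.norm_eq_abs, sq_abs, Real.sq_sqrt (h.spos i).le]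
  have e2 : (avg fun i => ‖(√(σ i) : ℂ) / bb q (σ i) r m‖ ^ 2) = A1 σ q r m := by
    rw [A1]; congr 1; ext i
    rw [norm_div, div_pow, Complex.norm_real, Real.norm_eq_abs, sq_abs, Real.sq_sqrt (h.spos i).le]
  rw [e1, e2, one_mul]

lemma norm_sub_lt_one (S : Sol σ q r m) (h : Par τ σ q) : ‖m - r‖ < 1 := by
  have := S.norm_sub_sq_le h
  have := S.A1_lt_one h
  have := norm_nonneg (m - r)
  nlinarith

lemma norm_le (S : Sol σ q r m) (h : Par τ σ q) : ‖m‖ ≤ 1 + ‖r‖ := by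
  have := S.norm_sub_lt_one h
  have : ‖m‖ ≤ ‖m - r‖ + ‖r‖ := by simpa using norm_add_le (m - r) r
  linarith

lemma im_le (S : Sol σ q r m) (h : Par τ σ q) : m.im ≤ r.im + 1 := by
  have h1 := S.norm_sub_lt_one h
  have h2 := (le_abs_self _).trans (Complex.abs_im_le_norm (m - r))
  rw [Complex.sub_im] at h2
  linarith

lemma r_im_le (S : Sol σ q r m) (h : Par τ σ q) : r.im ≤ m.im := by
  have h1 := S.im_eq
  have := A1_nonneg (r := r) (m := m) h
  have := K1_nonneg (r := r) (m := m) h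
  nlinarith [S.r_im, S.m_im]

lemma one_sub_K1 (S : Sol σ q r m) : 1 - K1 σ q r m = r.im * (1 + A1 σ q r m) / m.im := by
  rw [← S.im_eq]; have := S.m_im; field_simp

lemma K1_le (S : Sol σ q r m) (h : Par τ σ q) : K1 σ q r m ≤ 1 - r.im / m.im := by
  have h1 := S.one_sub_K1
  have : r.im / m.im ≤ r.im * (1 + A1 σ q r m) / m.im := by
    have := A1_nonneg (r := r) (m := m) h
    have := S.r_im; have := S.m_im
    gcongr; nlinarith
  linarith

lemma re_pos (S : Sol σ q r m) (h : Par τ σ q) (hr : 0 < r.re) : 0 < m.re := by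
  have h1 := S.re_eq
  have h2 : 0 < r.re * (1 - A1 σ q r m) := mul_pos hr (by linarith [S.A1_lt_one h])
  rw [← h1] at h2
  refine (pos_iff_pos_of_mul_pos h2).2 ?_
  have := S.K1_lt_one h
  have : 0 ≤ 2 * B1 σ q r m * (q / ‖m‖ ^ 2) := by
    have := B1_nonneg (σ := σ) (q := q) (r := r) (m := m); have := h.q0; positivity
  linarith

lemma A1_mul_le (S : Sol σ q r m) (h : Par τ σ q) : A1 σ q r m * q ≤ ‖m‖ ^ 2 := by
  have h1 := S.K1_lt_one h
  rw [K1_eq] at h1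
  have h2 : 0 ≤ B1 σ q r m * (1 + q / ‖m‖ ^ 2) := by
    have := B1_nonneg (σ := σ) (q := q) (r := r) (m := m); have := h.q0; positivity
  have := S.norm_m_pos
  have h3 : A1 σ q r m * (q / ‖m‖ ^ 2) ≤ 1 := by linarith
  rw [← mul_div_assoc, div_le_one (by positivity)] at h3
  exact h3

lemma B1_mul_le (S : Sol σ q r m) (h : Par τ σ q) : B1 σ q r m * (1 + q / ‖m‖ ^ 2) ≤ 1 := by
  have h1 := S.K1_lt_one h
  rw [K1_eq] at h1
  have h2 : 0 ≤ A1 σ q r m * (q / ‖m‖ ^ 2) := by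
    have := A1_nonneg (r := r) (m := m) h; have := h.q0; positivity
  linarith

lemma B1_le_one (S : Sol σ q r m) (h : Par τ σ q) : B1 σ q r m ≤ 1 := by
  have h1 := S.B1_mul_le h
  have : 0 ≤ B1 σ q r m * (q / ‖m‖ ^ 2) := by
    have := B1_nonneg (σ := σ) (q := q) (r := r) (m := m); have := h.q0; positivity
  linarith

/-- A universal lower bound for `a`. -/
lemma tau_le_norm_aa (S : Sol σ q r m) (h : Par τ σ q) : τ ≤ ‖aa q m‖ := by
  have h1 := S.avg_inv_bb h
  have ha := norm_pos_iff.2 (S.aa_ne h)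
  have hτ := h.tau
  -- `|1/a²| = |avg 1/(ab)| ≤ τ⁻¹ avg |σ/(ab)| ≤ τ⁻¹ √B ≤ τ⁻¹`
  have h2 : (aa q m)⁻¹ * (aa q m)⁻¹ = avg fun i => (1 : ℂ) * ((aa q m)⁻¹ * (bb q (σ i) r m)⁻¹) := by
    simp only [one_mul]
    rw [avg_mul_left, h1]
  have h3 : ‖(aa q m)⁻¹ * (aa q m)⁻¹‖ ^ 2 ≤ (τ⁻¹) ^ 2 := by
    rw [h2]
    refine (norm_avg_mul_sq_le _ _).trans ?_
    have e1 : (avg fun _ : Fin N => ‖(1 : ℂ)‖ ^ 2) = 1 := by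
      simpa using avg_const (K := ℝ) h.N_ne 1
    rw [e1, one_mul]
    calc _ ≤ avg fun i => (τ⁻¹) ^ 2 * (σ i ^ 2 / (‖bb q (σ i) r m‖ ^ 2 * ‖aa q m‖ ^ 2)) := by
          refine avg_mono fun i => ?_
          have hb := norm_pos_iff.2 (S.bb_ne h i)
          rw [norm_mul, norm_inv, norm_inv, mul_pow]
          have : 1 ≤ (τ⁻¹) ^ 2 * σ i ^ 2 := by
            rw [← mul_pow]
            refine one_le_pow₀ ?_
            rw [inv_mul_eq_div, one_le_div hτ]
            exact h.lo i
          calc _ = 1 * (1 / (‖bb q (σ i) r m‖ ^ 2 * ‖aa q m‖ ^ 2)) := by field_simp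
            _ ≤ ((τ⁻¹) ^ 2 * σ i ^ 2) * (1 / (‖bb q (σ i) r m‖ ^ 2 * ‖aa q m‖ ^ 2)) := by gcongr
            _ = _ := by ring
      _ = (τ⁻¹) ^ 2 * B1 σ q r m := by rw [avg_mul_left]; rfl
      _ ≤ (τ⁻¹) ^ 2 * 1 := by gcongr; exact S.B1_le_one h
      _ = _ := by ring
  rw [norm_mul, norm_inv] at h3
  have h4 : ‖aa q m‖⁻¹ * ‖aa q m‖⁻¹ ≤ τ⁻¹ := by
    have := abs_le_of_sq_le_sq' h3 (by positivity)
    exact this.2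
  have h5 : τ ≤ ‖aa q m‖ * ‖aa q m‖ := by
    rw [← mul_inv] at h4
    exact (inv_le_inv₀ (by positivity) hτ).1 h4
  nlinarith [h.tau_le_one]

/-- A bound on a single `1 / b`. It depends on `N` and is only used qualitatively, to know that
boundary values exist and are not singular. -/
lemma inv_bb_sq_le (S : Sol σ q r m) (h : Par τ σ q) (i : Fin N) :
    1 / ‖bb q (σ i) r m‖ ^ 2 ≤ N / τ := by
  have hτ := h.tau
  have h1 := le_avg_mul (x := fun i => σ i / ‖bb q (σ i) r m‖ ^ 2)
    (fun i => by have := h.spos i; positivity) i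
  have h2 : (N : ℝ) * A1 σ q r m ≤ N * 1 := by gcongr; exact (S.A1_lt_one h).le
  have h3 : τ / ‖bb q (σ i) r m‖ ^ 2 ≤ σ i / ‖bb q (σ i) r m‖ ^ 2 := by gcongr; exact h.lo i
  have h4 : τ * (1 / ‖bb q (σ i) r m‖ ^ 2) ≤ N := by
    rw [mul_one_div]; change _ ≤ (N : ℝ) * A1 σ q r m at h1; linarith
  rw [le_div_iff₀ hτ]; linarith

/-- A second form of the equation. -/
lemma sub_mul_ss (S : Sol σ q r m) (h : Par τ σ q) :
    (m - r) * ss q r m = -1 - avg fun i => (σ i : ℂ) ^ 2 * ((aa q m)⁻¹ * (bb q (σ i) r m)⁻¹) := by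
  have h1 := S.eq
  have h2 : (avg fun i => (σ i : ℂ)) = 1 := by rw [avg_ofReal, h.mean]; simp
  have h3 : ss q r m * (avg fun i => (σ i : ℂ) / bb q (σ i) r m) =
      (avg fun i => (σ i : ℂ)) +
        avg fun i => (σ i : ℂ) ^ 2 * ((aa q m)⁻¹ * (bb q (σ i) r m)⁻¹) := by
    rw [← avg_mul_left, ← avg_add]
    congr 1; ext i
    have h4 := S.bb_ne h i
    have h5 := S.aa_ne h
    have h6 : ss q r m = bb q (σ i) r m + σ i / aa q m := by rw [bb_eq]; ring
    rw [h6]; field_simp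
  rw [FF] at h1
  rw [h2] at h3
  linear_combination ss q r m * h1 - h3

/-- The equation is stable with a constant depending on `Im r` only, for every `u`. -/
lemma strong_stability (S : Sol σ q r m) (h : Par τ σ q) (hu : r.im ≤ u.im) :
    ‖u - m‖ ≤ (2 + 2 / r.im + 1 / r.im ^ 2) * ‖FF σ q r u‖ := by
  have hr := S.r_im
  have hu0 : 0 < u.im := hr.trans_le hu
  have hne : u ≠ 0 := ne_zero_of_im_pos hu0
  set y := r.im with hy
  -- A small residual keeps `K1` at `u` below one, so the kernel contracts; a residual above `Im r`
  -- makes the claim follow from the a priori bounds on `u` and `m`.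
  rcases le_or_gt ‖FF σ q r u‖ y with hε | hε
  · have h1 := FF_sub (σ := σ) (r := r) (r' := r) hne S.m_ne (SelfCon.aa_ne h.q0 hu0) (S.aa_ne h)
      (fun i => SelfCon.bb_ne h.q0 (h.spos i).le hr hu0) (S.bb_ne h)
    rw [S.eq, sub_zero, sub_self, zero_mul, sub_zero] at h1
    have h2 : K1 σ q r u ≤ 1 := by
      have h3 := FF_im (σ := σ) (q := q) (r := r) (m := u)
      have h4 : |(FF σ q r u).im| ≤ y := (Complex.abs_im_le_norm _).trans hε
      have h5 := (abs_le.1 h4).1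
      have h6 := A1_nonneg (r := r) (m := u) h
      by_contra! hc
      nlinarith
    have h3 : ‖KK σ q r u r m‖ ^ 2 ≤ 1 / (1 + y) := by
      refine (norm_KK_sq_le h).trans ?_
      have h4 : K1 σ q r m ≤ 1 / (1 + y) := by
        have h5 := S.K1_le h
        have h6 : y / (y + 1) ≤ y / m.im := by
          have := S.m_im; have := S.im_le h; gcongr
        have : 1 - y / (y + 1) = 1 / (1 + y) := by field_simp; ring
        linarith
      have := K1_nonneg (r := r) (m := m) h
      calc _ ≤ 1 * K1 σ q r m := by gcongr
        _ ≤ _ := by linarith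
    have h4 : ‖KK σ q r u r m‖ ≤ 1 - y / (2 * (1 + y)) := by
      refine abs_le_of_sq_le_sq' (h3.trans ?_) ?_ |>.2
      · have : 1 / (1 + y) = 1 - y / (1 + y) := by field_simp; ring
        have h7 : 0 ≤ (y / (2 * (1 + y))) ^ 2 := by positivity
        have : y / (1 + y) = 2 * (y / (2 * (1 + y))) := by field_simp
        nlinarith
      · have : y / (2 * (1 + y)) ≤ 1 := by rw [div_le_one (by positivity)]; linarith
        linarith
    have h5 : y / (2 * (1 + y)) ≤ ‖1 - KK σ q r u r m‖ := by
      have := norm_sub_norm_le (1 : ℂ) (KK σ q r u r m)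
      rw [norm_one] at this
      linarith
    have h6 : ‖u - m‖ * (y / (2 * (1 + y))) ≤ ‖FF σ q r u‖ := by
      rw [h1, norm_mul]; gcongr
    have h7 : ‖u - m‖ ≤ ‖FF σ q r u‖ * (2 + 2 / y) := by
      have : (2 + 2 / y) = (y / (2 * (1 + y)))⁻¹ * 1 := by field_simp; ring
      rw [this, mul_one, ← div_eq_mul_inv, le_div_iff₀ (by positivity)]
      exact h6
    have : 0 ≤ 1 / y ^ 2 * ‖FF σ q r u‖ := by positivity
    nlinarith
  · have h1 := avg_sigma_div_norm_le (r := r) h hr hu0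
    have h2 := S.norm_sub_lt_one h
    have h3 : u - m = FF σ q r u - (avg fun i => (σ i : ℂ) / bb q (σ i) r u) - (m - r) := by
      rw [FF]; ring
    have h4 : ‖u - m‖ ≤ ‖FF σ q r u‖ + y⁻¹ + 1 := by
      rw [h3]
      refine (norm_sub_le _ _).trans (add_le_add ((norm_sub_le _ _).trans ?_) h2.le)
      gcongr
    have h5 : y⁻¹ ≤ 1 / y ^ 2 * ‖FF σ q r u‖ := by
      calc y⁻¹ = 1 / y ^ 2 * y := by field_simp
        _ ≤ _ := by gcongr
    have h6 : 1 ≤ 1 / y * ‖FF σ q r u‖ := by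
      calc 1 = 1 / y * y := by field_simp
        _ ≤ _ := by gcongr
    have h7 : 0 ≤ 1 / y * ‖FF σ q r u‖ := by positivity
    have e : (2 + 2 / y + 1 / y ^ 2) * ‖FF σ q r u‖ =
      2 * ‖FF σ q r u‖ + 2 * (1 / y * ‖FF σ q r u‖) + 1 / y ^ 2 * ‖FF σ q r u‖ := by ring
    rw [e]
    have := norm_nonneg (FF σ q r u)
    linarith

end Sol
end

/-! ### The square root of the spectral parameter -/

section sqrt
variable {w : ℂ}

lemma sqrt_mul_self (w : ℂ) : Complex.sqrt w * Complex.sqrt w = w := by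
  rw [← sq]; simp [Complex.sqrt]

lemma sqrt_im_pos (hw : 0 < w.im) : 0 < (Complex.sqrt w).im := by
  have : (Complex.sqrt w).im = √((‖w‖ - w.re) / 2) := Complex.cpow_inv_two_im_eq_sqrt hw.le
  rw [this]
  apply Real.sqrt_pos.2
  have h1 : w.re < ‖w‖ := by
    refine lt_of_le_of_ne (Complex.re_le_norm w) fun h => ?_
    have := (Complex.re_eq_norm.1 h)
    rw [Complex.le_def] at this
    simp at this; linarith
  linarith

lemma im_eq_sqrt (w : ℂ) : w.im = 2 * (Complex.sqrt w).re * (Complex.sqrt w).im := by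
  conv_lhs => rw [← sqrt_mul_self w]
  rw [Complex.mul_im]; ring

lemma re_eq_sqrt (w : ℂ) : w.re = (Complex.sqrt w).re ^ 2 - (Complex.sqrt w).im ^ 2 := by
  conv_lhs => rw [← sqrt_mul_self w]
  rw [Complex.mul_re]; ring

lemma sqrt_re_pos (hw : 0 < w.im) : 0 < (Complex.sqrt w).re := by
  have h1 := im_eq_sqrt w
  have h2 := sqrt_im_pos hw
  rw [h1] at hw
  have : 0 < 2 * (Complex.sqrt w).re := (pos_iff_pos_of_mul_pos hw).2 h2
  linarith

lemma norm_sqrt_sq (w : ℂ) : ‖Complex.sqrt w‖ ^ 2 = ‖w‖ := by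
  conv_rhs => rw [← sqrt_mul_self w, norm_mul]
  ring

lemma sqrt_ne (hw : 0 < w.im) : Complex.sqrt w ≠ 0 := ne_zero_of_im_pos (sqrt_im_pos hw)

lemma differentiableOn_sqrt_half : DifferentiableOn ℂ Complex.sqrt {w : ℂ | 0 < w.im} :=
  Complex.differentiableOn_sqrt.mono fun _ hw => Or.inr (ne_of_gt hw)

end sqrt

/-! ### The cone of admissible `u`, and the equation in terms of `u` -/

/-- The two sign conditions satisfied by Stieltjes transforms of densities on `[0, ∞)`. -/
def Cone (w u : ℂ) : Prop := 0 ≤ u.im ∧ 0 ≤ (w * u).im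

section cone
variable {N : ℕ} {τ : ℝ} {σ : Fin N → ℝ} {q : ℝ} {w u : ℂ}

lemma Cone.le_im (hw : 0 < w.im) (hu : Cone w u) :
    (Complex.sqrt w).im ≤ (Complex.sqrt w * (1 + u)).im := by
  have h1 := sqrt_re_pos hw
  have h2 := sqrt_im_pos hw
  obtain ⟨h3, h4⟩ := hu
  rw [Complex.mul_im, im_eq_sqrt w, re_eq_sqrt w] at h4
  set x := (Complex.sqrt w).re
  set y := (Complex.sqrt w).im
  simp only [Complex.mul_im, Complex.add_re, Complex.one_re, Complex.add_im, Complex.one_im]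
  have : 0 ≤ 2 * x * (x * u.im + y * u.re) := by
    nlinarith [mul_nonneg (sq_nonneg x) h3, mul_nonneg (sq_nonneg y) h3]
  have : 0 ≤ x * u.im + y * u.re := (mul_nonneg_iff_of_pos_left (by positivity)).1 this
  linarith

lemma Cone.im_pos (hw : 0 < w.im) (hu : Cone w u) : 0 < (Complex.sqrt w * (1 + u)).im :=
  (sqrt_im_pos hw).trans_le (hu.le_im hw)

lemma neg_div_im_nonneg {t : ℝ} (ht : 0 ≤ t) {x : ℂ} (hx : 0 ≤ x.im) : 0 ≤ (-((t : ℂ) / x)).im := by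
  rw [Complex.neg_im, div_im_eq]
  have : 0 ≤ t * x.im / ‖x‖ ^ 2 := by positivity
  linarith

lemma neg_div_im_pos {t : ℝ} (ht : 0 < t) {x : ℂ} (hx : 0 < x.im) : 0 < (-((t : ℂ) / x)).im := by
  rw [Complex.neg_im, div_im_eq]
  have := norm_pos_iff.2 (ne_zero_of_im_pos hx)
  have : 0 < t * x.im / ‖x‖ ^ 2 := by positivity
  linarith

/-- The right-hand side of the equation maps the cone into its interior. -/
lemma Cone.step {s : ℝ} (hs : 0 < s) (hq : 0 ≤ q) (hw : 0 < w.im) (hu : Cone w u) :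
    0 < (-((s : ℂ) / (Complex.sqrt w * bb q s (Complex.sqrt w) (Complex.sqrt w * (1 + u))))).im ∧
    0 < (w * -((s : ℂ) / (Complex.sqrt w *
      bb q s (Complex.sqrt w) (Complex.sqrt w * (1 + u))))).im := by
  have hM := hu.im_pos hw
  have hr := sqrt_ne hw
  have hsq := sqrt_mul_self w
  obtain ⟨h3, h4⟩ := hu
  have hw0 := ne_zero_of_im_pos hw
  set r := Complex.sqrt w with hr_def
  have hM0 : r * (1 + u) ≠ 0 := ne_zero_of_im_pos hM
  have hu0 : 1 + u ≠ 0 := right_ne_zero_of_mul hM0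
  have ha := SelfCon.aa_ne hq hM
  have hb := SelfCon.bb_ne (r := r) hq hs.le (sqrt_im_pos hw) hM
  have h5 : 0 ≤ (1 + u).im := by simpa using h3
  have h6 : 0 < (w * (1 + u)).im := by
    rw [mul_add, mul_one, Complex.add_im]; linarith
  have h7 : 0 ≤ ((1 + u) - (q : ℂ) / (w * (1 + u))).im := by
    have := neg_div_im_nonneg hq h6.le
    rw [Complex.sub_im]; rw [Complex.neg_im] at this; linarith
  have h8 : 0 ≤ (w * (1 + u) - (q : ℂ) / (1 + u)).im := by
    have := neg_div_im_nonneg hq h5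
    rw [Complex.sub_im]; rw [Complex.neg_im] at this; linarith
  have ea : aa q (r * (1 + u)) = r * ((1 + u) - (q : ℂ) / (w * (1 + u))) := by
    unfold aa; rw [← hsq]; field_simp
  have ea' : aa q (r * (1 + u)) = (w * (1 + u) - (q : ℂ) / (1 + u)) / r := by
    unfold aa; rw [← hsq]; field_simp
  have hc : ((1 + u) - (q : ℂ) / (w * (1 + u))) ≠ 0 := fun h => ha (by rw [ea, h, mul_zero])
  have hd : (w * (1 + u) - (q : ℂ) / (1 + u)) ≠ 0 := fun h => ha (by rw [ea', h, zero_div])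
  have e1 : r * bb q s r (r * (1 + u)) =
      w + -((q : ℂ) / (1 + u)) + -((s : ℂ) / ((1 + u) - (q : ℂ) / (w * (1 + u)))) := by
    unfold bb; rw [ea, ← hsq]; field_simp; ring
  have e2 : bb q s r (r * (1 + u)) / r =
      1 + -((q : ℂ) / (w * (1 + u))) + -((s : ℂ) / (w * (1 + u) - (q : ℂ) / (1 + u))) := by
    have : (q : ℂ) / (r * (1 + u)) / r = (q : ℂ) / (w * (1 + u)) := by rw [← hsq]; field_simp
    unfold bb; rw [ea', sub_div, sub_div, this, div_self hr]
    field_simp; ring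
  have i1 : 0 < (r * bb q s r (r * (1 + u))).im := by
    rw [e1, Complex.add_im, Complex.add_im]
    have := neg_div_im_nonneg hq h5
    have := neg_div_im_nonneg hs.le h7
    linarith
  have h9 : 0 < (w * (1 + u) - (q : ℂ) / (1 + u)).im := by
    have := neg_div_im_nonneg hq h5
    rw [Complex.sub_im]; rw [Complex.neg_im] at this; linarith
  have i2 : 0 < (bb q s r (r * (1 + u)) / r).im := by
    rw [e2, Complex.add_im, Complex.add_im, Complex.one_im]
    have := neg_div_im_nonneg hq h6.le
    have := neg_div_im_pos hs h9
    linarith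
  refine ⟨neg_div_im_pos hs i1, ?_⟩
  have : w * -((s : ℂ) / (r * bb q s r (r * (1 + u)))) =
      -((s : ℂ) / (bb q s r (r * (1 + u)) / r)) := by
    rw [← hsq]; field_simp
  rw [this]
  exact neg_div_im_pos hs i2

/-- `Υ` in terms of `FF`. -/
lemma Upsilon_eq {z : ℂ} (h : Par τ σ (‖z‖ ^ 2)) (hw : 0 < w.im) (hu : Cone w u) :
    Upsilon σ z w u =
      FF σ (‖z‖ ^ 2) (Complex.sqrt w) (Complex.sqrt w * (1 + u)) / Complex.sqrt w := by
  have hM := hu.im_pos hw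
  have hr := sqrt_ne hw
  have hsq := sqrt_mul_self w
  have hi := sqrt_im_pos hw
  set r := Complex.sqrt w with hr_def
  have hM0 : r * (1 + u) ≠ 0 := ne_zero_of_im_pos hM
  have hu0 : 1 + u ≠ 0 := right_ne_zero_of_mul hM0
  have ha := SelfCon.aa_ne h.q0 hM
  rw [eq_div_iff hr, FF, Upsilon, add_mul, mul_assoc, Finset.sum_mul]
  have : (avg fun i => (σ i : ℂ) / bb (‖z‖ ^ 2) (σ i) r (r * (1 + u))) = 1 / (N : ℂ) * ∑ i,
      (σ i : ℂ) * (1 + u) * (w * (1 + (σ i : ℂ) * ((1 + u) / (-w * (1 + u) ^ 2 + (‖z‖ : ℂ) ^ 2)))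
        * (1 + u) - (‖z‖ : ℂ) ^ 2)⁻¹ * r := by
    unfold avg
    congr 2; ext i
    have hb := SelfCon.bb_ne (r := r) h.q0 (h.spos i).le hi hM
    have e1 : -w * (1 + u) ^ 2 + (‖z‖ : ℂ) ^ 2 = -(r * (1 + u)) * aa (‖z‖ ^ 2) (r * (1 + u)) := by
      unfold aa; rw [← hsq]; push_cast; field_simp; ring
    have e2 : w * (1 + (σ i : ℂ) * ((1 + u) / (-w * (1 + u) ^ 2 + (‖z‖ : ℂ) ^ 2)))
        * (1 + u) - (‖z‖ : ℂ) ^ 2 = (r * (1 + u)) * bb (‖z‖ ^ 2) (σ i) r (r * (1 + u)) := by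
      rw [e1]; unfold bb; rw [← hsq]; push_cast; field_simp; ring
    rw [e2]; field_simp
  rw [this]; ring

/-- The right-hand side of the defining equation of `m₁`, summand by summand. -/
lemma rhs_eq {s : ℝ} (hq : 0 ≤ q) (hw : 0 < w.im) (hu : Cone w u) :
    (-w * (1 + (s : ℂ) / (-w * (1 + u) + (q : ℂ) / (1 + u))) + (q : ℂ) / (1 + u)) =
      -(Complex.sqrt w * bb q s (Complex.sqrt w) (Complex.sqrt w * (1 + u))) := by
  have hM := hu.im_pos hw
  have hr := sqrt_ne hw
  have hsq := sqrt_mul_self w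
  have hi := sqrt_im_pos hw
  set r := Complex.sqrt w with hr_def
  have hM0 : r * (1 + u) ≠ 0 := ne_zero_of_im_pos hM
  have hu0 : 1 + u ≠ 0 := right_ne_zero_of_mul hM0
  have ha := SelfCon.aa_ne hq hM
  have e1 : -w * (1 + u) + (q : ℂ) / (1 + u) = -r * aa q (r * (1 + u)) := by
    unfold aa; rw [← hsq]; field_simp; ring
  rw [e1]; unfold bb; rw [← hsq]; field_simp; ring

/-- The defining equation of `m₁` is the equation `FF = 0`. -/
lemma eq_rhs_iff (h : Par τ σ q) (hw : 0 < w.im) (hu : Cone w u) :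
    u = (1 / (N : ℂ)) * ∑ i, (σ i : ℂ) *
        (-w * (1 + (σ i : ℂ) / (-w * (1 + u) + (q : ℂ) / (1 + u))) + (q : ℂ) / (1 + u))⁻¹ ↔
      FF σ q (Complex.sqrt w) (Complex.sqrt w * (1 + u)) = 0 := by
  have hr := sqrt_ne hw
  have : (1 / (N : ℂ)) * ∑ i, (σ i : ℂ) *
        (-w * (1 + (σ i : ℂ) / (-w * (1 + u) + (q : ℂ) / (1 + u))) + (q : ℂ) / (1 + u))⁻¹ =
      - (Complex.sqrt w)⁻¹ * avg fun i =>
        (σ i : ℂ) / bb q (σ i) (Complex.sqrt w) (Complex.sqrt w * (1 + u)) := by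
    rw [← avg_mul_left, avg]
    congr 2; ext i
    rw [rhs_eq h.q0 hw hu, ← neg_mul, mul_inv, div_eq_mul_inv, inv_neg]; ring
  rw [this, FF]
  set X := avg fun i => (σ i : ℂ) / bb q (σ i) (Complex.sqrt w) (Complex.sqrt w * (1 + u))
  constructor
  · intro h1
    have : Complex.sqrt w * u = -X := by rw [h1]; field_simp
    linear_combination this
  · intro h1
    field_simp
    linear_combination h1

end cone

/-! ### Existence of `m₁` -/

section existence
variable {N : ℕ} {τ : ℝ} {σ : Fin N → ℝ} {q : ℝ}

/-- The fixed point map of the equation. -/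
def Phi (σ : Fin N → ℝ) (q : ℝ) (r m : ℂ) : ℂ := r - avg fun i => (σ i : ℂ) / bb q (σ i) r m

lemma FF_eq_sub_Phi {r m : ℂ} : FF σ q r m = m - Phi σ q r m := by rw [FF, Phi]; ring

lemma Phi_im {r m : ℂ} :
    (Phi σ q r m).im = r.im * (1 + A1 σ q r m) + m.im * K1 σ q r m := by
  have h1 := FF_im (σ := σ) (q := q) (r := r) (m := m)
  rw [FF_eq_sub_Phi, Complex.sub_im] at h1
  linarith

lemma le_Phi_im (h : Par τ σ q) {r m : ℂ} (hr : 0 < r.im) (hm : 0 < m.im) :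
    r.im ≤ (Phi σ q r m).im := by
  rw [Phi_im]
  have := A1_nonneg (r := r) (m := m) h
  have := K1_nonneg (r := r) (m := m) h
  nlinarith [mul_nonneg hr.le (A1_nonneg (r := r) (m := m) h),
    mul_nonneg hm.le (K1_nonneg (r := r) (m := m) h)]

lemma norm_Phi_sub_le (h : Par τ σ q) {r m : ℂ} (hr : 0 < r.im) (hm : 0 < m.im) :
    ‖Phi σ q r m - r‖ ≤ r.im⁻¹ := by
  have := avg_sigma_div_norm_le h hr hm
  rw [Phi, sub_sub_cancel_left, norm_neg]; exact this

lemma Phi_im_le (h : Par τ σ q) {r m : ℂ} (hr : 0 < r.im) (hm : 0 < m.im) :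
    (Phi σ q r m).im ≤ r.im + r.im⁻¹ := by
  have h1 := norm_Phi_sub_le h hr hm
  have h2 := (le_abs_self _).trans (Complex.abs_im_le_norm (Phi σ q r m - r))
  rw [Complex.sub_im] at h2
  linarith

/-- The fixed point map contracts `|u - v|² / (Im u Im v)`. -/
lemma Phi_contract (h : Par τ σ q) {r u v : ℂ} (hr : 0 < r.im) (hu : 0 < u.im) (hv : 0 < v.im) :
    ‖Phi σ q r u - Phi σ q r v‖ ^ 2 * (u.im * v.im) ≤
      ‖u - v‖ ^ 2 * (((1 + r.im ^ 2)⁻¹ * (Phi σ q r u).im) *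
        ((1 + r.im ^ 2)⁻¹ * (Phi σ q r v).im)) := by
  have hk : ∀ u : ℂ, 0 < u.im →
      u.im * K1 σ q r u ≤ (1 + r.im ^ 2)⁻¹ * (Phi σ q r u).im := by
    intro u hu
    have h1 := Phi_im (σ := σ) (q := q) (r := r) (m := u)
    have h2 := Phi_im_le h hr hu
    have h3 := A1_nonneg (r := r) (m := u) h
    have h4 : u.im * K1 σ q r u ≤ (Phi σ q r u).im - r.im := by nlinarith
    have h5 : (Phi σ q r u).im - r.im ≤ (1 + r.im ^ 2)⁻¹ * (Phi σ q r u).im := by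
      rw [inv_mul_eq_div, le_div_iff₀ (by positivity)]
      have : r.im * r.im⁻¹ = 1 := mul_inv_cancel₀ hr.ne'
      nlinarith
    linarith
  have h1 := FF_sub (σ := σ) (q := q) (r := r) (r' := r) (ne_zero_of_im_pos hu)
    (ne_zero_of_im_pos hv) (aa_ne h.q0 hu) (aa_ne h.q0 hv)
    (fun i => bb_ne h.q0 (h.spos i).le hr hu) (fun i => bb_ne h.q0 (h.spos i).le hr hv)
  have h2 : Phi σ q r u - Phi σ q r v = (u - v) * KK σ q r u r v := by
    rw [FF_eq_sub_Phi, FF_eq_sub_Phi, sub_self, zero_mul, sub_zero] at h1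
    linear_combination -h1
  have h3 := norm_KK_sq_le (r := r) (m := u) (r' := r) (m' := v) h
  have k1 := K1_nonneg (r := r) (m := u) h
  have k2 := K1_nonneg (r := r) (m := v) h
  rw [h2, norm_mul, mul_pow]
  calc _ ≤ ‖u - v‖ ^ 2 * (K1 σ q r u * K1 σ q r v) * (u.im * v.im) := by gcongr
    _ = ‖u - v‖ ^ 2 * ((u.im * K1 σ q r u) * (v.im * K1 σ q r v)) := by ring
    _ ≤ _ := by
      have h4 := hk u hu
      have h5 := hk v hv
      exact mul_le_mul_of_nonneg_left (mul_le_mul h4 h5 (by positivity)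
        (le_trans (by positivity) h4)) (by positivity)

/-- The iterates of the fixed point map started from `r`. -/
def iter (σ : Fin N → ℝ) (q : ℝ) (r : ℂ) : ℕ → ℂ
  | 0 => r
  | n + 1 => Phi σ q r (iter σ q r n)

lemma le_iter_im (h : Par τ σ q) {r : ℂ} (hr : 0 < r.im) (n : ℕ) : r.im ≤ (iter σ q r n).im := by
  induction n with
  | zero => exact le_rfl
  | succ n ih => exact le_Phi_im h hr (hr.trans_le ih)

lemma iter_im_pos (h : Par τ σ q) {r : ℂ} (hr : 0 < r.im) (n : ℕ) : 0 < (iter σ q r n).im :=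
  hr.trans_le (le_iter_im h hr n)

lemma iter_im_le (h : Par τ σ q) {r : ℂ} (hr : 0 < r.im) (n : ℕ) :
    (iter σ q r n).im ≤ r.im + r.im⁻¹ := by
  cases n with
  | zero => have : 0 < r.im⁻¹ := by positivity
            simp only [iter]; linarith
  | succ n => exact Phi_im_le h hr (iter_im_pos h hr n)

lemma iter_sub_sq_le (h : Par τ σ q) {r : ℂ} (hr : 0 < r.im) (n : ℕ) :
    ‖iter σ q r (n + 1) - iter σ q r n‖ ^ 2 ≤ (r.im⁻¹) ^ 4 * ((1 + r.im ^ 2)⁻¹ ^ n) ^ 2 *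
      ((iter σ q r (n + 1)).im * (iter σ q r n).im) := by
  induction n with
  | zero =>
    have h1 := norm_Phi_sub_le h hr (m := r) hr
    have h2 := le_iter_im h hr 1
    have h3 : (r.im⁻¹) ^ 2 = (r.im⁻¹) ^ 4 * (r.im * r.im) := by field_simp
    simp only [iter, pow_zero, one_pow, mul_one]
    calc _ ≤ (r.im⁻¹) ^ 2 := by gcongr
      _ = (r.im⁻¹) ^ 4 * (r.im * r.im) := h3
      _ ≤ _ := by gcongr; exact h2
  | succ n ih =>
    have p0 := iter_im_pos h hr n
    have p1 := iter_im_pos h hr (n + 1)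
    have h1 := Phi_contract h hr p1 p0
    change ‖iter σ q r (n + 2) - iter σ q r (n + 1)‖ ^ 2 * _ ≤ _ at h1
    set x := iter σ q r (n + 1)
    set y := iter σ q r n
    have e1 : Phi σ q r x = iter σ q r (n + 2) := rfl
    have e2 : Phi σ q r y = x := rfl
    rw [e1, e2] at h1
    have p2 := iter_im_pos h hr (n + 2)
    set t := iter σ q r (n + 2)
    have h2 : ‖t - x‖ ^ 2 * (x.im * y.im) ≤ ((r.im⁻¹) ^ 4 * ((1 + r.im ^ 2)⁻¹ ^ n) ^ 2 *
      (x.im * y.im)) * (((1 + r.im ^ 2)⁻¹ * t.im) * ((1 + r.im ^ 2)⁻¹ * x.im)) := by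
      refine h1.trans ?_
      gcongr
    have h3 : 0 < x.im * y.im := by positivity
    refine le_of_mul_le_mul_right (h2.trans (le_of_eq ?_)) h3
    ring

lemma norm_iter_sub_le (h : Par τ σ q) {r : ℂ} {c : ℝ} (hc : 0 < c) (hr : c ≤ r.im) (n : ℕ) :
    ‖iter σ q r (n + 1) - iter σ q r n‖ ≤ (c⁻¹ + c⁻¹ ^ 3) * (1 + c ^ 2)⁻¹ ^ n := by
  have hr0 : 0 < r.im := hc.trans_le hr
  have h1 := iter_sub_sq_le h hr0 n
  have h2 := iter_im_le h hr0 n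
  have h3 := iter_im_le h hr0 (n + 1)
  have p0 := iter_im_pos h hr0 n
  have p1 := iter_im_pos h hr0 (n + 1)
  have h4 : ‖iter σ q r (n + 1) - iter σ q r n‖ ≤
      (r.im⁻¹ + r.im⁻¹ ^ 3) * (1 + r.im ^ 2)⁻¹ ^ n := by
    refine abs_le_of_sq_le_sq' (h1.trans ?_) (by positivity) |>.2
    calc _ ≤ (r.im⁻¹) ^ 4 * ((1 + r.im ^ 2)⁻¹ ^ n) ^ 2 * ((r.im + r.im⁻¹) * (r.im + r.im⁻¹)) := by
          gcongr
      _ = _ := by field_simp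
  refine h4.trans ?_
  gcongr

lemma bb_continuousAt (h : Par τ σ q) {r m : ℂ} (hm : 0 < m.im) (s : ℝ) :
    ContinuousAt (fun p : ℂ × ℂ => bb q s p.1 p.2) (r, m) := by
  have hm0 := ne_zero_of_im_pos hm
  have ha := aa_ne h.q0 hm
  unfold bb
  have h1 : ContinuousAt (fun p : ℂ × ℂ => aa q p.2) (r, m) := by
    unfold aa
    exact continuousAt_snd.sub (continuousAt_const.div continuousAt_snd hm0)
  exact (continuousAt_fst.sub (continuousAt_const.div continuousAt_snd hm0)).sub
    (continuousAt_const.div h1 ha)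

lemma differentiableAt_Phi_comp (h : Par τ σ q) {f g : ℂ → ℂ} {w : ℂ}
    (hf : DifferentiableAt ℂ f w) (hg : DifferentiableAt ℂ g w) (hfi : 0 < (f w).im)
    (hgi : 0 < (g w).im) : DifferentiableAt ℂ (fun w => Phi σ q (f w) (g w)) w := by
  have hm0 := ne_zero_of_im_pos hgi
  have ha := aa_ne h.q0 hgi
  have h1 : DifferentiableAt ℂ (fun w => aa q (g w)) w := by
    unfold aa
    exact hg.sub ((differentiableAt_const _).div hg hm0)
  unfold Phi avg
  refine hf.sub (DifferentiableAt.const_mul ?_ _)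
  refine DifferentiableAt.fun_sum fun i _ => ?_
  refine (differentiableAt_const _).div ?_ (bb_ne h.q0 (h.spos i).le hfi hgi)
  unfold bb
  exact (hf.sub ((differentiableAt_const _).div hg hm0)).sub ((differentiableAt_const _).div h1 ha)

lemma iter_differentiableOn (h : Par τ σ q) (n : ℕ) :
    DifferentiableOn ℂ (fun w => iter σ q (Complex.sqrt w) n) {w : ℂ | 0 < w.im} := by
  have ho : IsOpen {w : ℂ | 0 < w.im} := isOpen_lt continuous_const Complex.continuous_im
  induction n with
  | zero => exact differentiableOn_sqrt_half
  | succ n ih =>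
    intro w hw
    refine (differentiableAt_Phi_comp h ?_ ?_ (sqrt_im_pos hw)
      (iter_im_pos h (sqrt_im_pos hw) n)).differentiableWithinAt
    · exact differentiableOn_sqrt_half.differentiableAt (ho.mem_nhds hw)
    · exact ih.differentiableAt (ho.mem_nhds hw)

/-- The limit of the iterates. -/
def iterLim (σ : Fin N → ℝ) (q : ℝ) (r : ℂ) : ℂ :=
  r + ∑' n, (iter σ q r (n + 1) - iter σ q r n)

lemma summable_iter (h : Par τ σ q) {r : ℂ} (hr : 0 < r.im) :
    Summable fun n => iter σ q r (n + 1) - iter σ q r n := by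
  refine Summable.of_norm_bounded (g := fun n => (r.im⁻¹ + r.im⁻¹ ^ 3) * (1 + r.im ^ 2)⁻¹ ^ n) ?_
    (fun n => norm_iter_sub_le h hr le_rfl n)
  refine (summable_geometric_of_lt_one (by positivity) ?_).mul_left _
  exact inv_lt_one_of_one_lt₀ (by nlinarith)

lemma tendsto_iter (h : Par τ σ q) {r : ℂ} (hr : 0 < r.im) :
    Tendsto (iter σ q r) atTop (𝓝 (iterLim σ q r)) := by
  have h1 := (summable_iter h hr).hasSum.tendsto_sum_nat.const_add r
  refine h1.congr fun n => ?_
  rw [Finset.sum_range_sub]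
  simp [iter]

lemma iterLim_differentiableOn (h : Par τ σ q) :
    DifferentiableOn ℂ (fun w => iterLim σ q (Complex.sqrt w)) {w : ℂ | 0 < w.im} := by
  intro w hw
  have hs := sqrt_im_pos hw
  set c := (Complex.sqrt w).im / 2
  have hc : 0 < c := by positivity
  have ho : IsOpen {w : ℂ | 0 < w.im} := isOpen_lt continuous_const Complex.continuous_im
  have hU : IsOpen ({w : ℂ | 0 < w.im} ∩ Complex.sqrt ⁻¹' {x | c < x.im}) :=
    differentiableOn_sqrt_half.continuousOn.isOpen_inter_preimage ho
      (isOpen_lt continuous_const Complex.continuous_im)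
  have h1 := Complex.differentiableOn_tsum_of_summable_norm
    (F := fun n w => iter σ q (Complex.sqrt w) (n + 1) - iter σ q (Complex.sqrt w) n)
    (u := fun n => (c⁻¹ + c⁻¹ ^ 3) * (1 + c ^ 2)⁻¹ ^ n) (U := _)
    ((summable_geometric_of_lt_one (by positivity)
      (inv_lt_one_of_one_lt₀ (by nlinarith))).mul_left _)
    (fun n => ((iter_differentiableOn h (n + 1)).sub (iter_differentiableOn h n)).mono
      Set.inter_subset_left) hU (fun n w hw => norm_iter_sub_le h hc (le_of_lt hw.2) n)
  have hmem : w ∈ ({w : ℂ | 0 < w.im} ∩ Complex.sqrt ⁻¹' {x | c < x.im}) :=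
    ⟨hw, by change c < (Complex.sqrt w).im; exact half_lt_self hs⟩
  have h2 := h1.differentiableAt (hU.mem_nhds hmem)
  exact ((differentiableOn_sqrt_half.differentiableAt (ho.mem_nhds hw)).add
    h2).differentiableWithinAt

lemma iterLim_im (h : Par τ σ q) {r : ℂ} (hr : 0 < r.im) : r.im ≤ (iterLim σ q r).im :=
  ge_of_tendsto ((Complex.continuous_im.tendsto _).comp (tendsto_iter h hr))
    (Eventually.of_forall fun n => le_iter_im h hr n)

lemma sol_iterLim (h : Par τ σ q) {r : ℂ} (hr : 0 < r.im) : Sol σ q r (iterLim σ q r) := by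
  have hm : 0 < (iterLim σ q r).im := hr.trans_le (iterLim_im h hr)
  refine ⟨hr, hm, ?_⟩
  have h1 := tendsto_iter h hr
  have h2 : Tendsto (fun n => Phi σ q r (iter σ q r n)) atTop (𝓝 (Phi σ q r (iterLim σ q r))) := by
    unfold Phi avg
    refine tendsto_const_nhds.sub (Tendsto.const_mul _ (tendsto_finsetSum _ fun i _ => ?_))
    refine tendsto_const_nhds.div ?_ (bb_ne h.q0 (h.spos i).le hr hm)
    exact (bb_continuousAt h hm (σ i)).tendsto.comp (tendsto_const_nhds.prodMk_nhds h1)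
  have h3 := tendsto_nhds_unique ((tendsto_add_atTop_iff_nat 1).2 h1) h2
  rw [FF_eq_sub_Phi, ← h3, sub_self]

lemma cone_step_avg (h : Par τ σ q) {w u : ℂ} (hw : 0 < w.im) (hu : Cone w u) :
    0 < ((Phi σ q (Complex.sqrt w) (Complex.sqrt w * (1 + u))) / Complex.sqrt w - 1).im ∧
    0 < (w * ((Phi σ q (Complex.sqrt w) (Complex.sqrt w * (1 + u))) / Complex.sqrt w - 1)).im := by
  have hr := sqrt_ne hw
  have e : (Phi σ q (Complex.sqrt w) (Complex.sqrt w * (1 + u))) / Complex.sqrt w - 1 =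
      avg fun i => -((σ i : ℂ) / (Complex.sqrt w *
        bb q (σ i) (Complex.sqrt w) (Complex.sqrt w * (1 + u)))) := by
    have : (fun i => -((σ i : ℂ) / (Complex.sqrt w *
        bb q (σ i) (Complex.sqrt w) (Complex.sqrt w * (1 + u))))) =
      fun i => -(Complex.sqrt w)⁻¹ * ((σ i : ℂ) /
        bb q (σ i) (Complex.sqrt w) (Complex.sqrt w * (1 + u))) := by
      ext i
      have hb := bb_ne (q := q) h.q0 (h.spos i).le (sqrt_im_pos hw) (hu.im_pos hw)
      field_simp
    rw [this, avg_mul_left, Phi]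
    field_simp
    ring
  rw [e]
  constructor
  · rw [avg_im]
    exact avg_pos h.N_ne fun i => (hu.step (h.spos i) h.q0 hw).1
  · rw [← avg_mul_left, avg_im]
    exact avg_pos h.N_ne fun i => (hu.step (h.spos i) h.q0 hw).2

lemma cone_iter (h : Par τ σ q) {w : ℂ} (hw : 0 < w.im) (n : ℕ) :
    Cone w (iter σ q (Complex.sqrt w) n / Complex.sqrt w - 1) := by
  have hr := sqrt_ne hw
  induction n with
  | zero => simp [iter, Cone, div_self hr]
  | succ n ih =>
    have h1 := cone_step_avg h hw ih
    have e : Complex.sqrt w * (1 + (iter σ q (Complex.sqrt w) n / Complex.sqrt w - 1)) =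
      iter σ q (Complex.sqrt w) n := by field_simp; ring
    rw [e] at h1
    exact ⟨h1.1.le, h1.2.le⟩

/-- The limit satisfies the sign conditions, in the weak form in which they pass to limits; one
more application of the fixed point map makes them strict. -/
lemma cone_iterLim (h : Par τ σ q) {w : ℂ} (hw : 0 < w.im) :
    Cone w (iterLim σ q (Complex.sqrt w) / Complex.sqrt w - 1) := by
  have h1 := (tendsto_iter h (sqrt_im_pos hw)).div_const (Complex.sqrt w) |>.sub_const 1
  exact ⟨ge_of_tendsto ((Complex.continuous_im.tendsto _).comp h1)
    (Eventually.of_forall fun n => (cone_iter h hw n).1),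
    ge_of_tendsto ((Complex.continuous_im.tendsto _).comp (h1.const_mul w))
    (Eventually.of_forall fun n => (cone_iter h hw n).2)⟩

/-- Existence of `m₁`, so that the choice in its definition is not vacuous. -/
lemma exists_isM1c {z : ℂ} (h : Par τ σ (‖z‖ ^ 2)) : ∃ m, IsM1c σ z m := by
  have ho : IsOpen {w : ℂ | 0 < w.im} := isOpen_lt continuous_const Complex.continuous_im
  refine ⟨fun w => iterLim σ (‖z‖ ^ 2) (Complex.sqrt w) / Complex.sqrt w - 1, ?_, ?_⟩
  · exact ((iterLim_differentiableOn h).div differentiableOn_sqrt_half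
      fun w hw => sqrt_ne hw).sub_const 1
  · intro w hw
    have hr := sqrt_ne hw
    have hc := cone_iterLim h hw
    have S := sol_iterLim h (sqrt_im_pos hw)
    have e : Complex.sqrt w * (1 + (iterLim σ (‖z‖ ^ 2) (Complex.sqrt w) / Complex.sqrt w - 1)) =
      iterLim σ (‖z‖ ^ 2) (Complex.sqrt w) := by field_simp; ring
    have h1 := cone_step_avg h hw hc
    have h2 := S.eq
    have h3 : Phi σ (‖z‖ ^ 2) (Complex.sqrt w) (iterLim σ (‖z‖ ^ 2) (Complex.sqrt w)) =
      iterLim σ (‖z‖ ^ 2) (Complex.sqrt w) := by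
      rw [FF_eq_sub_Phi] at h2; exact (sub_eq_zero.1 h2).symm
    rw [e, h3] at h1
    refine ⟨h1.1, h1.2, ?_⟩
    have h4 := (eq_rhs_iff h hw hc).2 (by rw [e]; exact h2)
    push_cast at h4
    exact h4

end existence

/-! ### The function `m₁` -/

section m1c
variable {N : ℕ} {τ : ℝ} {σ : Fin N → ℝ} {z w : ℂ}

lemma isM1c_m1c (h : Par τ σ (‖z‖ ^ 2)) : IsM1c σ z (m1c σ z) :=
  Classical.epsilon_spec (exists_isM1c h)

/-- `m = √w (1 + m₁(w))`. -/
def mm (σ : Fin N → ℝ) (z w : ℂ) : ℂ := Complex.sqrt w * (1 + m1c σ z w)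

lemma cone_m1c (h : Par τ σ (‖z‖ ^ 2)) (hw : 0 < w.im) : Cone w (m1c σ z w) :=
  ⟨((isM1c_m1c h).2 w hw).1.le, ((isM1c_m1c h).2 w hw).2.1.le⟩

/-- `m = √w (1 + m₁)` solves the equation at `r = √w`. -/
lemma sol_mm (h : Par τ σ (‖z‖ ^ 2)) (hw : 0 < w.im) :
    Sol σ (‖z‖ ^ 2) (Complex.sqrt w) (mm σ z w) := by
  refine ⟨sqrt_im_pos hw, (cone_m1c h hw).im_pos hw, ?_⟩
  refine (eq_rhs_iff h hw (cone_m1c h hw)).1 ?_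
  have := ((isM1c_m1c h).2 w hw).2.2
  push_cast
  exact this

lemma m1c_im_pos (h : Par τ σ (‖z‖ ^ 2)) (hw : 0 < w.im) : 0 < (m1c σ z w).im :=
  ((isM1c_m1c h).2 w hw).1

lemma m1c_differentiableOn (h : Par τ σ (‖z‖ ^ 2)) :
    DifferentiableOn ℂ (m1c σ z) {w : ℂ | 0 < w.im} := (isM1c_m1c h).1

lemma mm_differentiableOn (h : Par τ σ (‖z‖ ^ 2)) :
    DifferentiableOn ℂ (mm σ z) {w : ℂ | 0 < w.im} :=
  differentiableOn_sqrt_half.mul ((m1c_differentiableOn h).const_add 1)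

lemma m1c_eq (hw : 0 < w.im) : m1c σ z w = (mm σ z w - Complex.sqrt w) / Complex.sqrt w := by
  have := sqrt_ne hw
  rw [mm]; field_simp; ring

lemma norm_m1c_le (h : Par τ σ (‖z‖ ^ 2)) (hw : 0 < w.im) : ‖m1c σ z w‖ ≤ ‖Complex.sqrt w‖⁻¹ := by
  have h1 := (sol_mm h hw).norm_sub_lt_one h
  rw [m1c_eq hw, norm_div, div_eq_mul_inv]
  nlinarith [inv_nonneg.2 (norm_nonneg (Complex.sqrt w))]

lemma m2c_eq (h : Par τ σ (‖z‖ ^ 2)) (hw : 0 < w.im) :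
    m2c σ z w = -(Complex.sqrt w * aa (‖z‖ ^ 2) (mm σ z w))⁻¹ := by
  have hr := sqrt_ne hw
  have hM0 := (sol_mm h hw).m_ne
  have hu0 : 1 + m1c σ z w ≠ 0 := right_ne_zero_of_mul hM0
  rw [m2c, ← inv_neg]
  congr 1
  have hsq := sqrt_mul_self w
  have : -w * (1 + m1c σ z w) + (‖z‖ : ℂ) ^ 2 / (1 + m1c σ z w) =
    -(Complex.sqrt w * Complex.sqrt w) * (1 + m1c σ z w) + (‖z‖ : ℂ) ^ 2 / (1 + m1c σ z w) := by
    rw [hsq]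
  rw [this, aa, mm]; push_cast; field_simp; ring

/-- The difference of `u` and `m₁` in terms of `m`. -/
lemma norm_sub_m1c (u : ℂ) :
    ‖Complex.sqrt w * (1 + u) - mm σ z w‖ = ‖Complex.sqrt w‖ * ‖u - m1c σ z w‖ := by
  rw [← norm_mul, mm]; congr 1; ring

/-- The residual of the equation in terms of `Υ`. -/
lemma norm_FF_eq (h : Par τ σ (‖z‖ ^ 2)) (hw : 0 < w.im) {u : ℂ} (hu : Cone w u) :
    ‖FF σ (‖z‖ ^ 2) (Complex.sqrt w) (Complex.sqrt w * (1 + u))‖ =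
      ‖Complex.sqrt w‖ * ‖Upsilon σ z w u‖ := by
  have := norm_pos_iff.2 (sqrt_ne hw)
  rw [Upsilon_eq h hw hu, norm_div]; field_simp

/-- Stability with a constant depending on `Im √w` only. -/
lemma strong_stability_m1c (h : Par τ σ (‖z‖ ^ 2)) (hw : 0 < w.im) {u : ℂ} (hu : Cone w u) :
    ‖u - m1c σ z w‖ ≤ (2 + 2 / (Complex.sqrt w).im + 1 / (Complex.sqrt w).im ^ 2) *
      ‖Upsilon σ z w u‖ := by
  have h1 := (sol_mm h hw).strong_stability h (hu.le_im hw)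
  rw [norm_FF_eq h hw hu, norm_sub_m1c] at h1
  have := norm_pos_iff.2 (sqrt_ne hw)
  refine le_of_mul_le_mul_left (h1.trans (le_of_eq ?_)) this
  ring

end m1c

/-! ### The Schwarz–Pick inequality -/

lemma norm_sub_conj_sq (a b : ℂ) :
    ‖a - (starRingEnd ℂ) b‖ ^ 2 = ‖a - b‖ ^ 2 + 4 * (a.im * b.im) := by
  rw [← Complex.normSq_eq_norm_sq, ← Complex.normSq_eq_norm_sq, Complex.normSq_apply,
    Complex.normSq_apply]
  simp; ring

/-- The Schwarz–Pick inequality for self-maps of the upper half plane. -/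
lemma schwarz_pick {f : ℂ → ℂ} (hf : DifferentiableOn ℂ f {w : ℂ | 0 < w.im})
    (hp : ∀ w : ℂ, 0 < w.im → 0 < (f w).im) {w w' : ℂ} (hw : 0 < w.im) (hw' : 0 < w'.im) :
    ‖f w - f w'‖ ^ 2 * (w.im * w'.im) ≤ ‖w - w'‖ ^ 2 * ((f w).im * (f w').im) := by
  set c : ℂ := (starRingEnd ℂ) w' with hc
  have hci : c.im = -w'.im := by simp [hc]
  have hcr : c.re = w'.re := by simp [hc]
  set φ : ℂ → ℂ := fun ζ => (w' - c * ζ) / (1 - ζ) with hφ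
  have h1 : ∀ ζ ∈ Metric.ball (0 : ℂ) 1, (1 : ℂ) - ζ ≠ 0 := by
    intro ζ hζ h
    rw [sub_eq_zero] at h
    rw [← h] at hζ; simp at hζ
  have hφim : ∀ ζ ∈ Metric.ball (0 : ℂ) 1, 0 < (φ ζ).im := by
    intro ζ hζ
    have e : φ ζ = c + (w' - c) / (1 - ζ) := by
      have := h1 ζ hζ
      rw [hφ]; field_simp; ring
    have e2 : w' - c = ((2 * w'.im : ℝ) : ℂ) * Complex.I := by
      apply Complex.ext <;> simp [hci, hcr]; ring
    have hn : 0 < Complex.normSq (1 - ζ) := Complex.normSq_pos.2 (h1 ζ hζ)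
    have hζ' : ζ.re ^ 2 + ζ.im ^ 2 < 1 := by
      have : ‖ζ‖ < 1 := by simpa using hζ
      have h2 : ‖ζ‖ ^ 2 < 1 := by nlinarith [norm_nonneg ζ]
      rw [← Complex.normSq_eq_norm_sq, Complex.normSq_apply] at h2
      linarith
    rw [e, e2, mul_div_assoc, Complex.add_im, Complex.im_ofReal_mul, hci, Complex.div_im]
    simp only [Complex.I_im, Complex.I_re, Complex.sub_re, Complex.one_re, one_mul, zero_mul,
      zero_div, sub_zero]
    have : 1 / 2 < (1 - ζ.re) / Complex.normSq (1 - ζ) := by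
      rw [lt_div_iff₀ hn, Complex.normSq_apply]
      simp; nlinarith
    nlinarith
  set g : ℂ → ℂ := fun ζ => (f (φ ζ) - f w') / (f (φ ζ) - (starRingEnd ℂ) (f w')) with hg
  have hden : ∀ v : ℂ, 0 < v.im → v - (starRingEnd ℂ) (f w') ≠ 0 := by
    intro v hv h
    have := congrArg Complex.im h
    simp at this
    have := hp w' hw'
    linarith
  have hmaps : Set.MapsTo g (Metric.ball 0 1) (Metric.ball 0 1) := by
    intro ζ hζ
    have h2 := hp _ (hφim ζ hζ)
    have h3 := norm_pos_iff.2 (hden _ h2)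
    rw [mem_ball_zero_iff, hg, norm_div, div_lt_one h3]
    refine lt_of_pow_lt_pow_left₀ 2 h3.le ?_
    rw [norm_sub_conj_sq]
    have := hp w' hw'
    have : 0 < (f (φ ζ)).im * (f w').im := by positivity
    linarith
  have hdiff : DifferentiableOn ℂ g (Metric.ball 0 1) := by
    have hφd : DifferentiableOn ℂ φ (Metric.ball 0 1) := by
      refine DifferentiableOn.div (by fun_prop) (by fun_prop) h1
    have h2 : DifferentiableOn ℂ (fun ζ => f (φ ζ)) (Metric.ball 0 1) := hf.comp hφd hφim
    exact (h2.sub_const _).div (h2.sub_const _) fun ζ hζ => hden _ (hp _ (hφim ζ hζ))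
  have hg0 : g 0 = 0 := by simp [hg, hφ]
  have hwc : w - c ≠ 0 := by
    intro h
    have := congrArg Complex.im h
    simp [hci] at this
    linarith
  set ζ := (w - w') / (w - c) with hζ
  have hζn : ‖w - w'‖ < ‖w - c‖ := by
    refine lt_of_pow_lt_pow_left₀ 2 (norm_nonneg _) ?_
    rw [hc, norm_sub_conj_sq]
    have : 0 < w.im * w'.im := by positivity
    linarith
  have hζ1 : ‖ζ‖ < 1 := by
    rw [hζ, norm_div, div_lt_one (norm_pos_iff.2 hwc)]; exact hζn
  have hφζ : φ ζ = w := by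
    have h3 : 1 - ζ ≠ 0 := h1 ζ (by simpa using hζ1)
    have h4 : w' - c ≠ 0 := by
      intro h
      apply h3
      rw [hζ]; field_simp
      linear_combination h
    have h5 : w - c - (w - w') ≠ 0 := by intro h; apply h4; linear_combination h
    rw [hφ]; simp only [hζ]; field_simp; ring
  have key : ‖g ζ‖ ≤ ‖ζ‖ :=
    Complex.norm_le_norm_of_mapsTo_ball hdiff (hmaps.mono_right Metric.ball_subset_closedBall)
      hg0 hζ1
  rw [hg] at key
  simp only [hφζ] at key
  rw [norm_div, hζ, norm_div, div_le_div_iff₀ (norm_pos_iff.2 (hden _ (hp w hw)))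
    (norm_pos_iff.2 hwc)] at key
  have key2 := pow_le_pow_left₀ (by positivity) key 2
  rw [mul_pow, mul_pow, norm_sub_conj_sq, norm_sub_conj_sq] at key2
  nlinarith

/-- For a self-map `f` of the upper half plane, `η |f(E + iη)|` is nondecreasing in `η`. -/
lemma im_mul_norm_mono {f : ℂ → ℂ} (hf : DifferentiableOn ℂ f {w : ℂ | 0 < w.im})
    (hp : ∀ w : ℂ, 0 < w.im → 0 < (f w).im) {w w' : ℂ} (hw : 0 < w.im) (hre : w.re = w'.re)
    (hle : w.im ≤ w'.im) : w.im * ‖f w‖ ≤ w'.im * ‖f w'‖ := by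
  have hw' := hw.trans_le hle
  have h1 := schwarz_pick hf hp hw hw'
  have h2 : ‖w - w'‖ ^ 2 = (w'.im - w.im) ^ 2 := by
    rw [← Complex.normSq_eq_norm_sq, Complex.normSq_apply]; simp [hre]; ring
  rw [h2] at h1
  have h3 : (f w).im ≤ ‖f w‖ := (le_abs_self _).trans (Complex.abs_im_le_norm _)
  have h4 : (f w').im ≤ ‖f w'‖ := (le_abs_self _).trans (Complex.abs_im_le_norm _)
  have h5 : ‖f w‖ - ‖f w'‖ ≤ ‖f w - f w'‖ := norm_sub_norm_le _ _
  have p1 := hp w hw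
  have p2 := hp w' hw'
  set X := ‖f w‖
  set Y := ‖f w'‖
  set a := w.im
  set b := w'.im
  have hX : 0 < X := p1.trans_le h3
  have hY : 0 < Y := p2.trans_le h4
  by_contra! hc
  -- with `x = aX > y = bY` the inequality `(X - Y)² ab ≤ (b - a)² XY` fails
  have hXY : Y < X := by
    by_contra! h
    have : a * X ≤ b * Y := by gcongr
    linarith
  have h6 : (X - Y) ^ 2 * (a * b) ≤ (b - a) ^ 2 * (X * Y) := by
    calc _ ≤ ‖f w - f w'‖ ^ 2 * (a * b) := by
          have : 0 ≤ X - Y := by linarith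
          gcongr
      _ ≤ _ := h1
      _ ≤ _ := by gcongr
  have h7 : (X * a - Y * b) * (X * b - Y * a) ≤ 0 := by nlinarith
  have h8 : 0 < (X * a - Y * b) * (X * b - Y * a) := by
    apply mul_pos
    · linarith
    · nlinarith
  linarith

/-! ### Stieltjes transforms -/

section stieltjes
variable {g : ℝ → ℝ} {w w' : ℂ}

lemma sub_ne_of_im (hw : 0 < w.im) (x : ℝ) : (x : ℂ) - w ≠ 0 := by
  intro h
  have := congrArg Complex.im h
  simp at this
  linarith

lemma im_le_norm_sub (hw : 0 < w.im) (x : ℝ) : w.im ≤ ‖(x : ℂ) - w‖ := by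
  have := Complex.abs_im_le_norm ((x : ℂ) - w)
  simpa [abs_of_pos hw] using this

lemma norm_ofReal_sub_sq (x : ℝ) : ‖(x : ℂ) - w‖ ^ 2 = (x - w.re) ^ 2 + w.im ^ 2 := by
  rw [← Complex.normSq_eq_norm_sq, Complex.normSq_apply]; simp; ring

lemma continuous_inv_sub (hw : 0 < w.im) : Continuous fun x : ℝ => ((x : ℂ) - w)⁻¹ :=
  (Complex.continuous_ofReal.sub continuous_const).inv₀ (sub_ne_of_im hw)

lemma integrable_stieltjes (hg : IsDensity g) (hw : 0 < w.im) :
    Integrable fun x : ℝ => (g x : ℂ) / ((x : ℂ) - w) := by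
  simp only [div_eq_mul_inv]
  refine (hg.1.ofReal (𝕜 := ℂ)).mul_bdd (c := w.im⁻¹)
    (continuous_inv_sub hw).aestronglyMeasurable (Eventually.of_forall fun x => ?_)
  rw [norm_inv]
  exact inv_anti₀ hw (im_le_norm_sub hw x)

lemma integrable_div_sq (hg : IsDensity g) (hw : 0 < w.im) :
    Integrable fun x : ℝ => g x / ‖(x : ℂ) - w‖ ^ 2 := by
  simp only [div_eq_mul_inv]
  refine hg.1.mul_bdd (c := (w.im ^ 2)⁻¹) ?_ (Eventually.of_forall fun x => ?_)
  · refine Continuous.aestronglyMeasurable ?_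
    refine Continuous.inv₀ (by fun_prop) fun x => ?_
    have := norm_pos_iff.2 (sub_ne_of_im hw x); positivity
  · have := im_le_norm_sub hw x
    rw [norm_inv, norm_pow, norm_norm]
    gcongr

/-- The integral `∫ g(x) / |x - w|² dx`. -/
def poissonMass (g : ℝ → ℝ) (w : ℂ) : ℝ := ∫ x : ℝ, g x / ‖(x : ℂ) - w‖ ^ 2

lemma stieltjes_im (hg : IsDensity g) (hw : 0 < w.im) :
    (stieltjes g w).im = w.im * poissonMass g w := by
  have h1 : (stieltjes g w).im = ∫ x : ℝ, ((g x : ℂ) / ((x : ℂ) - w)).im :=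
    (integral_im (𝕜 := ℂ) (integrable_stieltjes hg hw)).symm
  rw [h1, poissonMass, ← integral_const_mul]
  congr 1; ext x
  rw [div_im_eq]; simp; ring

lemma poissonMass_nonneg (hg : IsDensity g) : 0 ≤ poissonMass g w :=
  integral_nonneg fun x => by have := hg.2.1 x; positivity

/-- Stieltjes transforms of densities on `[0, ∞)` satisfy both sign conditions; the second one
holds because `w / (x - w) = x / (x - w) - 1`. -/
lemma cone_stieltjes (hg : IsDensity g) (hw : 0 < w.im) : Cone w (stieltjes g w) := by
  refine ⟨?_, ?_⟩
  · rw [stieltjes_im hg hw]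
    have := poissonMass_nonneg (w := w) hg; positivity
  · have h0 := (integrable_stieltjes hg hw).const_mul w
    have h1 : (w * stieltjes g w).im = ∫ x : ℝ, (w * ((g x : ℂ) / ((x : ℂ) - w))).im := by
      rw [stieltjes, ← integral_const_mul]
      exact (integral_im (𝕜 := ℂ) h0).symm
    rw [h1]
    refine integral_nonneg fun x => ?_
    have h2 := sub_ne_of_im hw x
    have e : w * ((g x : ℂ) / ((x : ℂ) - w)) = ((g x * x : ℝ) : ℂ) / ((x : ℂ) - w) - (g x : ℝ) := by
      push_cast; field_simp; ring
    change 0 ≤ (w * ((g x : ℂ) / ((x : ℂ) - w))).im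
    rw [e, Complex.sub_im, div_im_eq]
    simp only [Complex.sub_im, Complex.ofReal_im, zero_sub, sub_zero]
    have h3 : 0 ≤ g x * x := by
      rcases lt_or_ge x 0 with hx | hx
      · rw [hg.2.2 x hx, zero_mul]
      · exact mul_nonneg (hg.2.1 x) hx
    have : 0 ≤ g x * x * w.im / ‖(x : ℂ) - w‖ ^ 2 := by positivity
    rw [mul_neg, neg_div, neg_neg]; exact this

/-- The difference of two values of the Stieltjes transform, by `|1/(x-w) · 1/(x-w')| ≤ (|x-w|⁻² +
|x-w'|⁻²) / 2`. -/
lemma norm_stieltjes_sub_le (hg : IsDensity g) (hw : 0 < w.im) (hw' : 0 < w'.im) :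
    ‖stieltjes g w - stieltjes g w'‖ ≤
      ‖w - w'‖ * ((poissonMass g w + poissonMass g w') / 2) := by
  have i1 := integrable_stieltjes hg hw
  have i2 := integrable_stieltjes hg hw'
  have j1 := integrable_div_sq hg hw
  have j2 := integrable_div_sq hg hw'
  have e : ‖w - w'‖ * ((poissonMass g w + poissonMass g w') / 2) = ∫ x : ℝ,
      ‖w - w'‖ / 2 * (g x / ‖(x : ℂ) - w‖ ^ 2 + g x / ‖(x : ℂ) - w'‖ ^ 2) := by
    rw [integral_const_mul, integral_add j1 j2, poissonMass, poissonMass]; ring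
  rw [e, stieltjes, stieltjes, ← integral_sub i1 i2]
  refine norm_integral_le_of_norm_le ((j1.add j2).const_mul _) (Eventually.of_forall fun x => ?_)
  have h1 := sub_ne_of_im hw x
  have h2 := sub_ne_of_im hw' x
  have e2 : (g x : ℂ) / ((x : ℂ) - w) - (g x : ℂ) / ((x : ℂ) - w') =
      (w - w') * (g x : ℂ) * (((x : ℂ) - w)⁻¹ * ((x : ℂ) - w')⁻¹) := by
    field_simp; ring
  rw [e2, norm_mul, norm_mul, norm_mul, norm_inv, norm_inv, Complex.norm_real,
    Real.norm_of_nonneg (hg.2.1 x)]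
  have h3 := hg.2.1 x
  set p := ‖(x : ℂ) - w‖⁻¹ with hp
  set t := ‖(x : ℂ) - w'‖⁻¹ with ht
  have : p * t ≤ (p ^ 2 + t ^ 2) / 2 := by nlinarith [sq_nonneg (p - t)]
  calc _ ≤ ‖w - w'‖ * g x * ((p ^ 2 + t ^ 2) / 2) := by gcongr
    _ = _ := by rw [hp, ht]; simp only [inv_pow]; ring

/-- The Stieltjes transform at a lower point is controlled by its value at a higher one. -/
lemma stieltjes_step (hg : IsDensity g) (hw : 0 < w.im) (hre : w.re = w'.re)
    (hle : w.im ≤ w'.im) : ‖stieltjes g w - stieltjes g w'‖ ≤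
      (w'.im - w.im) * (w'.im / w.im ^ 2) * ‖stieltjes g w'‖ := by
  have hw' := hw.trans_le hle
  have h1 := norm_stieltjes_sub_le hg hw hw'
  have j1 := integrable_div_sq hg hw
  have j2 := integrable_div_sq hg hw'
  have h2 : ‖w - w'‖ = w'.im - w.im := by
    have : w - w' = ((w.im - w'.im : ℝ) : ℂ) * Complex.I := by
      apply Complex.ext <;> simp [hre]
    rw [this, norm_mul, Complex.norm_I, mul_one, Complex.norm_real, Real.norm_eq_abs,
      abs_of_nonpos (by linarith)]; ring
  have hcmp : poissonMass g w ≤ (w'.im / w.im) ^ 2 * poissonMass g w' := by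
    rw [poissonMass, poissonMass, ← integral_const_mul]
    refine integral_mono j1 (j2.const_mul _) fun x => ?_
    have hgx := hg.2.1 x
    simp only [norm_ofReal_sub_sq, hre]
    rw [← mul_div_assoc, div_le_div_iff₀ (by positivity) (by positivity)]
    have h3 : (x - w'.re) ^ 2 + w'.im ^ 2 ≤
        (w'.im / w.im) ^ 2 * ((x - w'.re) ^ 2 + w.im ^ 2) := by
      have h4 : 1 ≤ (w'.im / w.im) ^ 2 := one_le_pow₀ ((one_le_div hw).2 hle)
      have h5 : (w'.im / w.im) ^ 2 * w.im ^ 2 = w'.im ^ 2 := by field_simp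
      nlinarith [sq_nonneg (x - w'.re)]
    calc _ ≤ g x * ((w'.im / w.im) ^ 2 * ((x - w'.re) ^ 2 + w.im ^ 2)) := by gcongr
      _ = _ := by ring
  have hcmp2 : poissonMass g w' ≤ (w'.im / w.im) ^ 2 * poissonMass g w' := by
    have h4 : 1 ≤ (w'.im / w.im) ^ 2 := one_le_pow₀ ((one_le_div hw).2 hle)
    have := poissonMass_nonneg (w := w') hg
    nlinarith
  have h6 : w'.im * poissonMass g w' ≤ ‖stieltjes g w'‖ := by
    rw [← stieltjes_im hg hw']
    exact (le_abs_self _).trans (Complex.abs_im_le_norm _)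
  rw [h2] at h1
  have h7 : 0 ≤ w'.im - w.im := by linarith
  calc _ ≤ (w'.im - w.im) * ((w'.im / w.im) ^ 2 * poissonMass g w') := by
        refine h1.trans (mul_le_mul_of_nonneg_left ?_ h7); linarith
    _ = (w'.im - w.im) * (w'.im / w.im ^ 2) * (w'.im * poissonMass g w') := by field_simp
    _ ≤ _ := by gcongr

end stieltjes

/-! ### The fundamental domain is closed upwards -/

section domain
variable {N : ℕ} {τ : ℝ} {σ : Fin N → ℝ} {z w w' : ℂ} {ζ : ℝ}

lemma m2c_differentiableOn (h : Par τ σ (‖z‖ ^ 2)) :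
    DifferentiableOn ℂ (m2c σ z) {w : ℂ | 0 < w.im} := by
  have h1 : DifferentiableOn ℂ (fun w => aa (‖z‖ ^ 2) (mm σ z w)) {w : ℂ | 0 < w.im} := by
    unfold aa
    exact (mm_differentiableOn h).sub ((differentiableOn_const _).div (mm_differentiableOn h)
      fun w hw => (sol_mm h hw).m_ne)
  have h2 : DifferentiableOn ℂ (fun w => -(Complex.sqrt w * aa (‖z‖ ^ 2) (mm σ z w))⁻¹)
      {w : ℂ | 0 < w.im} :=
    ((differentiableOn_sqrt_half.mul h1).inv fun w hw =>
      mul_ne_zero (sqrt_ne hw) ((sol_mm h hw).aa_ne h)).neg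
  exact h2.congr fun w hw => m2c_eq h hw

lemma m2c_im_pos (h : Par τ σ (‖z‖ ^ 2)) (hw : 0 < w.im) : 0 < (m2c σ z w).im := by
  have h1 := isM1c_m1c h |>.2 w hw
  have hu := m1c_im_pos h hw
  have hq : (0 : ℝ) ≤ ‖z‖ ^ 2 := h.q0
  have h2 := neg_div_im_nonneg hq (x := 1 + m1c σ z w) (by simpa using hu.le)
  have h3 : 0 < (w * (1 + m1c σ z w) - ((‖z‖ ^ 2 : ℝ) : ℂ) / (1 + m1c σ z w)).im := by
    rw [Complex.neg_im] at h2
    rw [Complex.sub_im, mul_add, mul_one, Complex.add_im]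
    linarith [h1.2.1]
  have h4 := neg_div_im_pos one_pos h3
  have e : m2c σ z w = -(((1 : ℝ) : ℂ) / (w * (1 + m1c σ z w) -
      ((‖z‖ ^ 2 : ℝ) : ℂ) / (1 + m1c σ z w))) := by
    rw [m2c, Complex.ofReal_one, one_div, ← inv_neg]
    congr 1; push_cast; ring
  rw [e]; exact h4

/-- The domain is closed upwards, as `η |m₂(E + iη)|` is nondecreasing in `η`. -/
lemma dom_up (h : Par τ σ (‖z‖ ^ 2)) (hw : w ∈ dom σ z ζ) (hre : w'.re = w.re)
    (hle : w.im ≤ w'.im) (hup : w'.im ≤ ζ⁻¹) : w' ∈ dom σ z ζ := by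
  obtain ⟨h1, h2, h3, h4, h5⟩ := hw
  have h1' := h1.trans_le hle
  refine ⟨h1', by rwa [hre], by rwa [hre], ?_, hup⟩
  have h6 := im_mul_norm_mono (m2c_differentiableOn h) (fun w hw => m2c_im_pos h hw) h1 hre.symm hle
  have p1 : 0 < ‖m2c σ z w‖ := norm_pos_iff.2 (ne_zero_of_im_pos (m2c_im_pos h h1))
  have p2 : 0 < ‖m2c σ z w'‖ := norm_pos_iff.2 (ne_zero_of_im_pos (m2c_im_pos h h1'))
  rw [← div_eq_mul_inv, div_le_iff₀ p1] at h4
  rw [← div_eq_mul_inv, div_le_iff₀ p2]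
  exact h4.trans h6

/-- A lower bound on `η` in the fundamental domain, in terms of `N` alone. For bounded `N` it
keeps the domain away from the real axis. -/
lemma dom_im_ge (h : Par τ σ (‖z‖ ^ 2)) (hw : w ∈ dom σ z ζ) :
    ((N : ℝ) ^ (-1 + ζ) * τ) ^ 2 ≤ w.im := by
  obtain ⟨h1, h2, h3, h4, h5⟩ := hw
  have S := sol_mm h h1
  have ha := S.tau_le_norm_aa h
  have hτ := h.tau
  rw [m2c_eq h h1, norm_neg, norm_inv, inv_inv, norm_mul] at h4
  have hN : (0 : ℝ) ≤ (N : ℝ) ^ (-1 + ζ) := by positivity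
  have h6 : (N : ℝ) ^ (-1 + ζ) * τ * ‖Complex.sqrt w‖ ≤ w.im := by
    refine le_trans ?_ h4
    calc _ = (N : ℝ) ^ (-1 + ζ) * (‖Complex.sqrt w‖ * τ) := by ring
      _ ≤ _ := by gcongr
  have h7 : w.im ≤ ‖Complex.sqrt w‖ ^ 2 := by
    rw [norm_sqrt_sq]; exact (le_abs_self _).trans (Complex.abs_im_le_norm _)
  have hr := norm_pos_iff.2 (sqrt_ne h1)
  have h8 : (N : ℝ) ^ (-1 + ζ) * τ ≤ ‖Complex.sqrt w‖ := by
    refine le_of_mul_le_mul_right ?_ hr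
    nlinarith
  have h9 : 0 ≤ (N : ℝ) ^ (-1 + ζ) * τ := by positivity
  nlinarith

/-- The change of `m₁` along a vertical segment, from the Schwarz–Pick inequality. -/
lemma m1c_step (h : Par τ σ (‖z‖ ^ 2)) (hw : 0 < w.im) (hre : w.re = w'.re)
    (hle : w.im ≤ w'.im) :
    ‖m1c σ z w - m1c σ z w'‖ ^ 2 ≤ (w'.im - w.im) ^ 2 * (w.im⁻¹) ^ 3 := by
  have hw' := hw.trans_le hle
  have h1 := schwarz_pick (m1c_differentiableOn h) (fun w hw => m1c_im_pos h hw) hw hw'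
  have h2 : ‖w - w'‖ ^ 2 = (w'.im - w.im) ^ 2 := by
    rw [← Complex.normSq_eq_norm_sq, Complex.normSq_apply]; simp [hre]; ring
  have h3 : ∀ v : ℂ, w.im ≤ v.im → 0 < v.im → (m1c σ z v).im ^ 2 ≤ w.im⁻¹ := by
    intro v hle hv
    have h4 := norm_m1c_le h hv
    have h5 := (le_abs_self _).trans (Complex.abs_im_le_norm (m1c σ z v))
    have h6 := m1c_im_pos h hv
    have h7 : w.im ≤ ‖Complex.sqrt v‖ ^ 2 := by
      rw [norm_sqrt_sq]; exact hle.trans ((le_abs_self _).trans (Complex.abs_im_le_norm _))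
    calc _ ≤ (‖Complex.sqrt v‖⁻¹) ^ 2 := by gcongr; exact h5.trans h4
      _ = (‖Complex.sqrt v‖ ^ 2)⁻¹ := by rw [inv_pow]
      _ ≤ _ := inv_anti₀ hw h7
  have h4 := h3 w le_rfl hw
  have h5 := h3 w' hle hw'
  rw [h2] at h1
  have h6 : (m1c σ z w).im * (m1c σ z w').im ≤ w.im⁻¹ := by
    nlinarith [sq_nonneg ((m1c σ z w).im - (m1c σ z w').im)]
  have h7 : ‖m1c σ z w - m1c σ z w'‖ ^ 2 * (w.im * w.im) ≤ (w'.im - w.im) ^ 2 * w.im⁻¹ :=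
    calc _ ≤ ‖m1c σ z w - m1c σ z w'‖ ^ 2 * (w.im * w'.im) := by gcongr
      _ ≤ _ := h1
      _ ≤ _ := by gcongr
  have h8 : (w'.im - w.im) ^ 2 * (w.im⁻¹) ^ 3 =
      ((w'.im - w.im) ^ 2 * w.im⁻¹) / (w.im * w.im) := by field_simp
  rw [h8, le_div_iff₀ (by positivity)]
  exact h7

end domain

/-! ### The continuity argument along the lattice -/

section chain
variable {N : ℕ} {τ : ℝ} {σ : Fin N → ℝ} {z w : ℂ} {ζ : ℝ}

lemma Par.N_pos (h : Par τ σ (‖z‖ ^ 2)) : (1 : ℝ) ≤ N := by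
  exact_mod_cast Nat.one_le_iff_ne_zero.2 h.N_ne

lemma inv_log_le_two (N : ℕ) : (Real.log N)⁻¹ ≤ 2 := by
  rcases Nat.lt_or_ge N 2 with hN | hN
  · interval_cases N <;> simp
  · have h1 : Real.log 2 ≤ Real.log N := Real.log_le_log (by norm_num) (by exact_mod_cast hN)
    have h2 := Real.log_two_gt_d9
    rw [inv_le_comm₀ (by linarith) (by norm_num)]
    linarith

lemma sqrt_im_ge (hw : 0 < w.im) : w.im / (2 * ‖Complex.sqrt w‖) ≤ (Complex.sqrt w).im := by
  have h1 := im_eq_sqrt w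
  have h2 := norm_pos_iff.2 (sqrt_ne hw)
  have h3 := Complex.re_le_norm (Complex.sqrt w)
  have h4 := sqrt_im_pos hw
  rw [div_le_iff₀ (by positivity)]
  nlinarith

lemma dom_inv_im_le (h : Par τ σ (‖z‖ ^ 2)) (hζ : 0 < ζ) (hw : w ∈ dom σ z ζ) :
    (w.im)⁻¹ ≤ (N / τ) ^ 2 := by
  have h1 := dom_im_ge h hw
  have hN := h.N_pos
  have hτ := h.tau
  have hN0 : (0 : ℝ) < N := by linarith
  have h2 : (N : ℝ)⁻¹ ≤ (N : ℝ) ^ (-1 + ζ) := by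
    rw [← Real.rpow_neg_one]
    exact Real.rpow_le_rpow_of_exponent_le hN (by linarith)
  have h3 : ((N / τ) ^ 2)⁻¹ ≤ w.im := by
    refine le_trans ?_ h1
    rw [← inv_pow, inv_div, div_eq_inv_mul]
    gcongr
  exact (inv_le_comm₀ (by positivity) hw.1).1 h3

/-- The change of `m₁` over one step of the lattice. -/
lemma m1c_lattice_step (h : Par τ σ (‖z‖ ^ 2)) (hζ : 0 < ζ) (hw : w ∈ dom σ z ζ) {y y' : ℝ}
    (hy : w.im ≤ y) (hyy : y ≤ y') (hst : y' - y ≤ ((N : ℝ) ^ 10)⁻¹) :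
    ‖m1c σ z ⟨w.re, y⟩ - m1c σ z ⟨w.re, y'⟩‖ ≤ ((N : ℝ) ^ 5 * τ ^ 6)⁻¹ := by
  have hN := h.N_pos
  have hN0 : (0 : ℝ) < N := by linarith
  have hτ := h.tau
  have hτ1 := h.tau_le_one
  have hη := hw.1
  have hy0 : 0 < y := hη.trans_le hy
  have s2 := m1c_step h (w := ⟨w.re, y⟩) (w' := ⟨w.re, y'⟩) hy0 rfl hyy
  refine abs_le_of_sq_le_sq' (s2.trans ?_) (by positivity) |>.2
  have hia : y⁻¹ ≤ (N / τ) ^ 2 := (inv_anti₀ hη hy).trans (dom_inv_im_le h hζ hw)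
  have h0 : 0 ≤ y' - y := by linarith
  have : (y' - y) ^ 2 * y⁻¹ ^ 3 ≤ (((N : ℝ) ^ 10)⁻¹) ^ 2 * ((N / τ) ^ 2) ^ 3 := by gcongr
  refine this.trans ?_
  have e2 : (((N : ℝ) ^ 10)⁻¹) ^ 2 * (((N : ℝ) / τ) ^ 2) ^ 3 =
    (τ ^ 3 * ((N : ℝ)⁻¹) ^ 2) ^ 2 * (((N : ℝ) ^ 5 * τ ^ 6)⁻¹) ^ 2 := by field_simp
  rw [e2]
  have h4 : (N : ℝ)⁻¹ ≤ 1 := inv_le_one_of_one_le₀ hN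
  have h5 : τ ^ 3 ≤ 1 := pow_le_one₀ hτ.le hτ1
  have h6 : ((N : ℝ)⁻¹) ^ 2 ≤ 1 := pow_le_one₀ (by positivity) h4
  have h3 : τ ^ 3 * ((N : ℝ)⁻¹) ^ 2 ≤ 1 := mul_le_one₀ h5 (by positivity) h6
  have h7 : (τ ^ 3 * ((N : ℝ)⁻¹) ^ 2) ^ 2 ≤ 1 := pow_le_one₀ (by positivity) h3
  exact mul_le_of_le_one_left (by positivity) h7

/-- The discrete continuity argument: an a priori bound `T` at height one propagates down to `w`
along the lattice, provided that the bound improves itself at each lattice point. -/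
lemma chain (h : Par τ σ (‖z‖ ^ 2)) (hζ : 0 < ζ) (hζ1 : ζ < 1) (hw : w ∈ dom σ z ζ)
    (hw1 : w.im ≤ 1) {g : ℝ → ℝ} (hg : IsDensity g) (T : ℝ → ℝ)
    (hT : ∀ y, w.im ≤ y → y ≤ 1 → T y ≤ N / τ)
    (htop : ‖stieltjes g ⟨w.re, 1⟩ - m1c σ z ⟨w.re, 1⟩‖ ≤ T 1)
    (hstab : ∀ y, w.im ≤ y → y ≤ 1 → (⟨w.re, y⟩ : ℂ) ∈ lattice σ z ζ w →
      ‖stieltjes g ⟨w.re, y⟩ - m1c σ z ⟨w.re, y⟩‖ ≤ T y →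
      ‖stieltjes g ⟨w.re, y⟩ - m1c σ z ⟨w.re, y⟩‖ ≤ T y / 2)
    (hstep : ∀ y y', w.im ≤ y → y ≤ y' → y' ≤ 1 → y' - y ≤ ((N : ℝ) ^ 10)⁻¹ →
      T y' / 2 + 3 * ((N : ℝ) ^ 5 * τ ^ 6)⁻¹ ≤ T y) :
    ‖stieltjes g w - m1c σ z w‖ ≤ T w.im := by
  have hN := h.N_pos
  have hN0 : (0 : ℝ) < N := by linarith
  have hτ := h.tau
  have hτ1 := h.tau_le_one
  have hη := hw.1
  set η := w.im with hηd
  set D : ℝ := (N : ℝ) ^ 10 with hD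
  have hD0 : 0 < D := by positivity
  -- the lattice heights `1 - j N⁻¹⁰`, cut off at `η`
  set y : ℕ → ℝ := fun j => max η (1 - j / D) with hy
  have hyη : ∀ j, η ≤ y j := fun j => le_max_left _ _
  have hy1 : ∀ j, y j ≤ 1 := fun j => max_le hw1 (by
    have : (0 : ℝ) ≤ j / D := by positivity
    linarith)
  have hyanti : ∀ j, y (j + 1) ≤ y j := fun j => by
    apply max_le_max_left
    have : (j : ℝ) / D ≤ ((j + 1 : ℕ) : ℝ) / D := by gcongr; linarith
    linarith
  have hystep : ∀ j, y j - y (j + 1) ≤ D⁻¹ := fun j => by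
    have e : ((j + 1 : ℕ) : ℝ) / D = j / D + D⁻¹ := by push_cast; field_simp
    have : 0 < D⁻¹ := by positivity
    have : y j ≤ y (j + 1) + D⁻¹ := by
      apply max_le
      · linarith [hyη (j + 1)]
      · have : 1 - ((j + 1 : ℕ) : ℝ) / D ≤ y (j + 1) := le_max_right _ _
        linarith
    linarith
  have hζ' : 1 ≤ ζ⁻¹ := (one_le_inv₀ hζ).2 hζ1.le
  have hlat : ∀ j, j ≤ N ^ 10 → (⟨w.re, y j⟩ : ℂ) ∈ lattice σ z ζ w := by
    intro j hj
    rcases le_or_gt (1 - j / D) η with hc | hc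
    · left
      have : y j = η := max_eq_left hc
      rw [this]; rfl
    · right
      have e : y j = 1 - j / D := max_eq_right hc.le
      refine ⟨dom_up h hw rfl (hyη j) ((hy1 j).trans hζ'), rfl, hyη j, hy1 j, N ^ 10 - j, ?_⟩
      change y j = _
      rw [e, Nat.cast_sub hj, hD]; push_cast; field_simp
  have hinv := dom_inv_im_le h hζ hw
  rw [← hηd] at hinv
  have main : ∀ j : ℕ, j ≤ N ^ 10 →
      ‖stieltjes g ⟨w.re, y j⟩ - m1c σ z ⟨w.re, y j⟩‖ ≤ T (y j) := by
    intro j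
    induction j with
    | zero =>
      intro _
      have : y 0 = 1 := by simp [hy, hw1]
      rw [this]; exact htop
    | succ j ih =>
      intro hj
      have hj' : j ≤ N ^ 10 := by omega
      have h1 := hstab (y j) (hyη j) (hy1 j) (hlat j hj') (ih hj')
      have h2 := hstep (y (j + 1)) (y j) (hyη _) (hyanti j) (hy1 j) (hystep j)
      set a : ℂ := ⟨w.re, y (j + 1)⟩
      set b : ℂ := ⟨w.re, y j⟩
      have ha : 0 < a.im := hη.trans_le (hyη (j + 1))
      have hb : 0 < b.im := hη.trans_le (hyη j)
      -- passing to the next height changes both functions by a negative power of `N` only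
      have s1 := stieltjes_step hg (w := a) (w' := b) ha rfl (hyanti j)
      have hia : (a.im)⁻¹ ≤ (N / τ) ^ 2 := (inv_anti₀ hη (hyη (j + 1))).trans hinv
      have hib : (b.im)⁻¹ ≤ (N / τ) ^ 2 := (inv_anti₀ hη (hyη j)).trans hinv
      have hab : 0 ≤ b.im - a.im := sub_nonneg.2 (hyanti j)
      have hab' : b.im - a.im ≤ D⁻¹ := hystep j
      have n1 : ‖m1c σ z b‖ ≤ N / τ := by
        refine (norm_m1c_le h hb).trans ?_
        refine abs_le_of_sq_le_sq' ?_ (by positivity) |>.2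
        rw [inv_pow]
        refine (inv_anti₀ hb ?_).trans hib
        rw [norm_sqrt_sq]; exact (le_abs_self _).trans (Complex.abs_im_le_norm _)
      have n2 : ‖stieltjes g b‖ ≤ 2 * (N / τ) := by
        have := norm_sub_norm_le (stieltjes g b) (m1c σ z b)
        have := hT (y j) (hyη j) (hy1 j)
        have : 0 ≤ (N : ℝ) / τ := by positivity
        linarith
      have s1' : ‖stieltjes g a - stieltjes g b‖ ≤ 2 * ((N : ℝ) ^ 5 * τ ^ 6)⁻¹ := by
        refine s1.trans ?_
        have e1 : b.im / a.im ^ 2 ≤ (N / τ) ^ 4 := by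
          rw [div_eq_mul_inv, ← inv_pow]
          have : b.im ≤ 1 := hy1 j
          calc b.im * (a.im)⁻¹ ^ 2 ≤ 1 * ((N / τ) ^ 2) ^ 2 := by gcongr
            _ = _ := by ring
        have : (b.im - a.im) * (b.im / a.im ^ 2) * ‖stieltjes g b‖ ≤
            D⁻¹ * (N / τ) ^ 4 * (2 * (N / τ)) := by gcongr
        refine this.trans ?_
        have e2 : D⁻¹ * (N / τ) ^ 4 * (2 * (N / τ)) = 2 * (τ * ((N : ℝ) ^ 5 * τ ^ 6)⁻¹) := by
          rw [hD]; field_simp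
        rw [e2]
        have : 0 ≤ ((N : ℝ) ^ 5 * τ ^ 6)⁻¹ := by positivity
        nlinarith
      have s2' := m1c_lattice_step h hζ hw (hyη (j + 1)) (hyanti j) (hystep j)
      have tri : ‖stieltjes g a - m1c σ z a‖ ≤ ‖stieltjes g b - m1c σ z b‖ +
          ‖stieltjes g a - stieltjes g b‖ + ‖m1c σ z a - m1c σ z b‖ := by
        have e : stieltjes g a - m1c σ z a = (stieltjes g b - m1c σ z b) +
          (stieltjes g a - stieltjes g b) - (m1c σ z a - m1c σ z b) := by ring
        rw [e]
        exact (norm_sub_le _ _).trans (add_le_add (norm_add_le _ _) le_rfl)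
      linarith
  have h1 := main (N ^ 10) le_rfl
  have h2 : y (N ^ 10) = η := by
    rw [hy]; simp only [hD]; push_cast
    rw [div_self (by positivity), sub_self, max_eq_left hη.le]
  rw [h2] at h1
  exact h1

/-- Local stability of the equation at `w`, for `u` close to `m₁(w)`. -/
def LocalStable (σ : Fin N → ℝ) (z : ℂ) (θ C : ℝ) (w : ℂ) : Prop :=
  ∀ u, Cone w u → ‖u - m1c σ z w‖ ≤ θ * (1 + ‖m1c σ z w‖) →
    ‖u - m1c σ z w‖ ≤ C * ‖Upsilon σ z w u‖

/-- Strong stability with a uniform constant, away from the real axis. -/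
lemma strong_stable_uniform (h : Par τ σ (‖z‖ ^ 2)) {c R : ℝ} (hc : 0 < c) (hR : 0 < R)
    (hw : c ≤ w.im) (hwR : ‖w‖ ≤ R ^ 2) {u : ℂ} (hu : Cone w u) :
    ‖u - m1c σ z w‖ ≤ (2 + 2 / (c / (2 * R)) + 1 / (c / (2 * R)) ^ 2) * ‖Upsilon σ z w u‖ := by
  have hw0 : 0 < w.im := hc.trans_le hw
  refine (strong_stability_m1c h hw0 hu).trans ?_
  have h1 : c / (2 * R) ≤ (Complex.sqrt w).im := by
    refine le_trans ?_ (sqrt_im_ge hw0)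
    have h2 := norm_pos_iff.2 (sqrt_ne hw0)
    have h3 : ‖Complex.sqrt w‖ ≤ R := by
      rw [← norm_sqrt_sq] at hwR
      exact abs_le_of_sq_le_sq' hwR hR.le |>.2
    gcongr
  gcongr

lemma dom_norm_le {w : ℂ} (hζ : 0 < ζ) (hw : w ∈ dom σ z ζ) : ‖w‖ ≤ (2 * ζ⁻¹ + 1) ^ 2 := by
  obtain ⟨h1, h2, h3, h4, h5⟩ := hw
  have h6 := Complex.norm_le_abs_re_add_abs_im w
  rw [abs_of_nonneg h2, abs_of_pos h1] at h6
  have : 0 < ζ⁻¹ := by positivity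
  nlinarith

/-- Local stability on vertical lines implies stability in the form needed away from the edges. -/
lemma exists_bound_of_localStable (τ ζ θ C : ℝ) (hτ : 0 < τ) (hζ : 0 < ζ) (hζ1 : ζ < 1)
    (hθ : 0 < θ) (hθ1 : θ ≤ 1 / 2) (hC : 0 < C) : ∃ C' : ℝ, 0 < C' ∧ ∀ (N : ℕ) (σ : Fin N → ℝ)
      (z : ℂ), Par τ σ (‖z‖ ^ 2) → ∀ w ∈ dom σ z ζ,
      (∀ y, w.im ≤ y → y ≤ 1 → LocalStable σ z θ C ⟨w.re, y⟩) → ∀ g, IsDensity g →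
      ∀ δ : ℂ → ℝ, (∀ w' ∈ lattice σ z ζ w, δ w' ≤ (Real.log N)⁻¹ * ‖m1c σ z w'‖) →
      (∀ w' ∈ lattice σ z ζ w, ‖Upsilon σ z w' (stieltjes g w')‖ ≤ δ w') →
      ‖stieltjes g w - m1c σ z w‖ ≤ C' * δ w := by
  set R := 2 * ζ⁻¹ + 1 with hR
  have hR0 : 0 < R := by positivity
  set C1 := 2 + 2 / (1 / (2 * R)) + 1 / (1 / (2 * R)) ^ 2 with hC1
  have hC10 : 0 < C1 := by positivity
  have hlog : Tendsto (fun N : ℕ => (C + C1) * (Real.log N)⁻¹) atTop (𝓝 0) := by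
    have := (tendsto_inv_atTop_zero.comp
      (Real.tendsto_log_atTop.comp tendsto_natCast_atTop_atTop)).const_mul (C + C1)
    simpa using this
  have hpow : Tendsto (fun N : ℕ => 4 * ((N : ℝ) ^ 5 * τ ^ 6)⁻¹) atTop (𝓝 0) := by
    have h1 : Tendsto (fun N : ℕ => ((N : ℝ) ^ 5)⁻¹) atTop (𝓝 0) :=
      tendsto_inv_atTop_zero.comp ((tendsto_pow_atTop (by norm_num)).comp
        tendsto_natCast_atTop_atTop)
    have h2 := (h1.mul_const (τ ^ 6)⁻¹).const_mul 4
    rw [zero_mul, mul_zero] at h2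
    exact h2.congr fun N => by rw [mul_inv]
  obtain ⟨N0, hN0⟩ := eventually_atTop.1 ((hlog.eventually (ge_mem_nhds (half_pos hθ))).and
    (hpow.eventually (ge_mem_nhds (half_pos hθ))))
  set N1 := max N0 1
  have hN1 : (0 : ℝ) < N1 := by
    have : 1 ≤ N1 := le_max_right _ _
    exact_mod_cast this
  set c := ((N1 : ℝ) ^ (-1 + ζ) * τ) ^ 2 with hc
  have hc0 : 0 < c := by positivity
  set C2 := 2 + 2 / (c / (2 * R)) + 1 / (c / (2 * R)) ^ 2 with hC2
  refine ⟨C + C1 + C2, by positivity, ?_⟩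
  intro N σ z h w hw hLS g hg δ hδ hΥ
  have hwl : w ∈ lattice σ z ζ w := Or.inl rfl
  have hδ0 : 0 ≤ δ w := (norm_nonneg _).trans (hΥ w hwl)
  have hcone := cone_stieltjes hg hw.1
  have hC20 : 0 < C2 := by positivity
  -- For `η ≥ 1`, and for bounded `N`, where `η` is bounded below on the domain, strong stability
  -- applies directly.
  rcases le_or_gt 1 w.im with h1 | h1
  · have := strong_stable_uniform h one_pos hR0 h1 (dom_norm_le hζ hw) hcone
    rw [← hC1] at this
    have h2 := hΥ w hwl
    calc _ ≤ C1 * δ w := this.trans (by gcongr)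
      _ ≤ _ := by gcongr; linarith
  rcases lt_or_ge N N1 with hN | hN
  · have h2 : c ≤ w.im := by
      refine le_trans ?_ (dom_im_ge h hw)
      have : (N1 : ℝ) ^ (-1 + ζ) ≤ (N : ℝ) ^ (-1 + ζ) := by
        refine Real.rpow_le_rpow_of_nonpos ?_ (by exact_mod_cast hN.le) (by linarith)
        have := h.N_pos; linarith
      rw [hc]; gcongr
    have := strong_stable_uniform h hc0 hR0 h2 (dom_norm_le hζ hw) hcone
    rw [← hC2] at this
    have h2 := hΥ w hwl
    calc _ ≤ C2 * δ w := this.trans (by gcongr)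
      _ ≤ _ := by gcongr; linarith
  -- the main case: `N` is large and `η < 1`
  obtain ⟨hl, hp⟩ := hN0 N ((le_max_left _ _).trans hN)
  have hNp := h.N_pos
  have hNp0 : (0 : ℝ) < N := by linarith
  have hτ1 := h.tau_le_one
  have hη := hw.1
  have hlog0 : 0 ≤ (Real.log N)⁻¹ := by
    have := Real.log_nonneg hNp; positivity
  have key : ∀ y, w.im ≤ y → y ≤ 1 → ‖m1c σ z ⟨w.re, y⟩‖ ≤ N / τ := by
    intro y hy hy1
    have hy0 : 0 < y := hη.trans_le hy
    refine (norm_m1c_le h (w := ⟨w.re, y⟩) hy0).trans ?_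
    refine abs_le_of_sq_le_sq' ?_ (by positivity) |>.2
    rw [inv_pow]
    refine le_trans ?_ (dom_inv_im_le h hζ hw)
    refine inv_anti₀ hη ?_
    rw [norm_sqrt_sq]; exact hy.trans ((le_abs_self _).trans (Complex.abs_im_le_norm ⟨w.re, y⟩))
  have res := chain h hζ hζ1 hw h1.le hg (fun y => θ * (1 + ‖m1c σ z ⟨w.re, y⟩‖)) ?_ ?_ ?_ ?_
  · have h2 := (hLS w.im le_rfl h1.le) _ hcone res
    have h3 := hΥ w hwl
    calc _ ≤ C * δ w := h2.trans (by gcongr)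
      _ ≤ _ := by gcongr; linarith
  · intro y hy hy1
    have h2 := key y hy hy1
    have h3 : 1 ≤ (N : ℝ) / τ := by rw [one_le_div hτ]; linarith
    nlinarith [norm_nonneg (m1c σ z ⟨w.re, y⟩)]
  · have hζ' : 1 ≤ ζ⁻¹ := (one_le_inv₀ hζ).2 hζ1.le
    have h2 : (⟨w.re, 1⟩ : ℂ) ∈ dom σ z ζ := dom_up h hw rfl h1.le hζ'
    have h3 : (⟨w.re, 1⟩ : ℂ) ∈ lattice σ z ζ w := by
      refine Or.inr ⟨h2, rfl, h1.le, le_rfl, N ^ 10, ?_⟩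
      push_cast; rw [div_self (by positivity)]
    have h4 := strong_stable_uniform h one_pos hR0 (w := ⟨w.re, 1⟩) le_rfl (dom_norm_le hζ h2)
      (cone_stieltjes hg h2.1)
    rw [← hC1] at h4
    have h5 := (hΥ _ h3).trans (hδ _ h3)
    set M := ‖m1c σ z ⟨w.re, 1⟩‖
    have hM : 0 ≤ M := norm_nonneg _
    calc _ ≤ C1 * ((Real.log N)⁻¹ * M) := h4.trans (by gcongr)
      _ ≤ (C + C1) * ((Real.log N)⁻¹ * M) := by gcongr; linarith
      _ = ((C + C1) * (Real.log N)⁻¹) * M := by ring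
      _ ≤ θ / 2 * M := by gcongr
      _ ≤ θ * (1 + M) := by linarith [mul_nonneg hθ.le hM]
  · intro y hy hy1 hlat hle
    have hy0 : 0 < y := hη.trans_le hy
    have h2 := hLS y hy hy1 _ (cone_stieltjes hg (w := ⟨w.re, y⟩) hy0) hle
    have h5 := (hΥ _ hlat).trans (hδ _ hlat)
    set M := ‖m1c σ z ⟨w.re, y⟩‖
    have hM : 0 ≤ M := norm_nonneg _
    calc _ ≤ C * ((Real.log N)⁻¹ * M) := h2.trans (by gcongr)
      _ ≤ (C + C1) * ((Real.log N)⁻¹ * M) := by gcongr; linarith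
      _ = ((C + C1) * (Real.log N)⁻¹) * M := by ring
      _ ≤ θ / 2 * M := by gcongr
      _ ≤ _ := by nlinarith
  · intro y y' hy hyy hy1 hst
    have s3 := m1c_lattice_step h hζ hw hy hyy hst
    set M := ‖m1c σ z ⟨w.re, y⟩‖
    set M' := ‖m1c σ z ⟨w.re, y'⟩‖
    have h6 : M' ≤ M + ((N : ℝ) ^ 5 * τ ^ 6)⁻¹ := by
      have := norm_sub_norm_le (m1c σ z ⟨w.re, y'⟩) (m1c σ z ⟨w.re, y⟩)
      rw [norm_sub_rev] at this
      linarith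
    have hM : 0 ≤ M := norm_nonneg _
    have hx : 0 ≤ ((N : ℝ) ^ 5 * τ ^ 6)⁻¹ := by positivity
    set x := ((N : ℝ) ^ 5 * τ ^ 6)⁻¹
    have t1 : θ * M' ≤ θ * (M + x) := by gcongr
    have t2 : θ * x ≤ 1 / 2 * x := by gcongr
    have t3 : 0 ≤ θ * M := by positivity
    change θ * (1 + M') / 2 + 3 * x ≤ θ * (1 + M)
    linarith

/-- Local stability on an upwards closed part of the domain gives stability with the error bound
of the theorem, as soon as the quantity under the square root is bounded. -/
lemma exists_stableOn_of_localStable (τ ζ θ C M : ℝ) (hτ : 0 < τ) (hζ : 0 < ζ) (hζ1 : ζ < 1)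
    (hθ : 0 < θ) (hθ1 : θ ≤ 1 / 2) (hC : 0 < C) : ∃ C' : ℝ, 0 < C' ∧ ∀ (N : ℕ) (σ : Fin N → ℝ)
      (z : ℂ), Par τ σ (‖z‖ ^ 2) → ∀ S ⊆ dom σ z ζ, ∀ cap : ℝ → ℝ,
      (∀ w ∈ S, ∀ w' ∈ dom σ z ζ, w'.re = w.re → w.im ≤ w'.im → w' ∈ S) →
      (∀ w ∈ S, w.im ≤ 1 → LocalStable σ z θ C w) →
      (∀ w ∈ S, ∀ d, 0 ≤ d → d ≤ 2 * ‖m1c σ z w‖ →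
        0 ≤ cap d ∧ kappa σ z w.re + w.im + cap d ≤ M) →
      StableOn σ z ζ S cap C' := by
  obtain ⟨C', hC', hb⟩ := exists_bound_of_localStable τ ζ θ C hτ hζ hζ1 hθ hθ1 hC
  refine ⟨C' * √(max M 1), by positivity, ?_⟩
  intro N σ z h S hS cap hup hLS hcap δ hδ _ _ g hg w hw hΥ
  have hζ' : 1 ≤ ζ⁻¹ := (one_le_inv₀ hζ).2 hζ1.le
  have hlS : ∀ w' ∈ lattice σ z ζ w, w' ∈ S := by
    rintro w' (rfl | ⟨h1, h2, h3, _⟩)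
    · exact hw
    · exact hup w hw w' h1 h2 h3
  have h1 := hb N σ z h w (hS hw) (fun y hy hy1 => hLS _
    (hup w hw ⟨w.re, y⟩ (dom_up h (hS hw) rfl hy (hy1.trans hζ')) rfl hy) hy1) g hg δ
    (fun w' hw' => (hδ w' (hlS w' hw')).2) hΥ
  have hδ0 : 0 ≤ δ w := (norm_nonneg _).trans (hΥ w (Or.inl rfl))
  have hδ2 : δ w ≤ 2 * ‖m1c σ z w‖ :=
    (hδ w hw).2.trans (mul_le_mul_of_nonneg_right (inv_log_le_two N) (norm_nonneg _))
  obtain ⟨h2, h3⟩ := hcap w hw _ hδ0 hδ2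
  have hk : 0 ≤ kappa σ z w.re := Metric.infDist_nonneg
  have hw0 : 0 < w.im := (hS hw).1
  have hpos : 0 < kappa σ z w.re + w.im + cap (δ w) := by linarith
  rw [le_div_iff₀ (Real.sqrt_pos.2 hpos)]
  calc _ ≤ C' * δ w * √(max M 1) := by
        gcongr
        exact h3.trans (le_max_left _ _)
    _ = _ := by ring

end chain

/-! ### Perturbation of the kernel and local stability -/

/-- The pair `(r, m)` keeps distance `κ` from all singularities of the equation. -/
structure Nice {N : ℕ} (κ : ℝ) (σ : Fin N → ℝ) (q : ℝ) (r m : ℂ) : Prop where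
  m_ge : κ ≤ ‖m‖
  a_ge : κ ≤ ‖aa q m‖
  b_ge : ∀ i, κ ≤ ‖bb q (σ i) r m‖

section perturb
variable {N : ℕ} {τ : ℝ} {σ : Fin N → ℝ} {q κ : ℝ} {r m r' m' : ℂ}

lemma Nice.m_ne (n : Nice κ σ q r m) (hκ : 0 < κ) : m ≠ 0 := norm_pos_iff.1 (hκ.trans_le n.m_ge)
lemma Nice.a_ne (n : Nice κ σ q r m) (hκ : 0 < κ) : aa q m ≠ 0 :=
  norm_pos_iff.1 (hκ.trans_le n.a_ge)
lemma Nice.b_ne (n : Nice κ σ q r m) (hκ : 0 < κ) (i : Fin N) : bb q (σ i) r m ≠ 0 :=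
  norm_pos_iff.1 (hκ.trans_le (n.b_ge i))

lemma Nice.mono {κ' : ℝ} (n : Nice κ σ q r m) (h : κ' ≤ κ) : Nice κ' σ q r m :=
  ⟨h.trans n.m_ge, h.trans n.a_ge, fun i => h.trans (n.b_ge i)⟩

/-- Bounds on all quantities in a neighbourhood of a nonsingular pair. -/
lemma Nice.perturb (h : Par τ σ q) (hκ : 0 < κ) (n : Nice κ σ q r m) {P D : ℝ}
    (hP : P = 2 * (1 + τ⁻¹) / κ ^ 2) (hD : D ≤ κ / (2 * (1 + P) ^ 2))
    (hr : ‖r' - r‖ ≤ D) (hm : ‖m' - m‖ ≤ D) :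
    Nice (κ / 2) σ q r' m' ∧ ‖aa q m' - aa q m‖ ≤ (1 + P) * D ∧
      ∀ i, ‖bb q (σ i) r' m' - bb q (σ i) r m‖ ≤ (1 + P) ^ 2 * D := by
  have hτ := h.tau
  have hP0 : 0 < P := by rw [hP]; positivity
  have hD0 : 0 ≤ D := (norm_nonneg _).trans hr
  have hD2 : (1 + P) ^ 2 * D ≤ κ / 2 := by
    have : κ / 2 = (1 + P) ^ 2 * (κ / (2 * (1 + P) ^ 2)) := by field_simp
    rw [this]; gcongr
  have hD1 : (1 + P) * D ≤ κ / 2 := by nlinarith [mul_nonneg hP0.le hD0]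
  have hD3 : D ≤ κ / 2 := by nlinarith [mul_nonneg hP0.le hD0]
  have lower : ∀ x y : ℂ, κ ≤ ‖x‖ → ‖y - x‖ ≤ κ / 2 → κ / 2 ≤ ‖y‖ := by
    intro x y h1 h2
    have := norm_sub_norm_le x y
    rw [norm_sub_rev] at this
    linarith
  have inv2 : ∀ x y : ℂ, κ / 2 ≤ ‖x‖ → κ ≤ ‖y‖ → ‖x⁻¹ * y⁻¹‖ ≤ 2 / κ ^ 2 := by
    intro x y hx hy
    rw [norm_mul, norm_inv, norm_inv]
    calc _ ≤ (κ / 2)⁻¹ * κ⁻¹ := by gcongr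
      _ = _ := by field_simp
  have m1 : κ / 2 ≤ ‖m'‖ := lower m m' n.m_ge (hm.trans hD3)
  have hm0 := n.m_ne hκ
  have ha0 := n.a_ne hκ
  have hm0' : m' ≠ 0 := norm_pos_iff.1 ((half_pos hκ).trans_le m1)
  have hmm : ‖(q : ℂ) * (m'⁻¹ * m⁻¹)‖ ≤ P := by
    rw [norm_mul, Complex.norm_real, Real.norm_of_nonneg h.q0, hP]
    calc _ ≤ (1 + τ⁻¹) * (2 / κ ^ 2) := by
          have := inv2 m' m m1 n.m_ge
          have := h.qhi
          gcongr
      _ = _ := by ring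
  have hmm1 : ‖1 + (q : ℂ) * (m'⁻¹ * m⁻¹)‖ ≤ 1 + P := by
    refine (norm_add_le _ _).trans ?_
    rw [norm_one]; gcongr
  have a1 : ‖aa q m' - aa q m‖ ≤ (1 + P) * D := by
    rw [aa_sub hm0' hm0, norm_mul, mul_comm]
    gcongr
  have a2 : κ / 2 ≤ ‖aa q m'‖ := lower _ _ n.a_ge (a1.trans hD1)
  have ha0' : aa q m' ≠ 0 := norm_pos_iff.1 ((half_pos hκ).trans_le a2)
  have b1 : ∀ i, ‖bb q (σ i) r' m' - bb q (σ i) r m‖ ≤ (1 + P) ^ 2 * D := by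
    intro i
    rw [bb_sub hm0' hm0 ha0' ha0]
    have haa : ‖(σ i : ℂ) * ((aa q m')⁻¹ * (aa q m)⁻¹)‖ ≤ P := by
      rw [norm_mul, Complex.norm_real, Real.norm_of_nonneg (h.spos i).le, hP]
      calc _ ≤ (1 + τ⁻¹) * (2 / κ ^ 2) := by
            have := inv2 _ _ a2 n.a_ge
            have := h.hi i
            gcongr
            linarith
        _ = _ := by ring
    calc _ ≤ D + D * (P + P * (1 + P)) := by
          refine (norm_add_le _ _).trans (add_le_add hr ?_)
          rw [norm_mul]
          refine mul_le_mul hm ?_ (norm_nonneg _) hD0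
          refine (norm_add_le _ _).trans (add_le_add hmm ?_)
          rw [norm_mul]
          exact mul_le_mul haa hmm1 (norm_nonneg _) hP0.le
      _ = _ := by ring
  exact ⟨⟨m1, a2, fun i => lower _ _ (n.b_ge i) ((b1 i).trans hD2)⟩, a1, b1⟩

/-- Lipschitz continuity of the kernel near a nonsingular pair, with constants independent of
`N`. -/
lemma exists_kernel_lipschitz (τ κ : ℝ) (hτ : 0 < τ) (hκ : 0 < κ) : ∃ c L : ℝ, 0 < c ∧ 0 < L ∧
    ∀ (N : ℕ) (σ : Fin N → ℝ) (q : ℝ), Par τ σ q → ∀ r m, Nice κ σ q r m →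
      ∀ D ≤ c, ∀ r₁ m₁ r₂ m₂, ‖r₁ - r‖ ≤ D → ‖m₁ - m‖ ≤ D → ‖r₂ - r‖ ≤ D → ‖m₂ - m‖ ≤ D →
      Nice (κ / 2) σ q r₁ m₁ ∧ ‖KK σ q r₁ m₁ r₂ m₂ - KK σ q r m r m‖ ≤ L * D ∧
      ‖(avg fun i => (σ i : ℂ) * ((bb q (σ i) r₁ m₁)⁻¹ * (bb q (σ i) r₂ m₂)⁻¹))‖ ≤ L ∧
      ‖(avg fun i => (σ i : ℂ) * ((bb q (σ i) r₁ m₁)⁻¹ * (bb q (σ i) r₂ m₂)⁻¹)) -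
        avg fun i => (σ i : ℂ) * ((bb q (σ i) r m)⁻¹ * (bb q (σ i) r m)⁻¹)‖ ≤ L * D := by
  set T := 1 + τ⁻¹ with hT
  have hT0 : 0 < T := by positivity
  set P := 2 * T / κ ^ 2 with hP
  have hP0 : 0 < P := by positivity
  set c := κ / (2 * (1 + P) ^ 2) with hc
  set E := (2 / κ ^ 2) * (1 + P) ^ 2 with hE
  set G := 3 * E / κ with hG
  set H := 4 / κ ^ 2 with hH
  have hE0 : 0 < E := by positivity
  have hG0 : 0 < G := by positivity
  have hH0 : 0 < H := by positivity
  refine ⟨c, T * G + T * H + G * T ^ 2 * H * (4 + 3 * (T * H)), by positivity, by positivity, ?_⟩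
  intro N σ q h r m n D hD r₁ m₁ r₂ m₂ hr1 hm1 hr2 hm2
  have hD0 : 0 ≤ D := (norm_nonneg _).trans hr1
  obtain ⟨n1, a1, b1⟩ := n.perturb h hκ hP hD hr1 hm1
  obtain ⟨n2, a2, b2⟩ := n.perturb h hκ hP hD hr2 hm2
  have hκ2 : 0 < κ / 2 := by positivity
  have invd : ∀ x y : ℂ, κ / 2 ≤ ‖x‖ → κ ≤ ‖y‖ → ‖x - y‖ ≤ (1 + P) ^ 2 * D →
      ‖x⁻¹ - y⁻¹‖ ≤ E * D := by
    intro x y hx hy hxy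
    have hx0 : x ≠ 0 := norm_pos_iff.1 (hκ2.trans_le hx)
    have hy0 : y ≠ 0 := norm_pos_iff.1 (hκ.trans_le hy)
    have e : x⁻¹ - y⁻¹ = -(x - y) * (x⁻¹ * y⁻¹) := by field_simp; ring
    rw [e, norm_mul, norm_neg, norm_mul, norm_inv, norm_inv]
    calc _ ≤ (1 + P) ^ 2 * D * ((κ / 2)⁻¹ * κ⁻¹) := by gcongr
      _ = _ := by rw [hE]; field_simp
  have prodd : ∀ x y v : ℂ, κ / 2 ≤ ‖x‖ → κ / 2 ≤ ‖y‖ → κ ≤ ‖v‖ → ‖x - v‖ ≤ (1 + P) ^ 2 * D →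
      ‖y - v‖ ≤ (1 + P) ^ 2 * D → ‖x⁻¹ * y⁻¹ - v⁻¹ * v⁻¹‖ ≤ G * D ∧ ‖x⁻¹ * y⁻¹‖ ≤ H ∧
        ‖v⁻¹ * v⁻¹‖ ≤ H := by
    intro x y v hx hy hv hxv hyv
    have h1 := invd x v hx hv hxv
    have h2 := invd y v hy hv hyv
    refine ⟨?_, ?_, ?_⟩
    · have e : x⁻¹ * y⁻¹ - v⁻¹ * v⁻¹ = (x⁻¹ - v⁻¹) * y⁻¹ + v⁻¹ * (y⁻¹ - v⁻¹) := by ring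
      rw [e]
      refine (norm_add_le _ _).trans ?_
      rw [norm_mul, norm_mul, norm_inv y, norm_inv v]
      calc _ ≤ E * D * (κ / 2)⁻¹ + κ⁻¹ * (E * D) := by gcongr
        _ = _ := by rw [hG]; field_simp; ring
    · rw [norm_mul, norm_inv, norm_inv]
      calc _ ≤ (κ / 2)⁻¹ * (κ / 2)⁻¹ := by gcongr
        _ = _ := by rw [hH]; field_simp; ring
    · rw [norm_mul, norm_inv]
      calc _ ≤ (κ / 2)⁻¹ * (κ / 2)⁻¹ := by
            have : κ / 2 ≤ ‖v‖ := by linarith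
            gcongr
        _ = _ := by rw [hH]; field_simp; ring
  have hPD : D ≤ (1 + P) ^ 2 * D := by nlinarith [mul_nonneg hP0.le hD0]
  have hPD2 : (1 + P) * D ≤ (1 + P) ^ 2 * D := by nlinarith [mul_nonneg hP0.le hD0]
  obtain ⟨Y1, Y2, Y3⟩ := prodd m₁ m₂ m n1.m_ge n2.m_ge n.m_ge (hm1.trans hPD) (hm2.trans hPD)
  obtain ⟨Z1, Z2, Z3⟩ := prodd _ _ _ n1.a_ge n2.a_ge n.a_ge (a1.trans hPD2) (a2.trans hPD2)
  have hX := fun i => prodd _ _ _ (n1.b_ge i) (n2.b_ge i) (n.b_ge i) (b1 i) (b2 i)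
  have hq : ‖(q : ℂ)‖ ≤ T := by
    rw [Complex.norm_real, Real.norm_of_nonneg h.q0]; exact h.qhi
  have hs : ∀ i, ‖(σ i : ℂ)‖ ≤ T := by
    intro i
    rw [Complex.norm_real, Real.norm_of_nonneg (h.spos i).le]
    have := h.hi i; linarith
  set Y := m₁⁻¹ * m₂⁻¹
  set Y0 := m⁻¹ * m⁻¹
  set Z := (aa q m₁)⁻¹ * (aa q m₂)⁻¹
  set Z0 := (aa q m)⁻¹ * (aa q m)⁻¹
  have hqY : ‖(q : ℂ) * Y‖ ≤ T * H := by
    rw [norm_mul]; gcongr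
  have h1qY : ‖1 + (q : ℂ) * Y‖ ≤ 1 + T * H := by
    refine (norm_add_le _ _).trans ?_
    rw [norm_one]; gcongr
  have havg : ∀ x : Fin N → ℂ, ∀ t : ℝ, (∀ i, ‖x i‖ ≤ t) → ‖avg x‖ ≤ t := by
    intro x t ht
    refine (norm_avg_le _).trans ((avg_mono ht).trans ?_)
    rw [avg_const h.N_ne]
  refine ⟨n1, ?_, ?_, ?_⟩
  · rw [KK, KK, ← avg_sub]
    refine havg _ _ fun i => ?_
    obtain ⟨X1, X2, X3⟩ := hX i
    set X := (bb q (σ i) r₁ m₁)⁻¹ * (bb q (σ i) r₂ m₂)⁻¹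
    set X0 := (bb q (σ i) r m)⁻¹ * (bb q (σ i) r m)⁻¹
    have e : kterm q (σ i) r₁ m₁ r₂ m₂ - kterm q (σ i) r m r m =
        σ i * (X - X0) * (q * Y + σ i * Z * (1 + q * Y)) +
        σ i * X0 * (q * (Y - Y0) + σ i * (Z - Z0) * (1 + q * Y) + σ i * Z0 * (q * (Y - Y0))) := by
      simp only [kterm]; ring
    rw [e]
    have hsi := hs i
    have t1 : ‖(q : ℂ) * Y + σ i * Z * (1 + q * Y)‖ ≤ T * H + T * H * (1 + T * H) := by
      refine (norm_add_le _ _).trans (add_le_add hqY ?_)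
      rw [norm_mul, norm_mul]; gcongr
    have t2 : ‖(q : ℂ) * (Y - Y0)‖ ≤ T * (G * D) := by rw [norm_mul]; gcongr
    have t3 : ‖(q : ℂ) * (Y - Y0) + σ i * (Z - Z0) * (1 + q * Y) + σ i * Z0 * (q * (Y - Y0))‖ ≤
        T * (G * D) + T * (G * D) * (1 + T * H) + T * H * (T * (G * D)) := by
      refine (norm_add_le _ _).trans (add_le_add ((norm_add_le _ _).trans (add_le_add t2 ?_)) ?_)
      · rw [norm_mul, norm_mul]; gcongr
      · rw [norm_mul, norm_mul (σ i : ℂ)]; gcongr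
    calc _ ≤ T * (G * D) * (T * H + T * H * (1 + T * H)) +
          T * H * (T * (G * D) + T * (G * D) * (1 + T * H) + T * H * (T * (G * D))) := by
          refine (norm_add_le _ _).trans (add_le_add ?_ ?_)
          · rw [norm_mul, norm_mul]; gcongr
          · rw [norm_mul, norm_mul]; gcongr
      _ = (G * T ^ 2 * H * (4 + 3 * (T * H))) * D := by ring
      _ ≤ _ := by
        refine mul_le_mul_of_nonneg_right ?_ hD0
        have : 0 ≤ T * G + T * H := by positivity
        linarith
  · refine (havg _ (T * H) fun i => ?_).trans ?_
    · obtain ⟨X1, X2, X3⟩ := hX i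
      rw [norm_mul]; have := hs i; gcongr
    · have : 0 ≤ T * G + G * T ^ 2 * H * (4 + 3 * (T * H)) := by positivity
      linarith
  · rw [← avg_sub]
    refine havg _ _ fun i => ?_
    obtain ⟨X1, X2, X3⟩ := hX i
    rw [← mul_sub, norm_mul]
    calc _ ≤ T * (G * D) := by have := hs i; gcongr
      _ = T * G * D := by ring
      _ ≤ _ := by
        refine mul_le_mul_of_nonneg_right ?_ hD0
        have : 0 ≤ T * H + G * T ^ 2 * H * (4 + 3 * (T * H)) := by positivity
        linarith

/-- Local stability near a nonsingular, nondegenerate solution. -/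
lemma exists_local_stability (τ κ : ℝ) (hτ : 0 < τ) (hκ : 0 < κ) : ∃ c C : ℝ, 0 < c ∧ 0 < C ∧
    ∀ (N : ℕ) (σ : Fin N → ℝ) (q : ℝ), Par τ σ q → ∀ r m, Nice κ σ q r m → FF σ q r m = 0 →
      κ ≤ ‖1 - KK σ q r m r m‖ →
      ∀ r' m', ‖r' - r‖ ≤ c → ‖m' - m‖ ≤ c →
        ‖m' - m‖ ≤ C * (‖FF σ q r' m'‖ + ‖r' - r‖) := by
  obtain ⟨c, L, hc, hL, H⟩ := exists_kernel_lipschitz τ κ hτ hκ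
  refine ⟨min c (κ / (2 * L)), 2 / κ * (1 + (1 + L)), by positivity, by positivity, ?_⟩
  intro N σ q h r m n h0 hK r' m' hr hm
  obtain ⟨n', k1, k2, -⟩ := H N σ q h r m n _ (min_le_left _ _) r' m' r m hr hm
    (by rw [sub_self, norm_zero]; positivity) (by rw [sub_self, norm_zero]; positivity)
  have hκ2 : 0 < κ / 2 := by positivity
  have h1 := FF_sub (σ := σ) (q := q) (r := r') (r' := r) (n'.m_ne hκ2) (n.m_ne hκ) (n'.a_ne hκ2)
    (n.a_ne hκ) (n'.b_ne hκ2) (n.b_ne hκ)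
  rw [h0, sub_zero] at h1
  -- by Lipschitz continuity of the kernel the nondegeneracy persists nearby
  have k3 : κ / 2 ≤ ‖1 - KK σ q r' m' r m‖ := by
    have e : 1 - KK σ q r m r m = (1 - KK σ q r' m' r m) +
      (KK σ q r' m' r m - KK σ q r m r m) := by ring
    rw [e] at hK
    have h2 := hK.trans (norm_add_le _ _)
    have h3 : L * min c (κ / (2 * L)) ≤ κ / 2 := by
      calc _ ≤ L * (κ / (2 * L)) := by gcongr; exact min_le_right _ _
        _ = _ := by field_simp
    linarith
  set A := avg fun i => (σ i : ℂ) * ((bb q (σ i) r' m')⁻¹ * (bb q (σ i) r m)⁻¹)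
  have h2 : (m' - m) * (1 - KK σ q r' m' r m) = FF σ q r' m' + (r' - r) * (1 + A) := by
    rw [h1]; ring
  have h3 : ‖m' - m‖ * (κ / 2) ≤ ‖FF σ q r' m'‖ + ‖r' - r‖ * (1 + L) := by
    calc _ ≤ ‖m' - m‖ * ‖1 - KK σ q r' m' r m‖ := by gcongr
      _ = ‖FF σ q r' m' + (r' - r) * (1 + A)‖ := by rw [← norm_mul, h2]
      _ ≤ ‖FF σ q r' m'‖ + ‖r' - r‖ * ‖1 + A‖ := by
        refine (norm_add_le _ _).trans ?_
        rw [norm_mul]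
      _ ≤ _ := by
        gcongr
        refine (norm_add_le _ _).trans ?_
        rw [norm_one]; gcongr
  have h4 : ‖m' - m‖ ≤ (‖FF σ q r' m'‖ + ‖r' - r‖ * (1 + L)) * (2 / κ) := by
    have : 2 / κ = (κ / 2)⁻¹ := by field_simp
    rw [this, ← div_eq_mul_inv, le_div_iff₀ hκ2]; exact h3
  have p1 := norm_nonneg (FF σ q r' m')
  have p2 := norm_nonneg (r' - r)
  calc _ ≤ (‖FF σ q r' m'‖ + ‖r' - r‖ * (1 + L)) * (2 / κ) := h4
    _ ≤ ((1 + (1 + L)) * (‖FF σ q r' m'‖ + ‖r' - r‖)) * (2 / κ) := by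
      gcongr
      nlinarith [mul_nonneg hL.le p1]
    _ = _ := by ring

end perturb

/-! ### Continuation of the solution along connected sets -/

section continuation
variable {N : ℕ} {τ : ℝ} {σ : Fin N → ℝ} {z w w' : ℂ}

/-- A continuous function on a connected set which avoids the values in `(θ / 2, θ]` and is
`≤ θ` somewhere is `≤ θ / 2` everywhere. -/
lemma le_of_self_improving {X : Type*} [TopologicalSpace X] {U : Set X} (hU : IsPreconnected U)
    {f : X → ℝ} (hf : ContinuousOn f U) {θ : ℝ} (hθ : 0 < θ)
    (himp : ∀ x ∈ U, f x ≤ θ → f x ≤ θ / 2) {x₀ : X} (hx₀ : x₀ ∈ U) (h0 : f x₀ ≤ θ) :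
    ∀ x ∈ U, f x ≤ θ := by
  intro x hx
  by_contra! hc
  obtain ⟨y, hy, hyf⟩ := hU.intermediate_value hx₀ hx hf (show θ ∈ Set.Icc (f x₀) (f x) from
    ⟨h0, hc.le⟩)
  have := himp y hy hyf.le
  linarith

/-- Lipschitz continuity of the square root away from zero; both roots lie in the same quadrant,
so `|√w + r| ≥ |r|`. -/
lemma sqrt_sub_le {r : ℂ} (hw : 0 < w.im) (hr : 0 ≤ r.re) (hi : 0 ≤ r.im) (hr0 : r ≠ 0) :
    ‖Complex.sqrt w - r‖ ≤ ‖w - r * r‖ / ‖r‖ := by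
  have h1 := sqrt_re_pos hw
  have h2 := sqrt_im_pos hw
  have hr' := norm_pos_iff.2 hr0
  have h3 : ‖r‖ ≤ ‖Complex.sqrt w + r‖ := by
    refine abs_le_of_sq_le_sq' ?_ (norm_nonneg _) |>.2
    rw [← Complex.normSq_eq_norm_sq, ← Complex.normSq_eq_norm_sq, Complex.normSq_apply,
      Complex.normSq_apply, Complex.add_re, Complex.add_im]
    nlinarith [mul_nonneg h1.le hr, mul_nonneg h2.le hi]
  rw [le_div_iff₀ hr']
  have e : w - r * r = (Complex.sqrt w - r) * (Complex.sqrt w + r) := by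
    conv_lhs => rw [← sqrt_mul_self w]
    ring
  rw [e, norm_mul]; gcongr

/-- Continuation of the solution from a nonsingular, nondegenerate pair, possibly on the boundary,
along a connected subset of the upper half plane. -/
lemma exists_continuation (τ κ : ℝ) (hτ : 0 < τ) (hκ : 0 < κ) : ∃ c C : ℝ, 0 < c ∧ 0 < C ∧
    ∀ (N : ℕ) (σ : Fin N → ℝ) (z : ℂ), Par τ σ (‖z‖ ^ 2) → ∀ r m, Nice κ σ (‖z‖ ^ 2) r m →
      FF σ (‖z‖ ^ 2) r m = 0 → κ ≤ ‖1 - KK σ (‖z‖ ^ 2) r m r m‖ →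
      ∀ U : Set ℂ, IsPreconnected U → (∀ w ∈ U, 0 < w.im) →
      (∀ w ∈ U, ‖Complex.sqrt w - r‖ ≤ c) → (∃ w ∈ U, ‖mm σ z w - m‖ ≤ c) →
      ∀ w ∈ U, ‖mm σ z w - m‖ ≤ C * ‖Complex.sqrt w - r‖ := by
  obtain ⟨c, C, hc, hC, H⟩ := exists_local_stability τ κ hτ hκ
  refine ⟨min c (c / (2 * C)), C, by positivity, hC, ?_⟩
  intro N σ z h r m n h0 hK U hU hUi hUr ⟨w₀, hw₀, hw₀m⟩
  have key : ∀ w ∈ U, ‖mm σ z w - m‖ ≤ c → ‖mm σ z w - m‖ ≤ C * ‖Complex.sqrt w - r‖ := by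
    intro w hw hle
    have := H N σ _ h r m n h0 hK (Complex.sqrt w) (mm σ z w) ((hUr w hw).trans (min_le_left _ _))
      hle
    rwa [(sol_mm h (hUi w hw)).eq, norm_zero, zero_add] at this
  have hcont : ContinuousOn (fun w => ‖mm σ z w - m‖) U :=
    (((mm_differentiableOn h).continuousOn.mono hUi).sub continuousOn_const).norm
  have all := le_of_self_improving hU hcont hc (fun w hw hle => (key w hw hle).trans (by
    calc C * ‖Complex.sqrt w - r‖ ≤ C * (c / (2 * C)) := by
          gcongr; exact (hUr w hw).trans (min_le_right _ _)
      _ = c / 2 := by field_simp)) hw₀ (hw₀m.trans (min_le_left _ _))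
  exact fun w hw => key w hw (all w hw)

/-- Local stability of the equation at `w` from nonsingularity and nondegeneracy. -/
lemma exists_localStable_of_nice (τ κ R : ℝ) (hτ : 0 < τ) (hκ : 0 < κ) (hR : 0 < R) :
    ∃ θ C : ℝ, 0 < θ ∧ θ ≤ 1 / 2 ∧ 0 < C ∧ ∀ (N : ℕ) (σ : Fin N → ℝ) (z : ℂ),
      Par τ σ (‖z‖ ^ 2) → ∀ w : ℂ, 0 < w.im → ‖Complex.sqrt w‖ ≤ R →
      Nice κ σ (‖z‖ ^ 2) (Complex.sqrt w) (mm σ z w) →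
      κ ≤ ‖1 - KK σ (‖z‖ ^ 2) (Complex.sqrt w) (mm σ z w) (Complex.sqrt w) (mm σ z w)‖ →
      LocalStable σ z θ C w := by
  obtain ⟨c, C, hc, hC, H⟩ := exists_local_stability τ κ hτ hκ
  refine ⟨min (1 / 2) (c / (1 + R)), C, by positivity, min_le_left _ _, hC, ?_⟩
  intro N σ z h w hw hwR n hK u hu hle
  have hr := norm_pos_iff.2 (sqrt_ne hw)
  have h1 := norm_m1c_le h hw
  have h2 : ‖Complex.sqrt w * (1 + u) - mm σ z w‖ ≤ c := by
    rw [norm_sub_m1c]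
    calc _ ≤ ‖Complex.sqrt w‖ * (c / (1 + R) * (1 + ‖Complex.sqrt w‖⁻¹)) := by
          gcongr
          refine hle.trans ?_
          gcongr
          exact min_le_right _ _
      _ = c / (1 + R) * (‖Complex.sqrt w‖ + 1) := by field_simp
      _ ≤ c / (1 + R) * (R + 1) := by gcongr
      _ = c := by field_simp; ring
  have h3 := H N σ _ h _ _ n (sol_mm h hw).eq hK (Complex.sqrt w) _ (by simpa using hc.le) h2
  rw [sub_self, norm_zero, add_zero, norm_FF_eq h hw hu, norm_sub_m1c] at h3
  refine le_of_mul_le_mul_left (h3.trans (le_of_eq ?_)) hr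
  ring

end continuation

/-! ### Lower bounds for solutions -/

section bounds
variable {N : ℕ} {τ : ℝ} {σ : Fin N → ℝ} {q : ℝ} {r m u : ℂ}

lemma norm_aa_le (hq : 0 ≤ q) : ‖aa q m‖ ≤ ‖m‖ + q / ‖m‖ := by
  refine (norm_sub_le _ _).trans ?_
  rw [norm_div, Complex.norm_real, Real.norm_of_nonneg hq]

lemma tau_mul_A1_le (h : Par τ σ q) (ha : aa q m ≠ 0) :
    τ * A1 σ q r m ≤ ‖aa q m‖ ^ 2 * B1 σ q r m := by
  rw [A1, B1, ← avg_mul_left, ← avg_mul_left]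
  refine avg_mono fun i => ?_
  have h1 := norm_pos_iff.2 ha
  have := h.spos i
  have := h.lo i
  calc _ ≤ σ i * (σ i / ‖bb q (σ i) r m‖ ^ 2) := by gcongr
    _ = _ := by field_simp

lemma B1_le_A1 (h : Par τ σ q) (ha : aa q m ≠ 0) :
    ‖aa q m‖ ^ 2 * B1 σ q r m ≤ τ⁻¹ * A1 σ q r m := by
  rw [A1, B1, ← avg_mul_left, ← avg_mul_left]
  refine avg_mono fun i => ?_
  have h1 := norm_pos_iff.2 ha
  have := h.spos i
  have := h.hi i
  calc _ = σ i * (σ i / ‖bb q (σ i) r m‖ ^ 2) := by field_simp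
    _ ≤ _ := by gcongr

namespace Sol

/-- `|m - r|² ≤ 2 |m| / τ`: the solution can only be small together with `r`. -/
lemma norm_sub_sq_mul_le (S : Sol σ q r m) (h : Par τ σ q) : τ * ‖m - r‖ ^ 2 ≤ 2 * ‖m‖ := by
  have hτ := h.tau
  have hτ1 := h.tau_le_one
  have hm := S.norm_m_pos
  have hA0 := A1_nonneg (r := r) (m := m) h
  have hA1 := S.A1_lt_one h
  have hq := h.q0
  have h1 := tau_mul_A1_le (r := r) h (S.aa_ne h)
  have h2 := S.B1_mul_le h
  have h3 := S.A1_mul_le h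
  have h4 := norm_aa_le (m := m) hq
  have hB0 : 0 ≤ B1 σ q r m := B1_nonneg
  have key : τ * A1 σ q r m ^ 2 ≤ 4 * ‖m‖ ^ 2 := by
    rcases le_or_gt q (‖m‖ ^ 2) with hc | hc
    · have h5 : ‖aa q m‖ ≤ 2 * ‖m‖ := by
        refine h4.trans ?_
        have : q / ‖m‖ ≤ ‖m‖ := by rw [div_le_iff₀ hm]; nlinarith
        linarith
      have h6 : τ * A1 σ q r m ≤ (2 * ‖m‖) ^ 2 * 1 := by
        refine h1.trans ?_
        have := S.B1_le_one h
        gcongr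
      nlinarith [mul_nonneg hτ.le hA0]
    · have h5 : ‖aa q m‖ ≤ 2 * (q / ‖m‖) := by
        refine h4.trans ?_
        have : ‖m‖ ≤ q / ‖m‖ := by rw [le_div_iff₀ hm]; nlinarith
        linarith
      have h6 : B1 σ q r m * (q / ‖m‖ ^ 2) ≤ 1 := by linarith
      have h7 : τ * A1 σ q r m ≤ 4 * q := by
        calc _ ≤ (2 * (q / ‖m‖)) ^ 2 * B1 σ q r m := h1.trans (by gcongr)
          _ = 4 * q * (B1 σ q r m * (q / ‖m‖ ^ 2)) := by field_simp; ring
          _ ≤ 4 * q * 1 := by gcongr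
          _ = _ := by ring
      calc τ * A1 σ q r m ^ 2 = A1 σ q r m * (τ * A1 σ q r m) := by ring
        _ ≤ A1 σ q r m * (4 * q) := by gcongr
        _ = 4 * (A1 σ q r m * q) := by ring
        _ ≤ _ := by gcongr
  have h8 := S.norm_sub_sq_le h
  have h9 : (τ * A1 σ q r m) ^ 2 ≤ (2 * ‖m‖) ^ 2 := by nlinarith [sq_nonneg (A1 σ q r m)]
  have h10 := abs_le_of_sq_le_sq' h9 (by positivity) |>.2
  nlinarith

/-- A lower bound on `|m|` where `|r|` is bounded below. -/
lemma norm_ge (S : Sol σ q r m) (h : Par τ σ q) {c : ℝ} (hc : 0 ≤ c) (hc1 : c ≤ 1)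
    (hr : c ≤ ‖r‖) : τ * c ^ 2 / 8 ≤ ‖m‖ := by
  have hτ := h.tau
  have hτ1 := h.tau_le_one
  have h1 := S.norm_sub_sq_mul_le h
  have h2 : c ≤ ‖m‖ + ‖m - r‖ := by
    have : ‖r‖ ≤ ‖m‖ + ‖m - r‖ := by
      have := norm_sub_le m (m - r); simpa using this
    linarith
  by_contra! hcon
  have h3 : τ * c ^ 2 / 8 ≤ c / 8 := by
    have : τ * c ^ 2 ≤ 1 * c := by
      have : c ^ 2 ≤ c := by nlinarith
      gcongr
    linarith
  have h4 : c / 2 < ‖m - r‖ := by linarith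
  have h5 : (c / 2) ^ 2 < ‖m - r‖ ^ 2 := by gcongr
  nlinarith

/-- For large `r` the kernel is small. -/
lemma K1_le_half (S : Sol σ q r m) (h : Par τ σ q) (hr : 10 / τ ≤ ‖r‖) : K1 σ q r m ≤ 1 / 2 := by
  have hτ := h.tau
  have hτ1 := h.tau_le_one
  have hm := S.norm_m_pos
  have hA0 := A1_nonneg (r := r) (m := m) h
  have hA1 := S.A1_lt_one h
  have hq := h.q0
  have hqhi := h.qhi
  have t1 : 1 ≤ τ⁻¹ := (one_le_inv₀ hτ).2 hτ1
  rw [div_eq_mul_inv] at hr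
  set t := τ⁻¹ with ht
  have h1 : 9 * t ≤ ‖m‖ := by
    have h2 := S.norm_sub_lt_one h
    have : ‖r‖ ≤ ‖m‖ + ‖m - r‖ := by
      have := norm_sub_le m (m - r); simpa using this
    linarith
  have h2 : q / ‖m‖ ^ 2 ≤ 1 / 8 := by
    rw [div_le_div_iff₀ (by positivity) (by norm_num)]
    nlinarith
  have h3 : 8 * t ≤ ‖aa q m‖ := by
    have h4 := norm_sub_norm_le m ((q : ℂ) / m)
    rw [norm_div, Complex.norm_real, Real.norm_of_nonneg hq] at h4
    have : q / ‖m‖ ≤ 1 := by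
      rw [div_le_one hm]; linarith
    have : ‖m‖ - q / ‖m‖ ≤ ‖aa q m‖ := h4
    linarith
  have h4 := B1_le_A1 (r := r) h (S.aa_ne h)
  have hB0 : 0 ≤ B1 σ q r m := B1_nonneg
  have h5 : B1 σ q r m ≤ 1 / 8 := by
    have h6 : (8 * t) ^ 2 * B1 σ q r m ≤ t * 1 := by
      calc _ ≤ ‖aa q m‖ ^ 2 * B1 σ q r m := by gcongr
        _ ≤ t * A1 σ q r m := h4
        _ ≤ _ := by gcongr
    have h7 : 64 * t * B1 σ q r m ≤ (8 * t) ^ 2 * B1 σ q r m := by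
      gcongr; nlinarith
    nlinarith
  rw [K1_eq]
  have hq0 : 0 ≤ q / ‖m‖ ^ 2 := by positivity
  have h6 : A1 σ q r m * (q / ‖m‖ ^ 2) + B1 σ q r m * (1 + q / ‖m‖ ^ 2) ≤
      1 * (1 / 8) + 1 / 8 * (1 + 1 / 8) := by gcongr
  linarith

/-- If the kernel has a gap, then `Im m` is comparable with `Im r`. -/
lemma im_le_of_K1_le (S : Sol σ q r m) (h : Par τ σ q) {c : ℝ} (hK : K1 σ q r m ≤ 1 - c) :
    c * m.im ≤ 2 * r.im := by
  have h1 := S.im_eq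
  have h2 := S.A1_lt_one h
  have := S.m_im
  have := S.r_im
  nlinarith

lemma sub_le_abs_of_bound (S : Sol σ q r m) (h : Par τ σ q) {c : ℝ} (hc : m.im * c ≤ r.im) :
    c ≤ 1 - K1 σ q r m := by
  rw [S.one_sub_K1, le_div_iff₀ S.m_im]
  have := A1_nonneg (r := r) (m := m) h
  nlinarith [S.r_im]

end Sol

/-- Near the origin, for `|z| < 1`, the solution stays away from the real axis. -/
lemma exists_im_ge_near_zero (τ : ℝ) (hτ : 0 < τ) : ∃ r₀ c : ℝ, 0 < r₀ ∧ 0 < c ∧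
    ∀ (N : ℕ) (σ : Fin N → ℝ) (q : ℝ), Par τ σ q → q ≤ 1 - τ → ∀ r m, Sol σ q r m →
      0 < r.re → ‖r‖ ≤ r₀ → c ≤ m.im := by
  set β := τ ^ 3 / 16 with hβ
  have hβ0 : 0 < β := by positivity
  set k := τ / (1 + 1 / β) with hk
  have hk0 : 0 < k := by positivity
  set T := 1 + 1 / k + 1 / k ^ 2 with hT
  have hT0 : 0 < T := by positivity
  set q0 := τ / (4 * T) with hq0
  have hq00 : 0 < q0 := by positivity
  refine ⟨min (τ / 8) (β * q0 * k / 4), min (k / 2) (τ ^ 3 / 8 / (1 + 1 / β)), by positivity,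
    by positivity, ?_⟩
  intro N σ q h hq1 r m S hre hr
  have hr1 : ‖r‖ ≤ τ / 8 := hr.trans (min_le_left _ _)
  have hr2 : ‖r‖ ≤ β * q0 * k / 4 := hr.trans (min_le_right _ _)
  have hτ1 := h.tau_le_one
  have hm := S.norm_m_pos
  have hA0 := A1_nonneg (r := r) (m := m) h
  have hA1 := S.A1_lt_one h
  have hq := h.q0
  have hB0 : 0 ≤ B1 σ q r m := B1_nonneg
  have hre' := S.re_pos h hre
  have hm2 : ‖m‖ ≤ 2 := by have := S.norm_le h; linarith
  -- the second form of the equation bounds `B1` from below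
  have hBβ : β ≤ B1 σ q r m := by
    have h1 := S.sub_mul_ss h
    set G := avg fun i => (σ i : ℂ) ^ 2 * ((aa q m)⁻¹ * (bb q (σ i) r m)⁻¹) with hG
    have h2 : ‖(m - r) * ss q r m‖ ≤ ‖r‖ + (1 - τ / 2) := by
      have e1 : ‖m - r‖ ≤ 1 := (S.norm_sub_lt_one h).le
      have e2 : ‖m - r‖ * (q / ‖m‖) ≤ 1 - τ / 2 := by
        refine abs_le_of_sq_le_sq' ?_ (by linarith) |>.2
        calc (‖m - r‖ * (q / ‖m‖)) ^ 2 = ‖m - r‖ ^ 2 * q * q / ‖m‖ ^ 2 := by field_simp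
          _ ≤ A1 σ q r m * q * q / ‖m‖ ^ 2 := by gcongr; exact S.norm_sub_sq_le h
          _ ≤ ‖m‖ ^ 2 * q / ‖m‖ ^ 2 := by gcongr; exact S.A1_mul_le h
          _ = q := by field_simp
          _ ≤ _ := by nlinarith
      have e3 : ‖ss q r m‖ ≤ ‖r‖ + q / ‖m‖ := by
        refine (norm_sub_le _ _).trans ?_
        rw [norm_div, Complex.norm_real, Real.norm_of_nonneg hq]
      rw [norm_mul]
      calc _ ≤ ‖m - r‖ * (‖r‖ + q / ‖m‖) := by gcongr
        _ = ‖m - r‖ * ‖r‖ + ‖m - r‖ * (q / ‖m‖) := by ring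
        _ ≤ 1 * ‖r‖ + (1 - τ / 2) := by gcongr
        _ = _ := by ring
    have h3 : τ / 4 ≤ ‖G‖ := by
      have e : (1 : ℂ) = -((m - r) * ss q r m) - G := by rw [h1]; ring
      have := norm_sub_le (-((m - r) * ss q r m)) G
      rw [← e, norm_one, norm_neg] at this
      linarith
    have h4 : ‖G‖ ^ 2 ≤ τ⁻¹ * B1 σ q r m := by
      have e : G = avg fun i => (σ i : ℂ) * ((σ i : ℂ) * ((aa q m)⁻¹ * (bb q (σ i) r m)⁻¹)) := by
        rw [hG]; congr 1; ext i; ring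
      rw [e]
      refine (norm_avg_mul_sq_le _ _).trans ?_
      have e1 : (avg fun i => ‖(σ i : ℂ)‖ ^ 2) ≤ τ⁻¹ := by
        calc _ ≤ avg fun i => τ⁻¹ * σ i := by
              refine avg_mono fun i => ?_
              rw [Complex.norm_real, Real.norm_of_nonneg (h.spos i).le]
              have := h.hi i; have := h.spos i
              nlinarith
          _ = τ⁻¹ := by rw [avg_mul_left, h.mean, mul_one]
      have e2 : (avg fun i => ‖(σ i : ℂ) * ((aa q m)⁻¹ * (bb q (σ i) r m)⁻¹)‖ ^ 2) =
          B1 σ q r m := by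
        rw [B1]; congr 1; ext i
        rw [norm_mul, norm_mul, norm_inv, norm_inv, Complex.norm_real,
          Real.norm_of_nonneg (h.spos i).le]
        have := norm_pos_iff.2 (S.bb_ne h i)
        have := norm_pos_iff.2 (S.aa_ne h)
        field_simp
      rw [e2]
      gcongr
    have h5 : (τ / 4) ^ 2 ≤ τ⁻¹ * B1 σ q r m := (by gcongr : (τ / 4) ^ 2 ≤ ‖G‖ ^ 2).trans h4
    rw [inv_mul_eq_div, le_div_iff₀ hτ] at h5
    rw [hβ]; linarith
  -- since `B1 (1 + q / |m|²) ≤ 1`, a lower bound on `B1` bounds `q / |m|²`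
  have hqm : q / ‖m‖ ^ 2 ≤ 1 / β := by
    have h1 := S.B1_mul_le h
    rw [le_div_iff₀ hβ0]
    have : 0 ≤ q / ‖m‖ ^ 2 := by positivity
    nlinarith
  have hmk : k ≤ ‖m‖ := by
    have h1 := S.tau_le_norm_aa h
    have h2 := norm_aa_le (m := m) hq
    have h3 : ‖m‖ + q / ‖m‖ = ‖m‖ * (1 + q / ‖m‖ ^ 2) := by field_simp
    rw [hk, div_le_iff₀ (by positivity)]
    calc τ ≤ ‖m‖ * (1 + q / ‖m‖ ^ 2) := by linarith
      _ ≤ _ := by gcongr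
  rcases le_or_gt q q0 with hqq | hqq
  · -- for small `q`, the reduced equation forces `a` to be nearly imaginary
    refine (min_le_right _ _).trans ?_
    have ha := S.aa_ne h
    set x := aa q m * ss q r m with hx
    have hxn : ‖x‖ ≤ τ / 2 := by
      have e : x = r * m - (q + (q : ℂ) * (r / m) - (q : ℂ) * (q / m ^ 2)) := by
        have := S.m_ne
        rw [hx, aa, ss]; field_simp; ring
      have hqT : q * T ≤ τ / 4 := by
        calc q * T ≤ q0 * T := by gcongr
          _ = τ / 4 := by rw [hq0]; field_simp
      rw [e]
      refine (norm_sub_le _ _).trans ?_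
      have e1 : ‖r * m‖ ≤ τ / 8 * 2 := by rw [norm_mul]; gcongr
      have e2 : ‖(q : ℂ) + (q : ℂ) * (r / m) - (q : ℂ) * (q / m ^ 2)‖ ≤ q * T := by
        refine (norm_sub_le _ _).trans ((add_le_add_left (norm_add_le _ _) _).trans ?_)
        rw [norm_mul, norm_mul, norm_div, norm_div, norm_pow, Complex.norm_real,
          Real.norm_of_nonneg hq]
        have e3 : q * (‖r‖ / ‖m‖) ≤ q * (1 / k) := by gcongr; linarith
        have e4 : q * (q / ‖m‖ ^ 2) ≤ q * (1 / k ^ 2) := by gcongr; linarith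
        rw [hT]; linarith
      linarith
    set g := avg fun i => ((σ i : ℂ) - x)⁻¹ with hg
    have hga : aa q m ^ 2 * g = -1 := by
      have h1 := S.avg_inv_bb h
      have h2 : g = (-(aa q m)⁻¹) * avg fun i => (bb q (σ i) r m)⁻¹ := by
        rw [hg, ← avg_mul_left]
        congr 1; ext i
        have hb := S.bb_ne h i
        have : (σ i : ℂ) - x = -(aa q m * bb q (σ i) r m) := by
          rw [hx, bb_eq]; field_simp; ring
        rw [this, ← neg_inv, mul_inv]; ring
      rw [h2, h1]; field_simp
    have hterm : ∀ i, τ / 2 ≤ ((σ i : ℂ) - x).re ∧ ‖(σ i : ℂ) - x‖ ≤ 2 / τ := by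
      intro i
      have h1 := (Complex.re_le_norm x).trans hxn
      have h2 := h.lo i
      have h3 := h.hi i
      constructor
      · rw [Complex.sub_re, Complex.ofReal_re]; linarith
      · refine (norm_sub_le _ _).trans ?_
        rw [Complex.norm_real, Real.norm_of_nonneg (h.spos i).le]
        have : 1 ≤ τ⁻¹ := (one_le_inv₀ hτ).2 hτ1
        rw [div_eq_mul_inv]; linarith
    have hgre : τ ^ 3 / 8 ≤ g.re := by
      rw [hg, avg_re, ← avg_const (K := ℝ) h.N_ne (τ ^ 3 / 8)]
      refine avg_mono fun i => ?_
      obtain ⟨h1, h2⟩ := hterm i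
      have h3 : 0 < ‖(σ i : ℂ) - x‖ := by
        have := Complex.re_le_norm ((σ i : ℂ) - x); linarith
      rw [inv_re_eq]
      calc τ ^ 3 / 8 = (τ / 2) / (2 / τ) ^ 2 := by field_simp; norm_num
        _ ≤ _ := by gcongr; linarith
    have hgn : ‖g‖ ≤ 2 / τ := by
      refine (norm_avg_le _).trans ?_
      rw [← avg_const (K := ℝ) h.N_ne (2 / τ)]
      refine avg_mono fun i => ?_
      obtain ⟨h1, h2⟩ := hterm i
      rw [norm_inv, inv_le_comm₀ (by have := Complex.re_le_norm ((σ i : ℂ) - x); linarith)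
        (by positivity), inv_div]
      exact h1.trans (Complex.re_le_norm _)
    have hg0 : 0 < ‖g‖ := by
      have := Complex.re_le_norm g
      have : 0 < τ ^ 3 / 8 := by positivity
      linarith
    have h1 : aa q m ^ 2 = -g⁻¹ := by
      have : g ≠ 0 := norm_pos_iff.1 hg0
      field_simp; exact hga
    have h2 : (aa q m ^ 2).re ≤ -(τ ^ 5 / 32) := by
      rw [h1, Complex.neg_re, inv_re_eq]
      have : τ ^ 5 / 32 = (τ ^ 3 / 8) / (2 / τ) ^ 2 := by field_simp; norm_num
      rw [this, neg_le_neg_iff]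
      have : 0 < τ ^ 3 / 8 := by positivity
      gcongr
      linarith
    have h3 : (τ ^ 3 / 8) ^ 2 ≤ (aa q m).im ^ 2 := by
      have e : (aa q m ^ 2).re = (aa q m).re ^ 2 - (aa q m).im ^ 2 := by
        rw [sq, Complex.mul_re]; ring
      have e2 : τ ^ 6 ≤ τ ^ 5 := pow_le_pow_of_le_one hτ.le hτ1 (by norm_num)
      have e3 : (τ ^ 3 / 8) ^ 2 = τ ^ 6 / 64 := by ring
      have e4 : 0 < τ ^ 5 := by positivity
      nlinarith [sq_nonneg (aa q m).re]
    have h4 := abs_le_of_sq_le_sq' h3 (aa_im_pos hq S.m_im).le |>.2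
    rw [aa_im] at h4
    rw [div_le_iff₀ (by positivity)]
    refine h4.trans ?_
    have := S.m_im
    gcongr
  · refine (min_le_left _ _).trans ?_
    -- for `q` bounded below, the real part of the equation forces `Re m` to be small
    have h1 := S.re_eq
    have h2 := S.K1_lt_one h
    have h3 : m.re * (2 * β * (q0 / 2 ^ 2)) ≤ ‖r‖ := by
      calc _ ≤ m.re * (1 - K1 σ q r m + 2 * B1 σ q r m * (q / ‖m‖ ^ 2)) := by
            refine mul_le_mul_of_nonneg_left ?_ hre'.le
            have : 2 * β * (q0 / 2 ^ 2) ≤ 2 * B1 σ q r m * (q / ‖m‖ ^ 2) := by gcongr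
            linarith
        _ = r.re * (1 - A1 σ q r m) := h1
        _ ≤ r.re * 1 := by gcongr; linarith
        _ ≤ ‖r‖ := by rw [mul_one]; exact Complex.re_le_norm r
    have h4 : m.re ≤ k / 2 := by
      have h5 : m.re * (β * q0 / 2) ≤ k / 2 * (β * q0 / 2) := by linarith
      exact le_of_mul_le_mul_right h5 (by positivity)
    have h5 := Complex.norm_le_abs_re_add_abs_im m
    rw [abs_of_pos hre', abs_of_pos S.m_im] at h5
    linarith

/-- Near the origin, for `|z| > 1`, the kernel has a gap at all small points. -/
lemma exists_K1_le_near_zero (τ : ℝ) (hτ : 0 < τ) : ∃ t₀ : ℝ, 0 < t₀ ∧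
    ∀ (N : ℕ) (σ : Fin N → ℝ) (q : ℝ), Par τ σ q → 1 + τ ≤ q → ∀ r u : ℂ,
      u ≠ 0 → ‖u‖ ≤ t₀ → ‖r‖ ≤ t₀ → K1 σ q r u ≤ 1 - τ / 8 := by
  refine ⟨τ ^ 2 / 32, by positivity, ?_⟩
  intro N σ q h hq r u hu hut hrt
  have hτ1 := h.tau_le_one
  have hq0 := h.q0
  set t := ‖u‖ with ht
  have ht0 : 0 < t := norm_pos_iff.2 hu
  have hτ2 : τ ^ 2 ≤ τ := by nlinarith
  have ht1 : t ≤ τ / 32 := by linarith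
  have htt : t ^ 2 ≤ τ ^ 3 / 32 := by
    calc t ^ 2 = t * t := by ring
      _ ≤ τ ^ 2 / 32 * (τ / 32) := by gcongr
      _ ≤ _ := by nlinarith [pow_pos hτ 3]
  have htt' : t ^ 2 / τ ≤ τ ^ 2 / 32 := by
    rw [div_le_iff₀ hτ]; linarith
  have hτ3 : τ ^ 3 ≤ τ := by nlinarith [mul_pos hτ hτ]
  have ha1 : 1 ≤ ‖aa q u‖ * t := by
    have h1 := norm_sub_norm_le ((q : ℂ) / u) u
    rw [norm_sub_rev, norm_div, Complex.norm_real, Real.norm_of_nonneg hq0] at h1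
    change q / t - t ≤ ‖aa q u‖ at h1
    have h2 : (q / t - t) * t ≤ ‖aa q u‖ * t := by gcongr
    have h3 : (q / t - t) * t = q - t ^ 2 := by field_simp
    linarith
  have ha0 : 0 < ‖aa q u‖ := by
    by_contra! hc
    have : ‖aa q u‖ * t ≤ 0 := mul_nonpos_of_nonpos_of_nonneg hc ht0.le
    linarith
  have hb1 : ∀ i, q - τ / 8 ≤ ‖bb q (σ i) r u‖ * t := by
    intro i
    have h1 : ‖(q : ℂ) / u‖ ≤ ‖bb q (σ i) r u‖ + ‖r‖ + ‖(σ i : ℂ) / aa q u‖ := by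
      have e : (q : ℂ) / u = -bb q (σ i) r u + r - (σ i : ℂ) / aa q u := by rw [bb]; ring
      rw [e]
      refine (norm_sub_le _ _).trans (add_le_add_left ((norm_add_le _ _).trans ?_) _)
      rw [norm_neg]
    rw [norm_div, norm_div, Complex.norm_real, Complex.norm_real, Real.norm_of_nonneg hq0,
      Real.norm_of_nonneg (h.spos i).le, ← ht] at h1
    have h2 : σ i / ‖aa q u‖ ≤ τ⁻¹ * t := by
      rw [div_le_iff₀ ha0]
      calc σ i ≤ τ⁻¹ := h.hi i
        _ ≤ τ⁻¹ * (‖aa q u‖ * t) := le_mul_of_one_le_right (by positivity) ha1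
        _ = _ := by ring
    have h3 : q / t * t ≤ (‖bb q (σ i) r u‖ + τ ^ 2 / 32 + τ⁻¹ * t) * t := by
      gcongr; linarith
    rw [div_mul_cancel₀ _ ht0.ne'] at h3
    have h4 : τ⁻¹ * t * t = t ^ 2 / τ := by field_simp
    have h5 : τ ^ 2 / 32 * t ≤ τ / 32 * 1 := by gcongr; linarith
    nlinarith
  have hp : 1 + 7 * τ / 8 ≤ q - τ / 8 := by linarith
  have hp0 : 0 < q - τ / 8 := by linarith
  have hnum : t ^ 2 / τ * (t ^ 2 + q) ≤ τ / 8 := by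
    have h1 : t ^ 2 + q ≤ 3 / τ := by
      have h2 := h.qhi
      have : 1 ≤ τ⁻¹ := (one_le_inv₀ hτ).2 hτ1
      rw [div_eq_mul_inv]; linarith
    calc _ ≤ τ ^ 2 / 32 * (3 / τ) := by gcongr
      _ = 3 * τ / 32 := by field_simp
      _ ≤ _ := by linarith
  -- near zero `a` and `b` are close to `-q / u`, so the summand of `K1` is close to `σ / q`, and
  -- `q ≥ 1 + τ`
  have key : ∀ i, kpos q (σ i) r u ≤ (1 - τ / 8) * σ i := by
    intro i
    have hs := h.spos i
    set b := ‖bb q (σ i) r u‖ with hb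
    set a := ‖aa q u‖ with ha
    have hb0 : 0 < b := by
      have h1 := hb1 i
      by_contra! hc
      have : b * t ≤ 0 := mul_nonpos_of_nonpos_of_nonneg hc ht0.le
      linarith
    have e : kpos q (σ i) r u =
        σ i * ((q + σ i * t ^ 2 * (t ^ 2 + q) / (a * t) ^ 2) / (b * t) ^ 2) := by
      rw [kpos, ← hb, ← ha, ← ht]; field_simp
    rw [e, mul_comm]
    gcongr
    rw [div_le_iff₀ (by positivity)]
    have h1 : σ i * t ^ 2 * (t ^ 2 + q) / (a * t) ^ 2 ≤ τ / 8 := by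
      calc _ ≤ τ⁻¹ * t ^ 2 * (t ^ 2 + q) / 1 ^ 2 := by gcongr; exact h.hi i
        _ = t ^ 2 / τ * (t ^ 2 + q) := by field_simp
        _ ≤ _ := hnum
    have h2 : (q - τ / 8) ^ 2 ≤ (b * t) ^ 2 := by gcongr; exact hb1 i
    set p := q - τ / 8 with hp'
    have h3 : q + τ / 8 ≤ (1 - τ / 8) * p ^ 2 := by
      have e1 : 1 + τ / 2 ≤ (1 - τ / 8) * p := by nlinarith
      have e2 : (1 + τ / 2) * p ≤ (1 - τ / 8) * p * p := by gcongr
      nlinarith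
    have h4 : (1 - τ / 8) * p ^ 2 ≤ (1 - τ / 8) * (b * t) ^ 2 := by
      have : 0 ≤ 1 - τ / 8 := by linarith
      gcongr
    linarith
  refine (avg_mono key).trans ?_
  rw [avg_mul_left, h.mean, mul_one]

/-- For `|z| > 1` the solution is at most of the order of `r`. -/
lemma norm_le_mul_of_one_lt (S : Sol σ q r m) (h : Par τ σ q) (hq : 1 + τ ≤ q) :
    τ * ‖m‖ ≤ 4 * ‖r‖ := by
  have hτ := h.tau
  have hτ1 := h.tau_le_one
  have hm := S.norm_m_pos
  have h1 := S.norm_sub_sq_le h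
  have h2 := S.A1_mul_le h
  have hA0 := A1_nonneg (r := r) (m := m) h
  have h3 : ‖m - r‖ ≤ (1 - τ / 4) * ‖m‖ := by
    refine abs_le_of_sq_le_sq' ?_ (mul_nonneg (by linarith) hm.le) |>.2
    have h4 : A1 σ q r m * (1 + τ) ≤ ‖m‖ ^ 2 := (mul_le_mul_of_nonneg_left hq hA0).trans h2
    have h5 : 1 ≤ (1 - τ / 4) ^ 2 * (1 + τ) := by
      have e1 : (1 - τ / 4) ^ 2 * (1 + τ) = 1 + τ * (1 / 2 - 7 / 16 * τ + τ ^ 2 / 16) := by ring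
      have e2 : 0 ≤ τ * (1 / 2 - 7 / 16 * τ + τ ^ 2 / 16) :=
        mul_nonneg hτ.le (by nlinarith)
      linarith
    have h6 : ‖m - r‖ ^ 2 * (1 + τ) ≤ ((1 - τ / 4) * ‖m‖) ^ 2 * (1 + τ) := by
      calc _ ≤ A1 σ q r m * (1 + τ) := by gcongr
        _ ≤ 1 * ‖m‖ ^ 2 := by linarith
        _ ≤ ((1 - τ / 4) ^ 2 * (1 + τ)) * ‖m‖ ^ 2 := by gcongr
        _ = _ := by ring
    exact le_of_mul_le_mul_right h6 (by linarith)
  have h4 : ‖m‖ ≤ ‖m - r‖ + ‖r‖ := by simpa using norm_add_le (m - r) r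
  linarith

end bounds

/-! ### Nondegeneracy from a lower bound on `Im m` -/

section phase
variable {N : ℕ} {τ : ℝ} {σ : Fin N → ℝ} {q : ℝ} {r m : ℂ}

/-- The real part of a square falls short of the modulus by twice the square of the imaginary
part. -/
lemma sq_re_eq (v : ℂ) : (v ^ 2).re = ‖v‖ ^ 2 - 2 * v.im ^ 2 := by
  rw [← Complex.normSq_eq_norm_sq, Complex.normSq_apply, sq, Complex.mul_re]; ring

/-- Each summand of the kernel is a positive combination of squares, so the loss of phase bounds
`Re KK` away from `K1`. -/
lemma KK_re_le (h : Par τ σ q) {κ : ℝ}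
    (hκ : ∀ i, κ ≤ ((σ i : ℂ) * ((aa q m)⁻¹ * (bb q (σ i) r m)⁻¹)).im ^ 2 +
      q * ((σ i : ℂ) * ((aa q m)⁻¹ * (bb q (σ i) r m)⁻¹) * m⁻¹).im ^ 2) :
    (KK σ q r m r m).re ≤ K1 σ q r m - 2 * κ := by
  rw [KK, avg_re, K1, ← avg_const (K := ℝ) h.N_ne (2 * κ), ← avg_sub]
  refine avg_mono fun i => ?_
  have hi := hκ i
  set b := (bb q (σ i) r m)⁻¹ with hb
  set a := (aa q m)⁻¹ with ha
  set μ := m⁻¹ with hμ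
  have e1 : kterm q (σ i) r m r m = ((σ i * q : ℝ) : ℂ) * (b * μ) ^ 2 + (σ i * (a * b)) ^ 2 +
      (q : ℂ) * (σ i * (a * b) * μ) ^ 2 := by
    rw [kterm]; push_cast; ring
  have e2 : kpos q (σ i) r m = σ i * q * ‖b * μ‖ ^ 2 + ‖(σ i : ℂ) * (a * b)‖ ^ 2 +
      q * ‖(σ i : ℂ) * (a * b) * μ‖ ^ 2 := by
    simp only [norm_mul, hb, ha, hμ, norm_inv, Complex.norm_real, Real.norm_of_nonneg (h.spos i).le,
      kpos, div_eq_mul_inv]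
    ring
  rw [e1, e2, Complex.add_re, Complex.add_re, Complex.re_ofReal_mul, Complex.re_ofReal_mul,
    sq_re_eq, sq_re_eq, sq_re_eq]
  have : 0 ≤ σ i * q * (b * μ).im ^ 2 := by have := h.spos i; have := h.q0; positivity
  linarith

/-- Two numbers whose phases differ by the phase of `m` cannot both be nearly real. -/
lemma norm_sq_le_im_sq {y m : ℂ} {c M : ℝ} (hc : 0 < c) (hm : c ≤ m.im) (hM : ‖m‖ ≤ M) :
    ‖y‖ ^ 2 ≤ (2 * (M ^ 2 + M ^ 4) / c ^ 2 + 1) * (y.im ^ 2 + (y * m⁻¹).im ^ 2) := by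
  have hm0 : m ≠ 0 := ne_zero_of_im_pos (hc.trans_le hm)
  have hM0 : 0 ≤ M := (norm_nonneg m).trans hM
  set s := (y * m⁻¹).im with hs
  have h2 : m.im * y.re = y.im * m.re - ‖m‖ ^ 2 * s := by
    have e : y = (y * m⁻¹) * m := by field_simp
    have e1 : y.im = (y * m⁻¹).re * m.im + s * m.re := by
      conv_lhs => rw [e, Complex.mul_im]
    have e2 : y.re = (y * m⁻¹).re * m.re - s * m.im := by
      conv_lhs => rw [e, Complex.mul_re]
    rw [e1, e2, ← Complex.normSq_eq_norm_sq, Complex.normSq_apply]; ring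
  have h3 : c ^ 2 * y.re ^ 2 ≤ 2 * (M ^ 2 + M ^ 4) * (y.im ^ 2 + s ^ 2) := by
    have e1 : (y.im * m.re) ^ 2 ≤ M ^ 2 * y.im ^ 2 := by
      have : m.re ^ 2 ≤ M ^ 2 := by
        have := Complex.abs_re_le_norm m
        rw [← sq_abs]; gcongr; linarith
      rw [mul_pow, mul_comm]; gcongr
    have e2 : (‖m‖ ^ 2 * s) ^ 2 ≤ M ^ 4 * s ^ 2 := by
      rw [mul_pow, ← pow_mul]; gcongr
    have e3 : c ^ 2 * y.re ^ 2 ≤ (m.im * y.re) ^ 2 := by rw [mul_pow]; gcongr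
    rw [h2] at e3
    have e4 : 0 ≤ M ^ 2 * s ^ 2 + M ^ 4 * y.im ^ 2 := by positivity
    have e5 := sq_nonneg (y.im * m.re + ‖m‖ ^ 2 * s)
    linarith [e1, e2, e3, e4, e5]
  have e1 : y.re ^ 2 ≤ 2 * (M ^ 2 + M ^ 4) / c ^ 2 * (y.im ^ 2 + s ^ 2) := by
    rw [div_mul_eq_mul_div, le_div_iff₀ (by positivity)]; linarith
  rw [← Complex.normSq_eq_norm_sq, Complex.normSq_apply]
  have := sq_nonneg s
  linarith

/-- A lower bound on `Im m` makes the solution nonsingular, and nondegenerate unless both `r` and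
`q` are small. -/
lemma exists_nice_of_im (τ c R : ℝ) (hτ : 0 < τ) (hc : 0 < c) (hR : 0 < R) : ∃ κ : ℝ, 0 < κ ∧
    ∀ (N : ℕ) (σ : Fin N → ℝ) (q : ℝ), Par τ σ q → ∀ r m, Sol σ q r m → 0 < r.re → c ≤ m.im →
      ‖r‖ ≤ R → (c ≤ r.re ∨ c ≤ r.im ∨ c ≤ q) →
      Nice κ σ q r m ∧ κ ≤ ‖1 - KK σ q r m r m‖ := by
  set M := 1 + R with hM
  set T := 1 + τ⁻¹ with hT
  set A := M + T / c with hA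
  set B := R + T / c + T / c with hB
  set c1 := c ^ 2 / (2 * (R / c + T / c ^ 2)) with hc1
  set y0 := τ / (A * B) with hy0
  set P := 2 * (M ^ 2 + M ^ 4) / c ^ 2 + 1 with hP
  set κ1 := min 1 (min c c1) * (y0 ^ 2 / P) with hκ1
  set κ2 := (τ * (c ^ 2 / 2) / (A * B) ^ 2) ^ 2 with hκ2
  have hM0 : 0 < M := by positivity
  have hT0 : 0 < T := by positivity
  have hA0 : 0 < A := by positivity
  have hB0 : 0 < B := by positivity
  have hc10 : 0 < c1 := by positivity
  have hP0 : 0 < P := by positivity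
  have hκ10 : 0 < κ1 := by positivity
  have hκ20 : 0 < κ2 := by positivity
  refine ⟨min (min c (τ * c / A ^ 2)) (min (c / M) (min κ1 κ2)), by positivity, ?_⟩
  intro N σ q h r m S hre hm hr hcases
  have hτ1 := h.tau_le_one
  have hq := h.q0
  have hqT : q ≤ T := h.qhi
  have hsT : ∀ i, σ i ≤ T := fun i => by have := h.hi i; rw [hT]; linarith
  have hm0 := S.m_im
  have hmn : c ≤ ‖m‖ := hm.trans ((le_abs_self _).trans (Complex.abs_im_le_norm m))
  have hmM : ‖m‖ ≤ M := (S.norm_le h).trans (by linarith)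
  have haim := le_aa_im hq hm0
  have han : c ≤ ‖aa q m‖ :=
    (hm.trans haim).trans ((le_abs_self _).trans (Complex.abs_im_le_norm _))
  have haA : ‖aa q m‖ ≤ A := by
    refine (norm_aa_le hq).trans ?_
    rw [hA]; gcongr
  have han0 : 0 < ‖aa q m‖ := hc.trans_le han
  have hbB : ∀ i, ‖bb q (σ i) r m‖ ≤ B := by
    intro i
    refine (norm_sub_le _ _).trans ?_
    rw [hB]
    refine add_le_add ((norm_sub_le _ _).trans (add_le_add hr ?_)) ?_
    · rw [norm_div, Complex.norm_real, Real.norm_of_nonneg hq]; gcongr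
    · rw [norm_div, Complex.norm_real, Real.norm_of_nonneg (h.spos i).le]
      have := hsT i; gcongr
  have hbn : ∀ i, τ * c / A ^ 2 ≤ ‖bb q (σ i) r m‖ := by
    intro i
    refine le_trans ?_ ((le_abs_self _).trans (Complex.abs_im_le_norm _))
    rw [bb_im]
    have hs := h.spos i
    have h1 : τ / A ^ 2 ≤ σ i / ‖aa q m‖ ^ 2 := by have := h.lo i; gcongr
    have h2 : σ i / ‖aa q m‖ ^ 2 ≤ σ i / ‖aa q m‖ ^ 2 * (1 + q / ‖m‖ ^ 2) :=
      le_mul_of_one_le_right (by positivity) (le_add_of_nonneg_right (by positivity))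
    have h3 : 0 ≤ q / ‖m‖ ^ 2 := by positivity
    have h4 := S.r_im
    calc τ * c / A ^ 2 = c * (τ / A ^ 2) := by ring
      _ ≤ m.im * (q / ‖m‖ ^ 2 + σ i / ‖aa q m‖ ^ 2 * (1 + q / ‖m‖ ^ 2)) := by
          gcongr; linarith
      _ ≤ _ := by linarith
  refine ⟨⟨(min_le_left _ _).trans ((min_le_left _ _).trans hmn),
    (min_le_left _ _).trans ((min_le_left _ _).trans han),
    fun i => (min_le_left _ _).trans ((min_le_right _ _).trans (hbn i))⟩,
    (min_le_right _ _).trans ?_⟩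
  have hK1 := S.K1_lt_one h
  have hfin : ∀ κ : ℝ, (KK σ q r m r m).re ≤ 1 - κ → κ ≤ ‖1 - KK σ q r m r m‖ := by
    intro κ hle
    have := Complex.re_le_norm (1 - KK σ q r m r m)
    rw [Complex.sub_re, Complex.one_re] at this
    linarith
  have hyn : ∀ i, y0 ≤ ‖(σ i : ℂ) * ((aa q m)⁻¹ * (bb q (σ i) r m)⁻¹)‖ := by
    intro i
    have hb := norm_pos_iff.2 (S.bb_ne h i)
    rw [norm_mul, norm_mul, norm_inv, norm_inv, Complex.norm_real,
      Real.norm_of_nonneg (h.spos i).le, ← mul_inv, ← div_eq_mul_inv, hy0]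
    have := h.spos i; have := h.lo i; have := hbB i
    gcongr
  -- the case `q ≥ c'`: two squares with phases differing by the phase of `m²`
  have big_q : min c c1 ≤ q → min (c / M) (min κ1 κ2) ≤ ‖1 - KK σ q r m r m‖ := by
    intro hcq
    refine (min_le_right _ _).trans ((min_le_left _ _).trans (hfin _ ?_))
    have := KK_re_le (r := r) (m := m) (κ := κ1) h fun i => by
      set y := (σ i : ℂ) * ((aa q m)⁻¹ * (bb q (σ i) r m)⁻¹) with hy
      have h1 : y0 ^ 2 ≤ ‖y‖ ^ 2 := by have := hyn i; gcongr
      have h4 : y0 ^ 2 ≤ P * (y.im ^ 2 + (y * m⁻¹).im ^ 2) :=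
        h1.trans (norm_sq_le_im_sq hc hm hmM)
      set s := (y * m⁻¹).im with hs
      rw [← div_le_iff₀' hP0] at h4
      calc κ1 ≤ min 1 (min c c1) * (y.im ^ 2 + s ^ 2) := by rw [hκ1]; gcongr
        _ = min 1 (min c c1) * y.im ^ 2 + min 1 (min c c1) * s ^ 2 := by ring
        _ ≤ 1 * y.im ^ 2 + q * s ^ 2 := by
          have e1 : min 1 (min c c1) ≤ 1 := min_le_left _ _
          have e2 : min 1 (min c c1) ≤ q := (min_le_right _ _).trans hcq
          gcongr
        _ = _ := by rw [one_mul]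
    linarith
  rcases hcases with hc2 | hc2 | hc2
  · rcases le_or_gt c1 q with hq1 | hq1
    · exact big_q ((min_le_right _ _).trans hq1)
    -- the case `Re r ≥ c` with small `q`: then `a b` has a large imaginary part
    · refine (min_le_right _ _).trans ((min_le_right _ _).trans (hfin _ ?_))
      have hx : c ^ 2 / 2 ≤ (aa q m * ss q r m).im := by
        have e : aa q m * ss q r m = r * m - (q + (q : ℂ) * (r / m) - (q : ℂ) * (q / m ^ 2)) := by
          have := S.m_ne
          rw [aa, ss]; field_simp; ring
        have e1 : c * c ≤ (r * m).im := by
          rw [Complex.mul_im]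
          have : 0 ≤ r.im * m.re := (mul_pos S.r_im (S.re_pos h hre)).le
          have : c * c ≤ r.re * m.im := by gcongr
          linarith
        have e2 : ((q : ℂ) + (q : ℂ) * (r / m) - (q : ℂ) * (q / m ^ 2)).im ≤ c ^ 2 / 2 := by
          rw [Complex.sub_im, Complex.add_im, Complex.ofReal_im, Complex.im_ofReal_mul,
            Complex.im_ofReal_mul, zero_add, ← mul_sub]
          have f1 : (r / m).im ≤ R / c := by
            refine ((le_abs_self _).trans (Complex.abs_im_le_norm _)).trans ?_
            rw [norm_div]; gcongr
          have f2 : -((q : ℂ) / m ^ 2).im ≤ T / c ^ 2 := by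
            refine ((neg_le_abs _).trans (Complex.abs_im_le_norm _)).trans ?_
            rw [norm_div, norm_pow, Complex.norm_real, Real.norm_of_nonneg hq]; gcongr
          calc _ ≤ q * (R / c + T / c ^ 2) := by
                refine mul_le_mul_of_nonneg_left ?_ hq; linarith
            _ ≤ c1 * (R / c + T / c ^ 2) := by gcongr
            _ = _ := by rw [hc1]; field_simp
        rw [e, Complex.sub_im]; nlinarith
      have := KK_re_le (r := r) (m := m) (κ := κ2) h fun i => by
        have hb := norm_pos_iff.2 (S.bb_ne h i)
        have hab : aa q m * bb q (σ i) r m = aa q m * ss q r m - σ i := by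
          have := S.aa_ne h
          rw [bb_eq]; field_simp
        have h1 : ((σ i : ℂ) * ((aa q m)⁻¹ * (bb q (σ i) r m)⁻¹)).im =
            -(σ i * (aa q m * ss q r m).im / ‖aa q m * bb q (σ i) r m‖ ^ 2) := by
          rw [← mul_inv, Complex.im_ofReal_mul, inv_im_eq, hab, Complex.sub_im,
            Complex.ofReal_im, sub_zero]; ring
        have h2 : τ * (c ^ 2 / 2) / (A * B) ^ 2 ≤
            σ i * (aa q m * ss q r m).im / ‖aa q m * bb q (σ i) r m‖ ^ 2 := by
          have := h.lo i; have := h.spos i; have := hbB i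
          have h3 : 0 < (aa q m * ss q r m).im := lt_of_lt_of_le (by positivity) hx
          rw [norm_mul]
          gcongr
        have h3 : κ2 ≤ ((σ i : ℂ) * ((aa q m)⁻¹ * (bb q (σ i) r m)⁻¹)).im ^ 2 := by
          rw [h1, neg_sq, hκ2]; gcongr
        refine h3.trans (le_add_of_nonneg_right (by positivity))
      linarith
  · refine (min_le_left _ _).trans (hfin _ ?_)
    have h1 := S.K1_le h
    have h2 : c / M ≤ r.im / m.im := by
      have := (le_abs_self _).trans (Complex.abs_im_le_norm m)
      have := S.r_im
      gcongr; linarith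
    have h3 := KK_re_le (r := r) (m := m) (κ := 0) h fun i => by positivity
    linarith
  · exact big_q ((min_le_left _ _).trans hc2)

end phase

/-! ### Boundary values and the support -/

section boundary
variable {N : ℕ} {τ : ℝ} {σ : Fin N → ℝ} {z w : ℂ} {x : ℝ}

/-- Lipschitz continuity of the solution near a point with `Im m` bounded below, uniformly up to
the real axis. -/
lemma exists_continuation_of_im (τ c R : ℝ) (hτ : 0 < τ) (hc : 0 < c) (hR : 0 < R) :
    ∃ δ C : ℝ, 0 < δ ∧ 0 < C ∧ ∀ (N : ℕ) (σ : Fin N → ℝ) (z : ℂ), Par τ σ (‖z‖ ^ 2) →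
      ∀ w₀ : ℂ, 0 < w₀.im → ‖Complex.sqrt w₀‖ ≤ R → c ≤ (mm σ z w₀).im →
      c ≤ (Complex.sqrt w₀).re → ∀ w : ℂ, 0 < w.im → ‖w - w₀‖ ≤ δ →
      ‖mm σ z w - mm σ z w₀‖ ≤ C * ‖w - w₀‖ := by
  obtain ⟨κ, hκ, H⟩ := exists_nice_of_im τ c R hτ hc hR
  obtain ⟨d, C, hd, hC, H2⟩ := exists_continuation τ κ hτ hκ
  refine ⟨d * c, C / c, by positivity, by positivity, ?_⟩
  intro N σ z h w₀ hw₀ hR' him hre w hw hle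
  obtain ⟨n, hK⟩ := H N σ _ h _ _ (sol_mm h hw₀) (sqrt_re_pos hw₀) him hR' (Or.inl hre)
  have hsq : ∀ v : ℂ, 0 < v.im → ‖Complex.sqrt v - Complex.sqrt w₀‖ ≤ ‖v - w₀‖ / c := by
    intro v hv
    have h1 := sqrt_sub_le (r := Complex.sqrt w₀) hv (sqrt_re_pos hw₀).le (sqrt_im_pos hw₀).le
      (sqrt_ne hw₀)
    rw [sqrt_mul_self] at h1
    refine h1.trans ?_
    have : c ≤ ‖Complex.sqrt w₀‖ := hre.trans (Complex.re_le_norm _)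
    gcongr
  have hconv : Convex ℝ (Metric.closedBall w₀ (d * c) ∩ {v : ℂ | 0 < v.im}) :=
    (convex_closedBall _ _).inter (convex_halfSpace_im_gt 0)
  have := H2 N σ z h _ _ n (sol_mm h hw₀).eq hK _ hconv.isPreconnected (fun v hv => hv.2)
    (fun v hv => (hsq v hv.2).trans (by
      rw [div_le_iff₀ hc]; exact mem_closedBall_iff_norm.1 hv.1))
    ⟨w₀, ⟨Metric.mem_closedBall_self (by positivity), hw₀⟩, by simpa using hd.le⟩ w
    ⟨mem_closedBall_iff_norm.2 hle, hw⟩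
  refine this.trans ?_
  calc _ ≤ C * (‖w - w₀‖ / c) := by gcongr; exact hsq w hw
    _ = _ := by ring

/-- The point `x + iη`. -/
def vert (x η : ℝ) : ℂ := (x : ℂ) + (η : ℂ) * Complex.I

@[simp] lemma vert_re (x η : ℝ) : (vert x η).re = x := by simp [vert]
@[simp] lemma vert_im (x η : ℝ) : (vert x η).im = η := by simp [vert]

lemma vert_eq (w : ℂ) : vert w.re w.im = w := Complex.ext (by simp) (by simp)

lemma tendsto_vert (x : ℝ) :
    Tendsto (vert x) (𝓝[>] 0) (𝓝[{w : ℂ | 0 < w.im}] (x : ℂ)) := by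
  refine tendsto_nhdsWithin_iff.2 ⟨?_, ?_⟩
  · have : Continuous (vert x) := by unfold vert; fun_prop
    have := this.tendsto 0
    simp only [vert, Complex.ofReal_zero, zero_mul, add_zero] at this
    exact this.mono_left nhdsWithin_le_nhds
  · filter_upwards [self_mem_nhdsWithin] with η hη
    simpa using hη

lemma sqrt_sub_real_le (hw : 0 < w.im) (hx : 0 < x) :
    ‖Complex.sqrt w - (√x : ℝ)‖ ≤ ‖w - x‖ / √x := by
  have hs := Real.sqrt_pos.2 hx
  have := sqrt_sub_le (r := ((√x : ℝ) : ℂ)) hw (by simp) (by simp) (by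
    exact_mod_cast hs.ne')
  rwa [← Complex.ofReal_mul, Real.mul_self_sqrt hx.le, Complex.norm_real,
    Real.norm_of_nonneg hs.le] at this

lemma tendsto_sqrt (hx : 0 < x) :
    Tendsto Complex.sqrt (𝓝[{w : ℂ | 0 < w.im}] (x : ℂ)) (𝓝 ((√x : ℝ) : ℂ)) := by
  rw [tendsto_iff_norm_sub_tendsto_zero]
  have h1 : Tendsto (fun w : ℂ => ‖w - x‖ / √x) (𝓝[{w : ℂ | 0 < w.im}] (x : ℂ)) (𝓝 0) := by
    have : Continuous fun w : ℂ => ‖w - x‖ / √x := by fun_prop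
    have := this.tendsto (x : ℂ)
    simp only [sub_self, norm_zero, zero_div] at this
    exact this.mono_left nhdsWithin_le_nhds
  refine squeeze_zero' (Eventually.of_forall fun _ => norm_nonneg _) ?_ h1
  filter_upwards [self_mem_nhdsWithin] with w hw using sqrt_sub_real_le hw hx

lemma sqrt_re_ge (hw0 : 0 < w.im) (hw : x ≤ w.re) : √x ≤ (Complex.sqrt w).re := by
  have h1 := re_eq_sqrt w
  have h2 := (sqrt_re_pos hw0).le
  apply Real.sqrt_le_iff.2 ⟨h2, ?_⟩
  nlinarith [sq_nonneg (Complex.sqrt w).im]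

/-- At a positive point, either `Im m` tends to zero, or `m` extends continuously with a positive
imaginary part. -/
lemma boundary_dichotomy (h : Par τ σ (‖z‖ ^ 2)) (hx : 0 < x) :
    Tendsto (fun w => (mm σ z w).im) (𝓝[{w : ℂ | 0 < w.im}] (x : ℂ)) (𝓝 0) ∨
      ∃ M : ℂ, 0 < M.im ∧ Tendsto (mm σ z) (𝓝[{w : ℂ | 0 < w.im}] (x : ℂ)) (𝓝 M) := by
  rw [or_iff_not_imp_left]
  intro hnot
  have hfreq : ∃ ε > 0, ∃ᶠ w in 𝓝[{w : ℂ | 0 < w.im}] (x : ℂ), ε ≤ (mm σ z w).im := by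
    by_contra! hc
    apply hnot
    rw [Metric.tendsto_nhds]
    intro ε hε
    filter_upwards [hc ε hε, self_mem_nhdsWithin] with w h1 h2
    have h3 := (sol_mm (w := w) h h2).m_im
    rw [Real.dist_eq, sub_zero, abs_of_pos h3]
    exact h1
  -- Points arbitrarily close to `x` with `Im m ≥ ε` make `m` Lipschitz on neighbourhoods of a
  -- fixed size, so `m` has the Cauchy property at `x`.
  obtain ⟨ε, hε, hf⟩ := hfreq
  have hs := Real.sqrt_pos.2 hx
  obtain ⟨δ, C, hδ, hC, H⟩ := exists_continuation_of_im τ (min ε (√(x / 2))) (√(x + 1)) h.tau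
    (by positivity) (by positivity)
  have key : ∀ ρ > 0, ∃ w₀ : ℂ, ∃ η, 0 < η ∧ η ≤ ρ ∧ ∀ w : ℂ, 0 < w.im →
      ‖w - x‖ ≤ η → ‖mm σ z w - mm σ z w₀‖ ≤ C * (2 * η) := by
    intro ρ hρ
    set η := min ρ (min (δ / 2) (min 1 (x / 2))) with hη
    have h2 : 0 < η := by positivity
    have h4 : η ≤ δ / 2 := (min_le_right _ _).trans (min_le_left _ _)
    have h5 : η ≤ 1 := (min_le_right _ _).trans ((min_le_right _ _).trans (min_le_left _ _))
    have h5' : η ≤ x / 2 := (min_le_right _ _).trans ((min_le_right _ _).trans (min_le_right _ _))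
    have hev : ∀ᶠ w : ℂ in 𝓝[{w : ℂ | 0 < w.im}] (x : ℂ), 0 < w.im ∧ ‖w - x‖ ≤ η := by
      filter_upwards [self_mem_nhdsWithin, nhdsWithin_le_nhds (Metric.closedBall_mem_nhds _ h2)]
        with w h1 h2 using ⟨h1, mem_closedBall_iff_norm.1 h2⟩
    obtain ⟨w₀, h1, h3, h3'⟩ := (hf.and_eventually hev).exists
    refine ⟨w₀, η, h2, min_le_left _ _, ?_⟩
    intro w hw hwx
    have h6 : ‖w - w₀‖ ≤ 2 * η := by
      have := norm_sub_le (w - x) (w₀ - x)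
      rw [sub_sub_sub_cancel_right] at this
      linarith
    have h7 : ‖Complex.sqrt w₀‖ ≤ √(x + 1) := by
      apply Real.le_sqrt_of_sq_le
      rw [norm_sqrt_sq]
      have h8 := norm_le_norm_add_norm_sub' w₀ (x : ℂ)
      rw [Complex.norm_real, Real.norm_of_nonneg hx.le] at h8
      linarith
    have h9 : x / 2 ≤ w₀.re := by
      have := (neg_le_abs _).trans (Complex.abs_re_le_norm (w₀ - x))
      rw [Complex.sub_re, Complex.ofReal_re] at this
      linarith
    refine (H N σ z h w₀ h3 h7 ((min_le_left _ _).trans h1)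
      ((min_le_right _ _).trans (sqrt_re_ge h3 h9)) w hw (by linarith)).trans ?_
    gcongr
  have hne : (𝓝[{w : ℂ | 0 < w.im}] (x : ℂ)).NeBot := (tendsto_vert x).neBot
  have hcau : Cauchy (map (mm σ z) (𝓝[{w : ℂ | 0 < w.im}] (x : ℂ))) := by
    rw [Metric.cauchy_iff]
    refine ⟨hne.map _, fun ρ hρ => ?_⟩
    obtain ⟨w₀, η, h1, h2, h4⟩ := key (ρ / (8 * C)) (by positivity)
    refine ⟨mm σ z '' (Metric.ball (x : ℂ) η ∩ {w : ℂ | 0 < w.im}), ?_, ?_⟩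
    · refine image_mem_map (inter_mem (nhdsWithin_le_nhds (Metric.ball_mem_nhds _ h1))
        self_mem_nhdsWithin)
    · have h5 : C * (2 * η) ≤ ρ / 4 := by
        calc _ ≤ C * (2 * (ρ / (8 * C))) := by gcongr
          _ = _ := by field_simp; norm_num
      rintro _ ⟨a, ⟨ha, ha'⟩, rfl⟩ _ ⟨b, ⟨hb, hb'⟩, rfl⟩
      have t1 := h4 a ha' (mem_ball_iff_norm.1 ha).le
      have t2 := h4 b hb' (mem_ball_iff_norm.1 hb).le
      rw [← dist_eq_norm] at t1 t2
      have := dist_triangle_right (mm σ z a) (mm σ z b) (mm σ z w₀)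
      linarith
  obtain ⟨M, hM⟩ := CompleteSpace.complete hcau
  refine ⟨M, ?_, hM⟩
  have hv : Tendsto (fun w => (mm σ z w).im) (𝓝[{w : ℂ | 0 < w.im}] (x : ℂ)) (𝓝 M.im) :=
    (Complex.continuous_im.tendsto _).comp hM
  exact hε.trans_le (ge_of_tendsto_of_frequently hv hf)

lemma m1c_im_eq (hw : 0 < w.im) :
    (m1c σ z w).im = ((mm σ z w).im * (Complex.sqrt w).re -
      (mm σ z w).re * (Complex.sqrt w).im) / ‖Complex.sqrt w‖ ^ 2 := by
  have e : m1c σ z w = mm σ z w / Complex.sqrt w - 1 := by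
    rw [m1c_eq hw]; have := sqrt_ne hw; field_simp
  rw [e, Complex.sub_im, Complex.one_im, sub_zero, Complex.div_im, Complex.normSq_eq_norm_sq]
  ring

/-- If `Im m` tends to zero, the density vanishes. The real part of `m` need not converge for
this. -/
lemma rho1c_eq_zero (h : Par τ σ (‖z‖ ^ 2)) (hx : 0 < x)
    (hl : Tendsto (fun η => (mm σ z (vert x η)).im) (𝓝[>] 0) (𝓝 0)) : rho1c σ z x = 0 := by
  have hs := Real.sqrt_pos.2 hx
  have h1 := (tendsto_sqrt hx).comp (tendsto_vert x)
  have him : Tendsto (fun η => (Complex.sqrt (vert x η)).im) (𝓝[>] 0) (𝓝 0) := by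
    have := (Complex.continuous_im.tendsto _).comp h1
    rwa [Complex.ofReal_im] at this
  have hre : Tendsto (fun η => (Complex.sqrt (vert x η)).re) (𝓝[>] 0) (𝓝 (√x)) := by
    have := (Complex.continuous_re.tendsto _).comp h1
    rwa [Complex.ofReal_re] at this
  have hn : Tendsto (fun η => ‖Complex.sqrt (vert x η)‖ ^ 2) (𝓝[>] 0) (𝓝 (√x ^ 2)) := by
    have := h1.norm.pow 2
    simpa [abs_of_pos hs] using this
  have hb : Tendsto (fun η => (mm σ z (vert x η)).re * (Complex.sqrt (vert x η)).im)
      (𝓝[>] 0) (𝓝 0) := by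
    refine squeeze_zero_norm' ?_ (by simpa using ((h1.norm.const_add 1).mul him))
    filter_upwards [self_mem_nhdsWithin] with η hη
    have hη' : 0 < (vert x η).im := by simpa using hη
    rw [norm_mul, Real.norm_of_nonneg (sqrt_im_pos hη').le]
    have := (sol_mm h hη').norm_le h
    have := Complex.abs_re_le_norm (mm σ z (vert x η))
    have := (sqrt_im_pos hη').le
    rw [Real.norm_eq_abs]
    change _ ≤ (1 + ‖Complex.sqrt (vert x η)‖) * _
    gcongr
    linarith
  have hlim : Tendsto (fun η : ℝ => (m1c σ z (vert x η)).im) (𝓝[>] 0) (𝓝 0) := by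
    have := ((hl.mul hre).sub hb).div hn (by positivity)
    simp only [zero_mul, sub_zero, zero_div] at this
    refine this.congr' ?_
    filter_upwards [self_mem_nhdsWithin] with η hη
    rw [m1c_im_eq (by simpa using hη)]
    rfl
  rw [rho1c]
  have : limUnder (𝓝[>] (0 : ℝ)) (fun η : ℝ => (m1c σ z ((x : ℂ) + (η : ℂ) * Complex.I)).im) = 0 :=
    hlim.limUnder_eq
  rw [this, mul_zero]

lemma tendsto_m1c_vert (hx : 0 < x) {M : ℂ}
    (hl : Tendsto (fun η => mm σ z (vert x η)) (𝓝[>] 0) (𝓝 M)) :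
    Tendsto (fun η => m1c σ z (vert x η)) (𝓝[>] 0) (𝓝 (M / (√x : ℝ) - 1)) := by
  have hs := Real.sqrt_pos.2 hx
  have h1 := (tendsto_sqrt hx).comp (tendsto_vert x)
  have hs' : ((√x : ℝ) : ℂ) ≠ 0 := by exact_mod_cast hs.ne'
  refine ((hl.div h1 hs').sub_const 1).congr' ?_
  filter_upwards [self_mem_nhdsWithin] with η hη
  have hη' : 0 < (vert x η).im := by simpa using hη
  have := sqrt_ne hη'
  rw [m1c_eq hη']
  simp only [Function.comp, Pi.div_apply]
  field_simp

lemma rho1c_eq (hx : 0 < x) {M : ℂ}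
    (hl : Tendsto (fun η => mm σ z (vert x η)) (𝓝[>] 0) (𝓝 M)) :
    rho1c σ z x = 1 / Real.pi * (M.im / √x) := by
  have h1 := (Complex.continuous_im.tendsto _).comp (tendsto_m1c_vert hx hl)
  have h2 : limUnder (𝓝[>] (0 : ℝ)) (fun η : ℝ => (m1c σ z ((x : ℂ) + (η : ℂ) * Complex.I)).im) =
      (M / (√x : ℝ) - 1).im := h1.limUnder_eq
  rw [rho1c, h2, Complex.sub_im, Complex.one_im, sub_zero, Complex.div_ofReal_im]

lemma mcReal_eq (hx : 0 < x) {M : ℂ}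
    (hl : Tendsto (fun η => mm σ z (vert x η)) (𝓝[>] 0) (𝓝 M)) : mcReal σ z x = M := by
  have hs := Real.sqrt_pos.2 hx
  have hs' : ((√x : ℝ) : ℂ) ≠ 0 := by exact_mod_cast hs.ne'
  have h2 : m1cReal σ z x = M / (√x : ℝ) - 1 := (tendsto_m1c_vert hx hl).limUnder_eq
  rw [mcReal, h2]; field_simp; ring

lemma rho1c_of_neg (h : Par τ σ (‖z‖ ^ 2)) (hx : x < 0) : rho1c σ z x = 0 := by
  have hlim : Tendsto (fun η : ℝ => (m1c σ z (vert x η)).im) (𝓝[>] 0) (𝓝 0) := by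
    have hb : Tendsto (fun η : ℝ => η * (√(-x))⁻¹ / (-x)) (𝓝[>] 0) (𝓝 0) := by
      have : Continuous fun η : ℝ => η * (√(-x))⁻¹ / (-x) := by fun_prop
      have := this.tendsto 0
      simp only [zero_mul, zero_div] at this
      exact this.mono_left nhdsWithin_le_nhds
    refine squeeze_zero' ?_ ?_ hb
    · filter_upwards [self_mem_nhdsWithin] with η hη
      exact (m1c_im_pos h (by simpa using hη)).le
    · filter_upwards [self_mem_nhdsWithin] with η hη
      have hη0 : (0 : ℝ) < η := hη
      have hη' : 0 < (vert x η).im := by simpa using hη0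
      have h1 := ((isM1c_m1c h).2 _ hη').2.1
      rw [Complex.mul_im, vert_re, vert_im] at h1
      have h2 := norm_m1c_le h hη'
      have h3 : ‖Complex.sqrt (vert x η)‖⁻¹ ≤ (√(-x))⁻¹ := by
        have h4 : √(-x) ≤ ‖Complex.sqrt (vert x η)‖ := by
          apply Real.sqrt_le_iff.2 ⟨norm_nonneg _, ?_⟩
          rw [norm_sqrt_sq]
          have := (neg_le_abs _).trans (Complex.abs_re_le_norm (vert x η))
          simpa using this
        exact inv_anti₀ (Real.sqrt_pos.2 (by linarith)) h4
      have h5 := (Complex.re_le_norm (m1c σ z (vert x η))).trans (h2.trans h3)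
      rw [le_div_iff₀ (by linarith)]
      nlinarith
  rw [rho1c]
  have : limUnder (𝓝[>] (0 : ℝ)) (fun η : ℝ => (m1c σ z ((x : ℂ) + (η : ℂ) * Complex.I)).im) = 0 :=
    hlim.limUnder_eq
  rw [this, mul_zero]

/-- If the kernel has a gap above `x`, the density vanishes there. -/
lemma tendsto_im_of_gap (h : Par τ σ (‖z‖ ^ 2)) (hx : 0 < x) {c : ℝ} (hc : 0 < c)
    (hg : ∀ᶠ η in 𝓝[>] (0 : ℝ), c * (mm σ z (vert x η)).im ≤ 2 * (Complex.sqrt (vert x η)).im) :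
    Tendsto (fun η => (mm σ z (vert x η)).im) (𝓝[>] 0) (𝓝 0) := by
  have h1 := (tendsto_sqrt hx).comp (tendsto_vert x)
  have him : Tendsto (fun η => 2 / c * (Complex.sqrt (vert x η)).im) (𝓝[>] 0) (𝓝 0) := by
    have := ((Complex.continuous_im.tendsto _).comp h1).const_mul (2 / c)
    simpa using this
  refine squeeze_zero' ?_ ?_ him
  · filter_upwards [self_mem_nhdsWithin] with η hη
    exact (sol_mm h (by simpa using hη)).m_im.le
  · filter_upwards [hg] with η hη
    rw [div_mul_eq_mul_div, le_div_iff₀ hc]; linarith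

/-- The support lies in `[0, (10/τ)²]`: the density is zero on the negative half line by the sign
conditions, and for large `x` by smallness of the kernel. -/
lemma supp_subset (h : Par τ σ (‖z‖ ^ 2)) : supp σ z ⊆ Set.Icc 0 ((10 / τ) ^ 2) := by
  have hτ := h.tau
  refine closure_minimal ?_ isClosed_Icc
  intro x hx
  rw [Function.mem_support] at hx
  by_contra hc
  apply hx
  rw [Set.mem_Icc, not_and_or, not_le, not_le] at hc
  rcases hc with hc | hc
  · exact rho1c_of_neg h hc
  · have hx0 : 0 < x := lt_trans (by positivity) hc
    refine rho1c_eq_zero h hx0 (tendsto_im_of_gap h hx0 (c := 1 / 2) (by norm_num) ?_)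
    filter_upwards [self_mem_nhdsWithin] with η hη
    have hη' : 0 < (vert x η).im := by simpa using hη
    refine (sol_mm h hη').im_le_of_K1_le h ?_
    refine ((sol_mm h hη').K1_le_half h ?_).trans (by norm_num)
    have h1 := sqrt_re_ge hη' (x := x) (by simp)
    have h2 : 10 / τ ≤ √x := Real.le_sqrt_of_sq_le hc.le
    exact h2.trans (h1.trans (Complex.re_le_norm _))

lemma edges_subset : edges σ z ⊆ supp σ z :=
  (isClosed_tsupport _).frontier_subset

lemma kappa_le (h : Par τ σ (‖z‖ ^ 2)) (E : ℝ) : kappa σ z E ≤ |E| + (10 / τ) ^ 2 := by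
  rw [kappa]
  rcases Set.eq_empty_or_nonempty {e | e ∈ edges σ z ∧ 0 < e} with he | ⟨e, he⟩
  · rw [he, Metric.infDist_empty]; positivity
  · refine (Metric.infDist_le_dist_of_mem he).trans ?_
    have h1 := supp_subset h (edges_subset he.1)
    rw [Real.dist_eq]
    refine (abs_sub _ _).trans ?_
    rw [abs_of_pos he.2]
    linarith [h1.2]

/-- A continuous extension with positive imaginary part excludes edges. -/
lemma mem_interior_supp (h : Par τ σ (‖z‖ ^ 2)) (hx : 0 < x) {M : ℂ} (hM : 0 < M.im)
    (hl : Tendsto (mm σ z) (𝓝[{w : ℂ | 0 < w.im}] (x : ℂ)) (𝓝 M)) : x ∈ interior (supp σ z) := by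
  have h1 : ∀ᶠ w in 𝓝[{w : ℂ | 0 < w.im}] (x : ℂ), M.im / 2 < (mm σ z w).im :=
    ((Complex.continuous_im.tendsto _).comp hl).eventually (lt_mem_nhds (half_lt_self hM))
  obtain ⟨ρ, hρ, hball⟩ := Metric.mem_nhdsWithin_iff.1 h1
  rw [mem_interior_iff_mem_nhds]
  filter_upwards [Metric.ball_mem_nhds x (half_pos hρ), lt_mem_nhds hx] with y hy hy0
  refine subset_tsupport _ ?_
  rw [Function.mem_support]
  have hfreq : ∀ᶠ η in 𝓝[>] (0 : ℝ), M.im / 2 < (mm σ z (vert y η)).im := by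
    filter_upwards [self_mem_nhdsWithin, nhdsWithin_le_nhds (Iio_mem_nhds (half_pos hρ))]
      with η h2 h3
    refine hball ⟨?_, by simpa using h2⟩
    rw [mem_ball_iff_norm]
    have e : vert y η - (x : ℂ) = ((y - x : ℝ) : ℂ) + (η : ℂ) * Complex.I := by
      rw [vert]; push_cast; ring
    rw [e]
    refine (norm_add_le _ _).trans_lt ?_
    rw [norm_mul, Complex.norm_I, mul_one, Complex.norm_real, Complex.norm_real,
      Real.norm_eq_abs, Real.norm_of_nonneg (le_of_lt h2)]
    have h4 : |y - x| < ρ / 2 := by rwa [Metric.mem_ball, Real.dist_eq] at hy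
    have h5 : η < ρ / 2 := h3
    linarith
  rcases boundary_dichotomy h hy0 with hd | ⟨M', hM', hd⟩
  · exfalso
    have := ge_of_tendsto (hd.comp (tendsto_vert y)) (hfreq.mono fun η hη => hη.le)
    linarith
  · rw [rho1c_eq hy0 (hd.comp (tendsto_vert y))]
    have := Real.sqrt_pos.2 hy0
    have := Real.pi_pos
    positivity

/-- At a nonzero edge `Im m` tends to zero. -/
lemma tendsto_im_of_edge (h : Par τ σ (‖z‖ ^ 2)) {e : ℝ} (he : e ∈ edges σ z) (he0 : 0 < e) :
    Tendsto (fun w => (mm σ z w).im) (𝓝[{w : ℂ | 0 < w.im}] (e : ℂ)) (𝓝 0) := by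
  rcases boundary_dichotomy h he0 with hd | ⟨M, hM, hd⟩
  · exact hd
  · exact absurd (mem_interior_supp h he0 hM hd) he.2

/-- For `|z| < 1` a neighbourhood of zero in the half line lies in the support; for `|z| > 1` it
does not meet the support, except possibly at zero. -/
lemma exists_supp_near_zero (τ : ℝ) (hτ : 0 < τ) : ∃ c : ℝ, 0 < c ∧
    ∀ (N : ℕ) (σ : Fin N → ℝ) (z : ℂ), Par τ σ (‖z‖ ^ 2) →
      (‖z‖ ^ 2 ≤ 1 - τ → Set.Icc 0 c ⊆ supp σ z ∧ Set.Ioo 0 c ⊆ interior (supp σ z)) ∧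
      (1 + τ ≤ ‖z‖ ^ 2 → ∀ x, 0 < x → x < c → x ∉ supp σ z) := by
  obtain ⟨r₀, c₁, hr₀, hc₁, H1⟩ := exists_im_ge_near_zero τ hτ
  obtain ⟨t₀, ht₀, H2⟩ := exists_K1_le_near_zero τ hτ
  set s := min r₀ (min t₀ (τ * t₀ / 4)) with hs
  have hs0 : 0 < s := by positivity
  have hsr : s ≤ r₀ := min_le_left _ _
  have hst : s ≤ t₀ := (min_le_right _ _).trans (min_le_left _ _)
  have hst' : s ≤ τ * t₀ / 4 := (min_le_right _ _).trans (min_le_right _ _)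
  refine ⟨s ^ 2 / 2, by positivity, fun N σ z h => ?_⟩
  have hsmall : ∀ x, 0 < x → x < s ^ 2 / 2 → ∀ᶠ η in 𝓝[>] (0 : ℝ),
      0 < η ∧ ‖Complex.sqrt (vert x η)‖ ≤ s := by
    intro x hx hxc
    filter_upwards [self_mem_nhdsWithin, nhdsWithin_le_nhds (Iio_mem_nhds
      (show 0 < s ^ 2 / 2 by positivity))] with η h1 h2
    refine ⟨h1, abs_le_of_sq_le_sq' ?_ hs0.le |>.2⟩
    rw [norm_sqrt_sq]
    have h8 := Complex.norm_le_abs_re_add_abs_im (vert x η)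
    rw [vert_re, vert_im, abs_of_pos hx, abs_of_pos h1] at h8
    have : η < s ^ 2 / 2 := h2
    linarith
  constructor
  · intro hq
    have hint : Set.Ioo 0 (s ^ 2 / 2) ⊆ interior (supp σ z) := by
      rintro x ⟨hx, hxc⟩
      rcases boundary_dichotomy h hx with hd | ⟨M, hM, hd⟩
      · exfalso
        have := ge_of_tendsto (hd.comp (tendsto_vert x)) ((hsmall x hx hxc).mono fun η hη =>
          H1 N σ _ h hq _ _ (sol_mm (w := vert x η) h (by simpa using hη.1))
            (sqrt_re_pos (by simpa using hη.1)) (hη.2.trans hsr))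
        linarith
      · exact mem_interior_supp h hx hM hd
    refine ⟨?_, hint⟩
    rw [← closure_Ioo (by positivity)]
    exact closure_minimal (hint.trans interior_subset) (isClosed_tsupport _)
  · intro hq x hx hxc hxs
    have hz : ∀ y, 0 < y → y < s ^ 2 / 2 → rho1c σ z y = 0 := by
      intro y hy hyc
      refine rho1c_eq_zero h hy (tendsto_im_of_gap h hy (c := τ / 8) (by positivity) ?_)
      filter_upwards [hsmall y hy hyc] with η hη
      have S := sol_mm (w := vert y η) h (by simpa using hη.1)
      refine S.im_le_of_K1_le h (H2 N σ _ h hq _ _ S.m_ne ?_ (hη.2.trans hst))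
      have := norm_le_mul_of_one_lt S h hq
      have h2 : τ * ‖mm σ z (vert y η)‖ ≤ τ * t₀ := by linarith [hη.2]
      exact le_of_mul_le_mul_left h2 hτ
    have : Set.Ioo 0 (s ^ 2 / 2) ∈ 𝓝 x := Ioo_mem_nhds hx hxc
    obtain ⟨y, hy1, hy2⟩ := mem_closure_iff_nhds.1 hxs _ this
    exact hy2 (hz y hy1.1 hy1.2)

/-- Positive edges stay away from zero. -/
lemma exists_edge_ge (τ : ℝ) (hτ : 0 < τ) : ∃ c : ℝ, 0 < c ∧
    ∀ (N : ℕ) (σ : Fin N → ℝ) (z : ℂ), Par τ σ (‖z‖ ^ 2) → ∀ e ∈ edges σ z, e ≠ 0 →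
      c ≤ e ∧ e ≤ (10 / τ) ^ 2 := by
  obtain ⟨c, hc, H⟩ := exists_supp_near_zero τ hτ
  refine ⟨c, hc, fun N σ z h e he he0 => ?_⟩
  have h1 := supp_subset h (edges_subset he)
  have he' : 0 < e := lt_of_le_of_ne h1.1 (Ne.symm he0)
  refine ⟨?_, h1.2⟩
  by_contra! hlt
  rcases le_abs'.1 h.qgap with hq | hq
  · exact he.2 (((H N σ z h).1 (by linarith)).2 ⟨he', hlt⟩)
  · exact (H N σ z h).2 (by linarith) e he' hlt (edges_subset he)

end boundary

/-! ### Harmonic measure and gaps -/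

section gap

/-- A Poisson bound on the disc: where the Poisson kernel exceeds `K`, the boundary values of the
harmonic function `Im G` are assumed to vanish. -/
lemma disc_im_le {G : ℂ → ℂ} (hG : DifferentiableOn ℂ G (Metric.ball 0 1))
    (hpos : ∀ ζ ∈ Metric.ball (0 : ℂ) 1, 0 ≤ (G ζ).im) {B : ℝ}
    (hB : ∀ ζ ∈ Metric.ball (0 : ℂ) 1, ‖G ζ‖ ≤ B) {v : ℂ} (hv : v ∈ Metric.ball (0 : ℂ) 1)
    {K : ℝ} (hK0 : 0 ≤ K)
    (hK : ∀ e : ℂ, ‖e‖ = 1 → poissonKernel 0 v e ≤ K ∨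
      Tendsto (fun ρ : ℝ => (G (ρ * e)).im) (𝓝[<] 1) (𝓝 0)) :
    (G v).im ≤ K * (G 0).im := by
  have hv1 : ‖v‖ < 1 := by simpa using hv
  set J : ℝ → ℝ := fun ρ => ∫ θ in (0 : ℝ)..2 * Real.pi,
    max (poissonKernel 0 v (circleMap 0 ρ θ) - K) 0 * (G (circleMap 0 ρ θ)).im with hJ
  set D := 4 / (1 - ‖v‖) ^ 2 with hD
  have hD0 : 0 < D := by
    have : 0 < 1 - ‖v‖ := by linarith
    positivity
  have hcm : ∀ (ρ θ : ℝ), circleMap 0 ρ θ = ρ * circleMap 0 1 θ := by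
    intro ρ θ; simp [circleMap]
  have hn1 : ∀ θ : ℝ, ‖circleMap 0 1 θ‖ = 1 := by intro θ; simp
  have hnρ : ∀ {ρ : ℝ}, 0 < ρ → ∀ θ, ‖circleMap 0 ρ θ‖ = ρ := by
    intro ρ hρ θ; simp [abs_of_pos hρ]
  have hev : ∀ᶠ ρ in 𝓝[<] (1 : ℝ), (1 + ‖v‖) / 2 < ρ ∧ ρ < 1 := by
    filter_upwards [self_mem_nhdsWithin, nhdsWithin_le_nhds (Ioi_mem_nhds (show (1 + ‖v‖) / 2 < 1
      by linarith))] with ρ h1 h2 using ⟨h2, h1⟩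
  have hPb : ∀ ρ : ℝ, (1 + ‖v‖) / 2 < ρ → ρ < 1 → ∀ θ,
      poissonKernel 0 v (circleMap 0 ρ θ) ≤ D := by
    intro ρ h1 h2 θ
    have hρ : 0 < ρ := by have := norm_nonneg v; linarith
    rw [poissonKernel, sub_zero, sub_zero, hnρ hρ]
    have h3 : (1 - ‖v‖) / 2 ≤ ‖circleMap 0 ρ θ - v‖ := by
      have := norm_sub_norm_le (circleMap 0 ρ θ) v
      rw [hnρ hρ] at this
      linarith
    have h4 : 0 < (1 - ‖v‖) / 2 := by linarith
    calc _ ≤ 1 / ((1 - ‖v‖) / 2) ^ 2 := by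
          gcongr
          nlinarith [sq_nonneg ‖v‖]
      _ = D := by rw [hD]; field_simp; norm_num
  have hmem : ∀ ρ : ℝ, (1 + ‖v‖) / 2 < ρ → ρ < 1 → ∀ θ,
      circleMap 0 ρ θ ∈ Metric.ball (0 : ℂ) 1 := by
    intro ρ h1 h2 θ
    have hρ : 0 < ρ := by have := norm_nonneg v; linarith
    rw [mem_ball_zero_iff, hnρ hρ]; exact h2
  have hcontP : ∀ ρ : ℝ, (1 + ‖v‖) / 2 < ρ → ρ < 1 →
      Continuous fun θ => poissonKernel 0 v (circleMap 0 ρ θ) := by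
    intro ρ h1 h2
    have hρ : 0 < ρ := by have := norm_nonneg v; linarith
    unfold poissonKernel
    refine Continuous.div (by fun_prop) (by fun_prop) fun θ => ?_
    have := norm_sub_norm_le (circleMap 0 ρ θ) v
    rw [hnρ hρ] at this
    have h3 : 0 < ‖circleMap 0 ρ θ - v‖ := by linarith
    rw [sub_zero, sub_zero]
    positivity
  have hcontG : ∀ ρ : ℝ, (1 + ‖v‖) / 2 < ρ → ρ < 1 →
      Continuous fun θ => G (circleMap 0 ρ θ) := by
    intro ρ h1 h2
    exact hG.continuousOn.comp_continuous (continuous_circleMap 0 ρ) (hmem ρ h1 h2)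
  have hlim : Tendsto J (𝓝[<] 1) (𝓝 0) := by
    have e0 : (0 : ℝ) = ∫ _ in (0 : ℝ)..2 * Real.pi, (0 : ℝ) := by simp
    rw [e0]
    refine intervalIntegral.tendsto_integral_filter_of_dominated_convergence (fun _ => D * B)
      ?_ ?_ (by simp) ?_
    · filter_upwards [hev] with ρ hρ
      exact ((((hcontP ρ hρ.1 hρ.2).sub continuous_const).max continuous_const).mul
        (Complex.continuous_im.comp (hcontG ρ hρ.1 hρ.2))).aestronglyMeasurable
    · filter_upwards [hev] with ρ hρ
      refine Eventually.of_forall fun θ _ => ?_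
      rw [norm_mul, Real.norm_of_nonneg (le_max_right _ _), Real.norm_eq_abs]
      have h1 := hPb ρ hρ.1 hρ.2 θ
      have h2 := (Complex.abs_im_le_norm _).trans (hB _ (hmem ρ hρ.1 hρ.2 θ))
      have h3 : max (poissonKernel 0 v (circleMap 0 ρ θ) - K) 0 ≤ D :=
        max_le (by linarith) hD0.le
      gcongr
    · refine Eventually.of_forall fun θ _ => ?_
      have hP : Tendsto (fun ρ : ℝ => max (poissonKernel 0 v (circleMap 0 ρ θ) - K) 0) (𝓝[<] 1)
          (𝓝 (max (poissonKernel 0 v (circleMap 0 1 θ) - K) 0)) := by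
        have : ContinuousAt (fun ρ : ℝ => max (poissonKernel 0 v (circleMap 0 ρ θ) - K) 0) 1 := by
          simp only [poissonKernel, sub_zero]
          have h3 : ‖circleMap 0 1 θ - v‖ ^ 2 ≠ 0 := by
            have := norm_sub_norm_le (circleMap 0 1 θ) v
            rw [hn1] at this
            have : 0 < ‖circleMap 0 1 θ - v‖ := by linarith
            positivity
          have hc : Continuous fun ρ : ℝ => circleMap 0 ρ θ := by unfold circleMap; fun_prop
          exact (((((hc.norm.pow 2).sub continuous_const).continuousAt).div
            (((hc.sub continuous_const).norm.pow 2).continuousAt) h3).sub continuousAt_const).max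
            continuousAt_const
        exact this.tendsto.mono_left nhdsWithin_le_nhds
      rcases hK _ (hn1 θ) with h1 | h1
      · rw [max_eq_right (by linarith)] at hP
        refine squeeze_zero_norm' ?_ (by simpa using hP.mul_const B)
        filter_upwards [hev] with ρ hρ
        rw [norm_mul, Real.norm_of_nonneg (le_max_right _ _), Real.norm_eq_abs]
        have h2 := (Complex.abs_im_le_norm _).trans (hB _ (hmem ρ hρ.1 hρ.2 θ))
        gcongr
      · have := hP.mul h1
        rw [mul_zero] at this
        refine this.congr fun ρ => ?_
        rw [hcm ρ θ]
  have hle : ∀ᶠ ρ in 𝓝[<] (1 : ℝ), (G v).im - K * (G 0).im ≤ (2 * Real.pi)⁻¹ * J ρ := by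
    filter_upwards [hev] with ρ hρ
    have hρ0 : 0 < ρ := by have := norm_nonneg v; linarith
    have hd : DiffContOnCl ℂ G (Metric.ball 0 ρ) := by
      refine DifferentiableOn.diffContOnCl ?_
      rw [closure_ball _ hρ0.ne']
      exact hG.mono (Metric.closedBall_subset_ball hρ.2)
    have hvρ : v ∈ Metric.ball (0 : ℂ) ρ := by
      rw [mem_ball_zero_iff]; linarith [hρ.1]
    have h1 := hd.circleAverage_poissonKernel_smul hvρ
    have h2 : Real.circleAverage G 0 ρ = G 0 := by
      have := hd
      rw [← abs_of_pos hρ0] at this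
      exact this.circleAverage
    have i1 : CircleIntegrable (poissonKernel 0 v • G) 0 ρ := by
      refine Continuous.intervalIntegrable ?_ _ _
      exact (hcontP ρ hρ.1 hρ.2).smul (hcontG ρ hρ.1 hρ.2)
    have i2 : CircleIntegrable G 0 ρ := (hcontG ρ hρ.1 hρ.2).intervalIntegrable _ _
    have c1 := Complex.imCLM.circleAverage_comp_comm i1
    have c2 := Complex.imCLM.circleAverage_comp_comm i2
    rw [h1] at c1
    rw [h2] at c2
    simp only [Complex.imCLM_apply] at c1 c2
    rw [← c1, ← c2, Real.circleAverage_def, Real.circleAverage_def, smul_eq_mul, smul_eq_mul]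
    have e : ∀ a b : ℝ, (2 * Real.pi)⁻¹ * a - K * ((2 * Real.pi)⁻¹ * b) =
        (2 * Real.pi)⁻¹ * (a - K * b) := by intro a b; ring
    rw [e]
    refine mul_le_mul_of_nonneg_left ?_ (by positivity)
    have j1 : IntervalIntegrable (fun θ => poissonKernel 0 v (circleMap 0 ρ θ) *
        (G (circleMap 0 ρ θ)).im) volume 0 (2 * Real.pi) :=
      ((hcontP ρ hρ.1 hρ.2).mul
        (Complex.continuous_im.comp (hcontG ρ hρ.1 hρ.2))).intervalIntegrable _ _
    have j2 : IntervalIntegrable (fun θ => K * (G (circleMap 0 ρ θ)).im) volume 0 (2 * Real.pi) :=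
      (continuous_const.mul
        (Complex.continuous_im.comp (hcontG ρ hρ.1 hρ.2))).intervalIntegrable _ _
    have e2 : (∫ θ in (0 : ℝ)..2 * Real.pi, (⇑Complex.imCLM ∘ (poissonKernel 0 v • G))
        (circleMap 0 ρ θ)) = ∫ θ in (0 : ℝ)..2 * Real.pi, poissonKernel 0 v (circleMap 0 ρ θ) *
        (G (circleMap 0 ρ θ)).im := by
      congr 1; ext θ; simp
    have e3 : K * (∫ θ in (0 : ℝ)..2 * Real.pi, (⇑Complex.imCLM ∘ G) (circleMap 0 ρ θ)) =
        ∫ θ in (0 : ℝ)..2 * Real.pi, K * (G (circleMap 0 ρ θ)).im := by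
      rw [intervalIntegral.integral_const_mul]; rfl
    rw [e2, e3, ← intervalIntegral.integral_sub j1 j2]
    refine intervalIntegral.integral_mono_on (by positivity) (j1.sub j2) ?_ fun θ _ => ?_
    · exact ((((hcontP ρ hρ.1 hρ.2).sub continuous_const).max continuous_const).mul
        (Complex.continuous_im.comp (hcontG ρ hρ.1 hρ.2))).intervalIntegrable _ _
    · rw [← sub_mul]
      have := hpos _ (hmem ρ hρ.1 hρ.2 θ)
      gcongr
      exact le_max_left _ _
  have := le_of_tendsto_of_tendsto tendsto_const_nhds (hlim.const_mul (2 * Real.pi)⁻¹) hle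
  rw [mul_zero] at this
  linarith

/-- The Cayley transform of the unit disc onto the upper half plane, with `0 ↦ E + i`. -/
def cayley (E : ℝ) (ζ : ℂ) : ℂ := E + Complex.I * ((1 + ζ) / (1 - ζ))

/-- The Cayley transform maps the disc into the upper half plane and its boundary to the real
axis. -/
lemma cayley_im (E : ℝ) (ζ : ℂ) : (cayley E ζ).im = (1 - ‖ζ‖ ^ 2) / ‖1 - ζ‖ ^ 2 := by
  rw [cayley, Complex.add_im, Complex.ofReal_im, zero_add, Complex.I_mul_im, Complex.div_re,
    ← Complex.normSq_eq_norm_sq, ← Complex.normSq_eq_norm_sq, Complex.normSq_apply ζ]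
  simp only [Complex.add_re, Complex.sub_re, Complex.one_re, Complex.add_im, Complex.sub_im,
    Complex.one_im]
  ring

/-- If the boundary values of the bounded positive harmonic function `Im g` vanish on an interval
around `E`, then `Im g` decays linearly towards `E`. -/
lemma im_le_of_gap {g : ℂ → ℂ} (hg : DifferentiableOn ℂ g {w : ℂ | 0 < w.im})
    (hpos : ∀ w : ℂ, 0 < w.im → 0 ≤ (g w).im) {B : ℝ} (hB : ∀ w : ℂ, 0 < w.im → ‖g w‖ ≤ B)
    {E ℓ : ℝ} (hℓ : 0 < ℓ) (h0 : ∀ x : ℝ, |x - E| < ℓ →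
      Tendsto (fun w => (g w).im) (𝓝[{w : ℂ | 0 < w.im}] (x : ℂ)) (𝓝 0))
    {y : ℝ} (hy : 0 < y) :
    (g (vert E y)).im ≤ y * (1 + 1 / ℓ ^ 2) * (g (vert E 1)).im := by
  have hne : ∀ ζ : ℂ, ‖ζ‖ ≤ 1 → ζ ≠ 1 → 1 - ζ ≠ 0 := fun ζ _ h => sub_ne_zero.2 h.symm
  have hmap : ∀ ζ ∈ Metric.ball (0 : ℂ) 1, 0 < (cayley E ζ).im := by
    intro ζ hζ
    have h1 : ‖ζ‖ < 1 := by simpa using hζ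
    have h2 : 0 < ‖1 - ζ‖ := by
      have := norm_sub_norm_le (1 : ℂ) ζ
      rw [norm_one] at this; linarith
    rw [cayley_im]
    have : 0 < 1 - ‖ζ‖ ^ 2 := by nlinarith [norm_nonneg ζ]
    positivity
  set v : ℂ := (((y - 1) / (y + 1) : ℝ) : ℂ) with hv
  have hy1 : (y : ℂ) + 1 ≠ 0 := by exact_mod_cast (by positivity : y + 1 ≠ 0)
  have hvb : v ∈ Metric.ball (0 : ℂ) 1 := by
    rw [mem_ball_zero_iff, hv, Complex.norm_real, Real.norm_eq_abs, abs_lt]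
    constructor
    · rw [lt_div_iff₀ (by positivity)]; linarith
    · rw [div_lt_one (by positivity)]; linarith
  have ev : cayley E v = vert E y := by
    have e1 : 1 - v = 2 / (y + 1) := by rw [hv]; push_cast; field_simp; ring
    have e2 : 1 + v = 2 * y / (y + 1) := by rw [hv]; push_cast; field_simp; ring
    rw [cayley, e1, e2, vert]; field_simp
  have e0 : cayley E 0 = vert E 1 := by simp [cayley, vert]
  rw [← ev, ← e0]
  refine disc_im_le (G := fun ζ => g (cayley E ζ)) ?_ (fun ζ hζ => hpos _ (hmap ζ hζ))
    (fun ζ hζ => hB _ (hmap ζ hζ)) hvb (by positivity) ?_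
  · refine hg.comp ?_ hmap
    unfold cayley
    refine (differentiableOn_const _).add ((differentiableOn_const _).mul
      ((differentiableOn_id.const_add 1).div (differentiableOn_id.const_sub 1) fun ζ hζ => ?_))
    have h1 : ‖ζ‖ < 1 := by simpa using hζ
    exact hne ζ h1.le fun h => by rw [h, norm_one] at h1; exact lt_irrefl _ h1
  intro e he
  have hyv : y ≤ y * (1 + 1 / ℓ ^ 2) := le_mul_of_one_le_right hy.le
    (le_add_of_nonneg_right (by positivity))
  by_cases he1 : e = 1
  · left
    refine le_trans (le_of_eq ?_) hyv
    have e1 : 1 - v = ((2 / (y + 1) : ℝ) : ℂ) := by rw [hv]; push_cast; field_simp; ring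
    rw [he1, poissonKernel, sub_zero, sub_zero, e1, hv, norm_one, Complex.norm_real,
      Complex.norm_real, Real.norm_eq_abs, Real.norm_eq_abs, sq_abs, sq_abs]
    field_simp; ring
  -- the boundary point `E + t` corresponding to `e`
  set t := (Complex.I * ((1 + e) / (1 - e))).re with ht
  have hne1 : 1 - e ≠ 0 := sub_ne_zero.2 (Ne.symm he1)
  have him : (Complex.I * ((1 + e) / (1 - e))).im = 0 := by
    have := cayley_im E e
    rw [cayley, Complex.add_im, Complex.ofReal_im, zero_add, he] at this
    rw [this]; simp
  have htc : Complex.I * ((1 + e) / (1 - e)) = t := by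
    apply Complex.ext
    · simp [ht]
    · rw [him, Complex.ofReal_im]
  have hce : cayley E e = ((E + t : ℝ) : ℂ) := by
    rw [cayley, htc]; push_cast; rfl
  rcases le_or_gt ℓ |t| with hle | hlt
  · left
    have h1 : (1 + e) = -(Complex.I * t) * (1 - e) := by
      rw [← htc]
      have : -(Complex.I * (Complex.I * ((1 + e) / (1 - e)))) = (1 + e) / (1 - e) := by
        rw [← mul_assoc, Complex.I_mul_I]; ring
      rw [this]; field_simp
    have h2 : (e - v) * (1 - Complex.I * t) = -((1 + v : ℂ) + Complex.I * (t * (1 - v))) := by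
      linear_combination h1
    have h3 : ‖e - v‖ ^ 2 * (1 + t ^ 2) =
        ((2 * y / (y + 1)) ^ 2 + (t * (2 / (y + 1))) ^ 2) := by
      have n1 : ‖(1 : ℂ) - Complex.I * t‖ ^ 2 = 1 + t ^ 2 := by
        rw [← Complex.normSq_eq_norm_sq, Complex.normSq_apply]; simp; ring
      have e1 : 1 - v = ((2 / (y + 1) : ℝ) : ℂ) := by rw [hv]; push_cast; field_simp; ring
      have e2 : 1 + v = ((2 * y / (y + 1) : ℝ) : ℂ) := by rw [hv]; push_cast; field_simp; ring
      rw [← n1, ← mul_pow, ← norm_mul, h2, norm_neg, e1, e2, ← Complex.normSq_eq_norm_sq,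
        ← Complex.ofReal_mul, Complex.normSq_apply]
      simp only [Complex.add_re, Complex.add_im, Complex.ofReal_re, Complex.ofReal_im,
        Complex.I_mul_re, Complex.I_mul_im]
      ring
    have hT : 0 < 1 + t ^ 2 := by positivity
    have ht2 : ℓ ^ 2 ≤ t ^ 2 := by rw [← sq_abs t]; gcongr
    have ht0 : 0 < t ^ 2 := lt_of_lt_of_le (by positivity) ht2
    have h4 : ‖e - v‖ ^ 2 = 4 * (y ^ 2 + t ^ 2) / ((y + 1) ^ 2 * (1 + t ^ 2)) := by
      rw [eq_div_iff (by positivity)]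
      calc _ = (y + 1) ^ 2 * (‖e - v‖ ^ 2 * (1 + t ^ 2)) := by ring
        _ = _ := by rw [h3]; field_simp; ring
    have h5 : poissonKernel 0 v e = y * (1 + t ^ 2) / (y ^ 2 + t ^ 2) := by
      rw [poissonKernel, sub_zero, sub_zero, h4, he, hv, Complex.norm_real, Real.norm_eq_abs,
        sq_abs]
      field_simp; ring
    rw [h5, mul_div_assoc]
    gcongr
    calc (1 + t ^ 2) / (y ^ 2 + t ^ 2) ≤ (1 + t ^ 2) / t ^ 2 := by
          gcongr; nlinarith [sq_nonneg y]
      _ = 1 + 1 / t ^ 2 := by rw [add_div, div_self ht0.ne', add_comm]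
      _ ≤ _ := by gcongr
  · right
    refine (h0 (E + t) (by simpa using hlt)).comp ?_
    refine tendsto_nhdsWithin_iff.2 ⟨?_, ?_⟩
    · have hc : ContinuousAt (fun ρ : ℝ => cayley E (ρ * e)) 1 := by
        unfold cayley
        have hc1 : Continuous fun ρ : ℝ => (ρ : ℂ) * e := by fun_prop
        refine continuousAt_const.add (continuousAt_const.mul
          (((hc1.const_add 1).continuousAt).div ((continuous_const.sub hc1).continuousAt) ?_))
        simpa using hne1
      have := hc.tendsto
      rw [Complex.ofReal_one, one_mul, hce] at this
      exact this.mono_left nhdsWithin_le_nhds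
    · filter_upwards [self_mem_nhdsWithin, nhdsWithin_le_nhds (Ioi_mem_nhds (zero_lt_one (α := ℝ)))]
        with ρ h1 h2
      refine hmap _ ?_
      have h2' : (0 : ℝ) < ρ := h2
      rw [mem_ball_zero_iff, norm_mul, he, mul_one, Complex.norm_real, Real.norm_of_nonneg h2'.le]
      exact h1

end gap

/-! ### Large `η`, the bulk, and the neighbourhood of zero -/

section cases
variable {N : ℕ} {τ : ℝ} {σ : Fin N → ℝ} {z w : ℂ}

lemma stableLarge {ζ : ℝ} (hζ : 0 < ζ) (hζ1 : ζ < 1) (h : Par τ σ (‖z‖ ^ 2)) :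
    StableLarge σ z ζ 17 := by
  intro g hg w ⟨hw, h0, h1, h2⟩ δ hδ0 _ hΥ
  refine (strong_stability_m1c h hw (cone_stieltjes hg hw)).trans ?_
  have h3 := sqrt_re_pos hw
  have h4 := sqrt_im_pos hw
  have h5 := re_eq_sqrt w
  have h6 := im_eq_sqrt w
  have h7 : 1 ≤ ζ⁻¹ := (one_le_inv₀ hζ).2 hζ1.le
  set a := (Complex.sqrt w).re
  set b := (Complex.sqrt w).im
  have h8 : a ≤ 3 * b := by
    by_contra! hc
    nlinarith
  have h9 : 1 / 3 ≤ b := by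
    by_contra! hc
    nlinarith
  have h10 : 2 / b ≤ 6 := by rw [div_le_iff₀ h4]; linarith
  have h11 : 1 / b ^ 2 ≤ 9 := by rw [div_le_iff₀ (by positivity)]; nlinarith
  calc _ ≤ (2 + 6 + 9) * δ := by gcongr
    _ = _ := by norm_num

/-- Away from the real axis the equation is locally stable for all `u`. -/
lemma exists_localStable_of_im_ge {c R : ℝ} (hc : 0 < c) (hR : 0 < R) : ∃ C : ℝ, 0 < C ∧
    ∀ (τ : ℝ) (N : ℕ) (σ : Fin N → ℝ) (z : ℂ), Par τ σ (‖z‖ ^ 2) → ∀ w : ℂ, c ≤ w.im →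
      ‖w‖ ≤ R ^ 2 → ∀ θ, LocalStable σ z θ C w :=
  ⟨_, by positivity, fun _ _ _ _ h _ hw hwR _ _ hu _ => strong_stable_uniform h hc hR hw hwR hu⟩

lemma LocalStable.mono {θ θ' C C' : ℝ} (h : LocalStable σ z θ C w) (hθ : θ' ≤ θ) (hC : C ≤ C') :
    LocalStable σ z θ' C' w := fun u hu hle =>
  (h u hu (hle.trans (by gcongr))).trans (by gcongr)

lemma norm_sqrt_le {R : ℝ} (hR : 0 ≤ R) (hw : ‖w‖ ≤ R ^ 2) : ‖Complex.sqrt w‖ ≤ R := by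
  rw [← norm_sqrt_sq] at hw
  exact abs_le_of_sq_le_sq' hw hR |>.2

/-- Stability near zero for `|z| < 1`. -/
lemma exists_stableOn_zero (τ : ℝ) (hτ : 0 < τ) : ∃ τ₀ : ℝ, 0 < τ₀ ∧ ∀ τ' ≤ τ₀,
    ∀ ζ : ℝ, 0 < ζ → ζ < 1 → ∀ ε : ℝ, 0 < ε → ∃ C : ℝ, 0 < C ∧
      ∀ (N : ℕ) (σ : Fin N → ℝ) (z : ℂ), Par τ σ (‖z‖ ^ 2) → ‖z‖ ^ 2 ≤ 1 - τ →
        StableOn σ z ζ (domEdge σ z ζ τ' 0 ∩ {w : ℂ | ε ≤ √‖w‖ + ‖z‖ ^ 2})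
          (fun d => min d 1) C := by
  obtain ⟨r₀, c, hr₀, hc, H1⟩ := exists_im_ge_near_zero τ hτ
  refine ⟨r₀ ^ 2 / 2, by positivity, ?_⟩
  intro τ' hτ' ζ hζ hζ1 ε hε
  set R := 2 * ζ⁻¹ + 1 with hR
  have hR0 : 0 < R := by positivity
  obtain ⟨C₁, hC₁, L1⟩ := exists_localStable_of_im_ge (c := r₀ ^ 2 / 2) (by positivity) hR0
  obtain ⟨κ, hκ, H2⟩ := exists_nice_of_im τ (min c (ε / 4)) R hτ (by positivity) hR0
  obtain ⟨θ, C₂, hθ, hθ1, hC₂, L2⟩ := exists_localStable_of_nice τ κ R hτ hκ hR0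
  obtain ⟨C, hC, H3⟩ := exists_stableOn_of_localStable τ ζ θ (C₁ + C₂)
    (ζ⁻¹ + (10 / τ) ^ 2 + ζ⁻¹ + 1) hτ hζ hζ1 hθ hθ1 (by positivity)
  refine ⟨C, hC, fun N σ z h hq => H3 N σ z h _ (fun w hw => hw.1.1) _ ?_ ?_ ?_⟩
  · rintro w ⟨⟨hw, hE⟩, hε'⟩ w' hw' hre him
    refine ⟨⟨hw', by rw [hre]; exact hE⟩, ?_⟩
    have : ‖w‖ ≤ ‖w'‖ := by
      refine abs_le_of_sq_le_sq' ?_ (norm_nonneg _) |>.2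
      rw [← Complex.normSq_eq_norm_sq, ← Complex.normSq_eq_norm_sq, Complex.normSq_apply,
        Complex.normSq_apply, hre]
      have := hw.1
      nlinarith
    exact le_trans hε' (add_le_add_left (Real.sqrt_le_sqrt this) _)
  · rintro w ⟨⟨hw, hE⟩, hε'⟩ _
    have hw0 := hw.1
    rcases le_or_gt (r₀ ^ 2 / 2) w.im with hi | hi
    · exact (L1 τ N σ z h w hi (dom_norm_le hζ hw) θ).mono le_rfl (by linarith)
    have hwR := norm_sqrt_le hR0.le (dom_norm_le hζ hw)
    have hwr : ‖Complex.sqrt w‖ ≤ r₀ := by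
      refine norm_sqrt_le hr₀.le ?_
      have := Complex.norm_le_abs_re_add_abs_im w
      rw [abs_of_pos hw0] at this
      rw [sub_zero] at hE
      linarith
    have hm := H1 N σ _ h hq _ _ (sol_mm h hw0) (sqrt_re_pos hw0) hwr
    obtain ⟨n, hK⟩ := H2 N σ _ h _ _ (sol_mm h hw0) (sqrt_re_pos hw0)
      ((min_le_left _ _).trans hm) hwR (by
        by_contra! hcon
        obtain ⟨h1, h2, h3⟩ := hcon
        have h4 : min c (ε / 4) ≤ ε / 4 := min_le_right _ _
        have h5 := Complex.norm_le_abs_re_add_abs_im (Complex.sqrt w)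
        rw [abs_of_pos (sqrt_re_pos hw0), abs_of_pos (sqrt_im_pos hw0)] at h5
        have h6 : ε ≤ √‖w‖ + ‖z‖ ^ 2 := hε'
        rw [← norm_sqrt_sq, Real.sqrt_sq (norm_nonneg _)] at h6
        linarith)
    exact (L2 N σ z h w hw0 hwR n hK).mono le_rfl (by linarith)
  · rintro w ⟨⟨hw, _⟩, _⟩ d hd _
    refine ⟨le_min hd zero_le_one, ?_⟩
    have h1 := kappa_le h w.re
    rw [abs_of_nonneg hw.2.1] at h1
    have h2 : min d 1 ≤ 1 := min_le_right _ _
    have h3 := hw.2.2.1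
    have h4 := hw.2.2.2.2
    linarith

lemma norm_m1c_le_of_re (h : Par τ σ (‖z‖ ^ 2)) (hw : 0 < w.im) {x : ℝ} (hx : 0 < x)
    (hwx : x ≤ w.re) : ‖m1c σ z w‖ ≤ (√x)⁻¹ :=
  (norm_m1c_le h hw).trans (inv_anti₀ (Real.sqrt_pos.2 hx)
    ((sqrt_re_ge hw hwx).trans (Complex.re_le_norm _)))

/-- A lower bound on the density gives a lower bound for `Im m` on the whole vertical line. -/
lemma exists_im_ge_of_rho (τ c x₀ X : ℝ) (hτ : 0 < τ) (hc : 0 < c) (hx₀ : 0 < x₀) (hX : 0 < X) :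
    ∃ c' : ℝ, 0 < c' ∧ ∀ (N : ℕ) (σ : Fin N → ℝ) (z : ℂ), Par τ σ (‖z‖ ^ 2) →
      ∀ E, x₀ ≤ E → E ≤ X → c ≤ rho1c σ z E → ∀ y, 0 < y → y ≤ 1 → c' ≤ (mm σ z (vert E y)).im := by
  set c₁ := c * √x₀ / 2 with hc₁
  have hs := Real.sqrt_pos.2 hx₀
  obtain ⟨δ, C, hδ, hC, H⟩ := exists_continuation_of_im τ (min c₁ (√x₀)) (√(X + 1)) hτ
    (by positivity) (by positivity)
  set y₀ := min δ (c₁ / (2 * C)) with hy₀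
  refine ⟨min (c₁ / 2) (y₀ / (2 * √(X + 1))), by positivity, ?_⟩
  intro N σ z h E hE hEX hρ y hy hy1
  have hE0 : 0 < E := hx₀.trans_le hE
  have hR : ∀ t, 0 < t → t ≤ 1 → ‖Complex.sqrt (vert E t)‖ ≤ √(X + 1) := by
    intro t ht ht1
    apply Real.le_sqrt_of_sq_le
    rw [norm_sqrt_sq]
    have h8 := Complex.norm_le_abs_re_add_abs_im (vert E t)
    rw [vert_re, vert_im, abs_of_pos hE0, abs_of_pos ht] at h8
    linarith
  rcases le_or_gt y₀ y with hyy | hyy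
  · refine (min_le_right _ _).trans ?_
    have hw : 0 < (vert E y).im := by simpa using hy
    refine le_trans ?_ ((sqrt_im_ge hw).trans ((sol_mm h hw).r_im_le h))
    have h1 := norm_pos_iff.2 (sqrt_ne hw)
    have h2 := hR y hy hy1
    rw [vert_im]
    gcongr
  · refine (min_le_left _ _).trans ?_
    rcases boundary_dichotomy h hE0 with hd | ⟨M, hM, hd⟩
    · rw [rho1c_eq_zero h hE0 (hd.comp (tendsto_vert E))] at hρ
      linarith
    rw [rho1c_eq hE0 (hd.comp (tendsto_vert E))] at hρ
    have hsE := Real.sqrt_pos.2 hE0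
    have hM1 : c₁ < M.im := by
      have h1 : c * (Real.pi * √E) ≤ M.im := by
        have h2 : 1 / Real.pi * (M.im / √E) * (Real.pi * √E) = M.im := by
          have := Real.pi_pos; field_simp
        rw [← h2]
        have := Real.pi_pos
        gcongr
      have h3 : √x₀ ≤ √E := Real.sqrt_le_sqrt hE
      have h4 : c * (1 * √x₀) ≤ c * (Real.pi * √E) := by
        have := Real.pi_gt_three
        gcongr
        linarith
      have : 0 < c * √x₀ := by positivity
      rw [hc₁]; linarith
    have hv : Tendsto (fun η => (mm σ z (vert E η)).im) (𝓝[>] 0) (𝓝 M.im) :=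
      (Complex.continuous_im.tendsto _).comp (hd.comp (tendsto_vert E))
    have hev : ∀ᶠ η in 𝓝[>] (0 : ℝ), 0 < η ∧ η < y := by
      filter_upwards [self_mem_nhdsWithin, nhdsWithin_le_nhds (Iio_mem_nhds hy)] with η h1 h2
        using ⟨h1, h2⟩
    obtain ⟨η, h1, h2, h3⟩ := ((hv.eventually (lt_mem_nhds hM1)).and hev).exists
    have e : ‖vert E y - vert E η‖ = y - η := by
      have : vert E y - vert E η = ((y - η : ℝ) : ℂ) * Complex.I := by
        simp only [vert]; push_cast; ring
      rw [this, norm_mul, Complex.norm_I, mul_one, Complex.norm_real,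
        Real.norm_of_nonneg (by linarith)]
    have hη : 0 < (vert E η).im := by simpa using h2
    have hyd : y < δ := hyy.trans_le (min_le_left _ _)
    have hyd2 : y < c₁ / (2 * C) := hyy.trans_le (min_le_right _ _)
    have h4 := H N σ z h (vert E η) hη (hR η h2 (by linarith)) ((min_le_left _ _).trans h1.le)
      ((min_le_right _ _).trans (sqrt_re_ge hη (by simpa using hE))) (vert E y)
      (by simpa using hy) (by rw [e]; linarith)
    rw [e] at h4
    have h5 : C * (y - η) ≤ c₁ / 2 := by
      calc _ ≤ C * (c₁ / (2 * C)) := by gcongr; linarith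
        _ = _ := by field_simp
    have h6 := (neg_le_abs _).trans (Complex.abs_im_le_norm (mm σ z (vert E y) - mm σ z (vert E η)))
    rw [Complex.sub_im] at h6
    linarith

/-- Stability in regular bulk components. -/
lemma exists_stableOn_bulk (τ τ' ζ : ℝ) (hτ : 0 < τ) (hτ' : 0 < τ') (hζ : 0 < ζ) (hζ1 : ζ < 1)
    (c : ℝ → ℝ) (hc : ∀ r, 0 < r → 0 < c r) : ∃ C : ℝ, 0 < C ∧
      ∀ (N : ℕ) (σ : Fin N → ℝ) (z : ℂ), Par τ σ (‖z‖ ^ 2) → ∀ a b : ℝ,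
        IsBulkComponent σ z a b → RegularBulk σ z c a b →
          StableOn σ z ζ (domBulk σ z ζ τ' a b) (fun d => d) C := by
  set R := 2 * ζ⁻¹ + 1 with hR
  have hR0 : 0 < R := by positivity
  have hs := Real.sqrt_pos.2 hτ'
  obtain ⟨c', hc', H1⟩ := exists_im_ge_of_rho τ (c τ') τ' ζ⁻¹ hτ (hc τ' hτ') hτ' (by positivity)
  obtain ⟨κ, hκ, H2⟩ := exists_nice_of_im τ (min c' (√τ')) R hτ (by positivity) hR0
  obtain ⟨θ, C₂, hθ, hθ1, hC₂, L2⟩ := exists_localStable_of_nice τ κ R hτ hκ hR0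
  obtain ⟨C, hC, H3⟩ := exists_stableOn_of_localStable τ ζ θ C₂
    (ζ⁻¹ + (10 / τ) ^ 2 + ζ⁻¹ + 2 * (√τ')⁻¹) hτ hζ hζ1 hθ hθ1 hC₂
  refine ⟨C, hC, fun N σ z h a b hab hreg => H3 N σ z h _ (fun w hw => hw.1) _ ?_ ?_ ?_⟩
  · rintro w ⟨_, hE⟩ w' hw' hre _
    exact ⟨hw', by rwa [hre]⟩
  all_goals
    have ha : 0 ≤ a := by
      have h1 : a ∈ connectedComponentIn (supp σ z) a := by
        rw [hab.2]; exact Set.left_mem_Icc.2 hab.1.le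
      exact (supp_subset h (connectedComponentIn_subset _ _ h1)).1
  · rintro w ⟨hw, hE⟩ hw1
    have hw0 := hw.1
    have hEτ : τ' ≤ w.re := by linarith [hE.1]
    have hwR := norm_sqrt_le hR0.le (dom_norm_le hζ hw)
    have hm := H1 N σ z h w.re hEτ hw.2.2.1 (hreg τ' hτ' _ hE) w.im hw0 hw1
    rw [vert_eq] at hm
    obtain ⟨n, hK⟩ := H2 N σ _ h _ _ (sol_mm h hw0) (sqrt_re_pos hw0)
      ((min_le_left _ _).trans hm) hwR (Or.inl ((min_le_right _ _).trans (sqrt_re_ge hw0 hEτ)))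
    exact L2 N σ z h w hw0 hwR n hK
  · rintro w ⟨hw, hE⟩ d hd hd2
    refine ⟨hd, ?_⟩
    have hEτ : τ' ≤ w.re := by linarith [hE.1]
    have h1 := kappa_le h w.re
    rw [abs_of_nonneg hw.2.1] at h1
    have h2 := norm_m1c_le_of_re h hw.1 hτ' hEτ
    have h3 := hw.2.2.1
    have h4 := hw.2.2.2.2
    linarith

end cases

/-! ### Stability outside the spectrum -/

section out
variable {N : ℕ} {τ : ℝ} {σ : Fin N → ℝ} {q : ℝ} {r m : ℂ}

lemma one_sub_K1_le (h : Par τ σ q) : 1 - K1 σ q r m ≤ ‖1 - KK σ q r m r m‖ := by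
  have h1 : ‖KK σ q r m r m‖ ≤ K1 σ q r m := by
    refine abs_le_of_sq_le_sq' ?_ (K1_nonneg h) |>.2
    rw [sq (K1 σ q r m)]
    exact norm_KK_sq_le h
  have h2 := norm_sub_norm_le (1 : ℂ) (KK σ q r m r m)
  rw [norm_one] at h2
  linarith

lemma Sol.norm_bb_le (S : Sol σ q r m) (h : Par τ σ q) {c R : ℝ} (hc : 0 < c) (hm : c ≤ ‖m‖)
    (hr : ‖r‖ ≤ R) (i : Fin N) : ‖bb q (σ i) r m‖ ≤ R + (1 + τ⁻¹) / c + τ⁻¹ / τ := by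
  have hτ := h.tau
  refine (norm_sub_le _ _).trans (add_le_add ((norm_sub_le _ _).trans (add_le_add hr ?_)) ?_)
  · rw [norm_div, Complex.norm_real, Real.norm_of_nonneg h.q0]
    have := h.qhi; gcongr
  · rw [norm_div, Complex.norm_real, Real.norm_of_nonneg (h.spos i).le]
    have := h.hi i; have := S.tau_le_norm_aa h; gcongr

/-- Linear decay of `Im (-1/b)` gives nonsingularity and nondegeneracy. -/
lemma exists_nice_of_decay (τ c R D : ℝ) (hτ : 0 < τ) (hc : 0 < c) (hR : 0 < R) (hD : 0 < D) :
    ∃ κ : ℝ, 0 < κ ∧ ∀ (N : ℕ) (σ : Fin N → ℝ) (q : ℝ), Par τ σ q → ∀ r m, Sol σ q r m →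
      c ≤ ‖m‖ → ‖r‖ ≤ R →
      (∀ i, (bb q (σ i) r m).im ≤ D * r.im * ‖bb q (σ i) r m‖ ^ 2) →
      Nice κ σ q r m ∧ κ ≤ ‖1 - KK σ q r m r m‖ := by
  set M := 1 + R with hM
  set A := M + (1 + τ⁻¹) / c with hA
  set B := R + (1 + τ⁻¹) / c + τ⁻¹ / τ with hB
  have hA0 : 0 < A := by positivity
  have hB0 : 0 < B := by positivity
  set k := τ / A ^ 2 / (D * B ^ 2) with hk
  have hk0 : 0 < k := by positivity
  refine ⟨min (min c τ) (min (1 / √D) k), by positivity, ?_⟩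
  intro N σ q h r m S hm hr hdec
  have hq := h.q0
  have hri := S.r_im
  have hmi := S.m_im
  have haA : ‖aa q m‖ ≤ A := by
    refine (norm_aa_le hq).trans ?_
    have := S.norm_le h
    have := h.qhi
    rw [hA]; gcongr; linarith
  have han := S.tau_le_norm_aa h
  have hb : ∀ i, 1 / √D ≤ ‖bb q (σ i) r m‖ := by
    intro i
    have h1 := le_bb_im (r := r) (m := m) hq (h.spos i).le hmi
    have h2 : 1 ≤ D * ‖bb q (σ i) r m‖ ^ 2 := by
      have h3 : r.im * 1 ≤ r.im * (D * ‖bb q (σ i) r m‖ ^ 2) := by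
        have := hdec i; linarith
      exact le_of_mul_le_mul_left h3 hri
    rw [div_le_iff₀ (Real.sqrt_pos.2 hD)]
    refine abs_le_of_sq_le_sq' ?_ (by positivity) |>.2
    rw [mul_pow, Real.sq_sqrt hD.le]; linarith
  have hN : 0 < N := Nat.pos_of_ne_zero h.N_ne
  have hgap : k ≤ 1 - K1 σ q r m := by
    refine S.sub_le_abs_of_bound h ?_
    set i : Fin N := ⟨0, hN⟩
    have h1 : m.im * (τ / A ^ 2) ≤ (bb q (σ i) r m).im := by
      have hs := h.spos i
      have han0 : 0 < ‖aa q m‖ := hτ.trans_le han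
      have h1 : τ / A ^ 2 ≤ σ i / ‖aa q m‖ ^ 2 := by have := h.lo i; gcongr
      have h2 : σ i / ‖aa q m‖ ^ 2 ≤ σ i / ‖aa q m‖ ^ 2 * (1 + q / ‖m‖ ^ 2) :=
        le_mul_of_one_le_right (by positivity) (le_add_of_nonneg_right (by positivity))
      have h3 : 0 ≤ q / ‖m‖ ^ 2 := by positivity
      rw [bb_im]
      calc _ ≤ m.im * (q / ‖m‖ ^ 2 + σ i / ‖aa q m‖ ^ 2 * (1 + q / ‖m‖ ^ 2)) := by
            gcongr; linarith
        _ ≤ _ := by linarith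
    have h2 := hdec i
    have h3 : ‖bb q (σ i) r m‖ ^ 2 ≤ B ^ 2 := by
      have := S.norm_bb_le h hc hm hr i
      gcongr
    have h4 : m.im * (τ / A ^ 2) ≤ D * r.im * B ^ 2 := by
      refine h1.trans (h2.trans ?_)
      gcongr
    rw [hk, ← mul_div_assoc, div_le_iff₀ (by positivity)]
    linarith
  exact ⟨⟨(min_le_left _ _).trans ((min_le_left _ _).trans hm),
    (min_le_left _ _).trans ((min_le_right _ _).trans han),
    fun i => (min_le_right _ _).trans ((min_le_left _ _).trans (hb i))⟩,
    (min_le_right _ _).trans ((min_le_right _ _).trans (hgap.trans (one_sub_K1_le h)))⟩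

end out

section out'
variable {N : ℕ} {τ : ℝ} {σ : Fin N → ℝ} {z w : ℂ}

/-- Near zero, for `|z| > 1`, the equation is locally stable. -/
lemma localStable_of_small {t₀ : ℝ} (h : Par τ σ (‖z‖ ^ 2)) (hq : 1 + τ ≤ ‖z‖ ^ 2)
    (hK : ∀ u : ℂ, u ≠ 0 → ‖u‖ ≤ t₀ → K1 σ (‖z‖ ^ 2) (Complex.sqrt w) u ≤ 1 - τ / 8)
    (hw : 0 < w.im) (hr : 8 * ‖Complex.sqrt w‖ ≤ τ * t₀) : LocalStable σ z (1 / 2) (8 / τ) w := by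
  intro u hu hle
  have hτ := h.tau
  have hτ1 := h.tau_le_one
  have S := sol_mm h hw
  have hr0 := norm_pos_iff.2 (sqrt_ne hw)
  set r := Complex.sqrt w with hrdef
  set v := r * (1 + u) with hv
  set m := mm σ z w with hm
  have hvi : 0 < v.im := hu.im_pos hw
  have h1 : τ * ‖m‖ ≤ 4 * ‖r‖ := norm_le_mul_of_one_lt S h hq
  have h2 : ‖v - m‖ = ‖r‖ * ‖u - m1c σ z w‖ := norm_sub_m1c u
  have h3 : ‖r‖ * ‖m1c σ z w‖ ≤ ‖m‖ + ‖r‖ := by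
    have : r * m1c σ z w = m - r := by rw [hm, mm]; ring
    rw [← norm_mul, this]; exact norm_sub_le _ _
  have h4 : ‖v‖ ≤ t₀ := by
    have h5 : ‖v - m‖ ≤ 1 / 2 * (2 * ‖r‖ + ‖m‖) := by
      rw [h2]
      calc _ ≤ ‖r‖ * (1 / 2 * (1 + ‖m1c σ z w‖)) := by gcongr
        _ = 1 / 2 * (‖r‖ + ‖r‖ * ‖m1c σ z w‖) := by ring
        _ ≤ _ := by linarith
    have h6 : ‖v‖ ≤ ‖v - m‖ + ‖m‖ := by simpa using norm_add_le (v - m) m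
    have h7 : τ * ‖v‖ ≤ τ * t₀ := by
      have : τ * ‖v‖ ≤ τ * (‖r‖ + 3 / 2 * ‖m‖) := by gcongr; linarith
      nlinarith
    exact le_of_mul_le_mul_left h7 hτ
  have h5 : ‖m‖ ≤ t₀ := by
    have h7 : τ * ‖m‖ ≤ τ * t₀ := by linarith
    exact le_of_mul_le_mul_left h7 hτ
  have h6 := FF_sub (σ := σ) (r := r) (r' := r) (ne_zero_of_im_pos hvi) S.m_ne
    (aa_ne h.q0 hvi) (S.aa_ne h) (fun i => bb_ne h.q0 (h.spos i).le S.r_im hvi) (S.bb_ne h)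
  rw [S.eq, sub_zero, sub_self, zero_mul, sub_zero] at h6
  have h7 : ‖KK σ (‖z‖ ^ 2) r v r m‖ ≤ 1 - τ / 8 := by
    refine abs_le_of_sq_le_sq' ((norm_KK_sq_le h).trans ?_) (by linarith) |>.2
    rw [sq (1 - τ / 8)]
    exact mul_le_mul (hK v (ne_zero_of_im_pos hvi) h4) (hK m S.m_ne h5) (K1_nonneg h) (by linarith)
  have h8 : τ / 8 ≤ ‖1 - KK σ (‖z‖ ^ 2) r v r m‖ := by
    have := norm_sub_norm_le (1 : ℂ) (KK σ (‖z‖ ^ 2) r v r m)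
    rw [norm_one] at this
    linarith
  have h9 : ‖v - m‖ * (τ / 8) ≤ ‖r‖ * ‖Upsilon σ z w u‖ := by
    rw [← norm_FF_eq h hw hu, h6, norm_mul]; gcongr
  rw [h2] at h9
  have h10 : ‖r‖ * (‖u - m1c σ z w‖ * (τ / 8)) ≤ ‖r‖ * ‖Upsilon σ z w u‖ := by linarith
  have h11 := le_of_mul_le_mul_left h10 hr0
  rw [div_mul_eq_mul_div, le_div_iff₀ hτ]
  linarith

/-- The boundary values of `-1/b` are real in gaps of the support. -/
lemma tendsto_inv_bb_im (h : Par τ σ (‖z‖ ^ 2)) {x : ℝ} (hx : 0 < x) (hxs : x ∉ supp σ z)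
    (i : Fin N) : Tendsto (fun w => (-(bb (‖z‖ ^ 2) (σ i) (Complex.sqrt w) (mm σ z w))⁻¹).im)
      (𝓝[{w : ℂ | 0 < w.im}] (x : ℂ)) (𝓝 0) := by
  have hτ := h.tau
  have hd : Tendsto (fun w => (mm σ z w).im) (𝓝[{w : ℂ | 0 < w.im}] (x : ℂ)) (𝓝 0) := by
    rcases boundary_dichotomy h hx with hd | ⟨M, hM, hd⟩
    · exact hd
    · exact absurd (interior_subset (mem_interior_supp h hx hM hd)) hxs
  have hr : Tendsto (fun w => (Complex.sqrt w).im) (𝓝[{w : ℂ | 0 < w.im}] (x : ℂ)) (𝓝 0) := by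
    have := (Complex.continuous_im.tendsto _).comp (tendsto_sqrt hx)
    rwa [Complex.ofReal_im] at this
  set c := τ * (min 1 (√(x / 2))) ^ 2 / 8 with hc
  have hx2 : 0 < x / 2 := by positivity
  have hc0 : 0 < c := by
    have := Real.sqrt_pos.2 hx2
    positivity
  set T := 1 + τ⁻¹ with hT
  set L := T / c ^ 2 + τ⁻¹ / τ ^ 2 * (1 + T / c ^ 2) with hL
  have hlim : Tendsto (fun w => (N / τ) * ((Complex.sqrt w).im + (mm σ z w).im * L))
      (𝓝[{w : ℂ | 0 < w.im}] (x : ℂ)) (𝓝 0) := by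
    have := (hr.add (hd.mul_const L)).const_mul (N / τ)
    simpa using this
  have hre : ∀ᶠ w : ℂ in 𝓝[{w : ℂ | 0 < w.im}] (x : ℂ), x / 2 ≤ w.re := by
    have : Tendsto Complex.re (𝓝[{w : ℂ | 0 < w.im}] (x : ℂ)) (𝓝 x) :=
      (Complex.continuous_re.tendsto (x : ℂ)).mono_left nhdsWithin_le_nhds
    exact this.eventually (le_mem_nhds (half_lt_self hx))
  refine squeeze_zero' ?_ ?_ hlim
  · filter_upwards [self_mem_nhdsWithin] with w hw
    have S := sol_mm (σ := σ) (z := z) h hw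
    rw [Complex.neg_im, inv_im_eq, neg_div, neg_neg]
    have := bb_im_pos h.q0 (h.spos i).le S.r_im S.m_im
    positivity
  · filter_upwards [self_mem_nhdsWithin, hre] with w hw hwre
    have S := sol_mm (σ := σ) (z := z) h hw
    rw [Complex.neg_im, inv_im_eq, neg_div, neg_neg, div_eq_mul_inv, mul_comm, ← one_div]
    have h1 := S.inv_bb_sq_le h i
    have h2 : c ≤ ‖mm σ z w‖ := by
      refine S.norm_ge h (by positivity) (min_le_left _ _) ((min_le_right _ _).trans ?_)
      exact (sqrt_re_ge hw hwre).trans (Complex.re_le_norm _)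
    have h3 := S.tau_le_norm_aa h
    have h5 := h.qhi
    have h6 := h.hi i
    have h7 := h.q0
    have h8 := (h.spos i).le
    have h9 := S.m_im
    have h10 := (bb_im_pos h.q0 (h.spos i).le S.r_im S.m_im).le
    have hT0 : 0 < T := by positivity
    have h11 : ‖z‖ ^ 2 / ‖mm σ z w‖ ^ 2 ≤ T / c ^ 2 := by gcongr
    have h12 : σ i / ‖aa (‖z‖ ^ 2) (mm σ z w)‖ ^ 2 ≤ τ⁻¹ / τ ^ 2 := by gcongr
    refine mul_le_mul h1 ?_ h10 (by positivity)
    rw [bb_im, hL]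
    gcongr

/-- Decay of `Im (-1/b)` above gaps of the support. -/
lemma exists_decay (ℓ R : ℝ) (hℓ : 0 < ℓ) (hR : 0 < R) : ∃ D : ℝ, 0 < D ∧
    ∀ (τ : ℝ) (N : ℕ) (σ : Fin N → ℝ) (z : ℂ), Par τ σ (‖z‖ ^ 2) → ∀ E : ℝ,
      (∀ x, |x - E| < ℓ → 0 < x ∧ x ∉ supp σ z) → ∀ y, 0 < y → y ≤ 1 →
      ‖Complex.sqrt (vert E y)‖ ≤ R → ‖Complex.sqrt (vert E 1)‖ ≤ R → ∀ i,
      (bb (‖z‖ ^ 2) (σ i) (Complex.sqrt (vert E y)) (mm σ z (vert E y))).im ≤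
        D * (Complex.sqrt (vert E y)).im *
          ‖bb (‖z‖ ^ 2) (σ i) (Complex.sqrt (vert E y)) (mm σ z (vert E y))‖ ^ 2 := by
  refine ⟨(1 + 1 / ℓ ^ 2) * (2 * R) * (2 * R), by positivity, ?_⟩
  intro τ N σ z h E hgap y hy hy1 hyR h1R i
  have hτ := h.tau
  -- `g` maps the upper half plane into itself and is bounded, though by a constant depending on
  -- `N`; that constant does not enter the conclusion
  set g : ℂ → ℂ := fun w => -(bb (‖z‖ ^ 2) (σ i) (Complex.sqrt w) (mm σ z w))⁻¹ with hg
  have hdiff : DifferentiableOn ℂ g {w : ℂ | 0 < w.im} := by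
    refine (DifferentiableOn.inv ?_ fun w hw => (sol_mm h hw).bb_ne h i).neg
    unfold bb aa
    have hm := mm_differentiableOn (σ := σ) (z := z) h
    refine (differentiableOn_sqrt_half.sub ((differentiableOn_const _).div hm
      fun w hw => (sol_mm h hw).m_ne)).sub ((differentiableOn_const _).div
      (hm.sub ((differentiableOn_const _).div hm fun w hw => (sol_mm h hw).m_ne))
      fun w hw => (sol_mm h hw).aa_ne h)
  have him : ∀ w : ℂ, 0 < w.im → (g w).im =
      (bb (‖z‖ ^ 2) (σ i) (Complex.sqrt w) (mm σ z w)).im /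
        ‖bb (‖z‖ ^ 2) (σ i) (Complex.sqrt w) (mm σ z w)‖ ^ 2 := by
    intro w hw
    rw [hg, Complex.neg_im, inv_im_eq, neg_div, neg_neg]
  have hy' : 0 < (vert E y).im := by simpa using hy
  have h1' : 0 < (vert E 1).im := by simp
  have key := im_le_of_gap (g := g) hdiff (fun w hw => by
      rw [him w hw]
      have := bb_im_pos h.q0 (h.spos i).le (sol_mm (σ := σ) (z := z) h hw).r_im (sol_mm h hw).m_im
      positivity) (B := √(N / τ)) (fun w hw => by
      apply Real.le_sqrt_of_sq_le
      have := (sol_mm (σ := σ) (z := z) h hw).inv_bb_sq_le h i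
      rw [one_div] at this
      rwa [hg, norm_neg, norm_inv, inv_pow]) hℓ (E := E) (fun x hx =>
        tendsto_inv_bb_im h (hgap x hx).1 (hgap x hx).2 i) hy
  have hb1 : (g (vert E 1)).im ≤ 2 * R := by
    have S := sol_mm (σ := σ) (z := z) h h1'
    refine ((le_abs_self _).trans (Complex.abs_im_le_norm _)).trans ?_
    rw [hg, norm_neg, norm_inv]
    refine (norm_inv_bb_le h.q0 (h.spos i).le S.r_im S.m_im).trans ?_
    have h2 := sqrt_im_ge h1'
    rw [vert_im] at h2
    have h3 : 1 / (2 * R) ≤ (Complex.sqrt (vert E 1)).im := by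
      refine le_trans ?_ h2
      have := norm_pos_iff.2 (sqrt_ne h1')
      gcongr
    rw [inv_le_comm₀ S.r_im (by positivity), ← one_div]
    exact h3
  have hyr : y ≤ 2 * R * (Complex.sqrt (vert E y)).im := by
    have h2 := sqrt_im_ge hy'
    rw [vert_im, div_le_iff₀ (by have := norm_pos_iff.2 (sqrt_ne hy'); positivity)] at h2
    have h3 := sqrt_im_pos hy'
    nlinarith
  rw [him _ hy'] at key
  have hbpos := norm_pos_iff.2 ((sol_mm (σ := σ) (z := z) h hy').bb_ne h i)
  rw [div_le_iff₀ (by positivity)] at key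
  refine key.trans (mul_le_mul_of_nonneg_right ?_ (by positivity))
  have hi0 := sqrt_im_pos hy'
  calc y * (1 + 1 / ℓ ^ 2) * (g (vert E 1)).im ≤ y * (1 + 1 / ℓ ^ 2) * (2 * R) := by gcongr
    _ ≤ (2 * R * (Complex.sqrt (vert E y)).im) * (1 + 1 / ℓ ^ 2) * (2 * R) := by gcongr
    _ = _ := by ring

/-- Stability outside the spectrum. -/
lemma exists_stableOn_out (τ τ' ζ : ℝ) (hτ : 0 < τ) (hτ' : 0 < τ') (hζ : 0 < ζ) (hζ1 : ζ < 1) :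
    ∃ C : ℝ, 0 < C ∧ ∀ (N : ℕ) (σ : Fin N → ℝ) (z : ℂ), Par τ σ (‖z‖ ^ 2) →
      StableOn σ z ζ (domOut σ z ζ τ') (fun d => d) C := by
  obtain ⟨cz, hcz, Hz⟩ := exists_supp_near_zero τ hτ
  obtain ⟨t₀, ht₀, Ht⟩ := exists_K1_le_near_zero τ hτ
  set s := min t₀ (τ * t₀ / 8) with hs
  have hs0 : 0 < s := by positivity
  set e := min cz (s ^ 2 / 2) with he
  have he0 : 0 < e := by positivity
  set ℓ := min τ' e / 2 with hℓ
  have hℓ0 : 0 < ℓ := by positivity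
  set R := 2 * ζ⁻¹ + 2 with hR
  have hR0 : 0 < R := by positivity
  obtain ⟨C₁, hC₁, L1⟩ := exists_localStable_of_im_ge (c := s ^ 2 / 2) (by positivity) hR0
  obtain ⟨D, hD, HD⟩ := exists_decay ℓ R hℓ0 hR0
  have hse := Real.sqrt_pos.2 he0
  obtain ⟨κ, hκ, H2⟩ := exists_nice_of_decay τ (τ * (min 1 (√e)) ^ 2 / 8) R D hτ (by positivity)
    hR0 hD
  obtain ⟨θ, C₂, hθ, hθ1, hC₂, L2⟩ := exists_localStable_of_nice τ κ R hτ hκ hR0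
  obtain ⟨C, hC, H3⟩ := exists_stableOn_of_localStable τ ζ θ (C₁ + C₂ + 8 / τ)
    (ζ⁻¹ + (10 / τ) ^ 2 + ζ⁻¹ + 2 * (4 / τ + 1 + (√cz)⁻¹)) hτ hζ hζ1 hθ hθ1 (by positivity)
  refine ⟨C, hC, fun N σ z h => H3 N σ z h _ (fun w hw => hw.1) _ ?_ ?_ ?_⟩
  · rintro w ⟨_, hE⟩ w' hw' hre _
    exact ⟨hw', by rwa [hre]⟩
  all_goals
    -- for `|z| < 1` a neighbourhood of zero belongs to the support, so the domain avoids it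
    have hfar : ∀ w ∈ domOut σ z ζ τ', ‖z‖ ^ 2 ≤ 1 - τ → cz < w.re := by
      rintro w ⟨hw, hE⟩ hq
      by_contra! hle
      have : w.re ∈ supp σ z := ((Hz N σ z h).1 hq).1 ⟨hw.2.1, hle⟩
      rw [Metric.infDist_zero_of_mem this] at hE
      linarith
  · intro w hwo hw1
    have hw := hwo.1
    have hw0 := hw.1
    have hτ8 : 0 < 8 / τ := by positivity
    have hζ' : 0 < ζ⁻¹ := by positivity
    have hwn : ‖w‖ ≤ R ^ 2 := (dom_norm_le hζ hw).trans (by gcongr; linarith)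
    rcases le_or_gt (s ^ 2 / 2) w.im with hi | hi
    · exact (L1 τ N σ z h w hi hwn θ).mono le_rfl (by linarith)
    have hwR := norm_sqrt_le hR0.le hwn
    rcases le_or_gt w.re e with hEe | hEe
    · -- close to zero, which is only possible for `|z| > 1`
      have hq : 1 + τ ≤ ‖z‖ ^ 2 := by
        rcases le_abs'.1 h.qgap with hq | hq
        · have := hfar w hwo (by linarith)
          have : e ≤ cz := min_le_left _ _
          linarith
        · linarith
      have hws : ‖Complex.sqrt w‖ ≤ s := by
        refine norm_sqrt_le hs0.le ?_
        have := Complex.norm_le_abs_re_add_abs_im w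
        rw [abs_of_pos hw0, abs_of_nonneg hw.2.1] at this
        have : e ≤ s ^ 2 / 2 := min_le_right _ _
        linarith
      have h1 : s ≤ t₀ := min_le_left _ _
      have h2 : s ≤ τ * t₀ / 8 := min_le_right _ _
      exact (localStable_of_small h hq (fun u hu hut => Ht N σ _ h hq _ u hu hut (hws.trans h1))
        hw0 (by linarith)).mono hθ1 (by linarith)
    · have hgap : ∀ x, |x - w.re| < ℓ → 0 < x ∧ x ∉ supp σ z := by
        intro x hx
        have h1 : ℓ ≤ e / 2 := by rw [hℓ]; gcongr; exact min_le_right _ _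
        have h2 : ℓ ≤ τ' / 2 := by rw [hℓ]; gcongr; exact min_le_left _ _
        refine ⟨by have := (abs_lt.1 hx).1; linarith, fun hxs => ?_⟩
        have h3 := Metric.infDist_le_dist_of_mem (x := w.re) hxs
        rw [dist_comm, Real.dist_eq] at h3
        have := hwo.2
        linarith
      have h1R : ‖Complex.sqrt (vert w.re 1)‖ ≤ R := by
        refine norm_sqrt_le hR0.le ?_
        have := Complex.norm_le_abs_re_add_abs_im (vert w.re 1)
        rw [vert_re, vert_im, abs_one, abs_of_nonneg hw.2.1] at this
        have := hw.2.2.1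
        rw [hR]
        nlinarith
      have hdec := HD τ N σ z h w.re hgap w.im hw0 hw1 (by rwa [vert_eq]) h1R
      rw [vert_eq] at hdec
      have hm := (sol_mm (σ := σ) (z := z) h hw0).norm_ge h (c := min 1 (√e)) (by positivity)
        (min_le_left _ _) ((min_le_right _ _).trans
          ((sqrt_re_ge hw0 hEe.le).trans (Complex.re_le_norm _)))
      obtain ⟨n, hK⟩ := H2 N σ _ h _ _ (sol_mm h hw0) hm hwR hdec
      exact (L2 N σ z h w hw0 hwR n hK).mono le_rfl (by linarith)
  · intro w hwo d hd hd2
    refine ⟨hd, ?_⟩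
    have hw := hwo.1
    have h1 := kappa_le h w.re
    rw [abs_of_nonneg hw.2.1] at h1
    have hcs : 0 < (√cz)⁻¹ := by have := Real.sqrt_pos.2 hcz; positivity
    have h2 : ‖m1c σ z w‖ ≤ 4 / τ + 1 + (√cz)⁻¹ := by
      have hτ4 : 0 < 4 / τ := by positivity
      rcases le_abs'.1 h.qgap with hq | hq
      · have := norm_m1c_le_of_re h hw.1 hcz (hfar w hwo (by linarith)).le
        linarith
      · have h3 := norm_le_mul_of_one_lt (sol_mm (σ := σ) (z := z) h hw.1) h (by linarith)
        have hr := norm_pos_iff.2 (sqrt_ne hw.1)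
        have h4 : ‖m1c σ z w‖ ≤ 4 / τ + 1 := by
          rw [m1c_eq hw.1, norm_div, div_le_iff₀ hr]
          have h5 : ‖mm σ z w‖ ≤ 4 / τ * ‖Complex.sqrt w‖ := by
            rw [div_mul_eq_mul_div, le_div_iff₀ hτ]; linarith
          have := norm_sub_le (mm σ z w) (Complex.sqrt w)
          linarith
        linarith
    have h3 := hw.2.2.1
    have h4 := hw.2.2.2.2
    linarith

end out'

/-! ### Square root behaviour near a degenerate solution -/

/-- Second order Taylor expansion of differences, at a critical point of a bounded holomorphic
function. -/
lemma norm_sub_sub_le_of_deriv_eq_zero {R B : ℝ} (hR : 0 < R) {G : ℂ → ℂ} {M : ℂ}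
    (hG : DifferentiableOn ℂ G (Metric.ball M R)) (hB : ∀ x ∈ Metric.ball M R, ‖G x‖ ≤ B)
    (h1 : deriv G M = 0) {v m : ℂ} (hv : ‖v - M‖ ≤ R / 4) (hm : ‖m - M‖ ≤ R / 4) :
    ‖G v - G m - iteratedDeriv 2 G M / 2 * ((v - m) * ((v - M) + (m - M)))‖ ≤
      6 * B / (R / 4) ^ 3 * (‖v - m‖ * (‖v - M‖ + ‖m - M‖) ^ 2) := by
  set K := 6 * B / (R / 4) ^ 3 with hK
  have hG1 := hG.deriv Metric.isOpen_ball
  have hG2 := hG1.deriv Metric.isOpen_ball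
  have e2 : iteratedDeriv 2 G M = deriv (deriv G) M := by
    rw [iteratedDeriv_succ, iteratedDeriv_one]
  have hMR : ∀ ρ ≤ R / 4, ∀ x ∈ Metric.closedBall M ρ, x ∈ Metric.ball M R := by
    intro ρ hρ x hx
    rw [Metric.mem_closedBall] at hx
    rw [Metric.mem_ball]; linarith
  have d3 : ∀ x ∈ Metric.closedBall M (R / 4), ‖deriv (deriv (deriv G)) x‖ ≤ K := by
    intro x hx
    have e3 : iteratedDeriv 3 G x = deriv (deriv (deriv G)) x := by
      rw [iteratedDeriv_succ, iteratedDeriv_succ, iteratedDeriv_one]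
    have hsub : Metric.closedBall x (R / 4) ⊆ Metric.ball M R := by
      intro y hy
      rw [Metric.mem_closedBall] at hx hy
      rw [Metric.mem_ball]
      have := dist_triangle y x M
      linarith
    have := Complex.norm_iteratedDeriv_le_of_forall_mem_sphere_norm_le 3 (by positivity : 0 < R / 4)
      (f := G) (c := x) (C := B) ((hG.mono hsub).diffContOnCl_ball subset_rfl)
      (fun y hy => hB y (hsub (Metric.sphere_subset_closedBall hy)))
    rw [e3] at this
    refine this.trans (le_of_eq ?_)
    rw [hK]; norm_num [Nat.factorial]
  have hat : ∀ {H : ℂ → ℂ}, DifferentiableOn ℂ H (Metric.ball M R) → ∀ ρ ≤ R / 4,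
      ∀ x ∈ Metric.closedBall M ρ, DifferentiableAt ℂ H x := fun hH ρ hρ x hx =>
    hH.differentiableAt (Metric.isOpen_ball.mem_nhds (hMR ρ hρ x hx))
  have b2 : ∀ x ∈ Metric.closedBall M (R / 4), ‖deriv (deriv G) x - deriv (deriv G) M‖ ≤
      K * ‖x - M‖ := fun x hx =>
    (convex_closedBall M (R / 4)).norm_image_sub_le_of_norm_deriv_le (hat hG2 _ le_rfl) d3
      (Metric.mem_closedBall_self (by positivity)) hx
  have b1 : ∀ x ∈ Metric.closedBall M (R / 4), ‖deriv G x - deriv (deriv G) M * (x - M)‖ ≤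
      K * ‖x - M‖ * ‖x - M‖ := by
    intro x hx
    have hρ : ‖x - M‖ ≤ R / 4 := mem_closedBall_iff_norm.1 hx
    have hdiff : ∀ y ∈ Metric.closedBall M ‖x - M‖, HasDerivAt
        (fun y => deriv G y - deriv (deriv G) M * (y - M))
        (deriv (deriv G) y - deriv (deriv G) M) y := by
      intro y hy
      have := (hat hG1 _ hρ y hy).hasDerivAt.sub
        (((hasDerivAt_id y).sub_const M).const_mul (deriv (deriv G) M))
      exact this.congr_deriv (by simp)
    have := (convex_closedBall M ‖x - M‖).norm_image_sub_le_of_norm_hasDerivWithin_le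
      (fun y hy => (hdiff y hy).hasDerivWithinAt) (C := K * ‖x - M‖) (fun y hy => ?_)
      (Metric.mem_closedBall_self (norm_nonneg _)) (mem_closedBall_iff_norm.2 le_rfl : x ∈ _)
    · simpa [h1] using this
    · have h2 : ‖y - M‖ ≤ ‖x - M‖ := mem_closedBall_iff_norm.1 hy
      have hK0 : 0 ≤ K := (norm_nonneg _).trans (d3 x hx)
      refine (b2 y (mem_closedBall_iff_norm.2 (h2.trans hρ))).trans ?_
      gcongr
  set ρ := ‖v - M‖ + ‖m - M‖ with hρ
  have hK0 : 0 ≤ K := (norm_nonneg _).trans (d3 M (Metric.mem_closedBall_self (by positivity)))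
  have hdiff : ∀ y ∈ segment ℝ m v, ‖y - M‖ ≤ ρ ∧ ‖y - M‖ ≤ R / 4 := by
    intro y hy
    constructor
    · have hc := (convex_closedBall M ρ).segment_subset
        (mem_closedBall_iff_norm.2 (by rw [hρ]; linarith [norm_nonneg (v - M)]) : m ∈ _)
        (mem_closedBall_iff_norm.2 (by rw [hρ]; linarith [norm_nonneg (m - M)]) : v ∈ _) hy
      exact mem_closedBall_iff_norm.1 hc
    · exact mem_closedBall_iff_norm.1 ((convex_closedBall M (R / 4)).segment_subset
        (mem_closedBall_iff_norm.2 hm) (mem_closedBall_iff_norm.2 hv) hy)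
  have := (convex_segment m v).norm_image_sub_le_of_norm_hasDerivWithin_le
    (f := fun y => G y - deriv (deriv G) M / 2 * (y - M) ^ 2)
    (f' := fun y => deriv G y - deriv (deriv G) M * (y - M)) (C := K * ρ ^ 2)
    (fun y hy => HasDerivAt.hasDerivWithinAt (by
      have h2 := (hat hG _ le_rfl y (mem_closedBall_iff_norm.2 (hdiff y hy).2)).hasDerivAt.sub
        ((((hasDerivAt_id y).sub_const M).pow 2).const_mul (deriv (deriv G) M / 2))
      refine h2.congr_deriv ?_
      simp only [id]; push_cast; ring))
    (fun y hy => (b1 y (mem_closedBall_iff_norm.2 (hdiff y hy).2)).trans (by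
      have := (hdiff y hy).1
      rw [mul_assoc, ← sq]
      gcongr)) (left_mem_segment ℝ m v) (right_mem_segment ℝ m v)
  rw [e2]
  calc _ = ‖(G v - deriv (deriv G) M / 2 * (v - M) ^ 2) -
        (G m - deriv (deriv G) M / 2 * (m - M) ^ 2)‖ := by congr 1; ring
    _ ≤ K * ρ ^ 2 * ‖v - m‖ := this
    _ = _ := by ring

section expansion
variable {N : ℕ} {τ : ℝ} {σ : Fin N → ℝ} {q κ : ℝ} {r m r' m' : ℂ}

lemma FF_differentiableAt (hm : m ≠ 0) (ha : aa q m ≠ 0) (hb : ∀ i, bb q (σ i) r m ≠ 0) :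
    DifferentiableAt ℂ (FF σ q r) m := by
  have h1 : DifferentiableAt ℂ (aa q) m := by
    unfold aa; exact differentiableAt_id.sub ((differentiableAt_const _).div differentiableAt_id hm)
  have h2 : ∀ i, DifferentiableAt ℂ (bb q (σ i) r) m := fun i => by
    unfold bb
    exact ((differentiableAt_const _).sub ((differentiableAt_const _).div differentiableAt_id
      hm)).sub ((differentiableAt_const _).div h1 ha)
  unfold FF avg
  refine (differentiableAt_id.sub (differentiableAt_const _)).add
    ((differentiableAt_const _).mul ?_)
  exact DifferentiableAt.fun_sum fun i _ => (differentiableAt_const _).div (h2 i) (hb i)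

/-- The change of the average of `σ / (b(r₁, ·) b(r₂, ·))` in the second argument. -/
lemma exists_avg_lipschitz (τ κ : ℝ) (hτ : 0 < τ) (hκ : 0 < κ) : ∃ L : ℝ, 0 < L ∧
    ∀ (N : ℕ) (σ : Fin N → ℝ) (q : ℝ), Par τ σ q → ∀ r₁ r₂ v m,
      Nice κ σ q r₁ v → Nice κ σ q r₂ v → Nice κ σ q r₁ m → Nice κ σ q r₂ m →
      ‖(avg fun i => (σ i : ℂ) * ((bb q (σ i) r₁ v)⁻¹ * (bb q (σ i) r₂ v)⁻¹)) -
        avg fun i => (σ i : ℂ) * ((bb q (σ i) r₁ m)⁻¹ * (bb q (σ i) r₂ m)⁻¹)‖ ≤ L * ‖v - m‖ := by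
  set T := 1 + τ⁻¹ with hT
  have hT0 : 0 < T := by positivity
  set H := (κ⁻¹) ^ 2 with hH
  have hH0 : 0 < H := by positivity
  set P := T * H + T * H * (1 + T * H) with hP
  have hP0 : 0 < P := by positivity
  refine ⟨T * (2 * (P * H * κ⁻¹)), by positivity, ?_⟩
  intro N σ q h r₁ r₂ v m n1 n2 n3 n4
  have inv2 : ∀ x y : ℂ, κ ≤ ‖x‖ → κ ≤ ‖y‖ → ‖x⁻¹ * y⁻¹‖ ≤ H := by
    intro x y hx hy
    rw [norm_mul, norm_inv, norm_inv, hH, sq]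
    gcongr
  have hq : ‖(q : ℂ)‖ ≤ T := by
    rw [Complex.norm_real, Real.norm_of_nonneg h.q0]; exact h.qhi
  have hs : ∀ i, ‖(σ i : ℂ)‖ ≤ T := by
    intro i
    rw [Complex.norm_real, Real.norm_of_nonneg (h.spos i).le]
    have := h.hi i; linarith
  have bdiff : ∀ r, Nice κ σ q r v → Nice κ σ q r m → ∀ i,
      ‖(bb q (σ i) r v)⁻¹ - (bb q (σ i) r m)⁻¹‖ ≤ P * H * ‖v - m‖ := by
    intro r nv nm i
    have hb := nv.b_ne hκ i
    have hb' := nm.b_ne hκ i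
    have e : (bb q (σ i) r v)⁻¹ - (bb q (σ i) r m)⁻¹ =
        -(bb q (σ i) r v - bb q (σ i) r m) * ((bb q (σ i) r v)⁻¹ * (bb q (σ i) r m)⁻¹) := by
      field_simp; ring
    rw [e, bb_sub (nv.m_ne hκ) (nm.m_ne hκ) (nv.a_ne hκ) (nm.a_ne hκ), sub_self, zero_add, norm_mul,
      norm_neg, norm_mul]
    have hqY : ‖(q : ℂ) * (v⁻¹ * m⁻¹)‖ ≤ T * H := by
      rw [norm_mul]; have := inv2 _ _ nv.m_ge nm.m_ge; gcongr
    have h1qY : ‖1 + (q : ℂ) * (v⁻¹ * m⁻¹)‖ ≤ 1 + T * H := by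
      refine (norm_add_le _ _).trans ?_
      rw [norm_one]; gcongr
    have hsa : ‖(σ i : ℂ) * ((aa q v)⁻¹ * (aa q m)⁻¹)‖ ≤ T * H := by
      rw [norm_mul]; have := inv2 _ _ nv.a_ge nm.a_ge; have := hs i; gcongr
    have h3 : ‖(q : ℂ) * (v⁻¹ * m⁻¹) +
        σ i * ((aa q v)⁻¹ * (aa q m)⁻¹) * (1 + q * (v⁻¹ * m⁻¹))‖ ≤ P := by
      refine (norm_add_le _ _).trans (add_le_add hqY ?_)
      rw [norm_mul]; gcongr
    calc _ ≤ ‖v - m‖ * P * H := by have := inv2 _ _ (nv.b_ge i) (nm.b_ge i); gcongr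
      _ = _ := by ring
  rw [← avg_sub]
  refine (norm_avg_le _).trans ((avg_mono (y := fun _ => T * (2 * (P * H * κ⁻¹)) * ‖v - m‖)
    fun i => ?_).trans (le_of_eq (avg_const h.N_ne _)))
  have e : (σ i : ℂ) * ((bb q (σ i) r₁ v)⁻¹ * (bb q (σ i) r₂ v)⁻¹) -
      σ i * ((bb q (σ i) r₁ m)⁻¹ * (bb q (σ i) r₂ m)⁻¹) =
      σ i * (((bb q (σ i) r₁ v)⁻¹ - (bb q (σ i) r₁ m)⁻¹) * (bb q (σ i) r₂ v)⁻¹ +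
        (bb q (σ i) r₁ m)⁻¹ * ((bb q (σ i) r₂ v)⁻¹ - (bb q (σ i) r₂ m)⁻¹)) := by ring
  rw [e, norm_mul]
  have hinv : ∀ x : ℂ, κ ≤ ‖x‖ → ‖x⁻¹‖ ≤ κ⁻¹ := fun x hx => by
    rw [norm_inv]; gcongr
  calc _ ≤ T * ((P * H * ‖v - m‖) * κ⁻¹ + κ⁻¹ * (P * H * ‖v - m‖)) := by
        have := hs i
        gcongr
        refine (norm_add_le _ _).trans ?_
        rw [norm_mul, norm_mul]
        have := bdiff r₁ n1 n3 i
        have := bdiff r₂ n2 n4 i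
        have := hinv _ (n2.b_ge i)
        have := hinv _ (n3.b_ge i)
        gcongr
    _ = _ := by ring

/-- Expansion of the equation near a degenerate solution `(r₀, M)`. -/
lemma exists_expansion (τ κ : ℝ) (hτ : 0 < τ) (hκ : 0 < κ) : ∃ c C : ℝ, 0 < c ∧ 0 < C ∧
    ∀ (N : ℕ) (σ : Fin N → ℝ) (q : ℝ), Par τ σ q → ∀ r₀ M, Nice κ σ q r₀ M → FF σ q r₀ M = 0 →
      KK σ q r₀ M r₀ M = 1 →
      ∀ r v m, ‖r - r₀‖ ≤ c → ‖v - M‖ ≤ c → ‖m - M‖ ≤ c →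
        ‖FF σ q r v - FF σ q r m -
          iteratedDeriv 2 (FF σ q r₀) M / 2 * ((v - m) * ((v - M) + (m - M)))‖ ≤
          C * (‖v - m‖ * ((‖v - M‖ + ‖m - M‖) ^ 2 + ‖r - r₀‖)) := by
  obtain ⟨c, L, hc, hL, H⟩ := exists_kernel_lipschitz τ κ hτ hκ
  obtain ⟨L', hL', H'⟩ := exists_avg_lipschitz τ (κ / 2) hτ (by positivity)
  refine ⟨c / 4, 6 * (c * (L * c)) / (c / 4) ^ 3 + L', by positivity, by positivity, ?_⟩
  intro N σ q h r₀ M n h0 hK r v m hr hv hm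
  have hκ2 : 0 < κ / 2 := by positivity
  have hz : ‖r₀ - r₀‖ ≤ 0 := by simp
  have hz' : ‖M - M‖ ≤ 0 := by simp
  have nice : ∀ r' v', ‖r' - r₀‖ ≤ c → ‖v' - M‖ ≤ c → Nice (κ / 2) σ q r' v' := fun r' v' hr' hv' =>
    (H N σ q h r₀ M n c le_rfl r' v' r₀ M hr' hv' (hz.trans hc.le) (hz'.trans hc.le)).1
  -- as `KK = 1` at `(r₀, M)`, the equation vanishes to second order in `m` there
  have bound : ∀ x, ‖x - M‖ ≤ c → ‖FF σ q r₀ x‖ ≤ ‖x - M‖ * (L * ‖x - M‖) := by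
    intro x hx
    have n' := nice r₀ x (hz.trans hc.le) hx
    have h1 := FF_sub (σ := σ) (q := q) (r := r₀) (r' := r₀) (n'.m_ne hκ2) (n.m_ne hκ) (n'.a_ne hκ2)
      (n.a_ne hκ) (n'.b_ne hκ2) (n.b_ne hκ)
    rw [h0, sub_zero, sub_self, zero_mul, sub_zero] at h1
    rw [h1, norm_mul]
    obtain ⟨-, k, -⟩ := H N σ q h r₀ M n ‖x - M‖ hx r₀ x r₀ M (hz.trans (norm_nonneg _)) le_rfl
      (hz.trans (norm_nonneg _)) (hz'.trans (norm_nonneg _))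
    rw [hK, norm_sub_rev] at k
    gcongr
  have hdiff : DifferentiableOn ℂ (FF σ q r₀) (Metric.ball M c) := by
    intro x hx
    have n' := nice r₀ x (hz.trans hc.le) (mem_ball_iff_norm.1 hx).le
    exact (FF_differentiableAt (n'.m_ne hκ2) (n'.a_ne hκ2) (n'.b_ne hκ2)).differentiableWithinAt
  have hder : deriv (FF σ q r₀) M = 0 := by
    refine HasDerivAt.deriv ?_
    rw [hasDerivAt_iff_isLittleO]
    have hO : (fun x => FF σ q r₀ x - FF σ q r₀ M - (x - M) • (0 : ℂ)) =O[𝓝 M]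
        fun x => ‖x - M‖ ^ 2 := by
      refine Asymptotics.IsBigO.of_bound L ?_
      filter_upwards [Metric.closedBall_mem_nhds M hc] with x hx
      rw [h0, sub_zero, smul_zero, sub_zero, norm_pow, norm_norm]
      refine (bound x (mem_closedBall_iff_norm.1 hx)).trans (le_of_eq (by ring))
    exact hO.trans_isLittleO (Asymptotics.isLittleO_pow_sub_sub M one_lt_two)
  have key := norm_sub_sub_le_of_deriv_eq_zero hc hdiff (B := c * (L * c)) (fun x hx => by
    have := (mem_ball_iff_norm.1 hx).le
    refine (bound x this).trans ?_
    gcongr) hder hv hm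
  have hc4 : c / 4 ≤ c := by linarith
  have nv := nice r v (hr.trans hc4) (hv.trans hc4)
  have nm := nice r m (hr.trans hc4) (hm.trans hc4)
  have nv0 := nice r₀ v (hz.trans hc.le) (hv.trans hc4)
  have nm0 := nice r₀ m (hz.trans hc.le) (hm.trans hc4)
  have ev := FF_sub (σ := σ) (q := q) (r := r) (r' := r₀) (nv.m_ne hκ2) (nv.m_ne hκ2) (nv.a_ne hκ2)
    (nv.a_ne hκ2) (nv.b_ne hκ2) (nv0.b_ne hκ2)
  have em := FF_sub (σ := σ) (q := q) (r := r) (r' := r₀) (nm.m_ne hκ2) (nm.m_ne hκ2) (nm.a_ne hκ2)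
    (nm.a_ne hκ2) (nm.b_ne hκ2) (nm0.b_ne hκ2)
  have ha := H' N σ q h r r₀ v m nv nv0 nm nm0
  set Av := avg fun i => (σ i : ℂ) * ((bb q (σ i) r v)⁻¹ * (bb q (σ i) r₀ v)⁻¹)
  set Am := avg fun i => (σ i : ℂ) * ((bb q (σ i) r m)⁻¹ * (bb q (σ i) r₀ m)⁻¹)
  set β := iteratedDeriv 2 (FF σ q r₀) M / 2
  have e : FF σ q r v - FF σ q r m - β * ((v - m) * ((v - M) + (m - M))) =
      (FF σ q r₀ v - FF σ q r₀ m - β * ((v - m) * ((v - M) + (m - M)))) -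
        (r - r₀) * (Av - Am) := by
    linear_combination ev - em
  rw [e]
  refine (norm_sub_le _ _).trans ?_
  rw [norm_mul]
  set K := 6 * (c * (L * c)) / (c / 4) ^ 3
  have hK0 : 0 ≤ K := by positivity
  have p1 : ‖r - r₀‖ * ‖Av - Am‖ ≤ ‖r - r₀‖ * (L' * ‖v - m‖) := by gcongr
  have p2 : 0 ≤ K * (‖v - m‖ * ‖r - r₀‖) := by positivity
  have p3 : 0 ≤ L' * (‖v - m‖ * (‖v - M‖ + ‖m - M‖) ^ 2) := by positivity
  nlinarith [key, p1, p2, p3]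

end expansion

/-- Near a degenerate solution `(r₀, M)` with nonzero second derivative, solutions have square root
behaviour. -/
lemma exists_sqrt_behaviour (τ κ ε : ℝ) (hτ : 0 < τ) (hκ : 0 < κ) (hε : 0 < ε) :
    ∃ c C : ℝ, 0 < c ∧ 0 < C ∧
    ∀ (N : ℕ) (σ : Fin N → ℝ) (q : ℝ), Par τ σ q → ∀ r₀ M, Nice κ σ q r₀ M → FF σ q r₀ M = 0 →
      KK σ q r₀ M r₀ M = 1 →
      0 ≤ (avg fun i => (σ i : ℂ) * ((bb q (σ i) r₀ M)⁻¹ * (bb q (σ i) r₀ M)⁻¹)).re →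
      ε ≤ ‖iteratedDeriv 2 (FF σ q r₀) M‖ →
      ∀ r m, ‖r - r₀‖ ≤ c → ‖m - M‖ ≤ c → FF σ q r m = 0 →
        ‖m - M‖ ^ 2 ≤ C * ‖r - r₀‖ ∧ ‖r - r₀‖ ≤ C * ‖m - M‖ ^ 2 := by
  obtain ⟨c₁, C₁, hc₁, hC₁, H1⟩ := exists_expansion τ κ hτ hκ
  obtain ⟨c₂, L, hc₂, hL, H2⟩ := exists_kernel_lipschitz τ κ hτ hκ
  set b := ε / 2 with hb
  have hb0 : 0 < b := by positivity
  set c := min (min c₁ (c₂ / 2)) (min (1 / (4 * L)) (min 1 (b / (2 * C₁)))) with hc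
  have hc0 : 0 < c := by positivity
  have hcc1 : c ≤ c₁ := (min_le_left _ _).trans (min_le_left _ _)
  have hcc2 : c ≤ c₂ / 2 := (min_le_left _ _).trans (min_le_right _ _)
  have hcL : c ≤ 1 / (4 * L) := (min_le_right _ _).trans (min_le_left _ _)
  have hc1 : c ≤ 1 := (min_le_right _ _).trans ((min_le_right _ _).trans (min_le_left _ _))
  have hcb : c ≤ b / (2 * C₁) :=
    (min_le_right _ _).trans ((min_le_right _ _).trans (min_le_right _ _))
  rw [le_div_iff₀ (by positivity)] at hcb hcL
  clear_value c
  refine ⟨c, 2 / b * (1 + L + C₁) + 4 * L, hc0, by positivity, ?_⟩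
  intro N σ q h r₀ M n h0 hK hA hε' r m hr hm hF
  set d := ‖r - r₀‖ with hd
  set t := ‖m - M‖ with ht
  have hd0 : 0 ≤ d := norm_nonneg _
  have ht0 : 0 ≤ t := norm_nonneg _
  have hz : ‖r₀ - r₀‖ ≤ 0 := by simp
  have hz' : ‖M - M‖ ≤ 0 := by simp
  have hκ2 : 0 < κ / 2 := by positivity
  set β := iteratedDeriv 2 (FF σ q r₀) M / 2 with hβ
  have hβb : b ≤ ‖β‖ := by
    rw [hβ, norm_div, Complex.norm_ofNat, hb]; gcongr
  -- the size of the equation at `(r, M)`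
  obtain ⟨nM, -, a1, a2⟩ := H2 N σ q h r₀ M n d (by linarith) r M r₀ M le_rfl
    (hz'.trans hd0) (hz.trans hd0) (hz'.trans hd0)
  have eM := FF_sub (σ := σ) (q := q) (r := r) (r' := r₀) (nM.m_ne hκ2) (n.m_ne hκ) (nM.a_ne hκ2)
    (n.a_ne hκ) (nM.b_ne hκ2) (n.b_ne hκ)
  rw [h0, sub_zero, sub_self, zero_mul, zero_sub] at eM
  set A' := avg fun i => (σ i : ℂ) * ((bb q (σ i) r M)⁻¹ * (bb q (σ i) r₀ M)⁻¹)
  set A₀ := avg fun i => (σ i : ℂ) * ((bb q (σ i) r₀ M)⁻¹ * (bb q (σ i) r₀ M)⁻¹)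
  have hMn : ‖FF σ q r M‖ = d * ‖1 + A'‖ := by rw [eM, norm_neg, norm_mul]
  have hM1 : ‖FF σ q r M‖ ≤ d * (1 + L) := by
    rw [hMn]
    gcongr
    refine (norm_add_le _ _).trans ?_
    rw [norm_one]; gcongr
  have hM2 : 3 / 4 * d ≤ ‖FF σ q r M‖ := by
    rw [hMn, mul_comm]
    gcongr
    have h1 : 1 ≤ ‖1 + A₀‖ := by
      refine le_trans ?_ (Complex.re_le_norm _)
      rw [Complex.add_re, Complex.one_re]; linarith
    have h2 := norm_sub_norm_le (1 + A₀) (1 + A')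
    rw [add_sub_add_left_eq_sub, norm_sub_rev] at h2
    have : L * d ≤ L * c := by gcongr
    linarith
  -- square root behaviour
  have hup : t ^ 2 ≤ 2 / b * (1 + L + C₁) * d := by
    have h1 := H1 N σ q h r₀ M n h0 hK r m M (hr.trans hcc1) (hm.trans hcc1)
      (hz'.trans hc₁.le)
    rw [hF, zero_sub, sub_self, add_zero, norm_zero, add_zero, ← hβ] at h1
    have h2 : ‖β‖ * t ^ 2 ≤ ‖FF σ q r M‖ + C₁ * (t * (t ^ 2 + d)) := by
      have e : β * ((m - M) * (m - M)) = -FF σ q r M -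
        (-FF σ q r M - β * ((m - M) * (m - M))) := by ring
      calc ‖β‖ * t ^ 2 = ‖β * ((m - M) * (m - M))‖ := by rw [norm_mul, norm_mul, ← sq]
        _ ≤ _ := by
          rw [e]
          refine (norm_sub_le _ _).trans ?_
          rw [norm_neg]; gcongr
    have h3 : b * t ^ 2 ≤ ‖β‖ * t ^ 2 := by gcongr
    have h4 : C₁ * (t * t ^ 2) ≤ b / 2 * t ^ 2 := by
      have : C₁ * t ≤ b / 2 := by
        have h5 : C₁ * t ≤ C₁ * c := by gcongr
        linarith
      calc _ = C₁ * t * t ^ 2 := by ring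
        _ ≤ _ := by gcongr
    have h5 : C₁ * (t * d) ≤ C₁ * d := by
      have : t * d ≤ 1 * d := by gcongr; linarith
      have h6 := mul_le_mul_of_nonneg_left this hC₁.le
      linarith
    have h6 : b / 2 * t ^ 2 ≤ (1 + L + C₁) * d := by
      rw [mul_add, mul_add] at h2
      linarith
    calc t ^ 2 = 2 / b * (b / 2 * t ^ 2) := by field_simp
      _ ≤ 2 / b * ((1 + L + C₁) * d) := by gcongr
      _ = _ := by ring
  -- the factor `1 - KK` vanishes at `(r₀, M)`, so `FF(r, M)`, which is of size `d`, is at most of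
  -- the order `t (d + t)`
  have hlow : d ≤ 4 * L * t ^ 2 := by
    have hD : d + t ≤ c₂ := by linarith
    obtain ⟨nm, k, -⟩ := H2 N σ q h r₀ M n (d + t) hD r m r M (by linarith) (by linarith)
      (by linarith) (hz'.trans (by positivity))
    have em := FF_sub (σ := σ) (q := q) (r := r) (r' := r) (nm.m_ne hκ2) (nM.m_ne hκ2)
      (nm.a_ne hκ2) (nM.a_ne hκ2) (nm.b_ne hκ2) (nM.b_ne hκ2)
    rw [hF, zero_sub, sub_self, zero_mul, sub_zero] at em
    rw [hK, norm_sub_rev] at k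
    have h1 : ‖FF σ q r M‖ ≤ t * (L * (d + t)) := by
      rw [← norm_neg, em, norm_mul]; gcongr
    have h2 : L * t * d ≤ 1 / 4 * d := by
      gcongr
      have : L * t ≤ L * c := by gcongr
      linarith
    rw [mul_add, mul_add] at h1
    linarith
  refine ⟨hup.trans ?_, hlow.trans ?_⟩
  · gcongr
    linarith
  · gcongr
    have : 0 < 2 / b * (1 + L + C₁) := by positivity
    linarith

/-- Near a degenerate solution `(r₀, M)` with nonzero second derivative, the equation is stable
with a bound that degenerates like the square root. -/
lemma exists_sqrt_stability (τ κ ε K : ℝ) (hτ : 0 < τ) (hκ : 0 < κ) (hε : 0 < ε) (hK0 : 0 < K) :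
    ∃ c C : ℝ, 0 < c ∧ 0 < C ∧
    ∀ (N : ℕ) (σ : Fin N → ℝ) (q : ℝ), Par τ σ q → ∀ r₀ M, Nice κ σ q r₀ M → FF σ q r₀ M = 0 →
      KK σ q r₀ M r₀ M = 1 → ε ≤ ‖iteratedDeriv 2 (FF σ q r₀) M‖ →
      ∀ r m, ‖r - r₀‖ ≤ c → ‖m - M‖ ≤ c → FF σ q r m = 0 →
        ‖m - M‖ ^ 2 ≤ K * ‖r - r₀‖ → ‖r - r₀‖ ≤ K * ‖m - M‖ ^ 2 →
        ∀ v, ‖v - M‖ ≤ c →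
          (‖v - m‖ ≤ ‖m - M‖ → ‖m - M‖ * ‖v - m‖ ≤ C * ‖FF σ q r v‖) ∧
          ‖v - m‖ ^ 2 ≤ C * (‖r - r₀‖ + ‖FF σ q r v‖) := by
  obtain ⟨c₁, C₁, hc₁, hC₁, H1⟩ := exists_expansion τ κ hτ hκ
  set b := ε / 2 with hb
  have hb0 : 0 < b := by positivity
  set c := min c₁ (b / (4 * C₁ * (9 + K))) with hc
  have hc0 : 0 < c := by positivity
  have hcc1 : c ≤ c₁ := min_le_left _ _
  have hcb : c ≤ b / (4 * C₁ * (9 + K)) := min_le_right _ _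
  rw [le_div_iff₀ (by positivity)] at hcb
  clear_value c
  refine ⟨c, 16 * K + 4 / b, hc0, by positivity, ?_⟩
  intro N σ q h r₀ M n h0 hK hε' r m hr hm hF hup hlow
  set d := ‖r - r₀‖ with hd
  set t := ‖m - M‖ with ht
  have hd0 : 0 ≤ d := norm_nonneg _
  have ht0 : 0 ≤ t := norm_nonneg _
  set β := iteratedDeriv 2 (FF σ q r₀) M / 2 with hβ
  have hβb : b ≤ ‖β‖ := by
    rw [hβ, norm_div, Complex.norm_ofNat, hb]; gcongr
  intro v hv
  have h1 := H1 N σ q h r₀ M n h0 hK r v m (hr.trans hcc1) (hv.trans hcc1) (hm.trans hcc1)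
  rw [hF, sub_zero, ← hβ] at h1
  set x := ‖v - m‖ with hx
  have hx0 : 0 ≤ x := norm_nonneg _
  have hvx : ‖v - M‖ ≤ x + t := by
    have : v - M = (v - m) + (m - M) := by ring
    rw [this]; exact norm_add_le _ _
  have hx2 : x ≤ 2 * c := by
    have : v - m = (v - M) - (m - M) := by ring
    rw [hx, this]; refine (norm_sub_le _ _).trans ?_; linarith
  have h2 : ‖β‖ * (x * ‖(v - M) + (m - M)‖) ≤
      ‖FF σ q r v‖ + C₁ * (x * ((‖v - M‖ + t) ^ 2 + d)) := by
    have e : β * ((v - m) * ((v - M) + (m - M))) = FF σ q r v -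
      (FF σ q r v - β * ((v - m) * ((v - M) + (m - M)))) := by ring
    calc _ = ‖β * ((v - m) * ((v - M) + (m - M)))‖ := by rw [norm_mul, norm_mul]
      _ ≤ _ := by
        rw [e]
        refine (norm_sub_le _ _).trans ?_
        gcongr
  constructor
  -- as `|v - m| ≤ |m - M|`, the two roots near `M` are not confused: `(v - M) + (m - M)` has size
  -- at least `|m - M|`
  · intro hxt
    have h3 : t ≤ ‖(v - M) + (m - M)‖ := by
      have e : 2 * (m - M) = ((v - M) + (m - M)) - (v - m) := by ring
      have h4 : ‖2 * (m - M)‖ = 2 * t := by rw [norm_mul, Complex.norm_ofNat]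
      have h5 := norm_sub_le ((v - M) + (m - M)) (v - m)
      rw [← e, h4] at h5
      linarith
    have h4 : b * (x * t) ≤ ‖β‖ * (x * ‖(v - M) + (m - M)‖) := by gcongr
    have h5 : C₁ * (x * ((‖v - M‖ + t) ^ 2 + d)) ≤ b / 2 * (x * t) := by
      have h6 : (‖v - M‖ + t) ^ 2 ≤ (3 * t) ^ 2 := by
        gcongr; linarith
      have h7 : C₁ * (t * (9 + K)) ≤ b / 4 := by
        have : C₁ * (t * (9 + K)) ≤ C₁ * (c * (9 + K)) := by gcongr
        linarith
      calc _ ≤ C₁ * (x * ((3 * t) ^ 2 + K * t ^ 2)) := by gcongr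
        _ = C₁ * (t * (9 + K)) * (x * t) := by ring
        _ ≤ b / 2 * (x * t) := by gcongr; linarith
    have h6 : b / 2 * (t * x) ≤ ‖FF σ q r v‖ := by linarith
    calc t * x = 2 / b * (b / 2 * (t * x)) := by field_simp
      _ ≤ 2 / b * ‖FF σ q r v‖ := by gcongr
      _ ≤ _ := by
        gcongr
        have : 2 / b ≤ 4 / b := by gcongr; norm_num
        linarith
  · have hFn : 0 ≤ ‖FF σ q r v‖ := norm_nonneg _
    have hb4 : 0 < 4 / b := by positivity
    rcases le_or_gt x (4 * t) with hxt | hxt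
    · calc x ^ 2 ≤ (4 * t) ^ 2 := by gcongr
        _ = 16 * t ^ 2 := by ring
        _ ≤ 16 * (K * d) := by gcongr
        _ = 16 * K * d := by ring
        _ ≤ (16 * K + 4 / b) * (d + ‖FF σ q r v‖) := by
          gcongr <;> linarith
    · have h3 : x / 2 ≤ ‖(v - M) + (m - M)‖ := by
        have e : v - m = ((v - M) + (m - M)) - 2 * (m - M) := by ring
        have h4 : ‖2 * (m - M)‖ = 2 * t := by rw [norm_mul, Complex.norm_ofNat]
        have h5 := norm_sub_le ((v - M) + (m - M)) (2 * (m - M))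
        rw [← e, h4, ← hx] at h5
        linarith
      have h4 : b * (x * (x / 2)) ≤ ‖β‖ * (x * ‖(v - M) + (m - M)‖) := by gcongr
      have h5 : C₁ * (x * ((‖v - M‖ + t) ^ 2 + d)) ≤ b / 4 * x ^ 2 := by
        have h6 : (‖v - M‖ + t) ^ 2 ≤ (3 / 2 * x) ^ 2 := by
          gcongr; linarith
        have h8 : t ^ 2 ≤ (x / 4) ^ 2 := by gcongr; linarith
        have h7 : C₁ * (x * (9 / 4 + K / 16)) ≤ b / 4 := by
          have h9 : C₁ * (x * (9 / 4 + K / 16)) ≤ C₁ * (2 * c * (9 / 4 + K / 16)) := by gcongr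
          have h10 : 0 ≤ c * C₁ * K := by positivity
          have h11 : 0 ≤ c * C₁ := by positivity
          linarith
        calc _ ≤ C₁ * (x * ((3 / 2 * x) ^ 2 + K * (x / 4) ^ 2)) := by
              gcongr
              exact hlow.trans (by gcongr)
          _ = C₁ * (x * (9 / 4 + K / 16)) * x ^ 2 := by ring
          _ ≤ _ := by gcongr
      have h6 : b / 4 * x ^ 2 ≤ ‖FF σ q r v‖ := by linarith
      calc x ^ 2 = 4 / b * (b / 4 * x ^ 2) := by field_simp
        _ ≤ 4 / b * ‖FF σ q r v‖ := by gcongr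
        _ ≤ (16 * K + 4 / b) * (d + ‖FF σ q r v‖) := by
          gcongr <;> linarith

/-! ### Boundary values at the edges -/

section edges
variable {N : ℕ} {τ : ℝ} {σ : Fin N → ℝ} {q κ : ℝ} {z w r m : ℂ} {e : ℝ}

open ComplexConjugate in
/-- The equation is real for real `r`. -/
lemma FF_conj (x : ℝ) : FF σ q x (conj m) = conj (FF σ q x m) := by
  simp only [FF, avg, bb, aa, map_add, map_sub, map_mul, map_div₀, map_sum, Complex.conj_ofReal,
    map_one, map_natCast]

/-- Nonsingularity passes to limits, and the equation is continuous along them. -/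
lemma Nice.of_tendsto {ι : Type*} {l : Filter ι} [l.NeBot] {ρ μ : ι → ℂ} (hκ : 0 < κ)
    (hr : Tendsto ρ l (𝓝 r)) (hm : Tendsto μ l (𝓝 m)) (hn : ∀ᶠ i in l, Nice κ σ q (ρ i) (μ i)) :
    Nice κ σ q r m ∧ Tendsto (fun i => FF σ q (ρ i) (μ i)) l (𝓝 (FF σ q r m)) := by
  have h1 : κ ≤ ‖m‖ := ge_of_tendsto hm.norm (hn.mono fun i h => h.m_ge)
  have hm0 : m ≠ 0 := norm_pos_iff.1 (hκ.trans_le h1)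
  have ha : Tendsto (fun i => aa q (μ i)) l (𝓝 (aa q m)) :=
    hm.sub (tendsto_const_nhds.div hm hm0)
  have h2 : κ ≤ ‖aa q m‖ := ge_of_tendsto ha.norm (hn.mono fun i h => h.a_ge)
  have ha0 : aa q m ≠ 0 := norm_pos_iff.1 (hκ.trans_le h2)
  have hb : ∀ s : ℝ, Tendsto (fun i => bb q s (ρ i) (μ i)) l (𝓝 (bb q s r m)) := fun s =>
    (hr.sub (tendsto_const_nhds.div hm hm0)).sub (tendsto_const_nhds.div ha ha0)
  have h3 : ∀ j, κ ≤ ‖bb q (σ j) r m‖ := fun j =>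
    ge_of_tendsto (hb _).norm (hn.mono fun i h => h.b_ge j)
  refine ⟨⟨h1, h2, h3⟩, ?_⟩
  unfold FF avg
  exact (hm.sub hr).add (tendsto_const_nhds.mul (tendsto_finsetSum _ fun j _ =>
    tendsto_const_nhds.div (hb _) (norm_pos_iff.1 (hκ.trans_le (h3 j)))))

section polynomial
open Polynomial

/-- The cubic denominator as a polynomial in `m`. -/
def cubicPoly (s q : ℝ) (r : ℂ) : ℂ[X] :=
  C r * X ^ 3 - C ((s : ℂ) + q) * X ^ 2 - C (r * q) * X + C ((q : ℂ) ^ 2)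

lemma eval_cubicPoly {s : ℝ} (hm : m ≠ 0) (ha : aa q m ≠ 0) :
    (cubicPoly s q r).eval m = m ^ 2 * aa q m * bb q s r m := by
  have e : m ^ 2 * aa q m * bb q s r m = m ^ 2 * (aa q m * (r - q / m) - s) := by
    unfold bb; field_simp
  rw [e]
  unfold cubicPoly aa
  simp only [eval_add, eval_sub, eval_mul, eval_C, eval_pow, eval_X]
  field_simp; ring

/-- The equation with cleared denominators. -/
def clearedPoly (σ : Fin N → ℝ) (q : ℝ) (r : ℂ) : ℂ[X] :=
  (X - C r) * ∏ i, cubicPoly (σ i) q r + C (1 / (N : ℂ)) *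
    ∑ i, C (σ i : ℂ) * (X * (X ^ 2 - C (q : ℂ))) * ∏ j ∈ Finset.univ.erase i, cubicPoly (σ j) q r

lemma eval_clearedPoly (hm : m ≠ 0) (ha : aa q m ≠ 0) (hb : ∀ i, bb q (σ i) r m ≠ 0) :
    (clearedPoly σ q r).eval m = FF σ q r m * ∏ i, (cubicPoly (σ i) q r).eval m := by
  unfold clearedPoly FF avg
  rw [add_mul, mul_assoc, Finset.sum_mul]
  simp only [eval_add, eval_mul, eval_sub, eval_X, eval_C, eval_prod, eval_finsetSum, eval_pow]
  congr 2
  refine Finset.sum_congr rfl fun i _ => ?_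
  rw [← Finset.mul_prod_erase Finset.univ _ (Finset.mem_univ i), eval_cubicPoly hm ha]
  have h1 := hb i
  have e : m * (m ^ 2 - q) = m ^ 2 * aa q m := by unfold aa; field_simp
  rw [e]
  field_simp

lemma clearedPoly_ne_zero (hr : r ≠ 0) : clearedPoly σ q r ≠ 0 := by
  intro h0
  -- the equation is asymptotic to `m` at infinity
  have t1 : Tendsto (fun y : ℝ => y - q / y) atTop atTop := by
    have := tendsto_id.atTop_add (tendsto_const_nhds.div_atTop tendsto_id :
      Tendsto (fun y : ℝ => (-q) / y) atTop (𝓝 0))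
    refine this.congr fun y => ?_
    simp only [id]; ring
  have ea : ∀ y : ℝ, aa q (y : ℂ) = ((y - q / y : ℝ) : ℂ) := fun y => by unfold aa; push_cast; rfl
  have t2 : ∀ s : ℝ, Tendsto (fun y : ℝ => (s : ℂ) / aa q (y : ℂ)) atTop (𝓝 0) := by
    intro s
    have h1 : Tendsto (fun y : ℝ => s / (y - q / y)) atTop (𝓝 0) :=
      tendsto_const_nhds.div_atTop t1
    have h2 := (Complex.continuous_ofReal.tendsto 0).comp h1
    refine h2.congr fun y => ?_
    rw [ea]; simp
  have t3 : Tendsto (fun y : ℝ => (q : ℂ) / y) atTop (𝓝 0) := by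
    have h1 : Tendsto (fun y : ℝ => q / y) atTop (𝓝 0) := tendsto_const_nhds.div_atTop tendsto_id
    have h2 := (Complex.continuous_ofReal.tendsto 0).comp h1
    refine h2.congr fun y => ?_
    simp
  have t4 : ∀ s : ℝ, Tendsto (fun y : ℝ => bb q s r (y : ℂ)) atTop (𝓝 r) := by
    intro s
    have := (tendsto_const_nhds (x := r)).sub t3 |>.sub (t2 s)
    simpa [bb] using this
  have t5 : Tendsto (fun y : ℝ => (-r + avg fun i => (σ i : ℂ) / bb q (σ i) r (y : ℂ)).re) atTop
      (𝓝 (-r + avg fun i => (σ i : ℂ) / r).re) := by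
    refine (Complex.continuous_re.tendsto _).comp (tendsto_const_nhds.add ?_)
    unfold avg
    exact tendsto_const_nhds.mul (tendsto_finsetSum _ fun j _ => tendsto_const_nhds.div (t4 _) hr)
  have t6 := tendsto_id.atTop_add t5
  have hb : ∀ᶠ y : ℝ in atTop, ∀ i, bb q (σ i) r (y : ℂ) ≠ 0 :=
    eventually_all.2 fun i => (t4 (σ i)).eventually_ne hr
  obtain ⟨y, y1, y2, y3, y4⟩ := ((eventually_gt_atTop (0 : ℝ)).and
    ((t1.eventually_gt_atTop 0).and (hb.and (t6.eventually_gt_atTop 0)))).exists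
  have hm : (y : ℂ) ≠ 0 := by exact_mod_cast y1.ne'
  have ha : aa q (y : ℂ) ≠ 0 := by rw [ea]; exact_mod_cast y2.ne'
  have hev := eval_clearedPoly (σ := σ) (r := r) hm ha y3
  rw [h0, eval_zero] at hev
  have hF : FF σ q r y ≠ 0 := by
    intro hF
    have : (FF σ q r y).re = y + (-r + avg fun i => (σ i : ℂ) / bb q (σ i) r (y : ℂ)).re := by
      unfold FF; simp only [Complex.add_re, Complex.sub_re, Complex.neg_re, Complex.ofReal_re]; ring
    rw [hF, Complex.zero_re] at this
    simp only [id] at y4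
    linarith
  refine mul_ne_zero hF (Finset.prod_ne_zero_iff.2 fun i _ => ?_) hev.symm
  rw [eval_cubicPoly hm ha]
  exact mul_ne_zero (mul_ne_zero (pow_ne_zero _ hm) ha) (y3 i)

/-- For fixed `r ≠ 0` the equation has finitely many nonsingular solutions. -/
lemma finite_solutions (hκ : 0 < κ) (hr : r ≠ 0) :
    {m : ℂ | Nice κ σ q r m ∧ FF σ q r m = 0}.Finite := by
  refine ((clearedPoly σ q r).rootSet_finite ℂ).subset ?_
  rintro m ⟨n, hF⟩
  rw [mem_rootSet, coe_aeval_eq_eval, eval_clearedPoly (n.m_ne hκ) (n.a_ne hκ) (n.b_ne hκ), hF,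
    zero_mul]
  exact ⟨clearedPoly_ne_zero hr, rfl⟩

/-- All roots of the cubic are real: on the upper half plane it equals `m² a b`, where `m`, `a` and
`b` have positive imaginary part. Hence the distance of `m` to the real roots bounds the cubic from
below. -/
lemma exists_real_roots_eq {x : ℝ} (hx : x ≠ 0) {s : ℝ} (hs : 0 < s) (hq : 0 ≤ q) :
    ∃ a b c : ℝ, ∀ m : ℂ, (cubicPoly s q x).eval m = x * (m - a) * (m - b) * (m - c) := by
  have hreal : ∀ y : ℂ, (cubicPoly s q x).eval y = 0 → y.im = 0 := by
    have main : ∀ y : ℂ, 0 < y.im → (cubicPoly s q x).eval y ≠ 0 := by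
      intro y hy h0
      have hy0 : y ≠ 0 := ne_zero_of_im_pos hy
      have ha := aa_im_pos hq hy
      rw [eval_cubicPoly hy0 (ne_zero_of_im_pos ha)] at h0
      have hb : 0 < (bb q s (x : ℂ) y).im := by
        rw [bb_im, Complex.ofReal_im]
        have := norm_pos_iff.2 hy0
        have := norm_pos_iff.2 (ne_zero_of_im_pos ha)
        positivity
      exact mul_ne_zero (mul_ne_zero (pow_ne_zero _ hy0) (ne_zero_of_im_pos ha))
        (ne_zero_of_im_pos hb) h0
    intro y h0
    rcases lt_trichotomy y.im 0 with hy | hy | hy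
    · exfalso
      refine main (starRingEnd ℂ y) (by simpa using hy) ?_
      have : (cubicPoly s q x).eval (starRingEnd ℂ y) =
          starRingEnd ℂ ((cubicPoly s q x).eval y) := by
        simp [cubicPoly]
      rw [this, h0, map_zero]
    · exact hy
    · exact absurd h0 (main y hy)
  have hxc : (x : ℂ) ≠ 0 := by exact_mod_cast hx
  set P : Cubic ℂ := ⟨x, -((s : ℂ) + q), -((x : ℂ) * q), (q : ℂ) ^ 2⟩ with hP
  have hPoly : P.toPoly = cubicPoly s q x := by
    rw [Cubic.toPoly, cubicPoly, hP]
    simp only [map_neg]; ring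
  obtain ⟨a, b, c, habc⟩ := (Cubic.splits_iff_roots_eq_three (φ := RingHom.id ℂ) (P := P) hxc).1
    (IsAlgClosed.splits _)
  have hprod := Cubic.eq_prod_three_roots (φ := RingHom.id ℂ) (P := P) hxc habc
  have hmap : Cubic.map (RingHom.id ℂ) P = P := by simp [Cubic.map]
  rw [hmap, hPoly] at hprod
  have hev : ∀ m : ℂ, (cubicPoly s q x).eval m = x * (m - a) * (m - b) * (m - c) := by
    intro m
    rw [hprod]; simp [hP]
  have re : ∀ y : ℂ, (cubicPoly s q x).eval y = 0 → ((y.re : ℝ) : ℂ) = y := fun y hy =>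
    Complex.ext (by simp) (by simp [hreal y hy])
  refine ⟨a.re, b.re, c.re, fun m => ?_⟩
  rw [re a (by rw [hev]; ring), re b (by rw [hev]; ring), re c (by rw [hev]; ring)]
  exact hev m

end polynomial

lemma cubic_eq {s : ℝ} : cubic s z r m = (cubicPoly s (‖z‖ ^ 2) r).eval m := by
  simp only [cubic, cubicPoly, Polynomial.eval_add, Polynomial.eval_sub, Polynomial.eval_mul,
    Polynomial.eval_C, Polynomial.eval_pow, Polynomial.eval_X]
  push_cast; ring

/-- Away from its singularities the function `f` of the regularity condition is `FF`. -/
lemma f_eq (hm : m ≠ 0) (ha : aa (‖z‖ ^ 2) m ≠ 0) (hb : ∀ i, bb (‖z‖ ^ 2) (σ i) r m ≠ 0) :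
    f σ z r m = FF σ (‖z‖ ^ 2) r m := by
  rw [f, FF, avg, neg_add_eq_sub]
  congr 2
  refine Finset.sum_congr rfl fun i _ => ?_
  rw [cubic_eq, eval_cubicPoly hm ha]
  have h1 := hb i
  have e : m * (m ^ 2 - (‖z‖ : ℂ) ^ 2) = m ^ 2 * aa (‖z‖ ^ 2) m := by
    unfold aa; push_cast; field_simp
  rw [e]
  field_simp

/-- The solutions at points close to `x > 0` are nonsingular, with a constant depending on `N`. -/
lemma eventually_nice (h : Par τ σ (‖z‖ ^ 2)) {x : ℝ} (hx : 0 < x) (hw : 0 < w.im)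
    (hwx : x / 2 ≤ w.re) :
    Nice (min (τ * (min 1 (√(x / 2))) ^ 2 / 8) (min τ (√(τ / N)))) σ (‖z‖ ^ 2)
      (Complex.sqrt w) (mm σ z w) := by
  have S := sol_mm (σ := σ) (z := z) h hw
  refine ⟨(min_le_left _ _).trans (S.norm_ge h (by positivity) (min_le_left _ _)
    ((min_le_right _ _).trans ((sqrt_re_ge hw hwx).trans (Complex.re_le_norm _)))),
    (min_le_right _ _).trans ((min_le_left _ _).trans (S.tau_le_norm_aa h)), fun i => ?_⟩
  refine (min_le_right _ _).trans ((min_le_right _ _).trans (Real.sqrt_le_iff.2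
    ⟨norm_nonneg _, ?_⟩))
  have h1 := S.inv_bb_sq_le h i
  have h2 := norm_pos_iff.2 (S.bb_ne h i)
  have hN := h.N_pos
  have hτ := h.tau
  rw [div_le_div_iff₀ (by positivity) hτ] at h1
  rw [div_le_iff₀ (by linarith)]; linarith

lemma tendsto_of_re_im {ι : Type*} {l : Filter ι} {μ : ι → ℂ} {x : ℝ}
    (hr : Tendsto (fun i => (μ i).re) l (𝓝 x)) (hi : Tendsto (fun i => (μ i).im) l (𝓝 0)) :
    Tendsto μ l (𝓝 (x : ℂ)) := by
  have := ((Complex.continuous_ofReal.tendsto _).comp hr).add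
    (((Complex.continuous_ofReal.tendsto _).comp hi).mul_const Complex.I)
  simp only [Complex.ofReal_zero, zero_mul, add_zero] at this
  exact this.congr fun i => Complex.re_add_im _

/-- A continuous function oscillating between two values attains every value in between
arbitrarily close to the end point. -/
lemma frequently_eq_of_continuousOn {u : ℝ → ℝ} {d : ℝ} (hd : 0 < d)
    (hu : ContinuousOn u (Set.Ioo 0 d)) {a b c : ℝ}
    (ha : ∃ᶠ t in 𝓝[>] (0 : ℝ), u t < a) (hb : ∃ᶠ t in 𝓝[>] (0 : ℝ), b < u t) (hac : a ≤ c)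
    (hcb : c ≤ b) : ∃ᶠ t in 𝓝[>] (0 : ℝ), u t = c := by
  rw [frequently_iff]
  intro U hU
  have hI : U ∩ Set.Ioo 0 d ∈ 𝓝[>] (0 : ℝ) := inter_mem hU (Ioo_mem_nhdsGT hd)
  obtain ⟨ρ, hρ, hsub⟩ := mem_nhdsGT_iff_exists_Ioo_subset.1 hI
  have hmem := Ioo_mem_nhdsGT (show (0 : ℝ) < ρ from hρ)
  obtain ⟨t₁, h1, h1'⟩ := frequently_iff.1 ha hmem
  obtain ⟨t₂, h2, h2'⟩ := frequently_iff.1 hb hmem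
  have hsub2 : Set.uIcc t₁ t₂ ⊆ Set.Ioo 0 ρ := (Set.ordConnected_Ioo).uIcc_subset h1 h2
  obtain ⟨t, ht, hte⟩ := intermediate_value_uIcc (hu.mono (hsub2.trans fun t ht => (hsub ht).2))
    (Set.Icc_subset_uIcc (⟨by linarith, by linarith⟩ : c ∈ Set.Icc (u t₁) (u t₂)))
  exact ⟨t, (hsub (hsub2 ht)).1, hte⟩

lemma eventually_vert (hx : 0 < e) : ∀ᶠ η in 𝓝[>] (0 : ℝ), 0 < (vert e η).im ∧
    e / 2 ≤ (vert e η).re := by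
  filter_upwards [self_mem_nhdsWithin] with η hη
  have : (0 : ℝ) < η := hη
  rw [vert_im, vert_re]
  exact ⟨this, by linarith⟩

/-- At a nonzero edge the solution has a real boundary value. Its cluster points form an interval of
solutions of an equation with finitely many solutions. -/
lemma exists_edge_limit (h : Par τ σ (‖z‖ ^ 2)) (he : e ∈ edges σ z) (he0 : 0 < e) :
    ∃ M : ℝ, Tendsto (fun η => mm σ z (vert e η)) (𝓝[>] 0) (𝓝 (M : ℂ)) := by
  have hτ := h.tau
  have hN := h.N_pos
  have him := (tendsto_im_of_edge h he he0).comp (tendsto_vert e)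
  have hsq := (tendsto_sqrt he0).comp (tendsto_vert e)
  set κ := min (τ * (min 1 (√(e / 2))) ^ 2 / 8) (min τ (√(τ / N))) with hκd
  have hs := Real.sqrt_pos.2 (half_pos he0)
  have hκ : 0 < κ := by
    have : 0 < τ / N := by positivity
    have := Real.sqrt_pos.2 this
    positivity
  have hnice : ∀ᶠ η in 𝓝[>] (0 : ℝ), Nice κ σ (‖z‖ ^ 2) (Complex.sqrt (vert e η))
      (mm σ z (vert e η)) :=
    (eventually_vert he0).mono fun η hη => eventually_nice h he0 hη.1 hη.2
  have hFF : ∀ᶠ η in 𝓝[>] (0 : ℝ), FF σ (‖z‖ ^ 2) (Complex.sqrt (vert e η))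
      (mm σ z (vert e η)) = 0 :=
    (eventually_vert he0).mono fun η hη => (sol_mm h hη.1).eq
  have hcont : ContinuousOn (fun η => (mm σ z (vert e η)).re) (Set.Ioo 0 1) := by
    refine Complex.continuous_re.comp_continuousOn ((mm_differentiableOn h).continuousOn.comp
      ?_ fun η hη => ?_)
    · unfold vert; fun_prop
    · change 0 < (vert e η).im
      rw [vert_im]; exact hη.1
  have hbd : ∀ᶠ η in 𝓝[>] (0 : ℝ), |(mm σ z (vert e η)).re| ≤ 1 + (√e + 1) := by
    have : ∀ᶠ η in 𝓝[>] (0 : ℝ), ‖Complex.sqrt (vert e η)‖ < √e + 1 :=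
      hsq.norm.eventually (gt_mem_nhds (by
        rw [Complex.norm_real, Real.norm_of_nonneg (Real.sqrt_nonneg _)]; linarith))
    filter_upwards [this, eventually_vert he0] with η h1 h2
    refine (Complex.abs_re_le_norm _).trans (((sol_mm h h2.1).norm_le h).trans ?_)
    linarith
  have hre : ∃ M : ℝ, Tendsto (fun η => (mm σ z (vert e η)).re) (𝓝[>] 0) (𝓝 M) := by
    refine tendsto_of_no_upcrossings dense_univ ?_ ?_ ?_
    -- if `Re m` oscillated between `a < b`, every point of `[a, b]` would be a limit of solutions
    · rintro a - b - hab ⟨ha, hb⟩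
      have hsub : (fun c : ℝ => (c : ℂ)) '' Set.Icc a b ⊆
          {m : ℂ | Nice κ σ (‖z‖ ^ 2) (√e : ℝ) m ∧ FF σ (‖z‖ ^ 2) (√e : ℝ) m = 0} := by
        rintro _ ⟨c, hc, rfl⟩
        have hfr := frequently_eq_of_continuousOn one_pos hcont ha hb hc.1 hc.2
        have := frequently_iff_neBot.1 hfr
        set l := 𝓝[>] (0 : ℝ) ⊓ 𝓟 {η | (mm σ z (vert e η)).re = c}
        have hl : l ≤ 𝓝[>] (0 : ℝ) := inf_le_left
        have hc' : Tendsto (fun η => (mm σ z (vert e η)).re) l (𝓝 c) :=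
          tendsto_const_nhds.congr' (by
            have : {η | (mm σ z (vert e η)).re = c} ∈ l := mem_inf_of_right (mem_principal_self _)
            filter_upwards [this] with η hη using hη.symm)
        obtain ⟨n, hF⟩ := Nice.of_tendsto hκ (hsq.mono_left hl)
          (tendsto_of_re_im hc' (him.mono_left hl)) (hl hnice)
        refine ⟨n, tendsto_nhds_unique hF (tendsto_const_nhds.congr' ?_)⟩
        filter_upwards [hl hFF] with η hη using hη.symm
      have hfin := (finite_solutions hκ (by
        exact_mod_cast (Real.sqrt_pos.2 he0).ne')).subset hsub
      exact (Set.Icc_infinite hab) (hfin.of_finite_image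
        Complex.ofReal_injective.injOn)
    · exact isBoundedUnder_of_eventually_le (hbd.mono fun η hη => (abs_le.1 hη).2)
    · exact isBoundedUnder_of_eventually_ge (hbd.mono fun η hη => (abs_le.1 hη).1)
  obtain ⟨M, hM⟩ := hre
  exact ⟨M, tendsto_of_re_im hM him⟩

end edges

section degenerate
variable {N : ℕ} {τ : ℝ} {σ : Fin N → ℝ} {z w : ℂ} {e : ℝ}

lemma norm_sub_le_of_near {x : ℝ} {ρ : ℝ} (hw : ‖w - e‖ ≤ ρ) (hx : ρ ≤ e - x) : x ≤ w.re := by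
  have := (neg_le_abs _).trans (Complex.abs_re_le_norm (w - e))
  rw [Complex.sub_re, Complex.ofReal_re] at this
  linarith

/-- The solution is degenerate at nonzero edges: otherwise the solution near the edge is unique,
hence real on the axis, and the density vanishes around the edge. -/
lemma KK_eq_one_of_edge (h : Par τ σ (‖z‖ ^ 2)) (he : e ∈ edges σ z) (he0 : 0 < e) {M : ℂ}
    (hM : Tendsto (fun η => mm σ z (vert e η)) (𝓝[>] 0) (𝓝 M)) {κ : ℝ} (hκ : 0 < κ)
    (n : Nice κ σ (‖z‖ ^ 2) (√e : ℝ) M) (hF : FF σ (‖z‖ ^ 2) (√e : ℝ) M = 0)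
    (hMr : M.im = 0) : KK σ (‖z‖ ^ 2) (√e : ℝ) M (√e : ℝ) M = 1 := by
  by_contra hne
  have hτ := h.tau
  set Δ := ‖1 - KK σ (‖z‖ ^ 2) (√e : ℝ) M (√e : ℝ) M‖ with hΔ
  have hΔ0 : 0 < Δ := norm_pos_iff.2 (sub_ne_zero.2 (Ne.symm hne))
  obtain ⟨c, C, hc, hC, H1⟩ := exists_continuation τ (min κ Δ) hτ (by positivity)
  obtain ⟨c₂, L, hc₂, hL, H2⟩ := exists_kernel_lipschitz τ κ hτ hκ
  have hs := Real.sqrt_pos.2 he0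
  set D := min c₂ (Δ / (2 * L)) with hD
  have hD0 : 0 < D := by positivity
  set ρ := min (e / 2) (min (√e * c) (min (√e * D) (√e * D / C))) with hρ
  have hρ0 : 0 < ρ := by positivity
  have hρe : ρ ≤ e / 2 := min_le_left _ _
  have hρc : ρ / √e ≤ c := by
    rw [div_le_iff₀ hs, mul_comm]; exact (min_le_right _ _).trans (min_le_left _ _)
  have hρD : ρ / √e ≤ D := by
    rw [div_le_iff₀ hs, mul_comm]
    exact (min_le_right _ _).trans ((min_le_right _ _).trans (min_le_left _ _))
  have hρC : C * (ρ / √e) ≤ D := by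
    have : ρ ≤ √e * D / C :=
      (min_le_right _ _).trans ((min_le_right _ _).trans (min_le_right _ _))
    rw [le_div_iff₀ hC] at this
    rw [← mul_div_assoc, div_le_iff₀ hs]; linarith
  set U : Set ℂ := Metric.closedBall (e : ℂ) ρ ∩ {v : ℂ | 0 < v.im} with hU
  have hUpre : IsPreconnected U :=
    ((convex_closedBall _ _).inter (convex_halfSpace_im_gt 0)).isPreconnected
  have hUs : ∀ w ∈ U, ‖Complex.sqrt w - (√e : ℝ)‖ ≤ ρ / √e := fun w hw =>
    (sqrt_sub_real_le hw.2 he0).trans (by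
      have := mem_closedBall_iff_norm.1 hw.1
      gcongr)
  have hv : ∀ᶠ η in 𝓝[>] (0 : ℝ), vert e η ∈ U ∧ ‖mm σ z (vert e η) - M‖ < c := by
    have h1 : ∀ᶠ w in 𝓝[{w : ℂ | 0 < w.im}] (e : ℂ), w ∈ U :=
      inter_mem (nhdsWithin_le_nhds (Metric.closedBall_mem_nhds _ hρ0)) self_mem_nhdsWithin
    exact ((tendsto_vert e).eventually h1).and
      ((tendsto_iff_norm_sub_tendsto_zero.1 hM).eventually (gt_mem_nhds hc))
  obtain ⟨η₀, h1, h2⟩ := hv.exists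
  have hall : ∀ w ∈ U, ‖mm σ z w - M‖ ≤ D := fun w hw =>
    (H1 N σ z h _ _ (n.mono (min_le_left _ _)) hF (min_le_right _ _) U hUpre (fun w hw => hw.2)
      (fun w hw => (hUs w hw).trans hρc) ⟨_, h1, h2.le⟩ w hw).trans (by
        refine le_trans ?_ hρC
        have := hUs w hw
        gcongr)
  -- A boundary value off the real axis and its complex conjugate would be two solutions close to
  -- the real number `M`, contradicting uniqueness.
  have hzero : ∀ x ∈ Metric.ball e ρ, rho1c σ z x = 0 := by
    intro x hx
    rw [Metric.mem_ball, Real.dist_eq] at hx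
    have hx0 : 0 < x := by linarith [(abs_lt.1 hx).1]
    rcases boundary_dichotomy h hx0 with hd | ⟨M', hM', hd⟩
    · exact rho1c_eq_zero h hx0 (hd.comp (tendsto_vert x))
    exfalso
    have hne' : (𝓝[{w : ℂ | 0 < w.im}] (x : ℂ)).NeBot := (tendsto_vert x).neBot
    have hev : ∀ᶠ w in 𝓝[{w : ℂ | 0 < w.im}] (x : ℂ), w ∈ U := by
      refine inter_mem (nhdsWithin_le_nhds ?_) self_mem_nhdsWithin
      refine mem_of_superset (Metric.isOpen_ball.mem_nhds (?_ : (x : ℂ) ∈ Metric.ball (e : ℂ) ρ))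
        Metric.ball_subset_closedBall
      rwa [mem_ball_iff_norm, ← Complex.ofReal_sub, Complex.norm_real, Real.norm_eq_abs]
    have hsq : ‖((√x : ℝ) : ℂ) - (√e : ℝ)‖ ≤ D :=
      le_of_tendsto ((tendsto_sqrt hx0).sub_const _).norm (hev.mono fun w hw =>
        (hUs w hw).trans hρD)
    have hM'D : ‖M' - M‖ ≤ D := le_of_tendsto (hd.sub_const _).norm (hev.mono hall)
    have hcD : ‖starRingEnd ℂ M' - M‖ ≤ D := by
      have : starRingEnd ℂ M = M := Complex.conj_eq_iff_im.2 hMr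
      rw [← this, ← map_sub, Complex.norm_conj]; exact hM'D
    have hFF : FF σ (‖z‖ ^ 2) (√x : ℝ) M' = 0 := by
      have h0 := (Nice.of_tendsto (σ := σ) (half_pos hκ) (tendsto_sqrt hx0) hd
        (hev.mono fun w hw => (H2 N σ _ h _ _ n D (min_le_left _ _) _ _ _ _
          ((hUs w hw).trans hρD) (hall w hw) ((hUs w hw).trans hρD) (hall w hw)).1)).2
      refine tendsto_nhds_unique h0 (tendsto_const_nhds.congr' ?_)
      filter_upwards [hev] with w hw using (sol_mm h hw.2).eq.symm
    obtain ⟨n1, k, -⟩ := H2 N σ _ h _ _ n D (min_le_left _ _) _ _ _ _ hsq hM'D hsq hcD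
    obtain ⟨n2, -⟩ := H2 N σ _ h _ _ n D (min_le_left _ _) _ _ _ _ hsq hcD hsq hcD
    have hκ2 := half_pos hκ
    have h3 := FF_sub (σ := σ) (q := ‖z‖ ^ 2) (r := (√x : ℝ)) (r' := (√x : ℝ)) (n1.m_ne hκ2)
      (n2.m_ne hκ2) (n1.a_ne hκ2) (n2.a_ne hκ2) (n1.b_ne hκ2) (n2.b_ne hκ2)
    rw [FF_conj, hFF, map_zero, sub_self, sub_self, zero_mul, sub_zero] at h3
    rcases mul_eq_zero.1 h3.symm with h4 | h4
    · have := congrArg Complex.im h4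
      rw [Complex.sub_im, Complex.conj_im, Complex.zero_im] at this
      linarith
    · rw [← sub_eq_zero.1 h4, ← hΔ] at k
      have h5 : L * D ≤ Δ / 2 := by
        calc _ ≤ L * (Δ / (2 * L)) := by gcongr; exact min_le_right _ _
          _ = _ := by field_simp
      linarith
  have hmem : e ∈ tsupport (rho1c σ z) := edges_subset he
  refine (notMem_tsupport_iff_eventuallyEq.2 ?_) hmem
  filter_upwards [Metric.ball_mem_nhds e hρ0] with x hx using hzero x hx

/-- The data of the boundary value at a regular nonzero edge, with constants independent of `N`. -/
lemma exists_edge_data (τ ε : ℝ) (hτ : 0 < τ) (hε : 0 < ε) : ∃ κ : ℝ, 0 < κ ∧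
    ∀ (N : ℕ) (σ : Fin N → ℝ) (z : ℂ), Par τ σ (‖z‖ ^ 2) → ∀ e ∈ edges σ z, e ≠ 0 →
      RegularEdge σ z ε e → ∃ M : ℂ, Tendsto (fun η => mm σ z (vert e η)) (𝓝[>] 0) (𝓝 M) ∧
        Nice κ σ (‖z‖ ^ 2) (√e : ℝ) M ∧ FF σ (‖z‖ ^ 2) (√e : ℝ) M = 0 ∧
        KK σ (‖z‖ ^ 2) (√e : ℝ) M (√e : ℝ) M = 1 ∧
        0 ≤ (avg fun i => (σ i : ℂ) * ((bb (‖z‖ ^ 2) (σ i) (√e : ℝ) M)⁻¹ *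
          (bb (‖z‖ ^ 2) (σ i) (√e : ℝ) M)⁻¹)).re ∧
        ε ≤ ‖iteratedDeriv 2 (FF σ (‖z‖ ^ 2) (√e : ℝ)) M‖ := by
  obtain ⟨c₀, hc₀, He⟩ := exists_edge_ge τ hτ
  set c₁ := τ * (min 1 (√(c₀ / 2))) ^ 2 / 8 with hc₁
  have hs0 := Real.sqrt_pos.2 (half_pos hc₀)
  have hc₁0 : 0 < c₁ := by positivity
  set X := 1 + 10 / τ with hX
  have hX0 : 0 < X := by positivity
  set Y := X ^ 2 * (X + (1 + τ⁻¹) / c₁) with hY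
  have hY0 : 0 < Y := by positivity
  have hsc := Real.sqrt_pos.2 hc₀
  refine ⟨min (min c₁ τ) (√c₀ * ε ^ 3 / Y), by positivity, ?_⟩
  intro N σ z h e he hne ⟨hroot, hder⟩
  obtain ⟨hec, heX⟩ := He N σ z h e he hne
  have he0 : 0 < e := hc₀.trans_le hec
  have hN := h.N_pos
  obtain ⟨x, hM⟩ := exists_edge_limit h he he0
  have hsq := (tendsto_sqrt he0).comp (tendsto_vert e)
  rw [mcReal_eq he0 hM] at hroot hder
  set κ := min (τ * (min 1 (√(e / 2))) ^ 2 / 8) (min τ (√(τ / N))) with hκd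
  have hs := Real.sqrt_pos.2 (half_pos he0)
  have hκ : 0 < κ := by
    have : 0 < τ / N := by positivity
    have := Real.sqrt_pos.2 this
    positivity
  obtain ⟨n, hF⟩ := Nice.of_tendsto (σ := σ) (q := ‖z‖ ^ 2) hκ hsq hM
    ((eventually_vert he0).mono fun η hη => eventually_nice h he0 hη.1 hη.2)
  have hF0 : FF σ (‖z‖ ^ 2) (√e : ℝ) x = 0 := tendsto_nhds_unique hF
    (tendsto_const_nhds.congr' ((eventually_vert he0).mono fun η hη => (sol_mm h hη.1).eq.symm))
  have hm0 := n.m_ne hκ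
  have ha0 := n.a_ne hκ
  -- a priori bounds, by passing to the limit
  have hmge : c₁ ≤ ‖(x : ℂ)‖ := ge_of_tendsto hM.norm ((eventually_vert he0).mono fun η hη =>
    (sol_mm h hη.1).norm_ge h (by positivity) (min_le_left _ _) ((min_le_right _ _).trans
      ((sqrt_re_ge hη.1 ((by linarith : c₀ / 2 ≤ e / 2).trans hη.2)).trans
        (Complex.re_le_norm _))))
  have hage : τ ≤ ‖aa (‖z‖ ^ 2) (x : ℂ)‖ := by
    have ha : Tendsto (fun η => aa (‖z‖ ^ 2) (mm σ z (vert e η))) (𝓝[>] 0)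
        (𝓝 (aa (‖z‖ ^ 2) (x : ℂ))) := hM.sub (tendsto_const_nhds.div hM hm0)
    exact ge_of_tendsto ha.norm ((eventually_vert he0).mono fun η hη =>
      (sol_mm h hη.1).tau_le_norm_aa h)
  have hsX : √e ≤ 10 / τ := Real.sqrt_le_iff.2 ⟨by positivity, heX⟩
  have hmle : ‖(x : ℂ)‖ ≤ X := by
    have h1 : ‖(x : ℂ)‖ ≤ 1 + ‖((√e : ℝ) : ℂ)‖ := le_of_tendsto_of_tendsto hM.norm
      (hsq.norm.const_add 1) ((eventually_vert he0).mono fun η hη => (sol_mm h hη.1).norm_le h)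
    rw [Complex.norm_real √e, Real.norm_of_nonneg (Real.sqrt_nonneg _)] at h1
    linarith
  have hale : ‖aa (‖z‖ ^ 2) (x : ℂ)‖ ≤ X + (1 + τ⁻¹) / c₁ := by
    refine (norm_aa_le h.q0).trans ?_
    have := h.qhi
    gcongr
  have hbge : ∀ i, √c₀ * ε ^ 3 / Y ≤ ‖bb (‖z‖ ^ 2) (σ i) (√e : ℝ) x‖ := by
    intro i
    have hse := Real.sqrt_pos.2 he0
    obtain ⟨a, b, c, habc⟩ := exists_real_roots_eq hse.ne' (h.spos i) h.q0
    have hr : ∀ t : ℝ, (t = a ∨ t = b ∨ t = c) → ε ≤ ‖(x : ℂ) - t‖ := by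
      intro t ht
      refine hroot i t ?_
      rw [cubic_eq, habc]
      rcases ht with rfl | rfl | rfl <;> simp
    have h1 : √c₀ * ε ^ 3 ≤ ‖(cubicPoly (σ i) (‖z‖ ^ 2) (√e : ℝ)).eval (x : ℂ)‖ := by
      rw [habc, norm_mul, norm_mul, norm_mul, Complex.norm_real √e, Real.norm_of_nonneg hse.le]
      have := hr a (by simp)
      have := hr b (by simp)
      have := hr c (by simp)
      calc √c₀ * ε ^ 3 = √c₀ * ε * ε * ε := by ring
        _ ≤ _ := by gcongr
    rw [eval_cubicPoly hm0 ha0, norm_mul, norm_mul, norm_pow] at h1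
    rw [div_le_iff₀ hY0]
    refine h1.trans ?_
    rw [mul_comm _ Y, hY]
    gcongr
  have hb0 := n.b_ne hκ
  refine ⟨x, hM, ⟨(min_le_left _ _).trans ((min_le_left _ _).trans hmge),
    (min_le_left _ _).trans ((min_le_right _ _).trans hage),
    fun i => (min_le_right _ _).trans (hbge i)⟩, hF0,
    KK_eq_one_of_edge h he he0 hM hκ n hF0 (Complex.ofReal_im x), ?_, ?_⟩
  · rw [avg_re]
    refine avg_nonneg fun i => ?_
    have hreal : bb (‖z‖ ^ 2) (σ i) (√e : ℝ) x =
        ((√e - ‖z‖ ^ 2 / x - σ i / (x - ‖z‖ ^ 2 / x) : ℝ) : ℂ) := by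
      unfold bb aa; push_cast; rfl
    rw [hreal, ← Complex.ofReal_inv, ← Complex.ofReal_mul, ← Complex.ofReal_mul, Complex.ofReal_re]
    have := h.spos i
    exact mul_nonneg this.le (mul_self_nonneg _)
  · have heq : (fun m : ℂ => f σ z (√e : ℝ) m) =ᶠ[𝓝 (x : ℂ)] FF σ (‖z‖ ^ 2) (√e : ℝ) := by
      have ca : ContinuousAt (aa (‖z‖ ^ 2)) (x : ℂ) :=
        continuousAt_id.sub (continuousAt_const.div continuousAt_id hm0)
      have cb : ∀ i, ContinuousAt (bb (‖z‖ ^ 2) (σ i) (√e : ℝ)) (x : ℂ) := fun i =>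
        (continuousAt_const.sub (continuousAt_const.div continuousAt_id hm0)).sub
          (continuousAt_const.div ca ha0)
      filter_upwards [continuousAt_id.eventually_ne hm0, ca.eventually_ne ha0,
        eventually_all.2 fun i => (cb i).eventually_ne (hb0 i)] with m h1 h2 h3
        using f_eq h1 h2 h3
    rwa [heq.iteratedDeriv_eq 2] at hder

end degenerate

/-! ### Stability at regular edges -/

/-- Stability of the equation at the distance `‖w - e‖` from an edge: linear with the constant
`‖w - e‖^(-1/2)` in a small neighbourhood, and of square root type in a larger one. -/
def EdgeStable {N : ℕ} (σ : Fin N → ℝ) (z : ℂ) (c C e : ℝ) (w : ℂ) : Prop :=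
  ∀ u, Cone w u →
    (‖u - m1c σ z w‖ ≤ c * √‖w - e‖ → √‖w - e‖ * ‖u - m1c σ z w‖ ≤ C * ‖Upsilon σ z w u‖) ∧
    (‖u - m1c σ z w‖ ≤ c → ‖u - m1c σ z w‖ ^ 2 ≤ C * (‖w - e‖ + ‖Upsilon σ z w u‖))

set_option maxHeartbeats 600000 in
/-- Stability near regular edges, with constants independent of `N`. -/
lemma exists_edgeStable (τ ε : ℝ) (hτ : 0 < τ) (hε : 0 < ε) : ∃ c C : ℝ, 0 < c ∧ c ≤ 1 ∧ 0 < C ∧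
    ∀ (N : ℕ) (σ : Fin N → ℝ) (z : ℂ), Par τ σ (‖z‖ ^ 2) → ∀ e ∈ edges σ z, e ≠ 0 →
      RegularEdge σ z ε e → ∀ w : ℂ, 0 < w.im → ‖w - e‖ ≤ c → EdgeStable σ z c C e w := by
  obtain ⟨κ, hκ, H0⟩ := exists_edge_data τ ε hτ hε
  obtain ⟨c₁, K, hc₁, hK, H1⟩ := exists_sqrt_behaviour τ κ ε hτ hκ hε
  obtain ⟨c₂, C₂, hc₂, hC₂, H2⟩ := exists_sqrt_stability τ κ ε K hτ hκ hε hK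
  obtain ⟨c₀, hc₀, He⟩ := exists_edge_ge τ hτ
  set s₀ := √(c₀ / 2) with hs₀
  have hs₀0 : 0 < s₀ := Real.sqrt_pos.2 (by positivity)
  set c₃ := min c₁ (c₂ / 2) with hc₃
  have hc₃0 : 0 < c₃ := by positivity
  set X := 20 / τ + 1 with hX
  have hX0 : 0 < X := by positivity
  set S := √(X * K) with hS
  have hS0 : 0 < S := Real.sqrt_pos.2 (by positivity)
  set ρ := min (min 1 (c₀ / 2)) (min (s₀ * min 1 (min c₁ c₂)) (s₀ * (c₃ / 2) ^ 2 / K)) with hρ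
  have hρ0 : 0 < ρ := by positivity
  have hρ1 : ρ ≤ 1 := (min_le_left _ _).trans (min_le_left _ _)
  have hρc₀ : ρ ≤ c₀ / 2 := (min_le_left _ _).trans (min_le_right _ _)
  have hρs : ρ / s₀ ≤ min 1 (min c₁ c₂) := by
    rw [div_le_iff₀ hs₀0, mul_comm]; exact (min_le_right _ _).trans (min_le_left _ _)
  have hρK : K * (ρ / s₀) ≤ (c₃ / 2) ^ 2 := by
    have : ρ ≤ s₀ * (c₃ / 2) ^ 2 / K := (min_le_right _ _).trans (min_le_right _ _)
    rw [le_div_iff₀ hK] at this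
    rw [← mul_div_assoc, div_le_iff₀ hs₀0]; linarith
  set c := min ρ (min (1 / (X * S)) (c₂ / (2 * X))) with hc
  have hcX : X * c ≤ c₂ / 2 := by
    have : c ≤ c₂ / (2 * X) := (min_le_right _ _).trans (min_le_right _ _)
    rw [le_div_iff₀ (by positivity)] at this
    linarith
  have hcS : X * c ≤ 1 / S := by
    have : c ≤ 1 / (X * S) := (min_le_right _ _).trans (min_le_left _ _)
    rw [le_div_iff₀ (by positivity)] at this ⊢
    linarith
  refine ⟨c, C₂ * S + C₂ * (1 / s₀ + X) / s₀ ^ 2, by positivity, (min_le_left _ _).trans hρ1,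
    by positivity, ?_⟩
  intro N σ z h e he hne hreg w hw hwe u hu
  obtain ⟨M, hM, n, hF, hKK, hA, hder⟩ := H0 N σ z h e he hne hreg
  obtain ⟨hec, heX⟩ := He N σ z h e he hne
  have he0 : 0 < e := hc₀.trans_le hec
  have hse : s₀ ≤ √e := Real.sqrt_le_sqrt (by linarith)
  have hsX : √e ≤ 10 / τ := Real.sqrt_le_iff.2 ⟨by positivity, heX⟩
  have hsq : ∀ v : ℂ, 0 < v.im → ‖Complex.sqrt v - (√e : ℝ)‖ ≤ ‖v - e‖ / s₀ := fun v hv =>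
    (sqrt_sub_real_le hv he0).trans (by gcongr)
  -- the solution is close to `M` in a neighbourhood of the edge
  set U : Set ℂ := Metric.closedBall (e : ℂ) ρ ∩ {v : ℂ | 0 < v.im} with hU
  have hUs : ∀ v ∈ U, ‖Complex.sqrt v - (√e : ℝ)‖ ≤ ρ / s₀ := fun v hv =>
    (hsq v hv.2).trans (by have := mem_closedBall_iff_norm.1 hv.1; gcongr)
  have hUpre : IsPreconnected U :=
    ((convex_closedBall _ _).inter (convex_halfSpace_im_gt 0)).isPreconnected
  have hcont : ContinuousOn (fun v => ‖mm σ z v - M‖) U :=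
    (((mm_differentiableOn h).continuousOn.mono fun v hv => hv.2).sub continuousOn_const).norm
  have hv : ∀ᶠ η in 𝓝[>] (0 : ℝ), vert e η ∈ U ∧ ‖mm σ z (vert e η) - M‖ < c₃ := by
    have h1 : ∀ᶠ w in 𝓝[{w : ℂ | 0 < w.im}] (e : ℂ), w ∈ U :=
      inter_mem (nhdsWithin_le_nhds (Metric.closedBall_mem_nhds _ hρ0)) self_mem_nhdsWithin
    exact ((tendsto_vert e).eventually h1).and
      ((tendsto_iff_norm_sub_tendsto_zero.1 hM).eventually (gt_mem_nhds hc₃0))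
  obtain ⟨η₀, hη₁, hη₂⟩ := hv.exists
  have hclose := le_of_self_improving hUpre hcont hc₃0 (fun v hv hle => by
    have h1 := (H1 N σ _ h _ M n hF hKK hA hder (Complex.sqrt v) (mm σ z v)
      ((hUs v hv).trans (hρs.trans ((min_le_right _ _).trans (min_le_left _ _))))
      (hle.trans (min_le_left _ _)) (sol_mm h hv.2).eq).1
    refine abs_le_of_sq_le_sq' (h1.trans (le_trans ?_ hρK)) (by positivity) |>.2
    have := hUs v hv
    gcongr) hη₁ hη₂.le
  have hwρ : ‖w - e‖ ≤ ρ := hwe.trans (min_le_left _ _)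
  have hwU : w ∈ U := ⟨mem_closedBall_iff_norm.2 hwρ, hw⟩
  have ht := hclose w hwU
  have hd := (hUs w hwU).trans hρs
  have hd1 : ‖Complex.sqrt w - (√e : ℝ)‖ ≤ 1 := hd.trans (min_le_left _ _)
  obtain ⟨hup, hlow⟩ := H1 N σ _ h _ M n hF hKK hA hder (Complex.sqrt w) (mm σ z w)
    (hd.trans ((min_le_right _ _).trans (min_le_left _ _)))
    (ht.trans (min_le_left _ _)) (sol_mm h hw).eq
  have hstab := H2 N σ _ h _ M n hF hKK hder (Complex.sqrt w) (mm σ z w)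
    (hd.trans ((min_le_right _ _).trans (min_le_right _ _)))
    (ht.trans ((min_le_right _ _).trans (by linarith))) (sol_mm h hw).eq hup hlow
    (Complex.sqrt w * (1 + u))
  have hvm : ‖Complex.sqrt w * (1 + u) - mm σ z w‖ = ‖Complex.sqrt w‖ * ‖u - m1c σ z w‖ :=
    norm_sub_m1c u
  have hFΥ := norm_FF_eq h hw hu
  have hrX : ‖Complex.sqrt w‖ ≤ X := by
    have h1 := norm_le_norm_add_norm_sub' (Complex.sqrt w) ((√e : ℝ) : ℂ)
    rw [Complex.norm_real √e, Real.norm_of_nonneg (Real.sqrt_nonneg _)] at h1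
    have : 0 < 10 / τ := by positivity
    have : 20 / τ = 10 / τ + 10 / τ := by ring
    linarith
  have hrs : s₀ ≤ ‖Complex.sqrt w‖ :=
    (sqrt_re_ge hw (norm_sub_le_of_near hwρ (by linarith))).trans (Complex.re_le_norm _)
  have hr0 : 0 < ‖Complex.sqrt w‖ := hs₀0.trans_le hrs
  have hDX : ‖w - e‖ ≤ X * ‖Complex.sqrt w - (√e : ℝ)‖ := by
    have e1 : w - e = (Complex.sqrt w + (√e : ℝ)) * (Complex.sqrt w - (√e : ℝ)) := by
      have h1 := sqrt_mul_self w
      have h2 : ((√e : ℝ) : ℂ) * (√e : ℝ) = e := by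
        rw [← Complex.ofReal_mul, Real.mul_self_sqrt he0.le]
      linear_combination -h1 + h2
    rw [e1, norm_mul]
    gcongr
    have h1 := norm_le_norm_add_norm_sub' (Complex.sqrt w) ((√e : ℝ) : ℂ)
    have h2 := norm_add_le (Complex.sqrt w) ((√e : ℝ) : ℂ)
    rw [Complex.norm_real √e, Real.norm_of_nonneg (Real.sqrt_nonneg _)] at h1 h2
    have : 20 / τ = 10 / τ + 10 / τ := by ring
    linarith
  rw [hvm, hFΥ] at hstab
  set R := ‖Complex.sqrt w‖ with hR
  set d := ‖Complex.sqrt w - (√e : ℝ)‖ with hdd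
  set t := ‖mm σ z w - M‖ with htt
  set x := ‖u - m1c σ z w‖ with hx
  set Y := ‖Upsilon σ z w u‖ with hY
  set D := ‖w - e‖ with hD
  have hx0 : 0 ≤ x := norm_nonneg _
  have hY0 : 0 ≤ Y := norm_nonneg _
  have hD0 : 0 ≤ D := norm_nonneg _
  have hvM : ‖Complex.sqrt w * (1 + u) - M‖ ≤ R * x + t := by
    have e1 : Complex.sqrt w * (1 + u) - M =
      (Complex.sqrt w * (1 + u) - mm σ z w) + (mm σ z w - M) := by ring
    rw [e1, ← hvm]; exact norm_add_le _ _
  have htc : t ≤ c₂ / 2 := ht.trans (min_le_right _ _)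
  constructor
  · intro hle
    have h1 : √D / S ≤ t := by
      rw [div_le_iff₀ hS0]
      apply Real.sqrt_le_iff.2 ⟨by positivity, ?_⟩
      rw [mul_pow, hS, Real.sq_sqrt (by positivity)]
      calc D ≤ X * d := hDX
        _ ≤ X * (K * t ^ 2) := by gcongr
        _ = _ := by ring
    have h2 : R * x ≤ t := by
      calc R * x ≤ X * (c * √D) := by gcongr
        _ = X * c * √D := by ring
        _ ≤ 1 / S * √D := by gcongr
        _ = √D / S := by ring
        _ ≤ t := h1
    have h3 := (hstab (hvM.trans (by linarith))).1 h2
    have h4 : √D / S * (R * x) ≤ C₂ * (R * Y) := le_trans (by gcongr) h3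
    have h5 : R * (√D * x) ≤ R * (C₂ * S * Y) := by
      have : √D / S * (R * x) * S = R * (√D * x) := by field_simp
      rw [← this]
      calc _ ≤ C₂ * (R * Y) * S := by gcongr
        _ = _ := by ring
    refine (le_of_mul_le_mul_left h5 hr0).trans ?_
    gcongr
    have : 0 < C₂ * (1 / s₀ + X) / s₀ ^ 2 := by positivity
    linarith
  · intro hle
    have h2 : R * x ≤ c₂ / 2 := (by gcongr : R * x ≤ X * c).trans hcX
    have h3 := (hstab (hvM.trans (by linarith))).2
    have h4 : s₀ ^ 2 * x ^ 2 ≤ C₂ * ((1 / s₀ + X) * (D + Y)) := by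
      calc s₀ ^ 2 * x ^ 2 ≤ R ^ 2 * x ^ 2 := by gcongr
        _ = (R * x) ^ 2 := by ring
        _ ≤ C₂ * (d + R * Y) := h3
        _ ≤ C₂ * (D / s₀ + X * Y) := by
          have := hsq w hw
          gcongr
        _ ≤ _ := by
          gcongr
          have h6 : 0 ≤ 1 / s₀ * Y + X * D := by positivity
          have h7 : (1 / s₀ + X) * (D + Y) = D / s₀ + X * Y + (1 / s₀ * Y + X * D) := by ring
          linarith
    have h5 : x ^ 2 ≤ C₂ * (1 / s₀ + X) / s₀ ^ 2 * (D + Y) := by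
      rw [div_mul_eq_mul_div, le_div_iff₀ (by positivity)]
      linarith
    refine h5.trans ?_
    gcongr
    have : 0 < C₂ * S := by positivity
    linarith

section edgeChain
variable {N : ℕ} {τ : ℝ} {σ : Fin N → ℝ} {z w : ℂ}

lemma sqrt_dist_le (e E : ℝ) {y y' : ℝ} (hyy : y ≤ y') :
    √‖(⟨E, y'⟩ : ℂ) - e‖ ≤ √‖(⟨E, y⟩ : ℂ) - e‖ + √(y' - y) := by
  have h0 : 0 ≤ y' - y := by linarith
  have h1 : ‖(⟨E, y'⟩ : ℂ) - e‖ ≤ ‖(⟨E, y⟩ : ℂ) - e‖ + (y' - y) := by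
    have e1 : (⟨E, y'⟩ : ℂ) - e = ((⟨E, y⟩ : ℂ) - e) + ((y' - y : ℝ) : ℂ) * Complex.I := by
      apply Complex.ext <;> simp
    rw [e1]
    refine (norm_add_le _ _).trans ?_
    rw [norm_mul, Complex.norm_I, mul_one, Complex.norm_real, Real.norm_of_nonneg h0]
  refine (Real.sqrt_le_sqrt h1).trans (Real.sqrt_le_iff.2 ⟨by positivity, by
    rw [add_sq, Real.sq_sqrt (norm_nonneg _), Real.sq_sqrt h0]
    have : 0 ≤ 2 * √‖(⟨E, y⟩ : ℂ) - e‖ * √(y' - y) := by positivity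
    linarith⟩)

lemma dist_mono (e E : ℝ) {y y' : ℝ} (hy : 0 ≤ y) (hyy : y ≤ y') :
    ‖(⟨E, y⟩ : ℂ) - e‖ ≤ ‖(⟨E, y'⟩ : ℂ) - e‖ := by
  refine abs_le_of_sq_le_sq' ?_ (norm_nonneg _) |>.2
  rw [← Complex.normSq_eq_norm_sq, ← Complex.normSq_eq_norm_sq, Complex.normSq_apply,
    Complex.normSq_apply]
  simp only [Complex.sub_re, Complex.sub_im, Complex.ofReal_re, Complex.ofReal_im, sub_zero]
  nlinarith

lemma im_le_dist (e E y : ℝ) : y ≤ ‖(⟨E, y⟩ : ℂ) - e‖ := by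
  have := (le_abs_self _).trans (Complex.abs_im_le_norm ((⟨E, y⟩ : ℂ) - e))
  simpa using this

lemma dist_le (e E : ℝ) {y : ℝ} (hy : 0 ≤ y) : ‖(⟨E, y⟩ : ℂ) - e‖ ≤ |E - e| + y := by
  have := Complex.norm_le_abs_re_add_abs_im ((⟨E, y⟩ : ℂ) - e)
  simpa [abs_of_nonneg hy] using this

/-- The threshold for the continuity argument near an edge is of order `‖w - e‖^(1/2)` as long as
`‖w - e‖` dominates the error `d`, and of order one below. -/
def edgeThreshold (c K D d : ℝ) : ℝ := open Classical in if K * d ≤ D then c * √D else c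

set_option maxHeartbeats 600000 in
/-- Stability on vertical lines close to an edge. -/
lemma exists_bound_of_edgeStable (τ ζ c C X : ℝ) (hτ : 0 < τ) (hζ : 0 < ζ) (hζ1 : ζ < 1)
    (hc : 0 < c) (hc1 : c ≤ 1) (hC : 0 < C) (hX : 0 < X) : ∃ C' : ℝ, 0 < C' ∧
    ∀ (N : ℕ) (σ : Fin N → ℝ) (z : ℂ), Par τ σ (‖z‖ ^ 2) → ∀ (e : ℝ), ∀ w ∈ dom σ z ζ,
      |w.re - e| ≤ c / 2 → (∀ y, w.im ≤ y → ‖m1c σ z ⟨w.re, y⟩‖ ≤ X) →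
      (∀ y, w.im ≤ y → y ≤ c / 2 → EdgeStable σ z c C e ⟨w.re, y⟩) → ∀ g, IsDensity g →
      ∀ δ : ℝ → ℝ, (∀ y, w.im ≤ y → y ≤ ζ⁻¹ → 0 ≤ δ y ∧
        δ y ≤ (Real.log N)⁻¹ * ‖m1c σ z ⟨w.re, y⟩‖) →
      (∀ y y', w.im ≤ y → y ≤ y' → y' ≤ ζ⁻¹ → δ y' ≤ δ y) →
      (∀ y, (⟨w.re, y⟩ : ℂ) ∈ lattice σ z ζ w →
        ‖Upsilon σ z ⟨w.re, y⟩ (stieltjes g ⟨w.re, y⟩)‖ ≤ δ y) →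
      ‖stieltjes g w - m1c σ z w‖ * √(‖w - e‖ + δ w.im) ≤ C' * δ w.im := by
  set R := 2 * ζ⁻¹ + 1 with hR
  have hR0 : 0 < R := by positivity
  have hζ' : 1 ≤ ζ⁻¹ := (one_le_inv₀ hζ).2 hζ1.le
  obtain ⟨C₁, hC₁, HC₁⟩ := exists_localStable_of_im_ge (c := c / 2) (by positivity) hR0
  -- `K` is chosen such that `C δ ≤ (c / 2) ‖w - e‖` in the linear regime `K δ ≤ ‖w - e‖`, so that
  -- stability there halves the threshold `c ‖w - e‖^(1/2)`
  set K := 2 * C / c with hK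
  have hK0 : 0 < K := by positivity
  set J := C₁ + C * (K + 1) + K with hJ
  have hJ0 : 0 < J := by positivity
  set ε := min (min (c * √(c / 2)) c / 2) (min ((c / 2) ^ 2) (1 / 4)) with hε
  have hs2 : 0 < √(c / 2) := Real.sqrt_pos.2 (by positivity)
  have hε0 : 0 < ε := by positivity
  have hε1 : ε ≤ c * √(c / 2) / 2 := (min_le_left _ _).trans (by gcongr; exact min_le_left _ _)
  have hε2 : ε ≤ c / 2 := (min_le_left _ _).trans (by gcongr; exact min_le_right _ _)
  have hε3 : ε ≤ (c / 2) ^ 2 := (min_le_right _ _).trans (min_le_left _ _)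
  have hε4 : ε ≤ 1 / 4 := (min_le_right _ _).trans (min_le_right _ _)
  set P := c + 3 * (τ ^ 6)⁻¹ with hP
  have hP0 : 0 < P := by positivity
  have hlog : Tendsto (fun N : ℕ => J * X * (Real.log N)⁻¹) atTop (𝓝 0) := by
    have := (tendsto_inv_atTop_zero.comp
      (Real.tendsto_log_atTop.comp tendsto_natCast_atTop_atTop)).const_mul (J * X)
    simpa using this
  have hinv : Tendsto (fun N : ℕ => P * (N : ℝ)⁻¹) atTop (𝓝 0) := by
    have := (tendsto_inv_atTop_zero.comp (tendsto_natCast_atTop_atTop (R := ℝ))).const_mul P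
    simpa using this
  have hN2 : ∀ᶠ N : ℕ in atTop, (2 : ℝ) ≤ N :=
    tendsto_natCast_atTop_atTop.eventually (eventually_ge_atTop 2)
  obtain ⟨N0, hN0⟩ := eventually_atTop.1 (((hlog.eventually (ge_mem_nhds hε0)).and
    (hinv.eventually (ge_mem_nhds (show 0 < min (c * τ / 2) (c / 4) by positivity)))).and hN2)
  set N1 := max N0 1
  have hN1 : (0 : ℝ) < N1 := by
    have : 1 ≤ N1 := le_max_right _ _
    exact_mod_cast this
  set c₂ := ((N1 : ℝ) ^ (-1 + ζ) * τ) ^ 2 with hc₂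
  have hc₂0 : 0 < c₂ := by positivity
  obtain ⟨C₂, hC₂, HC₂⟩ := exists_localStable_of_im_ge (c := min c₂ (c / 2)) (by positivity) hR0
  set Z := √(c + ζ⁻¹ + 2 * X) with hZ
  refine ⟨C₂ * Z + C * √(1 + 1 / K) + √C * (K + 1), by positivity, ?_⟩
  intro N σ z h e w hw hwe hm hES g hg δ hδ hmono hΥ
  have hη := hw.1
  have hηζ : w.im ≤ ζ⁻¹ := hw.2.2.2.2
  have hw' : (⟨w.re, w.im⟩ : ℂ) = w := rfl
  have hwl : (⟨w.re, w.im⟩ : ℂ) ∈ lattice σ z ζ w := Or.inl rfl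
  obtain ⟨hδ0, hδ1⟩ := hδ w.im le_rfl hηζ
  have hcone := cone_stieltjes hg hw.1
  have hdist := dist_le e w.re hη.le
  rw [hw'] at hdist
  -- the trivial regime
  rcases le_or_gt (min c₂ (c / 2)) w.im with hbig | hsmall
  · have h1 := HC₂ τ N σ z h w hbig (dom_norm_le hζ hw) _ _ hcone
      (le_of_eq (div_mul_cancel₀ _ (by positivity :
        (1 + ‖m1c σ z w‖ : ℝ) ≠ 0)).symm)
    have h2 := hΥ w.im hwl
    have h3 : √(‖w - e‖ + δ w.im) ≤ Z := by
      apply Real.sqrt_le_sqrt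
      have h4 : δ w.im ≤ 2 * X := hδ1.trans (by
        have := inv_log_le_two N
        have := hm w.im le_rfl
        gcongr)
      linarith
    calc _ ≤ (C₂ * δ w.im) * Z := by
          gcongr
          exact h1.trans (by gcongr)
      _ = C₂ * Z * δ w.im := by ring
      _ ≤ _ := by
        gcongr
        have : 0 ≤ C * √(1 + 1 / K) + √C * (K + 1) := by positivity
        linarith
  have hNN : N1 ≤ N := by
    by_contra! hN
    have h2 : c₂ ≤ w.im := by
      refine le_trans ?_ (dom_im_ge h hw)
      have : (N1 : ℝ) ^ (-1 + ζ) ≤ (N : ℝ) ^ (-1 + ζ) := by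
        refine Real.rpow_le_rpow_of_nonpos ?_ (by exact_mod_cast hN.le) (by linarith)
        have := h.N_pos; linarith
      rw [hc₂]; gcongr
    exact absurd hsmall (not_lt.2 ((min_le_left _ _).trans h2))
  have hsm : w.im < c / 2 := by
    by_contra! hcon
    exact absurd hsmall (not_lt.2 ((min_le_right _ _).trans hcon))
  obtain ⟨⟨hl, hp⟩, hNtwo⟩ := hN0 N ((le_max_left _ _).trans hNN)
  have hNp := h.N_pos
  have hNp0 : (0 : ℝ) < N := by linarith
  have hτ1 := h.tau_le_one
  have hlog0 : 0 ≤ (Real.log N)⁻¹ := by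
    have := Real.log_nonneg hNp; positivity
  have hδε : ∀ y, w.im ≤ y → y ≤ ζ⁻¹ → ∀ A, 0 ≤ A → A ≤ J → A * δ y ≤ ε := by
    intro y hy hy1 A hA hAJ
    have h1 : δ y ≤ (Real.log N)⁻¹ * X := (hδ y hy hy1).2.trans (by
      have := hm y hy
      gcongr)
    calc A * δ y ≤ J * ((Real.log N)⁻¹ * X) := by
          have := (hδ y hy hy1).1
          gcongr
      _ = J * X * (Real.log N)⁻¹ := by ring
      _ ≤ ε := hl
  set s : ℝ → ℝ := fun y => ‖(⟨w.re, y⟩ : ℂ) - e‖ with hs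
  have hyζ : ∀ y, y ≤ 1 → y ≤ ζ⁻¹ := fun y hy => hy.trans hζ'
  -- far from the axis
  have hfar : ∀ y, w.im ≤ y → c / 2 ≤ y → y ≤ 1 → (⟨w.re, y⟩ : ℂ) ∈ lattice σ z ζ w →
      ‖stieltjes g ⟨w.re, y⟩ - m1c σ z ⟨w.re, y⟩‖ ≤ edgeThreshold c K (s y) (δ y) / 2 := by
    intro y hy hyc hy1 hlat
    have hy0 : 0 < y := hη.trans_le hy
    have hdomy : (⟨w.re, y⟩ : ℂ) ∈ dom σ z ζ := dom_up h hw rfl hy (hyζ y hy1)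
    have h1 := HC₁ τ N σ z h ⟨w.re, y⟩ hyc (dom_norm_le hζ hdomy) _ _
      (cone_stieltjes hg (w := ⟨w.re, y⟩) hy0)
      (le_of_eq (div_mul_cancel₀ _ (by positivity :
        (1 + ‖m1c σ z ⟨w.re, y⟩‖ : ℝ) ≠ 0)).symm)
    have h2 := hΥ y hlat
    have h3 : ‖stieltjes g ⟨w.re, y⟩ - m1c σ z ⟨w.re, y⟩‖ ≤ ε := by
      refine h1.trans (le_trans (by gcongr) (hδε y hy (hyζ y hy1) C₁ hC₁.le ?_))
      have : 0 < C * (K + 1) := by positivity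
      linarith
    refine h3.trans ?_
    unfold edgeThreshold
    split_ifs
    · refine hε1.trans ?_
      have : c / 2 ≤ s y := hyc.trans (im_le_dist _ _ _)
      gcongr
    · exact hε2
  -- self-improvement close to the axis
  have hnear : ∀ y, w.im ≤ y → y ≤ c / 2 → (⟨w.re, y⟩ : ℂ) ∈ lattice σ z ζ w →
      ‖stieltjes g ⟨w.re, y⟩ - m1c σ z ⟨w.re, y⟩‖ ≤ edgeThreshold c K (s y) (δ y) →
      (K * δ y ≤ s y → √(s y) * ‖stieltjes g ⟨w.re, y⟩ - m1c σ z ⟨w.re, y⟩‖ ≤ C * δ y) ∧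
      (s y < K * δ y → ‖stieltjes g ⟨w.re, y⟩ - m1c σ z ⟨w.re, y⟩‖ ^ 2 ≤
        C * (K + 1) * δ y) := by
    intro y hy hyc hlat hle
    have hy0 : 0 < y := hη.trans_le hy
    obtain ⟨h1, h2⟩ := hES y hy hyc _ (cone_stieltjes hg (w := ⟨w.re, y⟩) hy0)
    have h3 := hΥ y hlat
    unfold edgeThreshold at hle
    constructor
    · intro hcase
      rw [if_pos hcase] at hle
      refine (h1 hle).trans ?_
      gcongr
    · intro hcase
      rw [if_neg (not_le.2 hcase)] at hle
      refine (h2 hle).trans ?_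
      calc _ ≤ C * (K * δ y + δ y) := by
            gcongr
        _ = _ := by ring
  have res := chain h hζ hζ1 hw (by linarith : w.im ≤ 1) hg
    (fun y => edgeThreshold c K (s y) (δ y)) ?_ ?_ ?_ ?_
  · obtain ⟨ha, hb⟩ := hnear w.im le_rfl hsm.le hwl res
    rw [hw'] at ha hb
    have hss : s w.im = ‖w - e‖ := rfl
    rw [hss] at ha hb
    set x := ‖stieltjes g w - m1c σ z w‖
    set D := ‖w - e‖
    set d := δ w.im
    have hx0 : 0 ≤ x := norm_nonneg _
    have hD0 : 0 ≤ D := norm_nonneg _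
    rcases le_or_gt (K * d) D with hcase | hcase
    · have h1 : √(D + d) ≤ √(1 + 1 / K) * √D := by
        rw [← Real.sqrt_mul (by positivity)]
        apply Real.sqrt_le_sqrt
        have : d ≤ 1 / K * D := by
          rw [one_div, inv_mul_eq_div, le_div_iff₀ hK0]; linarith
        linarith
      calc x * √(D + d) ≤ x * (√(1 + 1 / K) * √D) := by gcongr
        _ = √(1 + 1 / K) * (√D * x) := by ring
        _ ≤ √(1 + 1 / K) * (C * d) :=
          mul_le_mul_of_nonneg_left (ha hcase) (Real.sqrt_nonneg _)
        _ = C * √(1 + 1 / K) * d := by ring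
        _ ≤ _ := by
          gcongr
          have : 0 ≤ C₂ * Z + √C * (K + 1) := by positivity
          linarith
    · have h1 := hb hcase
      have h2 : x ≤ √(C * (K + 1) * d) := Real.le_sqrt_of_sq_le h1
      have h3 : √(D + d) ≤ √((K + 1) * d) := Real.sqrt_le_sqrt (by linarith)
      calc x * √(D + d) ≤ √(C * (K + 1) * d) * √((K + 1) * d) := by gcongr
        _ = √C * ((K + 1) * d) := by
          rw [mul_assoc, Real.sqrt_mul hC.le, mul_assoc, Real.mul_self_sqrt (by positivity)]
        _ = √C * (K + 1) * d := by ring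
        _ ≤ _ := by
          gcongr
          have : 0 ≤ C₂ * Z + C * √(1 + 1 / K) := by positivity
          linarith
  · intro y hy hy1
    have hy0 : 0 < y := hη.trans_le hy
    have h1 : s y ≤ c / 2 + 1 := (dist_le e w.re hy0.le).trans (by linarith)
    have h2 : (2 : ℝ) ≤ N / τ := by
      rw [le_div_iff₀ hτ]; nlinarith
    refine le_trans ?_ h2
    unfold edgeThreshold
    split_ifs
    · have h3 : √(s y) ≤ 2 := Real.sqrt_le_iff.2 ⟨by norm_num, by linarith⟩
      calc c * √(s y) ≤ 1 * 2 := by gcongr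
        _ = 2 := by norm_num
    · linarith
  · have h2 : (⟨w.re, 1⟩ : ℂ) ∈ dom σ z ζ := dom_up h hw rfl (by linarith) hζ'
    have h3 : (⟨w.re, 1⟩ : ℂ) ∈ lattice σ z ζ w := by
      refine Or.inr ⟨h2, rfl, by change w.im ≤ 1; linarith, le_rfl, N ^ 10, ?_⟩
      push_cast; rw [div_self (by positivity)]
    have h4 := hfar 1 (by linarith) (by linarith) le_rfl h3
    have h5 : 0 ≤ edgeThreshold c K (s 1) (δ 1) := by
      unfold edgeThreshold; split_ifs <;> positivity
    linarith
  · intro y hy hy1 hlat hle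
    rcases le_or_gt (c / 2) y with hyc | hyc
    · exact hfar y hy hyc hy1 hlat
    obtain ⟨ha, hb⟩ := hnear y hy hyc.le hlat hle
    have hy0 : 0 < y := hη.trans_le hy
    have hsy : 0 < s y := hy0.trans_le (im_le_dist _ _ _)
    have hsq := Real.sqrt_pos.2 hsy
    unfold edgeThreshold
    split_ifs with hcase
    · have h1 := ha hcase
      have h2 : C * δ y = c / 2 * (K * δ y) := by rw [hK]; field_simp
      have h3 : C * δ y ≤ √(s y) * (c * √(s y) / 2) := by
        rw [h2]
        calc _ ≤ c / 2 * s y := by gcongr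
          _ = c / 2 * (√(s y) * √(s y)) := by rw [Real.mul_self_sqrt hsy.le]
          _ = _ := by ring
      exact le_of_mul_le_mul_left (h1.trans h3) hsq
    · have h1 := hb (not_le.1 hcase)
      refine abs_le_of_sq_le_sq' (h1.trans ((hδε y hy (hyζ y hy1) _ (by positivity) ?_).trans
        hε3)) (by positivity) |>.2
      linarith
  · intro y y' hy hyy hy1 hst
    have hy0 : 0 < y := hη.trans_le hy
    have hss : s y ≤ s y' := dist_mono e w.re hy0.le hyy
    have hdd : δ y' ≤ δ y := hmono y y' hy hyy (hyζ y' hy1)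
    have hinvN : (N : ℝ)⁻¹ ≤ 1 := inv_le_one_of_one_le₀ hNp
    have hinvN0 : 0 < (N : ℝ)⁻¹ := by positivity
    have hn5 : (N : ℝ)⁻¹ ^ 5 ≤ (N : ℝ)⁻¹ ^ 2 := pow_le_pow_of_le_one hinvN0.le hinvN (by norm_num)
    have hn2 : (N : ℝ)⁻¹ ^ 2 ≤ (N : ℝ)⁻¹ := by
      rw [sq]; exact mul_le_of_le_one_left hinvN0.le hinvN
    have hstep : √(s y') ≤ √(s y) + (N : ℝ)⁻¹ ^ 5 := by
      refine (sqrt_dist_le e w.re hyy).trans ?_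
      gcongr
      refine Real.sqrt_le_iff.2 ⟨by positivity, hst.trans (le_of_eq ?_)⟩
      rw [← inv_pow, ← pow_mul]
    have hx : 3 * ((N : ℝ) ^ 5 * τ ^ 6)⁻¹ = 3 * (τ ^ 6)⁻¹ * (N : ℝ)⁻¹ ^ 5 := by
      rw [mul_inv, inv_pow]; ring
    have hτ6 : 0 < (τ ^ 6)⁻¹ := by positivity
    have hP5 : c * (N : ℝ)⁻¹ ^ 5 + 3 * (τ ^ 6)⁻¹ * (N : ℝ)⁻¹ ^ 5 ≤ P * (N : ℝ)⁻¹ * (N : ℝ)⁻¹ := by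
      calc _ = P * (N : ℝ)⁻¹ ^ 5 := by rw [hP]; ring
        _ ≤ P * (N : ℝ)⁻¹ ^ 2 := by gcongr
        _ = _ := by ring
    have hp1 := hp.trans (min_le_left _ _)
    have hp2 := hp.trans (min_le_right _ _)
    have hP1 : P * (N : ℝ)⁻¹ * (N : ℝ)⁻¹ ≤ c * τ / 2 * (N : ℝ)⁻¹ := by gcongr
    have hP2 : P * (N : ℝ)⁻¹ * (N : ℝ)⁻¹ ≤ c / 4 := by
      calc _ ≤ c / 4 * 1 := by gcongr
        _ = _ := by ring
    have hc5 : 0 ≤ c * (N : ℝ)⁻¹ ^ 5 := by positivity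
    change edgeThreshold c K (s y') (δ y') / 2 + 3 * ((N : ℝ) ^ 5 * τ ^ 6)⁻¹ ≤
      edgeThreshold c K (s y) (δ y)
    rw [hx]
    unfold edgeThreshold
    -- Going down, `‖w - e‖` decreases and `δ` increases, so the chain can pass from the linear to
    -- the square root regime but not back.
    by_cases h1 : K * δ y ≤ s y
    · have h2 : K * δ y' ≤ s y' := by
        refine le_trans ?_ (h1.trans hss)
        gcongr
      rw [if_pos h1, if_pos h2]
      have h3 : τ * (N : ℝ)⁻¹ ≤ √(s y) := by
        apply Real.le_sqrt_of_sq_le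
        have h4 := dom_inv_im_le h hζ hw
        have h5 : (((N : ℝ) / τ) ^ 2)⁻¹ ≤ w.im := (inv_le_comm₀ hη (by positivity)).1 h4
        have h6 : (τ * (N : ℝ)⁻¹) ^ 2 = ((N / τ) ^ 2)⁻¹ := by field_simp
        rw [h6]
        exact h5.trans (hy.trans (im_le_dist _ _ _))
      have h4 : c * √(s y') ≤ c * √(s y) + c * (N : ℝ)⁻¹ ^ 5 := by
        rw [← mul_add]; gcongr
      have h5 : c * (τ * (N : ℝ)⁻¹) ≤ c * √(s y) := by gcongr
      linarith
    · rw [if_neg h1]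
      split_ifs with h2
      · have h3 : s y ≤ 1 / 4 := (not_le.1 h1).le.trans
          ((hδε y hy (hyζ y (hyy.trans hy1)) K hK0.le (by
            have : 0 < C * (K + 1) := by positivity
            linarith)).trans hε4)
        have h4 : √(s y) ≤ 1 / 2 := Real.sqrt_le_iff.2 ⟨by norm_num, by linarith⟩
        have h5 : √(s y') ≤ 3 / 2 := by linarith
        have h6 : c * √(s y') ≤ c * (3 / 2) := by gcongr
        linarith
      · linarith

end edgeChain

section edgeStable

/-- Stability at regular nonzero edges. -/
lemma exists_stableOn_edge (τ ε : ℝ) (hτ : 0 < τ) (hε : 0 < ε) : ∃ τ₀ : ℝ, 0 < τ₀ ∧ ∀ τ' ≤ τ₀,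
    ∀ ζ : ℝ, 0 < ζ → ζ < 1 → ∃ C : ℝ, 0 < C ∧
      ∀ (N : ℕ) (σ : Fin N → ℝ) (z : ℂ), Par τ σ (‖z‖ ^ 2) → ∀ e ∈ edges σ z, e ≠ 0 →
        RegularEdge σ z ε e → StableOn σ z ζ (domEdge σ z ζ τ' e) (fun d => d) C := by
  obtain ⟨c, C, hc, hc1, hC, HES⟩ := exists_edgeStable τ ε hτ hε
  obtain ⟨c₀, hc₀, He⟩ := exists_edge_ge τ hτ
  refine ⟨min (c / 2) (c₀ / 2), by positivity, ?_⟩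
  intro τ' hτ' ζ hζ hζ1
  have hs := Real.sqrt_pos.2 (half_pos hc₀)
  obtain ⟨C', hC', HB⟩ := exists_bound_of_edgeStable τ ζ c C (√(c₀ / 2))⁻¹ hτ hζ hζ1 hc hc1 hC
    (by positivity)
  refine ⟨C' * √2, by positivity, ?_⟩
  intro N σ z h e he hne hreg δ hδ _ hmono g hg w hw hΥ
  obtain ⟨hec, -⟩ := He N σ z h e he hne
  have he0 : 0 < e := hc₀.trans_le hec
  have hwd := hw.1
  have hη := hwd.1
  have hwE : |w.re - e| ≤ c / 2 := hw.2.trans (hτ'.trans (min_le_left _ _))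
  have hwre : c₀ / 2 ≤ w.re := by
    have h1 := hw.2.trans (hτ'.trans (min_le_right _ _))
    have := (neg_le_abs _).trans h1
    linarith
  have hvert : ∀ y, w.im ≤ y → y ≤ ζ⁻¹ → (⟨w.re, y⟩ : ℂ) ∈ domEdge σ z ζ τ' e := fun y hy hy1 =>
    ⟨dom_up h hwd rfl hy hy1, hw.2⟩
  have hN := h.N_pos
  have key := HB N σ z h e w hwd hwE
    (fun y hy => norm_m1c_le_of_re h (w := ⟨w.re, y⟩) (hη.trans_le hy) (by positivity) hwre)
    (fun y hy hy1 => HES N σ z h e he hne hreg ⟨w.re, y⟩ (hη.trans_le hy)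
      ((dist_le e w.re (hη.le.trans hy)).trans (by linarith))) g hg (fun y => δ ⟨w.re, y⟩)
    (fun y hy hy1 => ⟨le_trans (by positivity) (hδ _ (hvert y hy hy1)).1,
      (hδ _ (hvert y hy hy1)).2⟩)
    (fun y y' hy hyy hy1 => hmono _ (hvert y hy (hyy.trans hy1)) _
      (hvert y' (hy.trans hyy) hy1) rfl hyy)
    (fun y hlat => hΥ _ hlat)
  change ‖stieltjes g w - m1c σ z w‖ * √(‖w - e‖ + δ w) ≤ C' * δ w at key
  have hδ0 : 0 ≤ δ w := (norm_nonneg _).trans (hΥ w (Or.inl rfl))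
  have hk0 : 0 ≤ kappa σ z w.re := Metric.infDist_nonneg
  have hk : kappa σ z w.re ≤ |w.re - e| := by
    have hmem : e ∈ {x : ℝ | x ∈ edges σ z ∧ 0 < x} := ⟨he, he0⟩
    rw [kappa, ← Real.dist_eq]
    exact Metric.infDist_le_dist_of_mem hmem
  have hre : |w.re - e| ≤ ‖w - e‖ := by
    have := Complex.abs_re_le_norm (w - e)
    rwa [Complex.sub_re, Complex.ofReal_re] at this
  have him : w.im ≤ ‖w - e‖ := im_le_dist e w.re w.im
  have hpos : 0 < kappa σ z w.re + w.im + δ w := by linarith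
  rw [le_div_iff₀ (Real.sqrt_pos.2 hpos)]
  have h1 : √(kappa σ z w.re + w.im + δ w) ≤ √2 * √(‖w - e‖ + δ w) := by
    rw [← Real.sqrt_mul (by norm_num)]
    exact Real.sqrt_le_sqrt (by linarith)
  calc _ ≤ ‖stieltjes g w - m1c σ z w‖ * (√2 * √(‖w - e‖ + δ w)) := by gcongr
    _ = √2 * (‖stieltjes g w - m1c σ z w‖ * √(‖w - e‖ + δ w)) := by ring
    _ ≤ √2 * (C' * δ w) := by gcongr
    _ = _ := by ring

end edgeStable

end SelfCon

end

theorem lemma3p6 (τ : ℝ) (hτ : 0 < τ) :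
    -- bulk, outside the spectrum, and near zero: here `τ'` is small depending on `τ` only
    (∃ τ₀ : ℝ, 0 < τ₀ ∧ ∀ τ' : ℝ, 0 < τ' → τ' ≤ τ₀ → ∀ ζ : ℝ, 0 < ζ → ζ < 1 →
      -- regular bulk components
      (∀ c : ℝ → ℝ, (∀ r : ℝ, 0 < r → 0 < c r) → ∃ C : ℝ, 0 < C ∧
        ∀ (N : ℕ) (σ : Fin N → ℝ) (z : ℂ), SelfCon.Admissible τ σ z →
          ∀ a b : ℝ, SelfCon.IsBulkComponent σ z a b → SelfCon.RegularBulk σ z c a b →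
            SelfCon.StableOn σ z ζ (SelfCon.domBulk σ z ζ τ' a b) (fun d => d) C) ∧
      -- outside the spectrum
      (∃ C : ℝ, 0 < C ∧
        ∀ (N : ℕ) (σ : Fin N → ℝ) (z : ℂ), SelfCon.Admissible τ σ z →
          SelfCon.StableOn σ z ζ (SelfCon.domOut σ z ζ τ') (fun d => d) C) ∧
      -- near the edge zero
      (∀ ε : ℝ, 0 < ε → ∃ C : ℝ, 0 < C ∧
        ∀ (N : ℕ) (σ : Fin N → ℝ) (z : ℂ), SelfCon.Admissible τ σ z → ‖z‖ ^ 2 ≤ 1 - τ →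
          SelfCon.StableOn σ z ζ
            (SelfCon.domEdge σ z ζ τ' 0 ∩ {w : ℂ | ε ≤ Real.sqrt ‖w‖ + ‖z‖ ^ 2})
            (fun d => min d 1) C)) ∧
    -- regular nonzero edges; `τ'` is small depending on `τ` and the regularity constant
    (∀ ε : ℝ, 0 < ε → ∃ τ₀ : ℝ, 0 < τ₀ ∧ ∀ τ' : ℝ, 0 < τ' → τ' ≤ τ₀ →
      ∀ ζ : ℝ, 0 < ζ → ζ < 1 → ∃ C : ℝ, 0 < C ∧
        ∀ (N : ℕ) (σ : Fin N → ℝ) (z : ℂ), SelfCon.Admissible τ σ z →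
          ∀ e ∈ SelfCon.edges σ z, e ≠ 0 → SelfCon.RegularEdge σ z ε e →
            SelfCon.StableOn σ z ζ (SelfCon.domEdge σ z ζ τ' e) (fun d => d) C) ∧
    -- large `η`
    (∀ ζ : ℝ, 0 < ζ → ζ < 1 → ∃ C : ℝ, 0 < C ∧
      ∀ (N : ℕ) (σ : Fin N → ℝ) (z : ℂ), SelfCon.Admissible τ σ z →
        SelfCon.StableLarge σ z ζ C) := by
  refine ⟨?_, ?_, ?_⟩
  · obtain ⟨τ₀, hτ₀, Hz⟩ := SelfCon.exists_stableOn_zero τ hτ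
    refine ⟨τ₀, hτ₀, fun τ' hτ' hle ζ hζ hζ1 => ⟨fun c hc => ?_, ?_, fun ε hε => ?_⟩⟩
    · obtain ⟨C, hC, H⟩ := SelfCon.exists_stableOn_bulk τ τ' ζ hτ hτ' hζ hζ1 c hc
      exact ⟨C, hC, fun N σ z h => H N σ z (h.par hτ)⟩
    · obtain ⟨C, hC, H⟩ := SelfCon.exists_stableOn_out τ τ' ζ hτ hτ' hζ hζ1
      exact ⟨C, hC, fun N σ z h => H N σ z (h.par hτ)⟩
    · obtain ⟨C, hC, H⟩ := Hz τ' hle ζ hζ hζ1 ε hε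
      exact ⟨C, hC, fun N σ z h => H N σ z (h.par hτ)⟩
  · intro ε hε
    obtain ⟨τ₀, hτ₀, He⟩ := SelfCon.exists_stableOn_edge τ ε hτ hε
    refine ⟨τ₀, hτ₀, fun τ' _ hle ζ hζ hζ1 => ?_⟩
    obtain ⟨C, hC, H⟩ := He τ' hle ζ hζ hζ1
    exact ⟨C, hC, fun N σ z h => H N σ z (h.par hτ)⟩
  · exact fun ζ hζ hζ1 => ⟨17, by norm_num, fun N σ z h => SelfCon.stableLarge hζ hζ1 (h.par hτ)⟩
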